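/- Let $k$ be a commutative ring. A dg category $\mathcal{A}$ over $k$ is a small category enriched in cochain complexes of $k$-modules, so that $d(g\circ f)=d(g)\circ f+(-1)^{|g|}g\circ d(f)$ for homogeneous morphisms; $H^0(\mathcal{A})$ is the category with the same objects and morphisms $H^0({\rm Hom}_\mathcal{A}(x,y))$. A complex $F$ of $k$-modules is homotopically flat if $C\otimes_k F$ is acyclic for every acyclic complex $C$ of $k$-modules. Let $\mathcal{A}^{\rm pretr}$ be the pretriangulated hull of $\mathcal{A}$, that is, the dg category of one-sided twisted complexes over $\mathcal{A}$. Its objects are pairs $(\bigoplus_{i\in I}\Sigma^{n_i}x_i,\,q)$ with $I$ a finite set, $x_i$ in $\mathcal{A}$, $n_i\in\mathbb{Z}$, and $q=(q_{ji})$ an endomorphism of degree $1$ (a matrix whose entry from $\Sigma^{a}x$ to $\Sigma^{b}y$ lies in ${\rm Hom}_\mathcal{A}(x,y)^{1+b-a}$) which is strictly triangular for a suitable ordering of $I$ and satisfies $d(q)+q\circ q=0$; the morphisms of degree $p$ are all matrices of degree $p$, with differential $f\mapsto d(f)+q\circ f-(-1)^{|f|}f\circ q$. Then $\mathcal{A}^{\rm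 tr}=H^0(\mathcal{A}^{\rm pretr})$, the triangulated hull of $\mathcal{A}$, is a triangulated category, whose exact triangles are those isomorphic to a triangle $x\xrightarrow{f}y\to{\rm Cone}(f)\to\Sigma x$ for a closed morphism $f$ of degree $0$ in $\mathcal{A}^{\rm pretr}$. Let $\mathcal{B}\subseteq\mathcal{A}$ be a full dg subcategory. The dg quotient $\mathcal{A}/\mathcal{B}$ is the dg category obtained from $\mathcal{A}$ by freely adding, for each object $U$ of $\mathcal{B}$, a morphism $\varepsilon_U\colon U\to U$ of degree $-1$ with $d(\varepsilon_U)=1_U$. The Verdier quotient $\mathcal{A}^{\rm tr}/\mathcal{B}^{\rm tr}$ is the localization of $\mathcal{A}^{\rm tr}$ at the morphisms whose cone is isomorphic to an object of $\mathcal{B}^{\rm tr}$. **Theorem.** Assume that ${\rm Hom}_\mathcal{A}(x,U)$ is homotopically flat for each object $x$ of $\mathcal{A}$ and each object $U$ of $\mathcal{B}$. Then the triangle functor $\mathcal{A}^{\rm tr}\to(\mathcal{A}/\mathcal{B})^{\rm tr}$ induced by the canonical dg functor $\mathcal{A}\to\mathcal{A}/\mathcal{B}$ inverts the morphisms whose cone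 is isomorphic to an object of $\mathcal{B}^{\rm tr}$, and the induced canonical functor $$\Phi\colon \mathcal{A}^{\rm tr}/\mathcal{B}^{\rm tr}\longrightarrow(\mathcal{A}/\mathcal{B})^{\rm tr}$$ is a triangle equivalence. -/

import Mathlib

open CategoryTheory

universe u v w v' w'

noncomputable section

/-- The sign `(-1)^n`, as a scalar of the ground ring. -/
def dgSign (k : Type u) [CommRing k] (n : ℤ) : k := ((n.negOnePow : ℤ) : k)

theorem dgSign_add (k : Type u) [CommRing k] (m n : ℤ) :
    dgSign k (m + n) = dgSign k m * dgSign k n := by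
  simp [dgSign, Int.negOnePow_add]

theorem dgSign_zero (k : Type u) [CommRing k] : dgSign k 0 = 1 := by simp [dgSign]

theorem dgSign_one (k : Type u) [CommRing k] : dgSign k 1 = -1 := by simp [dgSign]

theorem dgSign_neg (k : Type u) [CommRing k] (n : ℤ) : dgSign k (-n) = dgSign k n := by
  simp [dgSign]

theorem dgSign_mul_self (k : Type u) [CommRing k] (n : ℤ) : dgSign k n * dgSign k n = 1 := by
  rw [← dgSign_add]
  simp [dgSign, Int.negOnePow_even (n + n) (by simp)]

/-- A dg category over `k`: graded Hom-modules `Hom x y p` with a differential of degree one and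
a bilinear, associative and unital composition `comp _ g f = g ∘ f` which is additive in degrees
and satisfies the graded Leibniz rule. -/
structure DGCat (k : Type u) [CommRing k] where
  /-- the objects -/
  Obj : Type v
  /-- the morphisms of a given degree -/
  Hom : Obj → Obj → ℤ → Type w
  [addCommGroup : ∀ x y p, AddCommGroup (Hom x y p)]
  [module : ∀ x y p, Module k (Hom x y p)]
  /-- the differential -/
  d : ∀ {x y : Obj} {p q : ℤ}, p + 1 = q → (Hom x y p →ₗ[k] Hom x y q)
  /-- the composition `g ∘ f` -/
  comp : ∀ {x y z : Obj} {p q r : ℤ}, q + p = r →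
    (Hom y z q →ₗ[k] Hom x y p →ₗ[k] Hom x z r)
  /-- the identities -/
  one : ∀ x : Obj, Hom x x 0
  d_d : ∀ {x y : Obj} {p q r : ℤ} (h : p + 1 = q) (h' : q + 1 = r) (f : Hom x y p),
    d h' (d h f) = 0
  assoc : ∀ {x y z t : Obj} {p q r qp rq s : ℤ} (h₁ : r + q = rq) (h₂ : rq + p = s)
    (h₃ : q + p = qp) (h₄ : r + qp = s) (e : Hom z t r) (g : Hom y z q) (f : Hom x y p),
    comp h₂ (comp h₁ e g) f = comp h₄ e (comp h₃ g f)
  one_comp : ∀ {x y : Obj} {p : ℤ} (f : Hom x y p), comp (zero_add p) (one y) f = f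
  comp_one : ∀ {x y : Obj} {p : ℤ} (f : Hom x y p), comp (add_zero p) f (one x) = f
  leibniz : ∀ {x y z : Obj} {p q r p' q' r' : ℤ} (h : q + p = r) (hp : p + 1 = p')
    (hq : q + 1 = q') (hr : r + 1 = r') (g : Hom y z q) (f : Hom x y p),
    d hr (comp h g f) = comp (by omega) (d hq g) f + dgSign k q • comp (by omega) g (d hp f)

attribute [instance] DGCat.addCommGroup DGCat.module

namespace DGCat

variable {k : Type u} [CommRing k]

theorem d_one (A : DGCat.{u, v, w} k) (x : A.Obj) {q : ℤ} (h : 0 + 1 = q) :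
    A.d h (A.one x) = 0 := by
  obtain rfl : q = 0 + 1 := h.symm
  have h1 := A.leibniz (zero_add 0) rfl rfl rfl (A.one x) (A.one x)
  have h2 : ∀ {q : ℤ} (e : q = 0 + 1) (f : A.Hom x x (0 + 1)) (hh : (0 + 1 : ℤ) + 0 = 0 + 1),
    A.comp hh f (A.one x) = f := fun _ f _ => A.comp_one f
  have h3 : ∀ (f : A.Hom x x (0 + 1)) (hh : 0 + (0 + 1 : ℤ) = 0 + 1),
    A.comp hh (A.one x) f = f := fun f _ => A.one_comp f
  rw [A.one_comp, h2 rfl, h3, dgSign_zero, one_smul] at h1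
  simpa using h1

/-- Transport along an equality of degrees. -/
def castDeg (A : DGCat.{u, v, w} k) {x y : A.Obj} {p q : ℤ} (h : p = q) :
    A.Hom x y p →ₗ[k] A.Hom x y q :=
  h ▸ LinearMap.id

theorem castDeg_rfl (A : DGCat.{u, v, w} k) {x y : A.Obj} {p : ℤ} (h : p = p)
    (f : A.Hom x y p) : A.castDeg h f = f := rfl

/-- The full dg subcategory on a family of objects `i : I ↦ o i`. -/
def induced (A : DGCat.{u, v, w} k) {I : Type v'} (o : I → A.Obj) : DGCat.{u, v', w} k where
  Obj := I
  Hom i j p := A.Hom (o i) (o j) p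
  d h := A.d h
  comp h := A.comp h
  one i := A.one (o i)
  d_d := A.d_d
  assoc := A.assoc
  one_comp := A.one_comp
  comp_one := A.comp_one
  leibniz := A.leibniz

/-- The full dg subcategory on a set of objects. -/
def full (A : DGCat.{u, v, w} k) (B : Set A.Obj) : DGCat.{u, v, w} k :=
  A.induced (Subtype.val : B → A.Obj)

/-- The Hom-complex, as a cochain complex of `k`-modules. -/
def homComplex (A : DGCat.{u, v, w} k) (x y : A.Obj) : CochainComplex (ModuleCat.{w} k) ℤ :=
  CochainComplex.of (fun p => ModuleCat.of k (A.Hom x y p))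
    (fun _ => ModuleCat.ofHom (A.d rfl))
    (fun _ => by
      ext f
      exact A.d_d rfl rfl f)

/-! ### The homotopy category -/

/-- Closed morphisms of degree zero. -/
def Z0 (A : DGCat.{u, v, w} k) (x y : A.Obj) : Submodule k (A.Hom x y 0) :=
  LinearMap.ker (A.d (zero_add 1))

/-- Boundaries of degree zero, inside the closed morphisms of degree zero. -/
def B0 (A : DGCat.{u, v, w} k) (x y : A.Obj) : Submodule k (A.Z0 x y) :=
  (LinearMap.range (A.d (x := x) (y := y) (neg_add_cancel 1))).comap (A.Z0 x y).subtype

theorem mem_Z0 (A : DGCat.{u, v, w} k) {x y : A.Obj} {f : A.Hom x y 0} :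
    f ∈ A.Z0 x y ↔ A.d (zero_add 1) f = 0 := LinearMap.mem_ker

theorem mem_B0 (A : DGCat.{u, v, w} k) {x y : A.Obj} {f : A.Z0 x y} :
    f ∈ A.B0 x y ↔ ∃ s : A.Hom x y (-1), A.d (neg_add_cancel 1) s = f.1 := Iff.rfl

/-- The composition of closed morphisms of degree zero. -/
def Z0.comp (A : DGCat.{u, v, w} k) {x y z : A.Obj} (g : A.Z0 y z) (f : A.Z0 x y) : A.Z0 x z :=
  ⟨A.comp (zero_add 0) g.1 f.1, by
    have hf := A.mem_Z0.1 f.2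
    have hg := A.mem_Z0.1 g.2
    rw [mem_Z0, A.leibniz (zero_add 0) (zero_add 1) (zero_add 1) (zero_add 1), hf, hg]
    simp⟩

theorem Z0.comp_mem_B0_left (A : DGCat.{u, v, w} k) {x y z : A.Obj} (g : A.Z0 y z) (f : A.Z0 x y)
    (hg : g ∈ A.B0 y z) : Z0.comp A g f ∈ A.B0 x z := by
  obtain ⟨s, hs⟩ := A.mem_B0.1 hg
  refine A.mem_B0.2 ⟨A.comp (add_zero _) s f.1, ?_⟩
  rw [A.leibniz (add_zero _) (zero_add 1) (neg_add_cancel 1) (neg_add_cancel 1), hs,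
    A.mem_Z0.1 f.2]
  simp [Z0.comp]

theorem Z0.comp_mem_B0_right (A : DGCat.{u, v, w} k) {x y z : A.Obj} (g : A.Z0 y z)
    (f : A.Z0 x y) (hf : f ∈ A.B0 x y) : Z0.comp A g f ∈ A.B0 x z := by
  obtain ⟨s, hs⟩ := A.mem_B0.1 hf
  refine A.mem_B0.2 ⟨A.comp (zero_add _) g.1 s, ?_⟩
  rw [A.leibniz (zero_add _) (neg_add_cancel 1) (zero_add 1) (neg_add_cancel 1), hs,
    A.mem_Z0.1 g.2]
  simp [Z0.comp, dgSign_zero]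

/-- The objects of the homotopy category `H⁰(A)`. -/
structure H0 (A : DGCat.{u, v, w} k) where
  /-- the underlying object of the dg category -/
  as : A.Obj

/-- The homotopy class of a closed morphism of degree zero. -/
def cls (A : DGCat.{u, v, w} k) {x y : A.Obj} (f : A.Z0 x y) : A.Z0 x y ⧸ A.B0 x y :=
  Submodule.Quotient.mk f

theorem cls_eq_iff (A : DGCat.{u, v, w} k) {x y : A.Obj} (f g : A.Z0 x y) :
    A.cls f = A.cls g ↔ ∃ s : A.Hom x y (-1), A.d (neg_add_cancel 1) s = f.1 - g.1 :=
  (Submodule.Quotient.eq _).trans A.mem_B0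

/-- The homotopy category: morphisms are the zeroth cohomology modules of the Hom-complexes. -/
instance (A : DGCat.{u, v, w} k) : Category (H0 A) where
  Hom X Y := A.Z0 X.as Y.as ⧸ A.B0 X.as Y.as
  id X := A.cls ⟨A.one X.as, A.mem_Z0.2 (A.d_one _ _)⟩
  comp {X Y Z} f g := Quotient.liftOn₂' f g (fun f g => A.cls (Z0.comp A g f)) (by
    intro f g f' g' hf hg
    have hf' := (Submodule.quotientRel_def _).1 hf
    have hg' := (Submodule.quotientRel_def _).1 hg
    have h1 := Z0.comp_mem_B0_right A g (f - f') hf'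
    have h2 := Z0.comp_mem_B0_left A (g - g') f' hg'
    refine (Submodule.Quotient.eq _).2 ?_
    convert add_mem h1 h2 using 1
    ext
    simp [Z0.comp])
  id_comp f := by
    obtain ⟨f, rfl⟩ := Submodule.Quotient.mk_surjective _ f
    refine congrArg A.cls (Subtype.ext ?_)
    exact A.comp_one f.1
  comp_id f := by
    obtain ⟨f, rfl⟩ := Submodule.Quotient.mk_surjective _ f
    refine congrArg A.cls (Subtype.ext ?_)
    exact A.one_comp f.1
  assoc f g h := by
    obtain ⟨f, rfl⟩ := Submodule.Quotient.mk_surjective _ f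
    obtain ⟨g, rfl⟩ := Submodule.Quotient.mk_surjective _ g
    obtain ⟨h, rfl⟩ := Submodule.Quotient.mk_surjective _ h
    refine congrArg A.cls (Subtype.ext ?_)
    exact (A.assoc _ _ _ _ h.1 g.1 f.1).symm

/-- The morphism of the homotopy category given by a closed morphism of degree zero. -/
def mk0 (A : DGCat.{u, v, w} k) {x y : A.Obj} (f : A.Hom x y 0) (hf : A.d (zero_add 1) f = 0) :
    (⟨x⟩ : H0 A) ⟶ ⟨y⟩ := A.cls ⟨f, A.mem_Z0.2 hf⟩

theorem mk0_surj (A : DGCat.{u, v, w} k) {X Y : H0 A} (f : X ⟶ Y) :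
    ∃ (g : A.Hom X.as Y.as 0) (hg : A.d (zero_add 1) g = 0), f = A.mk0 g hg := by
  obtain ⟨f, rfl⟩ := Submodule.Quotient.mk_surjective _ f
  exact ⟨f.1, A.mem_Z0.1 f.2, rfl⟩

theorem mk0_eq_iff (A : DGCat.{u, v, w} k) {x y : A.Obj} (f g : A.Hom x y 0)
    (hf : A.d (zero_add 1) f = 0) (hg : A.d (zero_add 1) g = 0) :
    A.mk0 f hf = A.mk0 g hg ↔ ∃ s : A.Hom x y (-1), A.d (neg_add_cancel 1) s = f - g :=
  A.cls_eq_iff _ _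

theorem d_comp_closed (A : DGCat.{u, v, w} k) {x y z : A.Obj} {p q r p' q' r' : ℤ}
    (h : q + p = r) (hp : p + 1 = p') (hq : q + 1 = q') (hr : r + 1 = r') (g : A.Hom y z q)
    (f : A.Hom x y p) (hg : A.d hq g = 0) (hf : A.d hp f = 0) : A.d hr (A.comp h g f) = 0 := by
  rw [A.leibniz h hp hq hr, hf, hg]
  simp

theorem mk0_comp (A : DGCat.{u, v, w} k) {x y z : A.Obj} (f : A.Hom x y 0) (g : A.Hom y z 0)
    (hf : A.d (zero_add 1) f = 0) (hg : A.d (zero_add 1) g = 0) :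
    A.mk0 f hf ≫ A.mk0 g hg =
      A.mk0 (A.comp (zero_add 0) g f) (A.d_comp_closed _ _ _ _ _ _ hg hf) := rfl

theorem mk0_one (A : DGCat.{u, v, w} k) (X : H0 A) :
    A.mk0 (A.one X.as) (A.d_one _ _) = 𝟙 X := rfl

end DGCat

/-- A dg functor. -/
structure DGFunctor {k : Type u} [CommRing k] (A : DGCat.{u, v, w} k)
    (B : DGCat.{u, v', w'} k) where
  /-- the map on objects -/
  obj : A.Obj → B.Obj
  /-- the maps on Hom-complexes -/
  map : ∀ {x y : A.Obj} {p : ℤ}, A.Hom x y p →ₗ[k] B.Hom (obj x) (obj y) p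
  map_d : ∀ {x y : A.Obj} {p q : ℤ} (h : p + 1 = q) (f : A.Hom x y p),
    map (A.d h f) = B.d h (map f)
  map_comp : ∀ {x y z : A.Obj} {p q r : ℤ} (h : q + p = r) (g : A.Hom y z q) (f : A.Hom x y p),
    map (A.comp h g f) = B.comp h (map g) (map f)
  map_one : ∀ x : A.Obj, map (A.one x) = B.one (obj x)

namespace DGFunctor

variable {k : Type u} [CommRing k] {A : DGCat.{u, v, w} k} {B : DGCat.{u, v', w'} k}

theorem d_map_eq_zero (F : DGFunctor A B) {x y : A.Obj} {p q : ℤ} (h : p + 1 = q)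
    (f : A.Hom x y p) (hf : A.d h f = 0) : B.d h (F.map f) = 0 := by
  rw [← F.map_d, hf, map_zero]

/-- The functor induced on homotopy categories. -/
def H0map (F : DGFunctor A B) : DGCat.H0 A ⥤ DGCat.H0 B where
  obj X := ⟨F.obj X.as⟩
  map {X Y} f := Quotient.liftOn' f
    (fun f => B.mk0 (F.map f.1) (F.d_map_eq_zero _ _ (A.mem_Z0.1 f.2))) (by
      intro f g h
      obtain ⟨s, hs⟩ := A.mem_B0.1 ((Submodule.quotientRel_def _).1 h)
      refine (B.mk0_eq_iff _ _ _ _).2 ⟨F.map s, ?_⟩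
      rw [← F.map_d, hs]
      simp)
  map_id X := by
    refine congrArg B.cls (Subtype.ext ?_)
    exact F.map_one _
  map_comp f g := by
    obtain ⟨f, rfl⟩ := Submodule.Quotient.mk_surjective _ f
    obtain ⟨g, rfl⟩ := Submodule.Quotient.mk_surjective _ g
    refine congrArg B.cls (Subtype.ext ?_)
    exact F.map_comp _ _ _

theorem H0map_mk0 (F : DGFunctor A B) {x y : A.Obj} (f : A.Hom x y 0)
    (hf : A.d (zero_add 1) f = 0) :
    F.H0map.map (A.mk0 f hf) = B.mk0 (F.map f) (F.d_map_eq_zero _ _ hf) := rfl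

end DGFunctor

/-- A complex `F` is homotopically flat if `C ⊗ F` is acyclic for every acyclic complex `C`. -/
def IsHomotopicallyFlat {k : Type u} [CommRing k] (F : CochainComplex (ModuleCat.{u} k) ℤ) :
    Prop :=
  ∀ C : CochainComplex (ModuleCat.{u} k) ℤ, C.Acyclic →
    (MonoidalCategory.tensorObj C F).Acyclic

/-! ### Forgetting the grading

An auxiliary device for computations: the underlying ungraded `k`-linear category of a dg
category, in which equalities of composites can be checked without keeping track of degrees. -/

namespace DGCat

variable {k : Type u} [CommRing k]

/-- The objects of the underlying ungraded category. -/
structure Tot (A : DGCat.{u, v, w} k) where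
  /-- the underlying object -/
  as : A.Obj

open DirectSum in
/-- The bilinear extension of the composition to inhomogeneous morphisms. -/
def totComp (A : DGCat.{u, v, w} k) (x y z : A.Obj) :
    (⨁ p, A.Hom x y p) →ₗ[k] (⨁ p, A.Hom y z p) →ₗ[k] (⨁ p, A.Hom x z p) :=
  DirectSum.toModule k ℤ _ fun p =>
    (DirectSum.toModule k ℤ _ fun q =>
      (LinearMap.compr₂ (A.comp (p := p) (q := q) rfl)
        (DirectSum.lof k ℤ (fun r => A.Hom x z r) (q + p)))).flip

open DirectSum in
theorem totComp_lof (A : DGCat.{u, v, w} k) {x y z : A.Obj} {p q r : ℤ} (h : q + p = r)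
    (g : A.Hom y z q) (f : A.Hom x y p) :
    A.totComp x y z (DirectSum.lof k ℤ (fun r => A.Hom x y r) p f)
      (DirectSum.lof k ℤ (fun r => A.Hom y z r) q g) =
        DirectSum.lof k ℤ (fun r => A.Hom x z r) r (A.comp h g f) := by
  subst h
  simp [totComp]

theorem tot_lof_eq (A : DGCat.{u, v, w} k) {x y : A.Obj} {p q : ℤ} (h : p = q)
    (f : A.Hom x y p) :
    DirectSum.lof k ℤ (fun r => A.Hom x y r) q (A.castDeg h f) =
      DirectSum.lof k ℤ (fun r => A.Hom x y r) p f := by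
  subst h
  rfl

open DirectSum in
instance (A : DGCat.{u, v, w} k) : Category (Tot A) where
  Hom X Y := ⨁ p, A.Hom X.as Y.as p
  id X := DirectSum.lof k ℤ (fun r => A.Hom X.as X.as r) 0 (A.one X.as)
  comp f g := A.totComp _ _ _ f g
  id_comp {X Y} f := by
    have h : A.totComp X.as X.as Y.as
        (DirectSum.lof k ℤ (fun r => A.Hom X.as X.as r) 0 (A.one X.as)) = LinearMap.id := by
      refine DirectSum.linearMap_ext k fun p => LinearMap.ext fun g => ?_
      refine (A.totComp_lof (add_zero p) _ _).trans ?_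
      rw [A.comp_one]
      rfl
    exact LinearMap.congr_fun h f
  comp_id {X Y} f := by
    have h : (A.totComp X.as Y.as Y.as).flip
        (DirectSum.lof k ℤ (fun r => A.Hom Y.as Y.as r) 0 (A.one Y.as)) = LinearMap.id := by
      refine DirectSum.linearMap_ext k fun p => LinearMap.ext fun g => ?_
      refine (A.totComp_lof (zero_add p) _ _).trans ?_
      rw [A.one_comp]
      rfl
    exact LinearMap.congr_fun h f
  assoc {X Y Z T} f g e := by
    induction f using DirectSum.induction_on with
    | zero => simp
    | add f f' hf hf' => simp only [map_add, LinearMap.add_apply, hf, hf']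
    | of p f =>
      induction g using DirectSum.induction_on with
      | zero => simp
      | add f f' hf hf' => simp only [map_add, LinearMap.add_apply, hf, hf']
      | of q g =>
        induction e using DirectSum.induction_on with
        | zero => simp
        | add f f' hf hf' => simp only [map_add, hf, hf']
        | of r e =>
          have h1 := A.totComp_lof rfl g f
          have h2 := A.totComp_lof rfl e g
          have h3 := A.totComp_lof (add_assoc r q p).symm e (A.comp rfl g f)
          have h4 := A.totComp_lof rfl (A.comp rfl e g) f
          rw [A.assoc rfl rfl rfl (add_assoc r q p).symm] at h4
          refine (congrArg (fun a => A.totComp _ _ _ a _) h1).trans (h3.trans (h4.symm.trans ?_))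
          exact (congrArg (fun a => A.totComp _ _ _ _ a) h2).symm

instance (A : DGCat.{u, v, w} k) : Preadditive (Tot A) where
  homGroup X Y := inferInstanceAs (AddCommGroup (DirectSum ℤ fun p => A.Hom X.as Y.as p))
  add_comp X Y Z f f' g := by
    change A.totComp _ _ _ _ _ = A.totComp _ _ _ _ _ + A.totComp _ _ _ _ _
    rw [← LinearMap.add_apply, ← map_add]
  comp_add X Y Z f g g' := by
    change A.totComp _ _ _ _ _ = A.totComp _ _ _ _ _ + A.totComp _ _ _ _ _
    rw [← map_add]

instance (A : DGCat.{u, v, w} k) : Linear k (Tot A) where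
  homModule X Y := inferInstanceAs (Module k (DirectSum ℤ fun p => A.Hom X.as Y.as p))
  smul_comp X Y Z c f g := by
    change A.totComp _ _ _ _ _ = c • A.totComp _ _ _ _ _
    rw [← LinearMap.smul_apply, ← map_smul]
  comp_smul X Y Z f c g := by
    change A.totComp _ _ _ _ _ = c • A.totComp _ _ _ _ _
    rw [← map_smul]

/-- A homogeneous morphism, as a morphism of the underlying ungraded category. -/
def tot (A : DGCat.{u, v, w} k) {x y : A.Obj} {p : ℤ} :
    A.Hom x y p →ₗ[k] ((⟨x⟩ : Tot A) ⟶ ⟨y⟩) :=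
  DirectSum.lof k ℤ (fun r => A.Hom x y r) p

theorem tot_inj (A : DGCat.{u, v, w} k) {x y : A.Obj} {p : ℤ} {f g : A.Hom x y p}
    (h : A.tot f = A.tot g) : f = g :=
  DirectSum.of_injective (β := fun r => A.Hom x y r) p h

theorem tot_comp (A : DGCat.{u, v, w} k) {x y z : A.Obj} {p q r : ℤ} (h : q + p = r)
    (g : A.Hom y z q) (f : A.Hom x y p) : A.tot (A.comp h g f) = A.tot f ≫ A.tot g :=
  (A.totComp_lof h g f).symm

theorem tot_one (A : DGCat.{u, v, w} k) (x : A.Obj) : A.tot (A.one x) = 𝟙 (⟨x⟩ : Tot A) := rfl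

theorem tot_castDeg (A : DGCat.{u, v, w} k) {x y : A.Obj} {p q : ℤ} (h : p = q)
    (f : A.Hom x y p) : A.tot (A.castDeg h f) = A.tot f := A.tot_lof_eq h f

end DGCat

namespace DGCat

variable {k : Type u} [CommRing k]

/-- The differential of a homogeneous morphism, in the underlying ungraded category. -/
def dtot (A : DGCat.{u, v, w} k) {x y : A.Obj} {p : ℤ} :
    A.Hom x y p →ₗ[k] ((⟨x⟩ : Tot A) ⟶ ⟨y⟩) :=
  A.tot ∘ₗ A.d rfl

theorem tot_d (A : DGCat.{u, v, w} k) {x y : A.Obj} {p q : ℤ} (h : p + 1 = q)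
    (f : A.Hom x y p) : A.tot (A.d h f) = A.dtot f := by
  subst h
  rfl

theorem dtot_eq_zero (A : DGCat.{u, v, w} k) {x y : A.Obj} {p q : ℤ} (h : p + 1 = q)
    {f : A.Hom x y p} (hf : A.d h f = 0) : A.dtot f = 0 := by
  rw [← A.tot_d h, hf, map_zero]

theorem dtot_d (A : DGCat.{u, v, w} k) {x y : A.Obj} {p q : ℤ} (h : p + 1 = q)
    (f : A.Hom x y p) : A.dtot (A.d h f) = 0 := by
  rw [← A.tot_d rfl, A.d_d, map_zero]

theorem dtot_one (A : DGCat.{u, v, w} k) (x : A.Obj) : A.dtot (A.one x) = 0 :=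
  A.dtot_eq_zero rfl (A.d_one x rfl)

theorem dtot_castDeg (A : DGCat.{u, v, w} k) {x y : A.Obj} {p q : ℤ} (h : p = q)
    (f : A.Hom x y p) : A.dtot (A.castDeg h f) = A.dtot f := by
  subst h
  rfl

theorem dtot_comp (A : DGCat.{u, v, w} k) {x y z : A.Obj} {p q r : ℤ} (h : q + p = r)
    (g : A.Hom y z q) (f : A.Hom x y p) :
    A.dtot (A.comp h g f) = A.tot f ≫ A.dtot g + dgSign k q • (A.dtot f ≫ A.tot g) := by
  rw [← A.tot_d rfl, A.leibniz h rfl rfl rfl, map_add, map_smul, A.tot_comp, A.tot_comp,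
    A.tot_d, A.tot_d]

end DGCat


namespace DGCat

variable {k : Type u} [CommRing k]

theorem d_eq_zero_of (A : DGCat.{u, v, w} k) {x y : A.Obj} {p q : ℤ} (h : p + 1 = q)
    {f : A.Hom x y p} (hf : A.dtot f = 0) : A.d h f = 0 :=
  A.tot_inj (by rw [A.tot_d, hf, map_zero])

theorem mk0_congr (A : DGCat.{u, v, w} k) {x y : A.Obj} {f g : A.Hom x y 0}
    (hf : A.d (zero_add 1) f = 0) (hg : A.d (zero_add 1) g = 0) (h : A.tot f = A.tot g) :
    A.mk0 f hf = A.mk0 g hg := by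
  obtain rfl := A.tot_inj h
  rfl

theorem cls_congr (A : DGCat.{u, v, w} k) {x y : A.Obj} (f g : A.Z0 x y)
    (h : A.tot f.1 = A.tot g.1) : A.cls f = A.cls g :=
  congrArg A.cls (Subtype.ext (A.tot_inj h))

theorem mk0_congr' (A : DGCat.{u, v, w} k) {x y : A.Obj} {f g : A.Hom x y 0}
    (hf : A.d (zero_add 1) f = 0) (hg : A.d (zero_add 1) g = 0) (s : A.Hom x y (-1))
    (h : A.dtot s = A.tot f - A.tot g) :
    A.mk0 f hf = A.mk0 g hg :=
  (A.mk0_eq_iff f g hf hg).2 ⟨s, A.tot_inj (by rw [A.tot_d, h, map_sub])⟩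

instance (A : DGCat.{u, v, w} k) : Preadditive (H0 A) where
  homGroup X Y := inferInstanceAs (AddCommGroup (A.Z0 X.as Y.as ⧸ A.B0 X.as Y.as))
  add_comp X Y Z f f' g := by
    obtain ⟨f, rfl⟩ := Submodule.Quotient.mk_surjective _ f
    obtain ⟨f', rfl⟩ := Submodule.Quotient.mk_surjective _ f'
    obtain ⟨g, rfl⟩ := Submodule.Quotient.mk_surjective _ g
    refine congrArg A.cls (Subtype.ext ?_)
    exact map_add (A.comp (zero_add 0) g.1) f.1 f'.1
  comp_add X Y Z f g g' := by
    obtain ⟨f, rfl⟩ := Submodule.Quotient.mk_surjective _ f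
    obtain ⟨g, rfl⟩ := Submodule.Quotient.mk_surjective _ g
    obtain ⟨g', rfl⟩ := Submodule.Quotient.mk_surjective _ g'
    refine congrArg A.cls (Subtype.ext ?_)
    exact LinearMap.map_add₂ (A.comp (zero_add 0)) g.1 g'.1 f.1

theorem mk0_zero (A : DGCat.{u, v, w} k) (x y : A.Obj) :
    A.mk0 (0 : A.Hom x y 0) (map_zero _) = 0 := rfl

theorem mk0_add (A : DGCat.{u, v, w} k) {x y : A.Obj} (f g : A.Hom x y 0)
    (hf : A.d (zero_add 1) f = 0) (hg : A.d (zero_add 1) g = 0) :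
    A.mk0 (f + g) (by rw [map_add, hf, hg, add_zero]) = A.mk0 f hf + A.mk0 g hg := rfl

theorem mk0_neg (A : DGCat.{u, v, w} k) {x y : A.Obj} (f : A.Hom x y 0)
    (hf : A.d (zero_add 1) f = 0) :
    A.mk0 (-f) (by rw [map_neg, hf, neg_zero]) = - A.mk0 f hf := rfl

theorem mk0_negOnePow (A : DGCat.{u, v, w} k) {x y : A.Obj} (f : A.Hom x y 0)
    (hf : A.d (zero_add 1) f = 0) (n : ℤ) :
    n.negOnePow • A.mk0 f hf = A.mk0 (dgSign k n • f) (by rw [map_smul, hf, smul_zero]) := by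
  obtain h | h := Int.even_or_odd n
  · rw [Int.negOnePow_even n h, one_smul]
    refine A.mk0_congr _ _ ?_
    simp [dgSign, Int.negOnePow_even n h]
  · rw [Int.negOnePow_odd n h, Units.neg_smul, one_smul, ← A.mk0_neg]
    refine A.mk0_congr _ _ ?_
    simp [dgSign, Int.negOnePow_odd n h]

theorem mk0_comp_eq (A : DGCat.{u, v, w} k) {x y z : A.Obj} (f : A.Hom x y 0) (g : A.Hom y z 0)
    (h : A.Hom x z 0) (hf : A.d (zero_add 1) f = 0) (hg : A.d (zero_add 1) g = 0)
    (hh : A.d (zero_add 1) h = 0) (H : A.tot f ≫ A.tot g = A.tot h) :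
    A.mk0 f hf ≫ A.mk0 g hg = A.mk0 h hh :=
  A.cls_congr _ _ ((A.tot_comp _ _ _).trans H)

theorem mk0_comp_one (A : DGCat.{u, v, w} k) {x y : A.Obj} (f : A.Hom x y 0) (g : A.Hom y x 0)
    (hf : A.d (zero_add 1) f = 0) (hg : A.d (zero_add 1) g = 0) (H : A.tot f ≫ A.tot g = 𝟙 _) :
    A.mk0 f hf ≫ A.mk0 g hg = 𝟙 _ :=
  A.mk0_comp_eq f g (A.one x) hf hg (A.d_one _ _) H

theorem mk0_sq (A : DGCat.{u, v, w} k) {x y z y' : A.Obj} {f : A.Hom x y 0} {g : A.Hom y z 0}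
    {f' : A.Hom x y' 0} {g' : A.Hom y' z 0} (hf : A.d (zero_add 1) f = 0)
    (hg : A.d (zero_add 1) g = 0) (hf' : A.d (zero_add 1) f' = 0)
    (hg' : A.d (zero_add 1) g' = 0) (H : A.tot f ≫ A.tot g = A.tot f' ≫ A.tot g') :
    A.mk0 f hf ≫ A.mk0 g hg = A.mk0 f' hf' ≫ A.mk0 g' hg' :=
  A.cls_congr _ _ ((A.tot_comp _ _ _).trans (H.trans (A.tot_comp _ _ _).symm))

theorem cls_sq (A : DGCat.{u, v, w} k) {x y z y' : A.Obj} (f : A.Z0 x y) (g : A.Z0 y z)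
    (f' : A.Z0 x y') (g' : A.Z0 y' z)
    (H : A.tot f.1 ≫ A.tot g.1 = A.tot f'.1 ≫ A.tot g'.1) :
    CategoryStruct.comp (X := (⟨x⟩ : H0 A)) (Y := ⟨y⟩) (Z := ⟨z⟩) (A.cls f) (A.cls g) =
      CategoryStruct.comp (X := (⟨x⟩ : H0 A)) (Y := ⟨y'⟩) (Z := ⟨z⟩) (A.cls f') (A.cls g') :=
  A.cls_congr _ _ ((A.tot_comp _ _ _).trans (H.trans (A.tot_comp _ _ _).symm))

theorem cls_congr' (A : DGCat.{u, v, w} k) {x y : A.Obj} (f g : A.Z0 x y) (s : A.Hom x y (-1))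
    (h : A.dtot s = A.tot f.1 - A.tot g.1) : A.cls f = A.cls g :=
  (A.cls_eq_iff f g).2 ⟨s, A.tot_inj (by rw [A.tot_d, h, map_sub])⟩

/-- An isomorphism of the homotopy category from inverse homotopy equivalences. -/
def isoMk0 (A : DGCat.{u, v, w} k) {x y : A.Obj} (f : A.Hom x y 0) (g : A.Hom y x 0)
    (hf : A.d (zero_add 1) f = 0) (hg : A.d (zero_add 1) g = 0)
    (h : A.mk0 f hf ≫ A.mk0 g hg = 𝟙 _) (h' : A.mk0 g hg ≫ A.mk0 f hf = 𝟙 _) :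
    (⟨x⟩ : H0 A) ≅ ⟨y⟩ := ⟨A.mk0 f hf, A.mk0 g hg, h, h'⟩

end DGCat

/-! ### Exact (strongly pretriangulated) dg categories -/

/-- The structure of an exact dg category: a zero object, iterated (de)suspensions `Σⁿ x`, `n ∈ ℤ`,
with closed isomorphisms `ξ n x : Σⁿ x → x` of degree `n`, and cones of closed morphisms
`f : x → y` of degree zero, i.e. biproducts of `y` and `Σ x` in the category of morphisms of
degree zero with `d j = 0`, `d p = 0` and `d s = j ∘ f ∘ ξ`. -/
class DGExact {k : Type u} [CommRing k] (P : DGCat.{u, v, w} k) where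
  /-- the zero object -/
  zero : P.Obj
  one_zero : P.one zero = 0
  /-- the iterated suspension of an object -/
  susp : ℤ → P.Obj → P.Obj
  /-- the closed isomorphism of degree `n` -/
  ξ : ∀ (n : ℤ) (x : P.Obj), P.Hom (susp n x) x n
  /-- the inverse of `ξ` -/
  ξinv : ∀ (n : ℤ) (x : P.Obj), P.Hom x (susp n x) (-n)
  d_ξ : ∀ (n : ℤ) (x : P.Obj), P.d rfl (ξ n x) = 0
  ξ_ξinv : ∀ (n : ℤ) (x : P.Obj), P.comp (add_neg_cancel n) (ξ n x) (ξinv n x) = P.one x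
  ξinv_ξ : ∀ (n : ℤ) (x : P.Obj), P.comp (neg_add_cancel n) (ξinv n x) (ξ n x) = P.one (susp n x)
  /-- the cone of a closed morphism of degree zero -/
  cone : ∀ {x y : P.Obj} (f : P.Hom x y 0), P.d (zero_add 1) f = 0 → P.Obj
  /-- the inclusion of the target -/
  j : ∀ {x y : P.Obj} (f : P.Hom x y 0) (hf : P.d (zero_add 1) f = 0), P.Hom y (cone f hf) 0
  /-- the graded retraction of `j` -/
  t : ∀ {x y : P.Obj} (f : P.Hom x y 0) (hf : P.d (zero_add 1) f = 0), P.Hom (cone f hf) y 0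
  /-- the projection to the suspension of the source -/
  p : ∀ {x y : P.Obj} (f : P.Hom x y 0) (hf : P.d (zero_add 1) f = 0),
    P.Hom (cone f hf) (susp 1 x) 0
  /-- the graded section of `p` -/
  s : ∀ {x y : P.Obj} (f : P.Hom x y 0) (hf : P.d (zero_add 1) f = 0),
    P.Hom (susp 1 x) (cone f hf) 0
  t_j : ∀ {x y : P.Obj} (f : P.Hom x y 0) (hf : P.d (zero_add 1) f = 0),
    P.comp (zero_add 0) (t f hf) (j f hf) = P.one y
  p_s : ∀ {x y : P.Obj} (f : P.Hom x y 0) (hf : P.d (zero_add 1) f = 0),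
    P.comp (zero_add 0) (p f hf) (s f hf) = P.one (susp 1 x)
  p_j : ∀ {x y : P.Obj} (f : P.Hom x y 0) (hf : P.d (zero_add 1) f = 0),
    P.comp (zero_add 0) (p f hf) (j f hf) = 0
  t_s : ∀ {x y : P.Obj} (f : P.Hom x y 0) (hf : P.d (zero_add 1) f = 0),
    P.comp (zero_add 0) (t f hf) (s f hf) = 0
  j_t_add_s_p : ∀ {x y : P.Obj} (f : P.Hom x y 0) (hf : P.d (zero_add 1) f = 0),
    P.comp (zero_add 0) (j f hf) (t f hf) + P.comp (zero_add 0) (s f hf) (p f hf) =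
      P.one (cone f hf)
  d_j : ∀ {x y : P.Obj} (f : P.Hom x y 0) (hf : P.d (zero_add 1) f = 0),
    P.d (zero_add 1) (j f hf) = 0
  d_p : ∀ {x y : P.Obj} (f : P.Hom x y 0) (hf : P.d (zero_add 1) f = 0),
    P.d (zero_add 1) (p f hf) = 0
  d_s : ∀ {x y : P.Obj} (f : P.Hom x y 0) (hf : P.d (zero_add 1) f = 0),
    P.d (zero_add 1) (s f hf) =
      P.comp (zero_add 1) (j f hf) (P.comp (zero_add 1) f (ξ 1 x))

namespace DGExact

variable {k : Type u} [CommRing k] (P : DGCat.{u, v, w} k) [DGExact P]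

section

variable {P}

theorem tot_ξ_ξinv (n : ℤ) (x : P.Obj) : P.tot (ξinv n x) ≫ P.tot (ξ n x) = 𝟙 _ := by
  rw [← P.tot_comp (add_neg_cancel n), ξ_ξinv, P.tot_one]

theorem tot_ξ_ξinv_assoc (n : ℤ) (x : P.Obj) {Z : P.Tot} (h : ⟨x⟩ ⟶ Z) :
    P.tot (ξinv n x) ≫ P.tot (ξ n x) ≫ h = h := by
  rw [← Category.assoc, tot_ξ_ξinv, Category.id_comp]

theorem tot_ξinv_ξ (n : ℤ) (x : P.Obj) : P.tot (ξ n x) ≫ P.tot (ξinv n x) = 𝟙 _ := by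
  rw [← P.tot_comp (neg_add_cancel n), ξinv_ξ, P.tot_one]

theorem tot_ξinv_ξ_assoc (n : ℤ) (x : P.Obj) {Z : P.Tot} (h : ⟨susp n x⟩ ⟶ Z) :
    P.tot (ξ n x) ≫ P.tot (ξinv n x) ≫ h = h := by
  rw [← Category.assoc, tot_ξinv_ξ, Category.id_comp]

theorem dtot_ξ (n : ℤ) (x : P.Obj) : P.dtot (ξ n x) = 0 := P.dtot_eq_zero rfl (d_ξ n x)

theorem dtot_ξinv (n : ℤ) (x : P.Obj) : P.dtot (ξinv n x) = 0 := by
  have h := P.dtot_comp (add_neg_cancel n) (ξ n x) (ξinv n x)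
  rw [ξ_ξinv, P.dtot_one, dtot_ξ] at h
  have h2 : dgSign k n • P.dtot (ξinv n x) ≫ P.tot (ξ n x) = 0 := by simpa using h.symm
  have h3 := congrArg (fun a => dgSign k n • (a ≫ P.tot (ξinv n x))) h2
  simpa [tot_ξinv_ξ, smul_smul, dgSign_mul_self] using h3

theorem tot_t_j {x y : P.Obj} (f : P.Hom x y 0) (hf : P.d (zero_add 1) f = 0) :
    P.tot (j f hf) ≫ P.tot (t f hf) = 𝟙 _ := by
  rw [← P.tot_comp (zero_add 0), DGExact.t_j, P.tot_one]

theorem tot_t_j_assoc {x y : P.Obj} (f : P.Hom x y 0) (hf : P.d (zero_add 1) f = 0) {Z : P.Tot}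
    (h : ⟨y⟩ ⟶ Z) : P.tot (j f hf) ≫ P.tot (t f hf) ≫ h = h := by
  rw [← Category.assoc, tot_t_j, Category.id_comp]

theorem tot_p_s {x y : P.Obj} (f : P.Hom x y 0) (hf : P.d (zero_add 1) f = 0) :
    P.tot (s f hf) ≫ P.tot (p f hf) = 𝟙 _ := by
  rw [← P.tot_comp (zero_add 0), DGExact.p_s, P.tot_one]

theorem tot_p_s_assoc {x y : P.Obj} (f : P.Hom x y 0) (hf : P.d (zero_add 1) f = 0) {Z : P.Tot}
    (h : ⟨susp 1 x⟩ ⟶ Z) : P.tot (s f hf) ≫ P.tot (p f hf) ≫ h = h := by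
  rw [← Category.assoc, tot_p_s, Category.id_comp]

theorem tot_p_j {x y : P.Obj} (f : P.Hom x y 0) (hf : P.d (zero_add 1) f = 0) :
    P.tot (j f hf) ≫ P.tot (p f hf) = 0 := by
  rw [← P.tot_comp (zero_add 0), DGExact.p_j, map_zero]

theorem tot_p_j_assoc {x y : P.Obj} (f : P.Hom x y 0) (hf : P.d (zero_add 1) f = 0) {Z : P.Tot}
    (h : ⟨susp 1 x⟩ ⟶ Z) : P.tot (j f hf) ≫ P.tot (p f hf) ≫ h = 0 := by
  rw [← Category.assoc, tot_p_j, Limits.zero_comp]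

theorem tot_t_s {x y : P.Obj} (f : P.Hom x y 0) (hf : P.d (zero_add 1) f = 0) :
    P.tot (s f hf) ≫ P.tot (t f hf) = 0 := by
  rw [← P.tot_comp (zero_add 0), DGExact.t_s, map_zero]

theorem tot_t_s_assoc {x y : P.Obj} (f : P.Hom x y 0) (hf : P.d (zero_add 1) f = 0) {Z : P.Tot}
    (h : ⟨y⟩ ⟶ Z) : P.tot (s f hf) ≫ P.tot (t f hf) ≫ h = 0 := by
  rw [← Category.assoc, tot_t_s, Limits.zero_comp]

theorem tot_total {x y : P.Obj} (f : P.Hom x y 0) (hf : P.d (zero_add 1) f = 0) :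
    P.tot (t f hf) ≫ P.tot (j f hf) + P.tot (p f hf) ≫ P.tot (s f hf) = 𝟙 _ := by
  rw [← P.tot_comp (zero_add 0), ← P.tot_comp (zero_add 0), ← map_add, j_t_add_s_p, P.tot_one]

theorem dtot_j {x y : P.Obj} (f : P.Hom x y 0) (hf : P.d (zero_add 1) f = 0) :
    P.dtot (j f hf) = 0 := P.dtot_eq_zero _ (d_j f hf)

theorem dtot_p {x y : P.Obj} (f : P.Hom x y 0) (hf : P.d (zero_add 1) f = 0) :
    P.dtot (p f hf) = 0 := P.dtot_eq_zero _ (d_p f hf)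

theorem dtot_s {x y : P.Obj} (f : P.Hom x y 0) (hf : P.d (zero_add 1) f = 0) :
    P.dtot (s f hf) = P.tot (ξ 1 x) ≫ P.tot f ≫ P.tot (j f hf) := by
  rw [← P.tot_d (zero_add 1), d_s, P.tot_comp, P.tot_comp, Category.assoc]

theorem dtot_t {x y : P.Obj} (f : P.Hom x y 0) (hf : P.d (zero_add 1) f = 0) :
    P.dtot (t f hf) = - (P.tot (p f hf) ≫ P.tot (ξ 1 x) ≫ P.tot f) := by
  have hj := P.dtot_comp (zero_add 0) (t f hf) (j f hf)
  have hs := P.dtot_comp (zero_add 0) (t f hf) (s f hf)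
  rw [DGExact.t_j, P.dtot_one, dtot_j, Limits.zero_comp, smul_zero, add_zero] at hj
  rw [DGExact.t_s, map_zero, dtot_s, dgSign_zero, one_smul] at hs
  simp only [Category.assoc, tot_t_j, Category.comp_id] at hs
  rw [← Category.id_comp (P.dtot (t f hf)), ← tot_total f hf, Preadditive.add_comp,
    Category.assoc, Category.assoc, ← hj, Limits.comp_zero, zero_add,
    eq_neg_of_add_eq_zero_left hs.symm, Preadditive.comp_neg]

/-- The morphism `ξ⁻¹ ∘ f ∘ ξ` between iterated suspensions. -/
def suspMap (n : ℤ) {x y : P.Obj} {m : ℤ} : P.Hom x y m →ₗ[k] P.Hom (susp n x) (susp n y) m :=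
  P.comp (q := -n) (p := m + n) (by omega) (ξinv n y) ∘ₗ (P.comp rfl).flip (ξ n x)

theorem tot_suspMap (n : ℤ) {x y : P.Obj} {m : ℤ} (f : P.Hom x y m) :
    P.tot (suspMap n f) = P.tot (ξ n x) ≫ P.tot f ≫ P.tot (ξinv n y) := by
  simp [suspMap, P.tot_comp]

theorem dtot_suspMap (n : ℤ) {x y : P.Obj} {m : ℤ} (f : P.Hom x y m) :
    P.dtot (suspMap n f) =
      dgSign k n • (P.tot (ξ n x) ≫ P.dtot f ≫ P.tot (ξinv n y)) := by
  simp [suspMap, P.dtot_comp, dtot_ξ, dtot_ξinv, dgSign_neg]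

theorem d_suspMap (n : ℤ) {x y : P.Obj} {m m' : ℤ} (h : m + 1 = m') (f : P.Hom x y m) :
    P.d h (suspMap n f) = dgSign k n • suspMap n (P.d h f) := by
  apply P.tot_inj
  rw [P.tot_d, dtot_suspMap, map_smul, tot_suspMap, P.tot_d]

theorem d_suspMap_eq_zero (n : ℤ) {x y : P.Obj} {m m' : ℤ} (h : m + 1 = m') (f : P.Hom x y m)
    (hf : P.d h f = 0) : P.d h (suspMap n f) = 0 := by
  rw [d_suspMap, hf, map_zero, smul_zero]

end

/-- The iterated suspension functor `f ↦ ξ⁻¹ ∘ f ∘ ξ` on the homotopy category. -/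
def suspFunctor (n : ℤ) : DGCat.H0 P ⥤ DGCat.H0 P where
  obj X := ⟨susp n X.as⟩
  map {X Y} f := Quotient.liftOn' f
    (fun f => P.mk0 (suspMap n f.1) (d_suspMap_eq_zero n _ _ (P.mem_Z0.1 f.2))) (by
      intro f g h
      obtain ⟨s, hs⟩ := P.mem_B0.1 ((Submodule.quotientRel_def _).1 h)
      refine (P.mk0_eq_iff _ _ _ _).2 ⟨dgSign k n • suspMap n s, ?_⟩
      rw [map_smul, d_suspMap, hs, smul_smul, dgSign_mul_self]
      simp)
  map_id X := by
    refine congrArg P.cls (Subtype.ext (P.tot_inj ?_))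
    refine (tot_suspMap _ _).trans ?_
    change _ ≫ P.tot (P.one _) ≫ _ = _
    rw [P.tot_one, Category.id_comp, tot_ξinv_ξ]
    rfl
  map_comp f g := by
    obtain ⟨f, hf, rfl⟩ := P.mk0_surj f
    obtain ⟨g, hg, rfl⟩ := P.mk0_surj g
    refine congrArg P.cls (Subtype.ext (P.tot_inj ?_))
    change P.tot (suspMap n (P.comp _ g f)) = P.tot (P.comp _ (suspMap n g) (suspMap n f))
    simp only [tot_suspMap, P.tot_comp, Category.assoc, tot_ξ_ξinv_assoc]

theorem suspFunctor_mk0 (n : ℤ) {x y : P.Obj} (f : P.Hom x y 0) (hf : P.d (zero_add 1) f = 0) :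
    (suspFunctor P n).map (P.mk0 f hf) = P.mk0 (suspMap n f) (d_suspMap_eq_zero n _ _ hf) := rfl

section

variable {P}

/-- The closed isomorphism `Σᶜ x → Σᵇ Σᵃ x` for `a + b = c`. -/
def suspAdd {a b c : ℤ} (h : a + b = c) (x : P.Obj) : P.Hom (susp c x) (susp b (susp a x)) 0 :=
  P.comp (q := -b) (p := b) (by omega) (ξinv b (susp a x))
    (P.comp (q := -a) (p := c) (by omega) (ξinv a x) (ξ c x))

/-- The inverse of `suspAdd`. -/
def suspAddInv {a b c : ℤ} (h : a + b = c) (x : P.Obj) :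
    P.Hom (susp b (susp a x)) (susp c x) 0 :=
  P.comp (q := -c) (p := c) (by omega) (ξinv c x)
    (P.comp (q := a) (p := b) (by omega) (ξ a x) (ξ b (susp a x)))

theorem tot_suspAdd {a b c : ℤ} (h : a + b = c) (x : P.Obj) : P.tot (suspAdd h x) =
    P.tot (ξ c x) ≫ P.tot (ξinv a x) ≫ P.tot (ξinv b (susp a x)) := by
  simp [suspAdd, P.tot_comp]

theorem tot_suspAddInv {a b c : ℤ} (h : a + b = c) (x : P.Obj) : P.tot (suspAddInv h x) =
    P.tot (ξ b (susp a x)) ≫ P.tot (ξ a x) ≫ P.tot (ξinv c x) := by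
  simp [suspAddInv, P.tot_comp]

theorem d_suspAdd {a b c : ℤ} (h : a + b = c) (x : P.Obj) :
    P.d (zero_add 1) (suspAdd h x) = 0 :=
  P.d_eq_zero_of _ (by simp [suspAdd, P.dtot_comp, dtot_ξ, dtot_ξinv])

theorem d_suspAddInv {a b c : ℤ} (h : a + b = c) (x : P.Obj) :
    P.d (zero_add 1) (suspAddInv h x) = 0 :=
  P.d_eq_zero_of _ (by simp [suspAddInv, P.dtot_comp, dtot_ξ, dtot_ξinv])

theorem suspAdd_hom_inv {a b c : ℤ} (h : a + b = c) (x : P.Obj) :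
    P.tot (suspAdd h x) ≫ P.tot (suspAddInv h x) = 𝟙 _ := by
  simp [tot_suspAdd, tot_suspAddInv, tot_ξ_ξinv_assoc, tot_ξinv_ξ]

theorem suspAdd_inv_hom {a b c : ℤ} (h : a + b = c) (x : P.Obj) :
    P.tot (suspAddInv h x) ≫ P.tot (suspAdd h x) = 𝟙 _ := by
  simp [tot_suspAdd, tot_suspAddInv, tot_ξ_ξinv_assoc, tot_ξinv_ξ_assoc, tot_ξinv_ξ]

/-- The comparison isomorphism `Σᶜ X ≅ Σᵇ Σᵃ X` in the homotopy category. -/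
def suspAddIso {a b c : ℤ} (h : a + b = c) :
    suspFunctor P c ≅ suspFunctor P a ⋙ suspFunctor P b :=
  NatIso.ofComponents
    (fun X => P.isoMk0 (suspAdd h X.as) (suspAddInv h X.as) (d_suspAdd h X.as)
      (d_suspAddInv h X.as)
      (P.mk0_comp_one _ _ _ _ (suspAdd_hom_inv h _))
      (P.mk0_comp_one _ _ _ _ (suspAdd_inv_hom h _)))
    (by
      intro X Y f
      obtain ⟨f, hf, rfl⟩ := P.mk0_surj f
      refine P.mk0_sq (f := suspMap c f) (g := suspAdd h _) (f' := suspAdd h _)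
        (g' := suspMap b (suspMap a f)) (d_suspMap_eq_zero _ _ _ hf) (d_suspAdd h _)
        (d_suspAdd h _) (d_suspMap_eq_zero _ _ _ (d_suspMap_eq_zero _ _ _ hf)) ?_
      simp [tot_suspAdd, tot_suspMap, tot_ξ_ξinv_assoc])

theorem suspAddIso_hom_app {a b c : ℤ} (h : a + b = c) (x : P.Obj) :
    (suspAddIso h).hom.app ⟨x⟩ = P.mk0 (suspAdd h x) (d_suspAdd h x) := rfl

theorem suspAddIso_inv_app {a b c : ℤ} (h : a + b = c) (x : P.Obj) :
    (suspAddIso h).inv.app ⟨x⟩ = P.mk0 (suspAddInv h x) (d_suspAddInv h x) := rfl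

/-- The closed isomorphism `Σᵃ x → Σᵇ x` for `a = b`. -/
def suspCongr {a b : ℤ} (h : a = b) (x : P.Obj) : P.Hom (susp a x) (susp b x) 0 :=
  P.comp (by omega) (ξinv b x) (ξ a x)

theorem tot_suspCongr {a b : ℤ} (h : a = b) (x : P.Obj) :
    P.tot (suspCongr h x) = P.tot (ξ a x) ≫ P.tot (ξinv b x) := by
  simp [suspCongr, P.tot_comp]

theorem d_suspCongr {a b : ℤ} (h : a = b) (x : P.Obj) :
    P.d (zero_add 1) (suspCongr h x) = 0 :=
  P.d_eq_zero_of _ (by simp [suspCongr, P.dtot_comp, dtot_ξ, dtot_ξinv])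

theorem eqToHom_susp {a b : ℤ} (h : a = b) (x : P.Obj)
    (h' : (⟨susp a x⟩ : DGCat.H0 P) = ⟨susp b x⟩) :
    eqToHom h' = P.mk0 (suspCongr h x) (d_suspCongr h x) := by
  subst h
  refine P.mk0_congr (P.d_one _ _) _ ?_
  rw [tot_suspCongr, tot_ξinv_ξ, P.tot_one]

/-- The inverse of `ξ 0 x`. -/
def suspZeroInv (x : P.Obj) : P.Hom x (susp 0 x) 0 := P.castDeg neg_zero (ξinv 0 x)

theorem tot_suspZeroInv (x : P.Obj) : P.tot (suspZeroInv x) = P.tot (ξinv 0 x) :=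
  P.tot_castDeg _ _

theorem d_suspZeroInv (x : P.Obj) : P.d (zero_add 1) (suspZeroInv x) = 0 :=
  P.d_eq_zero_of _ (by rw [suspZeroInv, P.dtot_castDeg, dtot_ξinv])

end

/-- The closed isomorphism `Σ⁰ x ≅ x`. -/
def suspZeroIso : suspFunctor P 0 ≅ 𝟭 (DGCat.H0 P) :=
  NatIso.ofComponents
    (fun X => P.isoMk0 (ξ 0 X.as) (suspZeroInv X.as)
      (P.d_eq_zero_of _ (dtot_ξ _ _)) (d_suspZeroInv _)
      (P.mk0_comp_one _ _ _ _ (by rw [tot_suspZeroInv, tot_ξinv_ξ]))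
      (P.mk0_comp_one _ _ _ _ (by rw [tot_suspZeroInv, tot_ξ_ξinv])))
    (by
      intro X Y f
      obtain ⟨f, hf, rfl⟩ := P.mk0_surj f
      refine P.mk0_sq (f := suspMap 0 f) (g := ξ 0 _) (f' := ξ 0 _) (g' := f)
        (d_suspMap_eq_zero _ _ _ hf) (P.d_eq_zero_of _ (dtot_ξ _ _))
        (P.d_eq_zero_of _ (dtot_ξ _ _)) hf ?_
      rw [tot_suspMap, Category.assoc, Category.assoc, tot_ξ_ξinv, Category.comp_id])

/-- The shift on the homotopy category of an exact dg category. -/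
instance : HasShift (DGCat.H0 P) ℤ :=
  hasShiftMk (DGCat.H0 P) ℤ
    { F := suspFunctor P
      zero := suspZeroIso P
      add := fun _ _ => suspAddIso rfl
      assoc_hom_app := by
        rintro a b c ⟨x⟩
        refine Eq.trans ?_ (congrArg (fun e => e ≫ _) (eqToHom_susp (add_assoc a b c) x _)).symm
        refine P.cls_congr _ _ ?_
        change P.tot (P.comp (zero_add 0) (suspMap c (suspAdd rfl x)) (suspAdd rfl x)) =
          P.tot (P.comp (zero_add 0) (P.comp (zero_add 0) (suspAdd rfl (susp a x))
            (suspAdd rfl x)) (suspCongr (add_assoc a b c) x))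
        simp [P.tot_comp, tot_suspAdd, tot_suspMap, tot_suspCongr, tot_ξ_ξinv_assoc]
      zero_add_hom_app := by
        rintro n ⟨x⟩
        refine Eq.trans ?_ (congrArg (fun e => e ≫ _) (eqToHom_susp (zero_add n) x _)).symm
        refine P.cls_congr _ _ ?_
        change P.tot (suspAdd rfl x) =
          P.tot (P.comp (zero_add 0) (suspMap n (suspZeroInv x)) (suspCongr (zero_add n) x))
        simp [P.tot_comp, tot_suspAdd, tot_suspMap, tot_ξ_ξinv_assoc, tot_suspZeroInv,
          tot_suspCongr]
      add_zero_hom_app := by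
        rintro n ⟨x⟩
        refine Eq.trans ?_ (congrArg (fun e => e ≫ _) (eqToHom_susp (add_zero n) x _)).symm
        refine P.cls_congr _ _ ?_
        change P.tot (suspAdd rfl x) =
          P.tot (P.comp (zero_add 0) (suspZeroInv (susp n x)) (suspCongr (add_zero n) x))
        simp [P.tot_comp, tot_suspAdd, tot_suspZeroInv, tot_suspCongr] }

section

variable {P}

theorem shift_mk0 (n : ℤ) {x y : P.Obj} (f : P.Hom x y 0) (hf : P.d (zero_add 1) f = 0) :
    (shiftFunctor (DGCat.H0 P) n).map (P.mk0 f hf) =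
      P.mk0 (suspMap n f) (d_suspMap_eq_zero n _ _ hf) := rfl

theorem shiftFunctorAdd_eq' {a b c : ℤ} (h : a + b = c) :
    shiftFunctorAdd' (DGCat.H0 P) a b c h = suspAddIso h := by
  subst h
  rw [shiftFunctorAdd'_eq_shiftFunctorAdd]
  rfl

end

instance (n : ℤ) : (shiftFunctor (DGCat.H0 P) n).Additive where
  map_add {X Y f g} := by
    obtain ⟨f, hf, rfl⟩ := P.mk0_surj f
    obtain ⟨g, hg, rfl⟩ := P.mk0_surj g
    refine P.mk0_congr (f := suspMap n (f + g)) (g := suspMap n f + suspMap n g) ?_ ?_ ?_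
    · exact d_suspMap_eq_zero n _ _ (by rw [map_add, hf, hg, add_zero])
    · rw [map_add, d_suspMap_eq_zero n _ _ hf, d_suspMap_eq_zero n _ _ hg, add_zero]
    · rw [map_add]

theorem isZero_zero : Limits.IsZero (⟨zero⟩ : DGCat.H0 P) := by
  rw [Limits.IsZero.iff_id_eq_zero]
  exact P.mk0_congr (P.d_one _ _) (map_zero _) (by rw [one_zero])

instance : Limits.HasZeroObject (DGCat.H0 P) := ⟨⟨_, isZero_zero P⟩⟩

end DGExact

/-! ### The triangulated structure on the homotopy category of an exact dg category -/

namespace DGExact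

open Pretriangulated

variable {k : Type u} [CommRing k] (P : DGCat.{u, v, w} k) [DGExact P]

section

variable {P}

/-- The standard triangle `x ⟶ y ⟶ Cone f ⟶ Σ x`. -/
def stdTriangle {x y : P.Obj} (f : P.Hom x y 0) (hf : P.d (zero_add 1) f = 0) :
    Triangle (DGCat.H0 P) :=
  Triangle.mk (Z := (⟨cone f hf⟩ : DGCat.H0 P)) (P.mk0 f hf) (P.mk0 (j f hf) (d_j f hf))
    (P.mk0 (p f hf) (d_p f hf))

/-- The morphism induced on cones by a square which commutes up to a homotopy `h`. -/
def coneMap {x y x' y' : P.Obj} (f : P.Hom x y 0) (hf : P.d (zero_add 1) f = 0)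
    (f' : P.Hom x' y' 0) (hf' : P.d (zero_add 1) f' = 0) (a : P.Hom x x' 0) (b : P.Hom y y' 0)
    (h : P.Hom x y' (-1)) : P.Hom (cone f hf) (cone f' hf') 0 :=
  P.comp (zero_add 0) (j f' hf') (P.comp (zero_add 0) b (t f hf)) +
    P.comp (zero_add 0) (s f' hf') (P.comp (zero_add 0) (suspMap 1 a) (p f hf)) +
    P.comp (zero_add 0) (j f' hf') (P.comp (neg_add_cancel 1) h
      (P.comp (add_zero 1) (ξ 1 x) (p f hf)))

section

variable {x y x' y' : P.Obj} (f : P.Hom x y 0) (hf : P.d (zero_add 1) f = 0)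
    (f' : P.Hom x' y' 0) (hf' : P.d (zero_add 1) f' = 0) (a : P.Hom x x' 0) (b : P.Hom y y' 0)
    (h : P.Hom x y' (-1))

theorem tot_coneMap : P.tot (coneMap f hf f' hf' a b h) =
    P.tot (t f hf) ≫ P.tot b ≫ P.tot (j f' hf') +
      P.tot (p f hf) ≫ P.tot (ξ 1 x) ≫ P.tot a ≫ P.tot (ξinv 1 x') ≫ P.tot (s f' hf') +
      P.tot (p f hf) ≫ P.tot (ξ 1 x) ≫ P.tot h ≫ P.tot (j f' hf') := by
  simp [coneMap, P.tot_comp, tot_suspMap]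

theorem d_coneMap (ha : P.d (zero_add 1) a = 0) (hb : P.d (zero_add 1) b = 0)
    (hh : P.dtot h = P.tot f ≫ P.tot b - P.tot a ≫ P.tot f') :
    P.d (zero_add 1) (coneMap f hf f' hf' a b h) = 0 := by
  have ha' := P.dtot_eq_zero _ ha
  have hb' := P.dtot_eq_zero _ hb
  refine P.d_eq_zero_of _ ?_
  simp [coneMap, P.dtot_comp, P.tot_comp, dtot_t, dtot_p, dtot_j, dtot_s, dtot_ξ, dtot_suspMap,
    tot_suspMap, ha', hb', hh, dgSign_zero, tot_ξ_ξinv_assoc]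

theorem j_coneMap : P.tot (j f hf) ≫ P.tot (coneMap f hf f' hf' a b h) =
    P.tot b ≫ P.tot (j f' hf') := by
  simp [tot_coneMap, tot_t_j_assoc, tot_p_j_assoc]

theorem coneMap_p : P.tot (coneMap f hf f' hf' a b h) ≫ P.tot (p f' hf') =
    P.tot (p f hf) ≫ P.tot (suspMap 1 a) := by
  simp [tot_coneMap, tot_suspMap, tot_p_s, tot_p_j]

end

theorem complete_std {x y x' y' : P.Obj} (f : P.Hom x y 0) (hf : P.d (zero_add 1) f = 0)
    (f' : P.Hom x' y' 0) (hf' : P.d (zero_add 1) f' = 0) (a : (⟨x⟩ : DGCat.H0 P) ⟶ ⟨x'⟩)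
    (b : (⟨y⟩ : DGCat.H0 P) ⟶ ⟨y'⟩) (hab : P.mk0 f hf ≫ b = a ≫ P.mk0 f' hf') :
    ∃ c : (stdTriangle f hf).obj₃ ⟶ (stdTriangle f' hf').obj₃,
      (stdTriangle f hf).mor₂ ≫ c = b ≫ (stdTriangle f' hf').mor₂ ∧
      (stdTriangle f hf).mor₃ ≫ (shiftFunctor (DGCat.H0 P) (1 : ℤ)).map a =
        c ≫ (stdTriangle f' hf').mor₃ := by
  obtain ⟨a, ha, rfl⟩ := P.mk0_surj a
  obtain ⟨b, hb, rfl⟩ := P.mk0_surj b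
  rw [P.mk0_comp, P.mk0_comp, P.mk0_eq_iff] at hab
  obtain ⟨h, hh⟩ := hab
  have hh' : P.dtot h = P.tot f ≫ P.tot b - P.tot a ≫ P.tot f' := by
    rw [← P.tot_d (neg_add_cancel 1), hh, map_sub, P.tot_comp, P.tot_comp]
  exact ⟨P.mk0 (coneMap f hf f' hf' a b h) (d_coneMap f hf f' hf' a b h ha hb hh'),
    P.cls_sq _ _ _ _ (j_coneMap f hf f' hf' a b h),
    P.cls_sq _ _ _ _ (coneMap_p f hf f' hf' a b h).symm⟩

/-- The cone of an identity is contractible. -/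
theorem isZero_cone_one (x : P.Obj) :
    Limits.IsZero (⟨cone (P.one x) (P.d_one _ _)⟩ : DGCat.H0 P) := by
  rw [Limits.IsZero.iff_id_eq_zero]
  refine P.mk0_congr' (f := P.one _) (g := 0) (P.d_one _ _) (map_zero _)
    (P.comp (zero_add (-1)) (s _ (P.d_one _ _)) (P.comp (add_zero (-1)) (ξinv 1 x)
      (t _ (P.d_one _ _)))) ?_
  rw [map_zero, sub_zero, P.tot_one, ← tot_total (P.one x) (P.d_one _ _)]
  simp [P.dtot_comp, P.tot_comp, dtot_s, dtot_t, dtot_ξinv, dgSign_zero, dgSign_neg, dgSign_one,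
    tot_ξ_ξinv_assoc, tot_ξinv_ξ_assoc, P.tot_one]

section rotate

variable {x y : P.Obj} (f : P.Hom x y 0) (hf : P.d (zero_add 1) f = 0)

/-- The comparison from `Σ x` to the cone of `y → Cone f`. -/
def rotHom : P.Hom (susp 1 x) (cone (j f hf) (d_j f hf)) 0 :=
  P.comp (zero_add 0) (j _ (d_j f hf)) (s f hf) -
    P.comp (zero_add 0) (s _ (d_j f hf)) (suspMap 1 f)

/-- The comparison from the cone of `y → Cone f` to `Σ x`. -/
def rotInv : P.Hom (cone (j f hf) (d_j f hf)) (susp 1 x) 0 :=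
  P.comp (zero_add 0) (p f hf) (t _ (d_j f hf))

theorem tot_rotHom : P.tot (rotHom f hf) = P.tot (s f hf) ≫ P.tot (j _ (d_j f hf)) -
    P.tot (ξ 1 x) ≫ P.tot f ≫ P.tot (ξinv 1 y) ≫ P.tot (s _ (d_j f hf)) := by
  simp [rotHom, P.tot_comp, tot_suspMap]

theorem tot_rotInv : P.tot (rotInv f hf) = P.tot (t _ (d_j f hf)) ≫ P.tot (p f hf) := by
  simp [rotInv, P.tot_comp]

theorem d_rotHom : P.d (zero_add 1) (rotHom f hf) = 0 := by
  have hf' := P.dtot_eq_zero _ hf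
  refine P.d_eq_zero_of _ ?_
  simp [rotHom, P.dtot_comp, dtot_s, dtot_j, dtot_suspMap, tot_suspMap, hf',
    dgSign_zero, tot_ξ_ξinv_assoc]

theorem d_rotInv : P.d (zero_add 1) (rotInv f hf) = 0 := by
  refine P.d_eq_zero_of _ ?_
  simp [rotInv, P.dtot_comp, dtot_p, dtot_t, dgSign_zero, tot_p_j]

/-- `Σ x` is homotopy equivalent to the cone of `y → Cone f`. -/
def rotIso : (⟨susp 1 x⟩ : DGCat.H0 P) ≅ ⟨cone (j f hf) (d_j f hf)⟩ :=
  P.isoMk0 (rotHom f hf) (rotInv f hf) (d_rotHom f hf) (d_rotInv f hf)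
    (P.mk0_comp_one _ _ _ _ (by
      simp [tot_rotHom, tot_rotInv, tot_t_j_assoc, tot_t_s_assoc, tot_p_s]))
    (by
      refine (P.cls_congr' ⟨P.one _, P.mem_Z0.2 (P.d_one _ _)⟩ _
        (P.comp (zero_add (-1)) (s _ (d_j f hf)) (P.comp (add_zero (-1)) (ξinv 1 y)
          (P.comp (zero_add 0) (t f hf) (t _ (d_j f hf))))) ?_).symm
      change _ = P.tot (P.one _) - P.tot (P.comp _ (rotHom f hf) (rotInv f hf))
      have h1 := tot_total (j f hf) (d_j f hf)
      have h2 := tot_total f hf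
      have h3 : P.tot (t _ (d_j f hf)) ≫ P.tot (j _ (d_j f hf)) =
          P.tot (t _ (d_j f hf)) ≫ (P.tot (t f hf) ≫ P.tot (j f hf) +
            P.tot (p f hf) ≫ P.tot (s f hf)) ≫ P.tot (j _ (d_j f hf)) := by
        rw [h2, Category.id_comp]
      rw [P.tot_one, ← h1, h3, P.tot_comp, tot_rotHom, tot_rotInv]
      simp [P.dtot_comp, P.tot_comp, dtot_s, dtot_t, dtot_ξinv, dgSign_zero, dgSign_neg,
        dgSign_one, tot_ξ_ξinv_assoc, tot_ξinv_ξ_assoc, tot_t_j_assoc]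
      abel)

theorem j_rotInv : P.tot (j _ (d_j f hf)) ≫ P.tot (rotInv f hf) = P.tot (p f hf) := by
  rw [tot_rotInv, tot_t_j_assoc]

theorem rotHom_p : P.tot (rotHom f hf) ≫ P.tot (p _ (d_j f hf)) = - P.tot (suspMap 1 f) := by
  simp [tot_rotHom, tot_suspMap, tot_p_j, tot_p_s]

/-- The rotation of a standard triangle is isomorphic to a standard triangle. -/
def rotStdIso : (stdTriangle f hf).rotate ≅ stdTriangle (j f hf) (d_j f hf) :=
  Triangle.isoMk _ _ (Iso.refl _) (Iso.refl _) (rotIso f hf)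
    ((Category.comp_id _).trans (Category.id_comp _).symm)
    ((Iso.eq_comp_inv (rotIso f hf)).1
      ((P.mk0_comp_eq _ _ _ (d_j _ (d_j f hf)) (d_rotInv f hf) (d_p f hf)
        (j_rotInv f hf)).symm.trans (congrArg (· ≫ (rotIso f hf).inv)
          (Category.id_comp (P.mk0 (j _ (d_j f hf)) (d_j _ (d_j f hf))))).symm))
    (by
      refine ((congrArg (fun e => (-P.mk0 (suspMap 1 f) (d_suspMap_eq_zero 1 _ _ hf)) ≫ e)
        (CategoryTheory.Functor.map_id (shiftFunctor (DGCat.H0 P) (1 : ℤ)) ⟨y⟩)).trans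
          (Category.comp_id _)).trans ?_
      refine P.cls_congr _ _ ?_
      refine Eq.trans ?_ (P.tot_comp (zero_add 0) (p _ (d_j f hf)) (rotHom f hf)).symm
      rw [rotHom_p, ← map_neg]
      rfl)

end rotate

section shift

variable (n : ℤ) {x y : P.Obj} (f : P.Hom x y 0) (hf : P.d (zero_add 1) f = 0)

/-- The comparison from `Σⁿ Cone f` to `Cone Σⁿ f`. -/
def shiftConeHom :
    P.Hom (susp n (cone f hf)) (cone (suspMap n f) (d_suspMap_eq_zero n _ f hf)) 0 :=
  P.comp (q := -n) (p := n) (by omega)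
    (P.comp (zero_add _) (j _ (d_suspMap_eq_zero n _ f hf))
      (P.comp (add_zero _) (ξinv n y) (t f hf)) +
    dgSign k n • P.comp (zero_add _) (s _ (d_suspMap_eq_zero n _ f hf))
      (P.comp (q := -1) (p := 1 - n) (by omega) (ξinv 1 (susp n x))
        (P.comp (q := -n) (p := 1) (by omega) (ξinv n x)
          (P.comp (add_zero _) (ξ 1 x) (p f hf)))))
    (ξ n _)

/-- The comparison from `Cone Σⁿ f` to `Σⁿ Cone f`. -/
def shiftConeInv :
    P.Hom (cone (suspMap n f) (d_suspMap_eq_zero n _ f hf)) (susp n (cone f hf)) 0 :=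
  P.comp (q := -n) (p := n) (by omega) (ξinv n _)
    (P.comp (zero_add _) (j f hf)
      (P.comp (add_zero _) (ξ n y) (t _ (d_suspMap_eq_zero n _ f hf))) +
    dgSign k n • P.comp (zero_add _) (s f hf)
      (P.comp (q := -1) (p := n + 1) (by omega) (ξinv 1 x)
        (P.comp (q := n) (p := 1) (by omega) (ξ n x)
          (P.comp (add_zero _) (ξ 1 _) (p _ (d_suspMap_eq_zero n _ f hf))))))

theorem tot_shiftConeHom : P.tot (shiftConeHom n f hf) =
    P.tot (ξ n _) ≫ (P.tot (t f hf) ≫ P.tot (ξinv n y) ≫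
        P.tot (j _ (d_suspMap_eq_zero n _ f hf)) +
      dgSign k n • (P.tot (p f hf) ≫ P.tot (ξ 1 x) ≫ P.tot (ξinv n x) ≫ P.tot (ξinv 1 _) ≫
        P.tot (s _ (d_suspMap_eq_zero n _ f hf)))) := by
  simp [shiftConeHom, P.tot_comp]

theorem tot_shiftConeInv : P.tot (shiftConeInv n f hf) =
    (P.tot (t _ (d_suspMap_eq_zero n _ f hf)) ≫ P.tot (ξ n y) ≫ P.tot (j f hf) +
      dgSign k n • (P.tot (p _ (d_suspMap_eq_zero n _ f hf)) ≫ P.tot (ξ 1 _) ≫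
        P.tot (ξ n x) ≫ P.tot (ξinv 1 x) ≫ P.tot (s f hf))) ≫ P.tot (ξinv n _) := by
  simp [shiftConeInv, P.tot_comp]

theorem d_shiftConeHom : P.d (zero_add 1) (shiftConeHom n f hf) = 0 := by
  refine P.d_eq_zero_of _ ?_
  simp [shiftConeHom, P.dtot_comp, P.tot_comp, dtot_s, dtot_t, dtot_p, dtot_j, dtot_ξ, dtot_ξinv,
    tot_suspMap, dgSign_zero, dgSign_neg, tot_ξ_ξinv_assoc]

theorem d_shiftConeInv : P.d (zero_add 1) (shiftConeInv n f hf) = 0 := by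
  refine P.d_eq_zero_of _ ?_
  simp [shiftConeInv, P.dtot_comp, P.tot_comp, dtot_s, dtot_t, dtot_p, dtot_j, dtot_ξ, dtot_ξinv,
    tot_suspMap, dgSign_zero, dgSign_neg, tot_ξ_ξinv_assoc]

theorem shiftCone_hom_inv : P.tot (shiftConeHom n f hf) ≫ P.tot (shiftConeInv n f hf) = 𝟙 _ := by
  have h := congrArg (fun e => P.tot (ξ n _) ≫ e ≫ P.tot (ξinv n _)) (tot_total f hf)
  simp only [Category.id_comp, tot_ξinv_ξ] at h
  rw [← h]
  simp [tot_shiftConeHom, tot_shiftConeInv, tot_t_j_assoc, tot_t_s_assoc, tot_p_s_assoc,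
    tot_p_j_assoc, tot_ξ_ξinv_assoc, tot_ξinv_ξ_assoc, smul_smul, dgSign_mul_self]

theorem shiftCone_inv_hom : P.tot (shiftConeInv n f hf) ≫ P.tot (shiftConeHom n f hf) = 𝟙 _ := by
  rw [← tot_total _ (d_suspMap_eq_zero n _ f hf)]
  simp [tot_shiftConeHom, tot_shiftConeInv, tot_t_j_assoc, tot_t_s_assoc, tot_p_s_assoc,
    tot_p_j_assoc, tot_ξ_ξinv_assoc, tot_ξinv_ξ_assoc, smul_smul, dgSign_mul_self]

theorem j_shiftConeHom : P.tot (suspMap n (j f hf)) ≫ P.tot (shiftConeHom n f hf) =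
    P.tot (j _ (d_suspMap_eq_zero n _ f hf)) := by
  simp [tot_shiftConeHom, tot_suspMap, tot_t_j_assoc, tot_p_j_assoc, tot_ξ_ξinv_assoc,
    tot_ξinv_ξ_assoc]

theorem shiftConeHom_p : P.tot (shiftConeHom n f hf) ≫ P.tot (p _ (d_suspMap_eq_zero n _ f hf)) =
    dgSign k n • (P.tot (suspMap n (p f hf)) ≫ P.tot (suspAddInv (add_comm 1 n) x) ≫
      P.tot (suspAdd rfl x)) := by
  simp [tot_shiftConeHom, tot_suspMap, tot_p_s, tot_p_j, tot_suspAdd, tot_suspAddInv,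
    tot_ξ_ξinv_assoc]

end shift

end

end DGExact

namespace DGExact

open Pretriangulated

theorem complete_of_iso {C : Type*} [Category* C] [HasShift C ℤ] {T₁ T₂ S₁ S₂ : Triangle C}
    (e₁ : T₁ ≅ S₁) (e₂ : T₂ ≅ S₂)
    (H : ∀ (a : S₁.obj₁ ⟶ S₂.obj₁) (b : S₁.obj₂ ⟶ S₂.obj₂) (_ : S₁.mor₁ ≫ b = a ≫ S₂.mor₁),
      ∃ c : S₁.obj₃ ⟶ S₂.obj₃, S₁.mor₂ ≫ c = b ≫ S₂.mor₂ ∧ S₁.mor₃ ≫ a⟦(1 : ℤ)⟧' = c ≫ S₂.mor₃)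
    (a : T₁.obj₁ ⟶ T₂.obj₁) (b : T₁.obj₂ ⟶ T₂.obj₂) (comm : T₁.mor₁ ≫ b = a ≫ T₂.mor₁) :
    ∃ c : T₁.obj₃ ⟶ T₂.obj₃, T₁.mor₂ ≫ c = b ≫ T₂.mor₂ ∧
      T₁.mor₃ ≫ a⟦(1 : ℤ)⟧' = c ≫ T₂.mor₃ := by
  obtain ⟨c, hc, hc'⟩ := H (e₁.inv.hom₁ ≫ a ≫ e₂.hom.hom₁) (e₁.inv.hom₂ ≫ b ≫ e₂.hom.hom₂) (by
    simp [e₁.inv.comm₁_assoc, reassoc_of% comm, e₂.hom.comm₁])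
  refine ⟨e₁.hom.hom₃ ≫ c ≫ e₂.inv.hom₃, ?_, ?_⟩
  · rw [e₁.hom.comm₂_assoc, reassoc_of% hc, e₂.inv.comm₂]
    simp
  · rw [Category.assoc, Category.assoc, ← e₂.inv.comm₃, ← reassoc_of% hc', ← e₁.hom.comm₃_assoc]
    simp only [← Functor.map_comp, Category.assoc, Iso.hom_inv_id_triangle_hom₁_assoc,
      Iso.hom_inv_id_triangle_hom₁, Category.comp_id]

variable {k : Type u} [CommRing k] {P : DGCat.{u, v, w} k} [DGExact P]

/-- Multiplication by the sign `(-1)^n`, as an automorphism in the homotopy category. -/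
def signIso (n : ℤ) (x : P.Obj) : (⟨x⟩ : DGCat.H0 P) ≅ ⟨x⟩ where
  hom := n.negOnePow • 𝟙 _
  inv := n.negOnePow • 𝟙 _
  hom_inv_id := by simp [Linear.comp_units_smul, smul_smul]
  inv_hom_id := by simp [Linear.comp_units_smul, smul_smul]

theorem shiftFunctorComm_hom_app_eq (n : ℤ) (x : P.Obj) :
    (shiftFunctorComm (DGCat.H0 P) 1 n).hom.app ⟨x⟩ =
      P.mk0 (P.comp (zero_add 0) (suspAdd rfl x) (suspAddInv (add_comm 1 n) x))
        (P.d_comp_closed _ _ _ _ _ _ (d_suspAdd _ _) (d_suspAddInv _ _)) := by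
  rw [shiftFunctorComm_eq (DGCat.H0 P) 1 n (n + 1) (add_comm 1 n), shiftFunctorAdd_eq',
    shiftFunctorAdd_eq']
  rfl

/-- The shift of a standard triangle is isomorphic to a standard triangle. -/
def shiftStdIso (n : ℤ) {x y : P.Obj} (f : P.Hom x y 0) (hf : P.d (zero_add 1) f = 0) :
    (Triangle.shiftFunctor (DGCat.H0 P) n).obj (stdTriangle f hf) ≅
      stdTriangle (suspMap n f) (d_suspMap_eq_zero n _ f hf) :=
  Triangle.isoMk _ _ (Iso.refl _) (signIso n (susp n y))
    (P.isoMk0 (shiftConeHom n f hf) (shiftConeInv n f hf) (d_shiftConeHom n f hf)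
      (d_shiftConeInv n f hf) (P.mk0_comp_one _ _ _ _ (shiftCone_hom_inv n f hf))
      (P.mk0_comp_one _ _ _ _ (shiftCone_inv_hom n f hf)))
    (by
      refine Eq.trans ?_ (Category.id_comp
        (P.mk0 (suspMap n f) (d_suspMap_eq_zero n _ f hf))).symm
      change (n.negOnePow • P.mk0 (suspMap n f) (d_suspMap_eq_zero n _ f hf)) ≫
        (n.negOnePow • 𝟙 _) = P.mk0 (suspMap n f) _
      simp [Linear.comp_units_smul, smul_smul])
    (by
      change (n.negOnePow • P.mk0 (suspMap n (j f hf)) (d_suspMap_eq_zero n _ _ (d_j f hf))) ≫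
        P.mk0 (shiftConeHom n f hf) (d_shiftConeHom n f hf) =
        (n.negOnePow • 𝟙 _) ≫ P.mk0 (j _ (d_suspMap_eq_zero n _ f hf)) (d_j _ _)
      rw [Linear.units_smul_comp, Linear.units_smul_comp, Category.id_comp,
        P.mk0_comp_eq _ _ _ _ _ _ (j_shiftConeHom n f hf)])
    (by
      change (n.negOnePow • P.mk0 (suspMap n (p f hf)) (d_suspMap_eq_zero n _ _ (d_p f hf)) ≫
        (shiftFunctorComm (DGCat.H0 P) 1 n).hom.app ⟨x⟩) ≫
          (shiftFunctor (DGCat.H0 P) (1 : ℤ)).map (𝟙 (⟨susp n x⟩ : DGCat.H0 P)) =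
        P.mk0 (shiftConeHom n f hf) (d_shiftConeHom n f hf) ≫
          P.mk0 (p _ (d_suspMap_eq_zero n _ f hf)) (d_p _ _)
      refine (congrArg₂ (fun (a : (⟨susp n (susp 1 x)⟩ : DGCat.H0 P) ⟶ ⟨susp 1 (susp n x)⟩)
        (b : (⟨susp 1 (susp n x)⟩ : DGCat.H0 P) ⟶ ⟨susp 1 (susp n x)⟩) =>
          (n.negOnePow • P.mk0 (suspMap n (p f hf)) (d_suspMap_eq_zero n _ _ (d_p f hf)) ≫ a) ≫ b)
        (shiftFunctorComm_hom_app_eq n x) (CategoryTheory.Functor.map_id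
          (shiftFunctor (DGCat.H0 P) (1 : ℤ)) (⟨susp n x⟩ : DGCat.H0 P))).trans ?_
      refine (Category.comp_id _).trans ?_
      have h := P.mk0_negOnePow (P.comp (zero_add 0) (P.comp (zero_add 0) (suspAdd rfl x)
        (suspAddInv (add_comm 1 n) x)) (suspMap n (p f hf)))
          (P.d_comp_closed _ _ (zero_add 1) _ _ _ (P.d_comp_closed _ _ _ _ _ _ (d_suspAdd _ _)
            (d_suspAddInv _ _)) (d_suspMap_eq_zero n _ _ (d_p f hf))) n
      refine h.trans (P.cls_congr _ _ ?_)
      refine Eq.trans ?_ (P.tot_comp (zero_add 0) _ _).symm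
      refine Eq.trans ?_ (shiftConeHom_p n f hf).symm
      rw [map_smul, P.tot_comp, P.tot_comp])

variable (P) in
/-- The distinguished triangles: those isomorphic to a standard triangle. -/
def distTriangles : Set (Triangle (DGCat.H0 P)) :=
  { T | ∃ (x y : P.Obj) (f : P.Hom x y 0) (hf : P.d (zero_add 1) f = 0),
    Nonempty (T ≅ stdTriangle f hf) }

theorem rotate_dist (T : Triangle (DGCat.H0 P)) (hT : T ∈ distTriangles P) :
    T.rotate ∈ distTriangles P := by
  obtain ⟨x, y, f, hf, ⟨e⟩⟩ := hT
  exact ⟨_, _, _, _, ⟨(rotate _).mapIso e ≪≫ rotStdIso f hf⟩⟩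

theorem shift_dist (n : ℤ) (T : Triangle (DGCat.H0 P)) (hT : T ∈ distTriangles P) :
    (Triangle.shiftFunctor _ n).obj T ∈ distTriangles P := by
  obtain ⟨x, y, f, hf, ⟨e⟩⟩ := hT
  exact ⟨_, _, _, _, ⟨(Triangle.shiftFunctor _ n).mapIso e ≪≫ shiftStdIso n f hf⟩⟩

theorem invRotate_dist (T : Triangle (DGCat.H0 P)) (hT : T ∈ distTriangles P) :
    T.invRotate ∈ distTriangles P := by
  obtain ⟨x, y, f, hf, ⟨e⟩⟩ := shift_dist (-1) _ (rotate_dist _ (rotate_dist _ hT))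
  exact ⟨x, y, f, hf, ⟨(invRotateIsoRotateRotateShiftFunctorNegOne _).app T ≪≫ e⟩⟩

/-- The homotopy category of an exact dg category is triangulated. The distinguished triangles
are those isomorphic to `x ⟶ y ⟶ Cone f ⟶ Σ x`. -/
instance : Pretriangulated (DGCat.H0 P) where
  distinguishedTriangles := distTriangles P
  isomorphic_distinguished := by
    rintro T₁ ⟨x, y, f, hf, ⟨e⟩⟩ T₂ e'
    exact ⟨x, y, f, hf, ⟨e' ≪≫ e⟩⟩
  contractible_distinguished := by
    intro X
    refine ⟨X.as, X.as, P.one X.as, P.d_one _ _, ⟨Triangle.isoMk _ _ (Iso.refl _) (Iso.refl _)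
      ((Limits.isZero_zero _).iso (isZero_cone_one X.as)) ?_ ?_ ?_⟩⟩
    · rfl
    · exact (isZero_cone_one X.as).eq_of_tgt _ _
    · exact (Limits.isZero_zero _).eq_of_src _ _
  distinguished_cocone_triangle := by
    intro X Y f
    obtain ⟨f, hf, rfl⟩ := P.mk0_surj f
    exact ⟨_, _, _, _, _, _, _, ⟨Iso.refl (stdTriangle f hf)⟩⟩
  rotate_distinguished_triangle := by
    intro T
    refine ⟨rotate_dist T, fun hT => ?_⟩
    obtain ⟨x, y, f, hf, ⟨e⟩⟩ := invRotate_dist _ hT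
    exact ⟨x, y, f, hf, ⟨(rotCompInvRot.app T) ≪≫ e⟩⟩
  complete_distinguished_triangle_morphism := by
    rintro T₁ T₂ ⟨x₁, y₁, f₁, hf₁, ⟨e₁⟩⟩ ⟨x₂, y₂, f₂, hf₂, ⟨e₂⟩⟩ a b comm
    exact complete_of_iso e₁ e₂ (complete_std f₁ hf₁ f₂ hf₂) a b comm

end DGExact

namespace DGExact

open Pretriangulated

variable {k : Type u} [CommRing k] {P : DGCat.{u, v, w} k} [DGExact P]

section octahedron

variable {x y z : P.Obj} (f : P.Hom x y 0) (hf : P.d (zero_add 1) f = 0)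
    (g : P.Hom y z 0) (hg : P.d (zero_add 1) g = 0) (gf : P.Hom x z 0)
    (hgf : P.d (zero_add 1) gf = 0) (H : P.tot f ≫ P.tot g = P.tot gf)

/-- The map `Cone f → Cone (g ∘ f)`. -/
def octHom₁ : P.Hom (cone f hf) (cone gf hgf) 0 := coneMap f hf gf hgf (P.one x) g 0

/-- The map `Cone (g ∘ f) → Cone g`. -/
def octHom₃ : P.Hom (cone gf hgf) (cone g hg) 0 := coneMap gf hgf g hg f (P.one z) 0

theorem tot_octHom₁ : P.tot (octHom₁ f hf g gf hgf) = P.tot (t f hf) ≫ P.tot g ≫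
    P.tot (j gf hgf) + P.tot (p f hf) ≫ P.tot (s gf hgf) := by
  simp [octHom₁, tot_coneMap, P.tot_one, tot_ξinv_ξ_assoc]

theorem tot_octHom₃ : P.tot (octHom₃ f g hg gf hgf) = P.tot (t gf hgf) ≫ P.tot (j g hg) +
    P.tot (p gf hgf) ≫ P.tot (ξ 1 x) ≫ P.tot f ≫ P.tot (ξinv 1 y) ≫ P.tot (s g hg) := by
  simp [octHom₃, tot_coneMap, P.tot_one]

theorem d_octHom₁ (hg : P.d (zero_add 1) g = 0) (H : P.tot f ≫ P.tot g = P.tot gf) :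
    P.d (zero_add 1) (octHom₁ f hf g gf hgf) = 0 :=
  d_coneMap _ _ _ _ _ _ _ (P.d_one _ _) hg (by simp [H, P.tot_one])

theorem d_octHom₃ (hf : P.d (zero_add 1) f = 0) (H : P.tot f ≫ P.tot g = P.tot gf) :
    P.d (zero_add 1) (octHom₃ f g hg gf hgf) = 0 :=
  d_coneMap _ _ _ _ _ _ _ hf (P.d_one _ _) (by simp [H, P.tot_one])

/-- The comparison from `Cone g` to the cone of `Cone f → Cone (g ∘ f)`. -/
def octHom : P.Hom (cone g hg) (cone (octHom₁ f hf g gf hgf) (d_octHom₁ f hf g gf hgf hg H)) 0 :=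
  P.comp (zero_add 0) (j _ (d_octHom₁ f hf g gf hgf hg H))
    (P.comp (zero_add 0) (j gf hgf) (t g hg)) +
  P.comp (zero_add 0) (s _ (d_octHom₁ f hf g gf hgf hg H))
    (P.comp (zero_add 0) (suspMap 1 (j f hf)) (p g hg))

/-- The comparison from the cone of `Cone f → Cone (g ∘ f)` to `Cone g`. -/
def octInv : P.Hom (cone (octHom₁ f hf g gf hgf) (d_octHom₁ f hf g gf hgf hg H)) (cone g hg) 0 :=
  P.comp (zero_add 0) (octHom₃ f g hg gf hgf) (t _ (d_octHom₁ f hf g gf hgf hg H)) +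
  P.comp (zero_add 0) (s g hg) (P.comp (zero_add 0) (suspMap 1 (t f hf))
    (p _ (d_octHom₁ f hf g gf hgf hg H)))

theorem tot_octHom : P.tot (octHom f hf g hg gf hgf H) =
    P.tot (t g hg) ≫ P.tot (j gf hgf) ≫ P.tot (j _ (d_octHom₁ f hf g gf hgf hg H)) +
      P.tot (p g hg) ≫ P.tot (ξ 1 y) ≫ P.tot (j f hf) ≫ P.tot (ξinv 1 _) ≫
        P.tot (s _ (d_octHom₁ f hf g gf hgf hg H)) := by
  simp [octHom, P.tot_comp, tot_suspMap]

theorem tot_octInv : P.tot (octInv f hf g hg gf hgf H) =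
    P.tot (t _ (d_octHom₁ f hf g gf hgf hg H)) ≫ P.tot (octHom₃ f g hg gf hgf) +
      P.tot (p _ (d_octHom₁ f hf g gf hgf hg H)) ≫ P.tot (ξ 1 _) ≫ P.tot (t f hf) ≫
        P.tot (ξinv 1 _) ≫ P.tot (s g hg) := by
  simp [octInv, P.tot_comp, tot_suspMap]

theorem d_octHom : P.d (zero_add 1) (octHom f hf g hg gf hgf H) = 0 := by
  refine P.d_eq_zero_of _ ?_
  simp [octHom, P.dtot_comp, P.tot_comp, dtot_s, dtot_t, dtot_p, dtot_j, dtot_suspMap,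
    tot_suspMap, dgSign_zero, tot_ξ_ξinv_assoc, tot_octHom₁, tot_t_j_assoc, tot_p_j_assoc]

theorem d_octInv : P.d (zero_add 1) (octInv f hf g hg gf hgf H) = 0 := by
  have h3 := P.dtot_eq_zero _ (d_octHom₃ f g hg gf hgf hf H)
  refine P.d_eq_zero_of _ ?_
  simp [octInv, P.dtot_comp, P.tot_comp, dtot_s, dtot_t, dtot_p, dtot_suspMap,
    tot_suspMap, dgSign_zero, dgSign_one, tot_ξ_ξinv_assoc, tot_octHom₁, tot_octHom₃,
    tot_t_j_assoc, tot_p_j_assoc, tot_p_s_assoc, tot_t_s_assoc, h3]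
  abel

theorem octHom_octInv :
    P.tot (octHom f hf g hg gf hgf H) ≫ P.tot (octInv f hf g hg gf hgf H) = 𝟙 _ := by
  rw [← tot_total g hg]
  simp [tot_octHom, tot_octInv, tot_octHom₃, tot_t_j_assoc, tot_p_j_assoc, tot_p_s_assoc,
    tot_t_s_assoc, tot_ξ_ξinv_assoc, tot_ξinv_ξ_assoc]

theorem octInv_octHom : P.dtot (P.comp (add_zero (-1)) (P.comp (zero_add (-1))
      (s _ (d_octHom₁ f hf g gf hgf hg H)) (P.comp (add_zero (-1)) (ξinv 1 _) (s f hf)))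
      (P.comp (zero_add 0) (p gf hgf) (t _ (d_octHom₁ f hf g gf hgf hg H)))) =
    𝟙 _ - P.tot (octInv f hf g hg gf hgf H) ≫ P.tot (octHom f hf g hg gf hgf H) := by
  have h1 := tot_total _ (d_octHom₁ f hf g gf hgf hg H)
  have h2 : P.tot (t _ (d_octHom₁ f hf g gf hgf hg H)) ≫
        P.tot (j _ (d_octHom₁ f hf g gf hgf hg H)) =
      P.tot (t _ (d_octHom₁ f hf g gf hgf hg H)) ≫ (P.tot (t gf hgf) ≫ P.tot (j gf hgf) +
        P.tot (p gf hgf) ≫ P.tot (s gf hgf)) ≫ P.tot (j _ (d_octHom₁ f hf g gf hgf hg H)) := by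
    rw [tot_total gf hgf, Category.id_comp]
  have h3 : P.tot (p _ (d_octHom₁ f hf g gf hgf hg H)) ≫
        P.tot (s _ (d_octHom₁ f hf g gf hgf hg H)) =
      P.tot (p _ (d_octHom₁ f hf g gf hgf hg H)) ≫ P.tot (ξ 1 _) ≫
        (P.tot (t f hf) ≫ P.tot (j f hf) + P.tot (p f hf) ≫ P.tot (s f hf)) ≫ P.tot (ξinv 1 _) ≫
          P.tot (s _ (d_octHom₁ f hf g gf hgf hg H)) := by
    rw [tot_total f hf, Category.id_comp, tot_ξinv_ξ_assoc]
  rw [← h1, h2, h3]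
  simp [P.dtot_comp, P.tot_comp, dtot_s, dtot_t, dtot_p, dtot_ξinv, dgSign_zero, dgSign_neg,
    dgSign_one, tot_octHom, tot_octInv, tot_octHom₁, tot_octHom₃, tot_t_j_assoc, tot_p_j_assoc,
    tot_p_s_assoc, tot_t_s_assoc, tot_ξ_ξinv_assoc]
  abel

end octahedron

theorem std_mem {x y : P.Obj} (f : P.Hom x y 0) (hf : P.d (zero_add 1) f = 0) :
    stdTriangle f hf ∈ distTriang (DGCat.H0 P) := ⟨_, _, f, hf, ⟨Iso.refl _⟩⟩

section octahedron

variable {x y z : P.Obj} (f : P.Hom x y 0) (hf : P.d (zero_add 1) f = 0)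
    (g : P.Hom y z 0) (hg : P.d (zero_add 1) g = 0) (gf : P.Hom x z 0)
    (hgf : P.d (zero_add 1) gf = 0) (H : P.tot f ≫ P.tot g = P.tot gf)

/-- `Cone g` is homotopy equivalent to the cone of `Cone f → Cone (g ∘ f)`. -/
def octIso : (⟨cone g hg⟩ : DGCat.H0 P) ≅
    ⟨cone (octHom₁ f hf g gf hgf) (d_octHom₁ f hf g gf hgf hg H)⟩ :=
  P.isoMk0 (octHom f hf g hg gf hgf H) (octInv f hf g hg gf hgf H) (d_octHom f hf g hg gf hgf H)
    (d_octInv f hf g hg gf hgf H) (P.mk0_comp_one _ _ _ _ (octHom_octInv f hf g hg gf hgf H))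
    (P.cls_congr' ⟨P.one _, P.mem_Z0.2 (P.d_one _ _)⟩ _ _
      ((octInv_octHom f hf g hg gf hgf H).trans
        (congrArg₂ (· - ·) (P.tot_one _).symm (P.tot_comp (zero_add 0) _ _).symm))).symm

theorem oct_mem : Triangle.mk
    (P.mk0 (octHom₁ f hf g gf hgf) (d_octHom₁ f hf g gf hgf hg H))
    (P.mk0 (octHom₃ f g hg gf hgf) (d_octHom₃ f g hg gf hgf hf H))
    (P.mk0 (p g hg) (d_p g hg) ≫
      (shiftFunctor (DGCat.H0 P) (1 : ℤ)).map (P.mk0 (j f hf) (d_j f hf))) ∈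
      distTriang (DGCat.H0 P) := by
  refine ⟨_, _, octHom₁ f hf g gf hgf, d_octHom₁ f hf g gf hgf hg H,
    ⟨Triangle.isoMk _ _ (Iso.refl _) (Iso.refl _) (octIso f hf g hg gf hgf H) ?_ ?_ ?_⟩⟩
  · exact (Category.comp_id _).trans (Category.id_comp _).symm
  · refine (Iso.eq_comp_inv (octIso f hf g hg gf hgf H)).1 ?_
    refine Eq.trans ?_ (congrArg (· ≫ (octIso f hf g hg gf hgf H).inv)
      (Category.id_comp (P.mk0 (j _ (d_octHom₁ f hf g gf hgf hg H)) (d_j _ _)))).symm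
    refine P.cls_congr _ _ (Eq.trans ?_ (P.tot_comp (zero_add 0) _ _).symm)
    change P.tot (octHom₃ f g hg gf hgf) = P.tot (j _ (d_octHom₁ f hf g gf hgf hg H)) ≫
      P.tot (octInv f hf g hg gf hgf H)
    rw [tot_octInv, Preadditive.comp_add, tot_t_j_assoc, tot_p_j_assoc, add_zero]
  · refine (congrArg (fun e : (⟨susp 1 (cone f hf)⟩ : DGCat.H0 P) ⟶ ⟨susp 1 (cone f hf)⟩ =>
        (P.mk0 (p g hg) (d_p g hg) ≫ P.mk0 (suspMap 1 (j f hf))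
          (d_suspMap_eq_zero 1 _ _ (d_j f hf))) ≫ e)
      (CategoryTheory.Functor.map_id (shiftFunctor (DGCat.H0 P) (1 : ℤ))
        (⟨cone f hf⟩ : DGCat.H0 P))).trans ?_
    refine (Category.comp_id _).trans ?_
    refine P.cls_sq ⟨p g hg, P.mem_Z0.2 (d_p g hg)⟩ ⟨suspMap 1 (j f hf), _⟩
      ⟨octHom f hf g hg gf hgf H, _⟩ ⟨p _ (d_octHom₁ f hf g gf hgf hg H), _⟩ ?_
    change P.tot (p g hg) ≫ P.tot (suspMap 1 (j f hf)) = P.tot (octHom f hf g hg gf hgf H) ≫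
      P.tot (p _ (d_octHom₁ f hf g gf hgf hg H))
    simp [tot_octHom, tot_suspMap, tot_p_j, tot_p_s]

/-- The octahedron of a composable pair of closed morphisms of degree zero. -/
def octahedron : Triangulated.Octahedron (C := DGCat.H0 P)
    (u₁₃ := P.mk0 gf hgf) (P.mk0_comp_eq f g gf hf hg hgf H)
    (std_mem f hf) (std_mem g hg) (std_mem gf hgf) where
  m₁ := P.mk0 (octHom₁ f hf g gf hgf) (d_octHom₁ f hf g gf hgf hg H)
  m₃ := P.mk0 (octHom₃ f g hg gf hgf) (d_octHom₃ f g hg gf hgf hf H)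
  comm₁ := P.cls_sq _ _ _ _ (j_coneMap f hf gf hgf (P.one x) g 0)
  comm₂ := P.mk0_comp_eq _ _ _ _ (d_p gf hgf) (d_p f hf) (by
    simp [tot_octHom₁, tot_p_j, tot_p_s])
  comm₃ := P.mk0_comp_eq _ _ _ (d_j gf hgf) _ (d_j g hg) (by
    simp [tot_octHom₃, tot_t_j_assoc, tot_p_j_assoc])
  comm₄ := P.cls_sq _ _ _ _ (coneMap_p gf hgf g hg f (P.one z) 0).symm
  mem := oct_mem f hf g hg gf hgf H

end octahedron

/-- The octahedron axiom. -/
instance : IsTriangulated (DGCat.H0 P) := by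
  refine IsTriangulated.mk' ?_
  intro X Y Z a b
  obtain ⟨f, hf, rfl⟩ := P.mk0_surj a
  obtain ⟨g, hg, rfl⟩ := P.mk0_surj b
  exact ⟨X, Y, Z, ⟨cone f hf⟩, ⟨cone g hg⟩, ⟨cone _ (P.d_comp_closed (zero_add 0) (zero_add 1)
    (zero_add 1) (zero_add 1) g f hg hf)⟩, P.mk0 f hf, P.mk0 g hg, Iso.refl _, Iso.refl _,
    Iso.refl _, (Category.comp_id _).trans (Category.id_comp _).symm,
    (Category.comp_id _).trans (Category.id_comp _).symm, _, _, std_mem f hf, _, _, std_mem g hg,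
    _, _, std_mem _ _, ⟨octahedron f hf g hg _ _ (P.tot_comp _ _ _).symm⟩⟩

end DGExact

/-! ### Dg functors between exact dg categories induce triangulated functors -/

namespace DGFunctor

open DGExact Pretriangulated

variable {k : Type u} [CommRing k]

section

variable {A : DGCat.{u, v, w} k} {B : DGCat.{u, v', w'} k} (F : DGFunctor A B)

theorem tot_map_comp {x y z : A.Obj} {p q r : ℤ} (h : q + p = r) (g : A.Hom y z q)
    (f : A.Hom x y p) :
    B.tot (F.map (A.comp h g f)) = B.tot (F.map f) ≫ B.tot (F.map g) := by
  rw [F.map_comp, B.tot_comp]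

theorem tot_map_one (x : A.Obj) : B.tot (F.map (A.one x)) = 𝟙 _ := by
  rw [F.map_one, B.tot_one]

theorem dtot_map {x y : A.Obj} {p q : ℤ} (h : p + 1 = q) (f : A.Hom x y p) :
    B.dtot (F.map f) = B.tot (F.map (A.d h f)) := by
  rw [F.map_d, B.tot_d]

instance : F.H0map.Additive where
  map_add {X Y f g} := by
    obtain ⟨f, hf, rfl⟩ := A.mk0_surj f
    obtain ⟨g, hg, rfl⟩ := A.mk0_surj g
    refine B.cls_congr _ _ ?_
    change B.tot (F.map (f + g)) = B.tot (F.map f + F.map g)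
    rw [map_add]

theorem H0map_full (h : ∀ (x y : A.Obj) (p : ℤ),
    Function.Bijective (F.map : A.Hom x y p → B.Hom _ _ p)) : F.H0map.Full where
  map_surjective {X Y} f := by
    obtain ⟨f, hf, rfl⟩ := B.mk0_surj f
    obtain ⟨g, rfl⟩ := (h _ _ _).2 f
    exact ⟨A.mk0 g ((h _ _ _).1 (by rw [F.map_d, map_zero]; exact hf)), rfl⟩

end

variable {P : DGCat.{u, v, w} k} {Q : DGCat.{u, v', w'} k} [DGExact P]
  (F : DGFunctor P Q)

theorem tot_map_ξ_ξinv (n : ℤ) (x : P.Obj) :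
    Q.tot (F.map (ξinv n x)) ≫ Q.tot (F.map (ξ n x)) = 𝟙 _ := by
  rw [← F.tot_map_comp (add_neg_cancel n), ξ_ξinv, tot_map_one]

theorem tot_map_ξinv_ξ (n : ℤ) (x : P.Obj) :
    Q.tot (F.map (ξ n x)) ≫ Q.tot (F.map (ξinv n x)) = 𝟙 _ := by
  rw [← F.tot_map_comp (neg_add_cancel n), ξinv_ξ, tot_map_one]

theorem tot_map_ξ_ξinv_assoc (n : ℤ) (x : P.Obj) {Z : Q.Tot} (h : ⟨F.obj x⟩ ⟶ Z) :
    Q.tot (F.map (ξinv n x)) ≫ Q.tot (F.map (ξ n x)) ≫ h = h := by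
  rw [← Category.assoc, tot_map_ξ_ξinv, Category.id_comp]

theorem tot_map_ξinv_ξ_assoc (n : ℤ) (x : P.Obj) {Z : Q.Tot} (h : ⟨F.obj (susp n x)⟩ ⟶ Z) :
    Q.tot (F.map (ξ n x)) ≫ Q.tot (F.map (ξinv n x)) ≫ h = h := by
  rw [← Category.assoc, tot_map_ξinv_ξ, Category.id_comp]

theorem dtot_map_ξ (n : ℤ) (x : P.Obj) : Q.dtot (F.map (ξ n x)) = 0 := by
  rw [F.dtot_map rfl, d_ξ, map_zero, map_zero]

theorem dtot_map_ξinv (n : ℤ) (x : P.Obj) : Q.dtot (F.map (ξinv n x)) = 0 := by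
  rw [F.dtot_map rfl, P.d_eq_zero_of _ (dtot_ξinv n x), map_zero, map_zero]

section cone

variable {x y : P.Obj} (f : P.Hom x y 0) (hf : P.d (zero_add 1) f = 0)

theorem tot_map_t_j : Q.tot (F.map (j f hf)) ≫ Q.tot (F.map (t f hf)) = 𝟙 _ := by
  rw [← F.tot_map_comp (zero_add 0), DGExact.t_j, tot_map_one]

theorem tot_map_p_s : Q.tot (F.map (s f hf)) ≫ Q.tot (F.map (p f hf)) = 𝟙 _ := by
  rw [← F.tot_map_comp (zero_add 0), DGExact.p_s, tot_map_one]

theorem tot_map_p_j : Q.tot (F.map (j f hf)) ≫ Q.tot (F.map (p f hf)) = 0 := by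
  rw [← F.tot_map_comp (zero_add 0), DGExact.p_j, map_zero, map_zero]

theorem tot_map_t_s : Q.tot (F.map (s f hf)) ≫ Q.tot (F.map (t f hf)) = 0 := by
  rw [← F.tot_map_comp (zero_add 0), DGExact.t_s, map_zero, map_zero]

theorem tot_map_t_j_assoc {Z : Q.Tot} (h : ⟨F.obj y⟩ ⟶ Z) :
    Q.tot (F.map (j f hf)) ≫ Q.tot (F.map (t f hf)) ≫ h = h := by
  rw [← Category.assoc, tot_map_t_j, Category.id_comp]

theorem tot_map_p_s_assoc {Z : Q.Tot} (h : ⟨F.obj (susp 1 x)⟩ ⟶ Z) :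
    Q.tot (F.map (s f hf)) ≫ Q.tot (F.map (p f hf)) ≫ h = h := by
  rw [← Category.assoc, tot_map_p_s, Category.id_comp]

theorem tot_map_p_j_assoc {Z : Q.Tot} (h : ⟨F.obj (susp 1 x)⟩ ⟶ Z) :
    Q.tot (F.map (j f hf)) ≫ Q.tot (F.map (p f hf)) ≫ h = 0 := by
  rw [← Category.assoc, tot_map_p_j, Limits.zero_comp]

theorem tot_map_t_s_assoc {Z : Q.Tot} (h : ⟨F.obj y⟩ ⟶ Z) :
    Q.tot (F.map (s f hf)) ≫ Q.tot (F.map (t f hf)) ≫ h = 0 := by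
  rw [← Category.assoc, tot_map_t_s, Limits.zero_comp]

theorem tot_map_total : Q.tot (F.map (t f hf)) ≫ Q.tot (F.map (j f hf)) +
    Q.tot (F.map (p f hf)) ≫ Q.tot (F.map (s f hf)) = 𝟙 _ := by
  rw [← F.tot_map_comp (zero_add 0), ← F.tot_map_comp (zero_add 0), ← map_add, ← map_add,
    j_t_add_s_p, tot_map_one]

theorem dtot_map_j : Q.dtot (F.map (j f hf)) = 0 := by
  rw [F.dtot_map (zero_add 1), d_j, map_zero, map_zero]

theorem dtot_map_p : Q.dtot (F.map (p f hf)) = 0 := by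
  rw [F.dtot_map (zero_add 1), d_p, map_zero, map_zero]

theorem dtot_map_s : Q.dtot (F.map (s f hf)) =
    Q.tot (F.map (ξ 1 x)) ≫ Q.tot (F.map f) ≫ Q.tot (F.map (j f hf)) := by
  rw [F.dtot_map (zero_add 1), d_s, tot_map_comp, tot_map_comp, Category.assoc]

theorem dtot_map_t : Q.dtot (F.map (t f hf)) =
    -(Q.tot (F.map (p f hf)) ≫ Q.tot (F.map (ξ 1 x)) ≫ Q.tot (F.map f)) := by
  have h : P.d (zero_add 1) (t f hf) =
      - P.comp (zero_add 1) f (P.comp (add_zero 1) (ξ 1 x) (p f hf)) := by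
    apply P.tot_inj
    rw [P.tot_d, dtot_t, map_neg, P.tot_comp, P.tot_comp, Category.assoc]
  rw [F.dtot_map (zero_add 1), h, map_neg, map_neg, tot_map_comp, tot_map_comp, Category.assoc]

end cone

variable [DGExact Q]

/-- The comparison `F (Σⁿ x) → Σⁿ (F x)`. -/
def shiftHom (n : ℤ) (x : P.Obj) : Q.Hom (F.obj (susp n x)) (susp n (F.obj x)) 0 :=
  Q.comp (neg_add_cancel n) (ξinv n (F.obj x)) (F.map (ξ n x))

/-- The comparison `Σⁿ (F x) → F (Σⁿ x)`. -/
def shiftInv (n : ℤ) (x : P.Obj) : Q.Hom (susp n (F.obj x)) (F.obj (susp n x)) 0 :=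
  Q.comp (neg_add_cancel n) (F.map (ξinv n x)) (ξ n (F.obj x))

theorem tot_shiftHom (n : ℤ) (x : P.Obj) : Q.tot (F.shiftHom n x) =
    Q.tot (F.map (ξ n x)) ≫ Q.tot (ξinv n (F.obj x)) := Q.tot_comp _ _ _

theorem tot_shiftInv (n : ℤ) (x : P.Obj) : Q.tot (F.shiftInv n x) =
    Q.tot (ξ n (F.obj x)) ≫ Q.tot (F.map (ξinv n x)) := Q.tot_comp _ _ _

theorem d_shiftHom (n : ℤ) (x : P.Obj) : Q.d (zero_add 1) (F.shiftHom n x) = 0 :=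
  Q.d_eq_zero_of _ (by simp [shiftHom, Q.dtot_comp, dtot_ξinv, dtot_map_ξ])

theorem d_shiftInv (n : ℤ) (x : P.Obj) : Q.d (zero_add 1) (F.shiftInv n x) = 0 :=
  Q.d_eq_zero_of _ (by simp [shiftInv, Q.dtot_comp, dtot_ξ, dtot_map_ξinv])

theorem shiftHom_shiftInv (n : ℤ) (x : P.Obj) :
    Q.tot (F.shiftHom n x) ≫ Q.tot (F.shiftInv n x) = 𝟙 _ := by
  simp [tot_shiftHom, tot_shiftInv, tot_ξ_ξinv_assoc, tot_map_ξinv_ξ]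

theorem shiftInv_shiftHom (n : ℤ) (x : P.Obj) :
    Q.tot (F.shiftInv n x) ≫ Q.tot (F.shiftHom n x) = 𝟙 _ := by
  simp [tot_shiftHom, tot_shiftInv, tot_map_ξ_ξinv_assoc, tot_ξinv_ξ]

/-- The comparison `F (Σⁿ x) ≅ Σⁿ (F x)` in the homotopy category. -/
def shiftIso (n : ℤ) :
    shiftFunctor (DGCat.H0 P) n ⋙ F.H0map ≅ F.H0map ⋙ shiftFunctor (DGCat.H0 Q) n :=
  NatIso.ofComponents
    (fun X => Q.isoMk0 (F.shiftHom n X.as) (F.shiftInv n X.as) (F.d_shiftHom n X.as)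
      (F.d_shiftInv n X.as)
      (Q.mk0_comp_one _ _ _ _ (F.shiftHom_shiftInv n X.as))
      (Q.mk0_comp_one _ _ _ _ (F.shiftInv_shiftHom n X.as)))
    (by
      intro X Y f
      obtain ⟨f, hf, rfl⟩ := P.mk0_surj f
      refine Q.cls_sq ⟨F.map (suspMap n f), Q.mem_Z0.2 (F.d_map_eq_zero _ _
        (d_suspMap_eq_zero n _ f hf))⟩ ⟨F.shiftHom n Y.as, _⟩ ⟨F.shiftHom n X.as, _⟩
        ⟨suspMap n (F.map f), Q.mem_Z0.2 (d_suspMap_eq_zero n _ _ (F.d_map_eq_zero _ _ hf))⟩ ?_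
      change Q.tot (F.map (suspMap n f)) ≫ Q.tot (F.shiftHom n Y.as) =
        Q.tot (F.shiftHom n X.as) ≫ Q.tot (suspMap n (F.map f))
      simp [tot_shiftHom, suspMap, tot_map_comp, Q.tot_comp, tot_map_ξ_ξinv_assoc,
        tot_ξ_ξinv_assoc])

theorem shiftIso_hom_app (n : ℤ) (x : P.Obj) :
    (F.shiftIso n).hom.app ⟨x⟩ = Q.mk0 (F.shiftHom n x) (F.d_shiftHom n x) := rfl

/-- The functor induced by a dg functor between exact dg categories commutes with the shift. -/
instance : F.H0map.CommShift ℤ where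
  commShiftIso := F.shiftIso
  commShiftIso_zero := by
    ext ⟨x⟩
    refine Eq.trans ?_ (Functor.CommShift.isoZero_hom_app F.H0map ℤ ⟨x⟩).symm
    refine Q.cls_congr _ ⟨Q.comp (zero_add 0) (suspZeroInv (F.obj x)) (F.map (ξ 0 x)), _⟩ ?_
    change Q.tot (F.shiftHom 0 x) =
      Q.tot (Q.comp (zero_add 0) (suspZeroInv (F.obj x)) (F.map (ξ 0 x)))
    rw [tot_shiftHom, Q.tot_comp, tot_suspZeroInv]
  commShiftIso_add a b := by
    ext ⟨x⟩
    refine Eq.trans ?_ (Functor.CommShift.isoAdd_hom_app (F.shiftIso a) (F.shiftIso b) ⟨x⟩).symm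
    refine Q.cls_congr _ ⟨Q.comp (zero_add 0) (Q.comp (zero_add 0) (Q.comp (zero_add 0)
      (suspAddInv rfl (F.obj x)) (suspMap b (F.shiftHom a x))) (F.shiftHom b (susp a x)))
      (F.map (suspAdd rfl x)), _⟩ ?_
    change Q.tot (F.shiftHom (a + b) x) = Q.tot (Q.comp (zero_add 0) (Q.comp (zero_add 0)
      (Q.comp (zero_add 0) (suspAddInv rfl (F.obj x)) (suspMap b (F.shiftHom a x)))
        (F.shiftHom b (susp a x))) (F.map (suspAdd rfl x)))
    simp [tot_shiftHom, suspAdd, tot_map_comp, Q.tot_comp, tot_suspMap, tot_suspAddInv,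
      tot_map_ξ_ξinv_assoc, tot_ξ_ξinv_assoc]

section cone

variable {x y : P.Obj} (f : P.Hom x y 0) (hf : P.d (zero_add 1) f = 0)

/-- The comparison `F (Cone f) → Cone (F f)`. -/
def coneHom : Q.Hom (F.obj (cone f hf)) (cone (F.map f) (F.d_map_eq_zero _ f hf)) 0 :=
  Q.comp (zero_add 0) (j _ (F.d_map_eq_zero _ f hf)) (F.map (t f hf)) +
    Q.comp (zero_add 0) (s _ (F.d_map_eq_zero _ f hf))
      (Q.comp (zero_add 0) (F.shiftHom 1 x) (F.map (p f hf)))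

/-- The comparison `Cone (F f) → F (Cone f)`. -/
def coneInv : Q.Hom (cone (F.map f) (F.d_map_eq_zero _ f hf)) (F.obj (cone f hf)) 0 :=
  Q.comp (zero_add 0) (F.map (j f hf)) (t _ (F.d_map_eq_zero _ f hf)) +
    Q.comp (zero_add 0) (F.map (s f hf))
      (Q.comp (zero_add 0) (F.shiftInv 1 x) (p _ (F.d_map_eq_zero _ f hf)))

theorem tot_coneHom : Q.tot (F.coneHom f hf) =
    Q.tot (F.map (t f hf)) ≫ Q.tot (j _ (F.d_map_eq_zero _ f hf)) +
      Q.tot (F.map (p f hf)) ≫ Q.tot (F.map (ξ 1 x)) ≫ Q.tot (ξinv 1 (F.obj x)) ≫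
        Q.tot (s _ (F.d_map_eq_zero _ f hf)) := by
  simp [coneHom, Q.tot_comp, tot_shiftHom]

theorem tot_coneInv : Q.tot (F.coneInv f hf) =
    Q.tot (t _ (F.d_map_eq_zero _ f hf)) ≫ Q.tot (F.map (j f hf)) +
      Q.tot (p _ (F.d_map_eq_zero _ f hf)) ≫ Q.tot (ξ 1 (F.obj x)) ≫
        Q.tot (F.map (ξinv 1 x)) ≫ Q.tot (F.map (s f hf)) := by
  simp [coneInv, Q.tot_comp, tot_shiftInv]

theorem d_coneHom : Q.d (zero_add 1) (F.coneHom f hf) = 0 := by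
  have h := Q.dtot_eq_zero _ (F.d_shiftHom 1 x)
  refine Q.d_eq_zero_of _ ?_
  simp [coneHom, Q.dtot_comp, Q.tot_comp, dtot_s, dtot_j, dtot_map_t, dtot_map_p, h,
    tot_shiftHom, dgSign_zero, tot_ξ_ξinv_assoc]

theorem d_coneInv : Q.d (zero_add 1) (F.coneInv f hf) = 0 := by
  have h := Q.dtot_eq_zero _ (F.d_shiftInv 1 x)
  refine Q.d_eq_zero_of _ ?_
  simp [coneInv, Q.dtot_comp, Q.tot_comp, dtot_t, dtot_p, dtot_map_s, dtot_map_j, h,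
    tot_shiftInv, dgSign_zero, tot_map_ξ_ξinv_assoc]

/-- The comparison `F (Cone f) ≅ Cone (F f)` in the homotopy category. -/
def coneIso : (⟨F.obj (cone f hf)⟩ : DGCat.H0 Q) ≅
    ⟨cone (F.map f) (F.d_map_eq_zero _ f hf)⟩ :=
  Q.isoMk0 (F.coneHom f hf) (F.coneInv f hf) (F.d_coneHom f hf) (F.d_coneInv f hf)
    (Q.mk0_comp_one _ _ _ _ (by
      rw [← F.tot_map_total f hf]
      simp [tot_coneHom, tot_coneInv, tot_t_j_assoc, tot_p_j_assoc, tot_p_s_assoc,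
        tot_t_s_assoc, tot_ξ_ξinv_assoc, tot_map_ξinv_ξ_assoc]))
    (Q.mk0_comp_one _ _ _ _ (by
      rw [← tot_total _ (F.d_map_eq_zero _ f hf)]
      simp [tot_coneHom, tot_coneInv, tot_map_t_j_assoc, tot_map_p_j_assoc, tot_map_p_s_assoc,
        tot_map_t_s_assoc, tot_map_ξ_ξinv_assoc, tot_ξinv_ξ_assoc]))

/-- A dg functor sends standard triangles to triangles isomorphic to standard triangles. -/
def mapStdIso : F.H0map.mapTriangle.obj (stdTriangle f hf) ≅
    stdTriangle (F.map f) (F.d_map_eq_zero _ f hf) :=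
  Triangle.isoMk _ _ (Iso.refl _) (Iso.refl _) (F.coneIso f hf)
    ((Category.comp_id _).trans (Category.id_comp _).symm)
    (by
      refine Eq.trans ?_ (Category.id_comp
        (Q.mk0 (j _ (F.d_map_eq_zero _ f hf)) (d_j _ (F.d_map_eq_zero _ f hf)))).symm
      refine Q.mk0_comp_eq (F.map (j f hf)) (F.coneHom f hf) _ (F.d_map_eq_zero _ _ (d_j f hf))
        (F.d_coneHom f hf) (d_j _ _) ?_
      simp [tot_coneHom, tot_map_t_j_assoc, tot_map_p_j_assoc])
    (by
      refine (congrArg (fun e : (⟨susp 1 (F.obj x)⟩ : DGCat.H0 Q) ⟶ ⟨susp 1 (F.obj x)⟩ =>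
          (Q.mk0 (F.map (p f hf)) (F.d_map_eq_zero _ _ (d_p f hf)) ≫
            Q.mk0 (F.shiftHom 1 x) (F.d_shiftHom 1 x)) ≫ e)
        (CategoryTheory.Functor.map_id (shiftFunctor (DGCat.H0 Q) (1 : ℤ))
          (⟨F.obj x⟩ : DGCat.H0 Q))).trans ?_
      refine (Category.comp_id _).trans ?_
      refine Q.mk0_sq (f := F.map (p f hf)) (g := F.shiftHom 1 x) (f' := F.coneHom f hf)
        (g' := p _ (F.d_map_eq_zero _ f hf)) (F.d_map_eq_zero _ _ (d_p f hf)) (F.d_shiftHom 1 x)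
        (F.d_coneHom f hf) (d_p _ _) ?_
      simp [tot_coneHom, tot_shiftHom, tot_p_j, tot_p_s])

end cone

instance : F.H0map.IsTriangulated where
  map_distinguished := by
    rintro T ⟨x, y, f, hf, ⟨e⟩⟩
    exact ⟨_, _, _, _, ⟨F.H0map.mapTriangle.mapIso e ≪≫ F.mapStdIso f hf⟩⟩

end DGFunctor

/-! ### Drinfeld's dg quotient -/

namespace DGCat

variable {k : Type u} [CommRing k] (A : DGCat.{u, v, w} k) (B : Set A.Obj)

/-- Formal expressions in the morphisms of `A` and new morphisms `ε_U : U → U` of degree `-1`,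
for `U` in `B`. -/
inductive QExpr : A.Obj → A.Obj → ℤ → Type (max u v w)
  /-- a morphism of `A` -/
  | of {x y : A.Obj} {p : ℤ} (f : A.Hom x y p) : QExpr x y p
  /-- the new morphism `ε_U` -/
  | eps (U : A.Obj) (hU : U ∈ B) : QExpr U U (-1)
  /-- the zero morphism -/
  | zero {x y : A.Obj} {p : ℤ} : QExpr x y p
  /-- a sum -/
  | add {x y : A.Obj} {p : ℤ} (f g : QExpr x y p) : QExpr x y p
  /-- a scalar multiple -/
  | smul {x y : A.Obj} {p : ℤ} (c : k) (f : QExpr x y p) : QExpr x y p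
  /-- a composite `g ∘ f` -/
  | comp {x y z : A.Obj} {p q r : ℤ} (h : q + p = r) (g : QExpr y z q) (f : QExpr x y p) :
      QExpr x z r

/-- The relations: those of a graded `k`-linear category, and those which hold in `A`. -/
inductive QRel : ∀ {x y : A.Obj} {p : ℤ}, QExpr A B x y p → QExpr A B x y p → Prop
  | add_left {x y : A.Obj} {p : ℤ} (f f' g : QExpr A B x y p) :
      QRel f f' → QRel (.add f g) (.add f' g)
  | add_right {x y : A.Obj} {p : ℤ} (f g g' : QExpr A B x y p) :
      QRel g g' → QRel (.add f g) (.add f g')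
  | smul_right {x y : A.Obj} {p : ℤ} (c : k) (f f' : QExpr A B x y p) :
      QRel f f' → QRel (.smul c f) (.smul c f')
  | comp_left {x y z : A.Obj} {p q r : ℤ} (h : q + p = r) (g g' : QExpr A B y z q)
      (f : QExpr A B x y p) : QRel g g' → QRel (.comp h g f) (.comp h g' f)
  | comp_right {x y z : A.Obj} {p q r : ℤ} (h : q + p = r) (g : QExpr A B y z q)
      (f f' : QExpr A B x y p) : QRel f f' → QRel (.comp h g f) (.comp h g f')
  | add_comm {x y : A.Obj} {p : ℤ} (f g : QExpr A B x y p) : QRel (.add f g) (.add g f)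
  | add_assoc {x y : A.Obj} {p : ℤ} (f g e : QExpr A B x y p) :
      QRel (.add (.add f g) e) (.add f (.add g e))
  | zero_add {x y : A.Obj} {p : ℤ} (f : QExpr A B x y p) : QRel (.add .zero f) f
  | one_smul {x y : A.Obj} {p : ℤ} (f : QExpr A B x y p) : QRel (.smul 1 f) f
  | zero_smul {x y : A.Obj} {p : ℤ} (f : QExpr A B x y p) : QRel (.smul 0 f) .zero
  | mul_smul {x y : A.Obj} {p : ℤ} (c c' : k) (f : QExpr A B x y p) :
      QRel (.smul (c * c') f) (.smul c (.smul c' f))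
  | add_smul {x y : A.Obj} {p : ℤ} (c c' : k) (f : QExpr A B x y p) :
      QRel (.smul (c + c') f) (.add (.smul c f) (.smul c' f))
  | smul_add {x y : A.Obj} {p : ℤ} (c : k) (f g : QExpr A B x y p) :
      QRel (.smul c (.add f g)) (.add (.smul c f) (.smul c g))
  | add_comp {x y z : A.Obj} {p q r : ℤ} (h : q + p = r) (g g' : QExpr A B y z q)
      (f : QExpr A B x y p) : QRel (.comp h (.add g g') f) (.add (.comp h g f) (.comp h g' f))
  | comp_add {x y z : A.Obj} {p q r : ℤ} (h : q + p = r) (g : QExpr A B y z q)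
      (f f' : QExpr A B x y p) : QRel (.comp h g (.add f f')) (.add (.comp h g f) (.comp h g f'))
  | smul_comp {x y z : A.Obj} {p q r : ℤ} (h : q + p = r) (c : k) (g : QExpr A B y z q)
      (f : QExpr A B x y p) : QRel (.comp h (.smul c g) f) (.smul c (.comp h g f))
  | comp_smul {x y z : A.Obj} {p q r : ℤ} (h : q + p = r) (c : k) (g : QExpr A B y z q)
      (f : QExpr A B x y p) : QRel (.comp h g (.smul c f)) (.smul c (.comp h g f))
  | assoc {x y z t : A.Obj} {p q r qp rq s : ℤ} (h₁ : r + q = rq) (h₂ : rq + p = s)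
      (h₃ : q + p = qp) (h₄ : r + qp = s) (e : QExpr A B z t r) (g : QExpr A B y z q)
      (f : QExpr A B x y p) : QRel (.comp h₂ (.comp h₁ e g) f) (.comp h₄ e (.comp h₃ g f))
  | one_comp {x y : A.Obj} {p : ℤ} (f : QExpr A B x y p) :
      QRel (.comp (_root_.zero_add p) (.of (A.one y)) f) f
  | comp_one {x y : A.Obj} {p : ℤ} (f : QExpr A B x y p) :
      QRel (.comp (_root_.add_zero p) f (.of (A.one x))) f
  | of_add {x y : A.Obj} {p : ℤ} (f g : A.Hom x y p) : QRel (.of (f + g)) (.add (.of f) (.of g))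
  | of_smul {x y : A.Obj} {p : ℤ} (c : k) (f : A.Hom x y p) : QRel (.of (c • f)) (.smul c (.of f))
  | of_comp {x y z : A.Obj} {p q r : ℤ} (h : q + p = r) (g : A.Hom y z q) (f : A.Hom x y p) :
      QRel (.of (A.comp h g f)) (.comp h (.of g) (.of f))

/-- The morphisms of the dg quotient. -/
def QHom (x y : A.Obj) (p : ℤ) : Type (max u v w) := Quot (QRel A B (x := x) (y := y) (p := p))

namespace QHom

variable {A B}

/-- The class of an expression. -/
def mk {x y : A.Obj} {p : ℤ} (e : QExpr A B x y p) : QHom A B x y p := Quot.mk _ e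

theorem ind {x y : A.Obj} {p : ℤ} {motive : QHom A B x y p → Prop} (h : ∀ e, motive (mk e))
    (f : QHom A B x y p) : motive f := Quot.ind h f

theorem sound {x y : A.Obj} {p : ℤ} {e e' : QExpr A B x y p} (h : QRel A B e e') :
    mk e = mk e' := Quot.sound h

instance {x y : A.Obj} {p : ℤ} : Zero (QHom A B x y p) := ⟨mk .zero⟩

instance {x y : A.Obj} {p : ℤ} : Add (QHom A B x y p) :=
  ⟨Quot.map₂ .add (fun _ _ _ h => .add_right _ _ _ h) (fun _ _ _ h => .add_left _ _ _ h)⟩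

instance {x y : A.Obj} {p : ℤ} : SMul k (QHom A B x y p) :=
  ⟨fun c => Quot.map (.smul c) (fun _ _ h => .smul_right _ _ _ h)⟩

instance {x y : A.Obj} {p : ℤ} : Neg (QHom A B x y p) := ⟨fun f => (-1 : k) • f⟩

theorem mk_zero {x y : A.Obj} {p : ℤ} : mk (.zero : QExpr A B x y p) = 0 := rfl

theorem mk_add {x y : A.Obj} {p : ℤ} (e e' : QExpr A B x y p) :
    mk (.add e e') = mk e + mk e' := rfl

theorem mk_smul {x y : A.Obj} {p : ℤ} (c : k) (e : QExpr A B x y p) :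
    mk (.smul c e) = c • mk e := rfl

protected theorem zero_smul {x y : A.Obj} {p : ℤ} (f : QHom A B x y p) : (0 : k) • f = 0 := by
  induction f using ind
  exact sound (.zero_smul _)

protected theorem add_comm {x y : A.Obj} {p : ℤ} (f g : QHom A B x y p) : f + g = g + f := by
  induction f using ind
  induction g using ind
  exact sound (.add_comm _ _)

protected theorem zero_add {x y : A.Obj} {p : ℤ} (f : QHom A B x y p) : 0 + f = f := by
  induction f using ind
  exact sound (.zero_add _)

protected theorem one_smul {x y : A.Obj} {p : ℤ} (f : QHom A B x y p) : (1 : k) • f = f := by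
  induction f using ind
  exact sound (.one_smul _)

protected theorem add_smul {x y : A.Obj} {p : ℤ} (c c' : k) (f : QHom A B x y p) :
    (c + c') • f = c • f + c' • f := by
  induction f using ind
  exact sound (.add_smul _ _ _)

protected theorem mul_smul {x y : A.Obj} {p : ℤ} (c c' : k) (f : QHom A B x y p) :
    (c * c') • f = c • c' • f := by
  induction f using ind
  exact sound (.mul_smul _ _ _)

instance {x y : A.Obj} {p : ℤ} : AddCommGroup (QHom A B x y p) where
  add_assoc f g e := by
    induction f using ind
    induction g using ind
    induction e using ind
    exact sound (.add_assoc _ _ _)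
  zero_add := QHom.zero_add
  add_zero f := by rw [QHom.add_comm, QHom.zero_add]
  nsmul := nsmulRec
  zsmul := zsmulRec
  add_comm := QHom.add_comm
  neg_add_cancel f := by
    change (-1 : k) • f + f = 0
    nth_rw 2 [← QHom.one_smul f]
    rw [← QHom.add_smul, neg_add_cancel, QHom.zero_smul]

instance {x y : A.Obj} {p : ℤ} : Module k (QHom A B x y p) where
  one_smul := QHom.one_smul
  mul_smul := QHom.mul_smul
  smul_zero c := by
    rw [← QHom.zero_smul (0 : QHom A B x y p), ← QHom.mul_smul, mul_zero]
  smul_add c f g := by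
    induction f using ind
    induction g using ind
    exact sound (.smul_add _ _ _)
  add_smul := QHom.add_smul
  zero_smul := QHom.zero_smul

/-- The composition. -/
def comp {x y z : A.Obj} {p q r : ℤ} (h : q + p = r) :
    QHom A B y z q →ₗ[k] QHom A B x y p →ₗ[k] QHom A B x z r :=
  LinearMap.mk₂ k
    (Quot.map₂ (QExpr.comp h) (fun _ _ _ h' => .comp_right _ _ _ _ h')
      (fun _ _ _ h' => .comp_left _ _ _ _ h'))
    (fun g g' f => by
      induction f using ind
      induction g using ind
      induction g' using ind
      exact sound (.add_comp _ _ _ _))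
    (fun c g f => by
      induction f using ind
      induction g using ind
      exact sound (.smul_comp _ _ _ _))
    (fun g f f' => by
      induction f using ind
      induction g using ind
      induction f' using ind
      exact sound (.comp_add _ _ _ _))
    (fun c g f => by
      induction f using ind
      induction g using ind
      exact sound (.comp_smul _ _ _ _))

theorem mk_comp {x y z : A.Obj} {p q r : ℤ} (h : q + p = r) (g : QExpr A B y z q)
    (f : QExpr A B x y p) : mk (.comp h g f) = comp h (mk g) (mk f) := rfl

theorem comp_assoc {x y z t : A.Obj} {p q r qp rq s : ℤ} (h₁ : r + q = rq) (h₂ : rq + p = s)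
    (h₃ : q + p = qp) (h₄ : r + qp = s) (e : QHom A B z t r) (g : QHom A B y z q)
    (f : QHom A B x y p) : comp h₂ (comp h₁ e g) f = comp h₄ e (comp h₃ g f) := by
  induction f using ind
  induction g using ind
  induction e using ind
  exact sound (.assoc _ _ _ _ _ _ _)

/-- The image of a morphism of `A`. -/
def of {x y : A.Obj} {p : ℤ} : A.Hom x y p →ₗ[k] QHom A B x y p where
  toFun f := mk (.of f)
  map_add' f g := sound (.of_add f g)
  map_smul' c f := sound (.of_smul c f)

theorem mk_of {x y : A.Obj} {p : ℤ} (f : A.Hom x y p) :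
    mk (.of f : QExpr A B x y p) = of f := rfl

theorem of_comp {x y z : A.Obj} {p q r : ℤ} (h : q + p = r) (g : A.Hom y z q) (f : A.Hom x y p) :
    (of (A.comp h g f) : QHom A B x z r) = comp h (of g) (of f) :=
  sound (.of_comp h g f)

theorem one_comp {x y : A.Obj} {p q : ℤ} (h : q + p = p) (e : A.Hom y y q)
    (he : ∃ h : 0 = q, e = A.castDeg h (A.one y)) (f : QHom A B x y p) :
    comp h (of e) f = f := by
  obtain ⟨rfl, rfl⟩ := he
  induction f using ind
  exact sound (.one_comp _)

theorem comp_one {x y : A.Obj} {p q : ℤ} (h : p + q = p) (e : A.Hom x x q)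
    (he : ∃ h : 0 = q, e = A.castDeg h (A.one x)) (f : QHom A B x y p) :
    comp h f (of e) = f := by
  obtain ⟨rfl, rfl⟩ := he
  induction f using ind
  exact sound (.comp_one _)

end QHom

/-- The differential of an expression: it extends the differential of `A`, satisfies the graded
Leibniz rule, and sends `ε_U` to the identity of `U`. -/
def QExpr.diff {A : DGCat.{u, v, w} k} {B : Set A.Obj} : ∀ {x y : A.Obj} {p : ℤ},
    QExpr A B x y p → ∀ {q : ℤ}, p + 1 = q → QExpr A B x y q
  | _, _, _, .of f, _, h => .of (A.d h f)
  | _, _, _, .eps U _, _, h => .of (A.castDeg ((neg_add_cancel 1).symm.trans h) (A.one U))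
  | _, _, _, .zero, _, _ => .zero
  | _, _, _, .add f g, _, h => .add (diff f h) (diff g h)
  | _, _, _, .smul c f, _, h => .smul c (diff f h)
  | _, _, _, .comp (q := n) hr g f, _, h =>
      .add (.comp (by omega) (diff g rfl) f) (.smul (dgSign k n) (.comp (by omega) g (diff f rfl)))

namespace QHom

variable {A B}

theorem mk_diff_comp {x y z : A.Obj} {p q r p' q' r' : ℤ} (h : q + p = r) (hp : p + 1 = p')
    (hq : q + 1 = q') (hr : r + 1 = r') (g : QExpr A B y z q) (f : QExpr A B x y p) :
    mk (QExpr.diff (.comp h g f) hr) = comp (by omega) (mk (g.diff hq)) (mk f) +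
      dgSign k q • comp (by omega) (mk g) (mk (f.diff hp)) := by
  subst hp hq
  rfl

theorem mk_diff_eq {x y : A.Obj} {p : ℤ} {e e' : QExpr A B x y p} (H : QRel A B e e') {q : ℤ}
    (h : p + 1 = q) : mk (e.diff h) = mk (e'.diff h) := by
  induction H generalizing q with
  | add_left f f' g _ ih => exact congrArg (· + mk (g.diff h)) (ih h)
  | add_right f g g' _ ih => exact congrArg (mk (f.diff h) + ·) (ih h)
  | smul_right c f f' _ ih => exact congrArg (c • ·) (ih h)
  | comp_left hr g g' f hg ih =>
    rw [mk_diff_comp hr rfl rfl h, mk_diff_comp hr rfl rfl h, ih rfl, sound hg]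
  | comp_right hr g f f' hf ih =>
    rw [mk_diff_comp hr rfl rfl h, mk_diff_comp hr rfl rfl h, ih rfl, sound hf]
  | add_comm f g => exact add_comm (mk (f.diff h)) (mk (g.diff h))
  | add_assoc f g e => exact add_assoc (mk (f.diff h)) (mk (g.diff h)) (mk (e.diff h))
  | zero_add f => exact zero_add (mk (f.diff h))
  | one_smul f => exact one_smul k (mk (f.diff h))
  | zero_smul f => exact zero_smul k (mk (f.diff h))
  | mul_smul c c' f => exact mul_smul c c' (mk (f.diff h))
  | add_smul c c' f => exact add_smul c c' (mk (f.diff h))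
  | smul_add c f g => exact smul_add c (mk (f.diff h)) (mk (g.diff h))
  | add_comp hr g g' f =>
    simp only [QExpr.diff, mk_add, mk_smul, mk_comp, map_add, LinearMap.add_apply, smul_add]
    abel
  | comp_add hr g f f' =>
    simp only [QExpr.diff, mk_add, mk_smul, mk_comp, map_add, LinearMap.add_apply, smul_add]
    abel
  | smul_comp hr c g f =>
    simp only [QExpr.diff, mk_add, mk_smul, mk_comp, map_smul, LinearMap.smul_apply, smul_add,
      smul_comm c]
  | comp_smul hr c g f =>
    simp only [QExpr.diff, mk_add, mk_smul, mk_comp, map_smul, LinearMap.smul_apply, smul_add,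
      smul_comm c]
  | assoc h₁ h₂ h₃ h₄ e g f =>
    rw [mk_diff_comp h₂ rfl rfl h, mk_diff_comp h₄ rfl rfl h, mk_diff_comp h₁ rfl rfl rfl,
      mk_diff_comp h₃ rfl rfl rfl]
    simp only [mk_comp, map_add, map_smul, LinearMap.add_apply, LinearMap.smul_apply, smul_add,
      smul_smul, ← h₁, dgSign_add, add_assoc]
    congr 1
    · exact comp_assoc _ _ _ _ _ _ _
    · congr 2
      · exact comp_assoc _ _ _ _ _ _ _
      · exact comp_assoc _ _ _ _ _ _ _
  | one_comp f =>
    rw [mk_diff_comp _ rfl rfl h]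
    simp only [QExpr.diff, d_one, mk_of, map_zero, LinearMap.zero_apply, zero_add, dgSign_zero,
      one_smul]
    subst h
    exact one_comp _ _ ⟨rfl, rfl⟩ _
  | comp_one f =>
    rw [mk_diff_comp _ rfl rfl h]
    simp only [QExpr.diff, d_one, mk_of, map_zero, smul_zero, add_zero]
    subst h
    exact comp_one _ _ ⟨rfl, rfl⟩ _
  | of_add f g => simp only [QExpr.diff, mk_add, mk_of, map_add]
  | of_smul c f => simp only [QExpr.diff, mk_smul, mk_of, map_smul]
  | of_comp hr g f =>
    rw [mk_diff_comp hr rfl rfl h]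
    simp only [QExpr.diff, mk_of, A.leibniz hr rfl rfl h, map_add, map_smul, of_comp]

/-- The differential of the dg quotient. -/
def diff {x y : A.Obj} {p q : ℤ} (h : p + 1 = q) : QHom A B x y p →ₗ[k] QHom A B x y q where
  toFun := Quot.lift (fun e => mk (e.diff h)) (fun _ _ H => mk_diff_eq H h)
  map_add' f g := by
    induction f using ind
    induction g using ind
    rfl
  map_smul' c f := by
    induction f using ind
    rfl

theorem diff_mk {x y : A.Obj} {p q : ℤ} (h : p + 1 = q) (e : QExpr A B x y p) :
    diff h (mk e) = mk (e.diff h) := rfl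

theorem diff_comp {x y z : A.Obj} {p q r p' q' r' : ℤ} (h : q + p = r) (hp : p + 1 = p')
    (hq : q + 1 = q') (hr : r + 1 = r') (g : QHom A B y z q) (f : QHom A B x y p) :
    diff hr (comp h g f) = comp (by omega) (diff hq g) f +
      dgSign k q • comp (by omega) g (diff hp f) := by
  induction f using ind
  induction g using ind
  exact mk_diff_comp h hp hq hr _ _

theorem diff_diff {x y : A.Obj} {p q r : ℤ} (h : p + 1 = q) (h' : q + 1 = r)
    (f : QHom A B x y p) : diff h' (diff h f) = 0 := by
  induction f using ind with | h e
  induction e generalizing q r with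
  | of f =>
    change of (A.d h' (A.d h f)) = 0
    rw [A.d_d, map_zero]
  | eps U hU =>
    obtain rfl : q = 0 := by omega
    change of (A.d h' (A.one U)) = 0
    rw [A.d_one, map_zero]
  | zero => rw [mk_zero, map_zero, map_zero]
  | add f g hf hg => rw [mk_add, map_add, map_add, hf, hg, add_zero]
  | smul c f hf => rw [mk_smul, map_smul, map_smul, hf, smul_zero]
  | @comp x y z n m l hr g f hg hf =>
    have e1 : m + 1 + n = q := by omega
    have e2 : m + (n + 1) = q := by omega
    rw [mk_comp, diff_comp hr rfl rfl h, map_add, map_smul, diff_comp e1 rfl rfl h',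
      diff_comp e2 rfl rfl h', hg, hf, dgSign_add, dgSign_one]
    simp

end QHom

/-- Drinfeld's dg quotient: the dg category obtained from `A` by freely adding, for each object `U`
in `B`, a morphism `ε_U : U → U` of degree `-1` with differential the identity of `U`. -/
def quot : DGCat.{u, v, max u v w} k where
  Obj := A.Obj
  Hom := QHom A B
  d h := QHom.diff h
  comp h := QHom.comp h
  one x := QHom.of (A.one x)
  d_d := QHom.diff_diff
  assoc := QHom.comp_assoc
  one_comp f := QHom.one_comp _ _ ⟨rfl, rfl⟩ f
  comp_one f := QHom.comp_one _ _ ⟨rfl, rfl⟩ f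
  leibniz := QHom.diff_comp

/-- The canonical dg functor from `A` to the dg quotient. -/
def quotFunctor : DGFunctor A (A.quot B) where
  obj x := x
  map := QHom.of
  map_d _ _ := rfl
  map_comp := QHom.of_comp
  map_one _ := rfl

end DGCat

/-! ### Formal finite sums of shifts -/

namespace DGCat

variable {k : Type u} [CommRing k]

/-- The morphism given by an equality of objects, put in a degree which is equal to zero. -/
def eqHom (A : DGCat.{u, v, w} k) {x y : A.Obj} (h : x = y) {p : ℤ} (hp : 0 = p) : A.Hom x y p :=
  A.castDeg hp (h ▸ A.one x)

theorem eqHom_comp_eqHom (A : DGCat.{u, v, w} k) {x y z : A.Obj} (e : x = y) (e' : y = z)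
    {p q r : ℤ} (h : q + p = r) (hp : 0 = p) (hq : 0 = q) (hr : 0 = r) :
    A.comp h (A.eqHom e' hq) (A.eqHom e hp) = A.eqHom (e.trans e') hr := by
  subst e e' hp hq hr
  exact A.one_comp _

theorem eqHom_comp (A : DGCat.{u, v, w} k) {x y : A.Obj} {p q : ℤ} (h : q + p = p) (hq : 0 = q)
    (f : A.Hom x y p) : A.comp h (A.eqHom rfl hq) f = f := by
  subst hq
  exact A.one_comp f

theorem comp_eqHom (A : DGCat.{u, v, w} k) {x y : A.Obj} {p q : ℤ} (h : p + q = p) (hq : 0 = q)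
    (f : A.Hom x y p) : A.comp h f (A.eqHom rfl hq) = f := by
  subst hq
  exact A.comp_one f

theorem d_eqHom (A : DGCat.{u, v, w} k) {x y : A.Obj} (e : x = y) {p q : ℤ} (hp : 0 = p)
    (h : p + 1 = q) : A.d h (A.eqHom e hp) = 0 := by
  subst e hp
  exact A.d_one _ _

/-- A formal finite direct sum `⨁ᵢ Σ^(deg i) (obj i)` of shifts of objects of `A`. -/
structure AddObj (A : DGCat.{u, v, w} k) where
  /-- the index set -/
  ι : Type
  [fintype : Fintype ι]
  /-- the objects -/
  obj : ι → A.Obj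
  /-- the shifts -/
  deg : ι → ℤ

attribute [instance] AddObj.fintype

/-- The matrices of degree `p` between formal sums of shifts. A morphism `Σᵃ x → Σᵇ y` of degree
`p` is a morphism `x → y` of degree `p + b - a`. -/
abbrev AddHom (A : DGCat.{u, v, w} k) (X Y : AddObj A) (p : ℤ) : Type w :=
  ∀ (i : X.ι) (j : Y.ι), A.Hom (X.obj i) (Y.obj j) (p + Y.deg j - X.deg i)

namespace AddHom

variable {A : DGCat.{u, v, w} k}

/-- The differential of a matrix: `d (ξ⁻¹ f ξ) = (-1)^b ξ⁻¹ (d f) ξ` for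
`ξ⁻¹ f ξ : Σᵃ x → Σᵇ y`. -/
def d {X Y : AddObj A} {p q : ℤ} (h : p + 1 = q) : AddHom A X Y p →ₗ[k] AddHom A X Y q where
  toFun f i j := dgSign k (Y.deg j) • A.d (by omega) (f i j)
  map_add' f g := by
    funext i j
    simp
  map_smul' c f := by
    funext i j
    simp [smul_comm c]

/-- The product of matrices. -/
def comp {X Y Z : AddObj A} {p q r : ℤ} (h : q + p = r) :
    AddHom A Y Z q →ₗ[k] AddHom A X Y p →ₗ[k] AddHom A X Z r :=
  LinearMap.mk₂ k (fun g f i l => ∑ j, A.comp (by omega) (g j l) (f i j))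
    (fun g g' f => by
      funext i l
      simp [Finset.sum_add_distrib])
    (fun c g f => by
      funext i l
      simp [Finset.smul_sum])
    (fun g f f' => by
      funext i l
      simp [Finset.sum_add_distrib])
    (fun c g f => by
      funext i l
      simp [Finset.smul_sum])

theorem d_apply {X Y : AddObj A} {p q : ℤ} (h : p + 1 = q) (f : AddHom A X Y p) (i : X.ι)
    (j : Y.ι) : d h f i j = dgSign k (Y.deg j) • A.d (by omega) (f i j) := rfl

theorem comp_apply {X Y Z : AddObj A} {p q r : ℤ} (h : q + p = r) (g : AddHom A Y Z q)
    (f : AddHom A X Y p) (i : X.ι) (l : Z.ι) :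
    comp h g f i l = ∑ j, A.comp (by omega) (g j l) (f i j) := rfl

open Classical in
/-- The matrix with entries `1` at the places where a relation holds and `0` elsewhere. -/
def mat {X Y : AddObj A} {p : ℤ} (r : X.ι → Y.ι → Prop)
    (h : ∀ i j, r i j → X.obj i = Y.obj j ∧ 0 = p + Y.deg j - X.deg i) : AddHom A X Y p :=
  fun i j => if hr : r i j then A.eqHom (h i j hr).1 (h i j hr).2 else 0

theorem mat_pos {X Y : AddObj A} {p : ℤ} (r : X.ι → Y.ι → Prop)
    (h : ∀ i j, r i j → X.obj i = Y.obj j ∧ 0 = p + Y.deg j - X.deg i) {i : X.ι} {j : Y.ι}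
    (hr : r i j) : mat r h i j = A.eqHom (h i j hr).1 (h i j hr).2 := dif_pos hr

theorem mat_neg {X Y : AddObj A} {p : ℤ} (r : X.ι → Y.ι → Prop)
    (h : ∀ i j, r i j → X.obj i = Y.obj j ∧ 0 = p + Y.deg j - X.deg i) {i : X.ι} {j : Y.ι}
    (hr : ¬ r i j) : mat r h i j = 0 := dif_neg hr

theorem d_mat {X Y : AddObj A} {p q : ℤ} (r : X.ι → Y.ι → Prop)
    (h : ∀ i j, r i j → X.obj i = Y.obj j ∧ 0 = p + Y.deg j - X.deg i) (hq : p + 1 = q) :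
    d hq (mat r h) = 0 := by
  funext i j
  rw [d_apply]
  by_cases hr : r i j
  · rw [mat_pos r h hr, d_eqHom, smul_zero]
    rfl
  · rw [mat_neg r h hr, map_zero, smul_zero]
    rfl

theorem mat_comp_mat {X Y Z : AddObj A} {p q s : ℤ} (r : X.ι → Y.ι → Prop)
    (r' : Y.ι → Z.ι → Prop) (r'' : X.ι → Z.ι → Prop)
    (h : ∀ i j, r i j → X.obj i = Y.obj j ∧ 0 = p + Y.deg j - X.deg i)
    (h' : ∀ i j, r' i j → Y.obj i = Z.obj j ∧ 0 = q + Z.deg j - Y.deg i)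
    (h'' : ∀ i j, r'' i j → X.obj i = Z.obj j ∧ 0 = s + Z.deg j - X.deg i)
    (hs : q + p = s) (h1 : ∀ i l, r'' i l → ∃ j, r i j ∧ r' j l)
    (h2 : ∀ i j l, r i j → r' j l → r'' i l)
    (h3 : ∀ i j j' l, r i j → r' j l → r i j' → r' j' l → j' = j) :
    comp hs (mat r' h') (mat r h) = mat r'' h'' := by
  funext i l
  rw [comp_apply]
  by_cases hr : r'' i l
  · obtain ⟨j, hj, hj'⟩ := h1 i l hr
    rw [Finset.sum_eq_single j, mat_pos r h hj, mat_pos r' h' hj', mat_pos r'' h'' hr,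
      A.eqHom_comp_eqHom]
    · intro j' _ hne
      by_cases ha : r i j'
      · rw [mat_neg r' h' (fun hb => hne (h3 i j j' l hj hj' ha hb)), map_zero,
          LinearMap.zero_apply]
      · rw [mat_neg r h ha, map_zero]
    · intro hj
      exact absurd (Finset.mem_univ j) hj
  · rw [mat_neg r'' h'' hr]
    refine Finset.sum_eq_zero fun j _ => ?_
    by_cases ha : r i j
    · rw [mat_neg r' h' (fun hb => hr (h2 i j l ha hb)), map_zero, LinearMap.zero_apply]
    · rw [mat_neg r h ha, map_zero]

theorem mat_add_mat {X Y : AddObj A} {p : ℤ} (r r' r'' : X.ι → Y.ι → Prop)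
    (h : ∀ i j, r i j → X.obj i = Y.obj j ∧ 0 = p + Y.deg j - X.deg i)
    (h' : ∀ i j, r' i j → X.obj i = Y.obj j ∧ 0 = p + Y.deg j - X.deg i)
    (h'' : ∀ i j, r'' i j → X.obj i = Y.obj j ∧ 0 = p + Y.deg j - X.deg i)
    (h1 : ∀ i j, r'' i j ↔ r i j ∨ r' i j) (h2 : ∀ i j, r i j → ¬ r' i j) :
    mat r h + mat r' h' = mat r'' h'' := by
  funext i j
  rw [Pi.add_apply, Pi.add_apply]
  by_cases ha : r i j
  · rw [mat_pos r h ha, mat_neg r' h' (h2 i j ha), mat_pos r'' h'' ((h1 i j).2 (Or.inl ha)),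
      add_zero]
  · by_cases hb : r' i j
    · rw [mat_neg r h ha, mat_pos r' h' hb, mat_pos r'' h'' ((h1 i j).2 (Or.inr hb)), zero_add]
    · rw [mat_neg r h ha, mat_neg r' h' hb, mat_neg r'' h'' (fun hc => ((h1 i j).1 hc).elim ha hb),
        add_zero]

/-- The identity matrix. -/
def one (X : AddObj A) : AddHom A X X 0 :=
  mat (fun i j => i = j) (by
    rintro i _ rfl
    exact ⟨rfl, by omega⟩)

end AddHom

/-- The dg category of formal finite sums of shifts of objects of `A`. -/
def add (A : DGCat.{u, v, w} k) : DGCat.{u, max 1 v, w} k where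
  Obj := AddObj A
  Hom := AddHom A
  d h := AddHom.d h
  comp h := AddHom.comp h
  one X := AddHom.one X
  d_d h h' f := by
    funext i j
    simp [AddHom.d_apply, A.d_d]
  assoc h₁ h₂ h₃ h₄ e g f := by
    funext i l
    simp only [AddHom.comp_apply, map_sum, LinearMap.sum_apply]
    rw [Finset.sum_comm]
    exact Finset.sum_congr rfl fun _ _ => Finset.sum_congr rfl fun _ _ => A.assoc _ _ _ _ _ _ _
  one_comp {X Y p} f := by
    funext i l
    rw [AddHom.comp_apply, Finset.sum_eq_single l, AddHom.one, AddHom.mat_pos _ _ rfl]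
    · exact A.eqHom_comp _ _ _
    · intro j _ hj
      rw [AddHom.one, AddHom.mat_neg _ _ hj, map_zero, LinearMap.zero_apply]
    · intro hj
      exact absurd (Finset.mem_univ _) hj
  comp_one {X Y p} f := by
    funext i l
    rw [AddHom.comp_apply, Finset.sum_eq_single i, AddHom.one, AddHom.mat_pos _ _ rfl]
    · exact A.comp_eqHom _ _ _
    · intro j _ hj
      rw [AddHom.one, AddHom.mat_neg _ _ hj.symm, map_zero]
    · intro hj
      exact absurd (Finset.mem_univ _) hj
  leibniz {X Y Z p q r p' q' r'} h hp hq hr g f := by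
    funext i l
    rw [AddHom.d_apply, AddHom.comp_apply, map_sum, Finset.smul_sum]
    simp only [Pi.add_apply, Pi.smul_apply, AddHom.comp_apply, AddHom.d_apply, Finset.smul_sum,
      ← Finset.sum_add_distrib]
    refine Finset.sum_congr rfl fun j _ => ?_
    rw [A.leibniz _ (show p + Y.deg j - X.deg i + 1 = p' + Y.deg j - X.deg i by omega)
      (show q + Z.deg l - Y.deg j + 1 = q' + Z.deg l - Y.deg j by omega), smul_add, map_smul,
      map_smul, LinearMap.smul_apply, smul_smul, smul_smul]
    congr 2
    rw [sub_eq_add_neg, dgSign_add, dgSign_add, dgSign_neg]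
    linear_combination (dgSign k q * dgSign k (Y.deg j)) * dgSign_mul_self k (Z.deg l)

end DGCat

/-! ### Dg categories with shifts and finite sums, and Maurer-Cartan objects -/

/-- The structure of a dg category with shifts and finite direct sums. -/
class DGSum {k : Type u} [CommRing k] (P : DGCat.{u, v, w} k) where
  /-- the zero object -/
  zero : P.Obj
  one_zero : P.one zero = 0
  /-- the iterated suspension of an object -/
  susp : ℤ → P.Obj → P.Obj
  /-- the closed isomorphism of degree `n` -/
  ξ : ∀ (n : ℤ) (x : P.Obj), P.Hom (susp n x) x n
  /-- the inverse of `ξ` -/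
  ξinv : ∀ (n : ℤ) (x : P.Obj), P.Hom x (susp n x) (-n)
  d_ξ : ∀ (n : ℤ) (x : P.Obj), P.d rfl (ξ n x) = 0
  d_ξinv : ∀ (n : ℤ) (x : P.Obj), P.d rfl (ξinv n x) = 0
  ξ_ξinv : ∀ (n : ℤ) (x : P.Obj), P.comp (add_neg_cancel n) (ξ n x) (ξinv n x) = P.one x
  ξinv_ξ : ∀ (n : ℤ) (x : P.Obj), P.comp (neg_add_cancel n) (ξinv n x) (ξ n x) = P.one (susp n x)
  /-- the direct sum of two objects -/
  sum : P.Obj → P.Obj → P.Obj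
  /-- the first inclusion -/
  inl : ∀ x y : P.Obj, P.Hom x (sum x y) 0
  /-- the second inclusion -/
  inr : ∀ x y : P.Obj, P.Hom y (sum x y) 0
  /-- the first projection -/
  fst : ∀ x y : P.Obj, P.Hom (sum x y) x 0
  /-- the second projection -/
  snd : ∀ x y : P.Obj, P.Hom (sum x y) y 0
  fst_inl : ∀ x y : P.Obj, P.comp (zero_add 0) (fst x y) (inl x y) = P.one x
  snd_inr : ∀ x y : P.Obj, P.comp (zero_add 0) (snd x y) (inr x y) = P.one y
  snd_inl : ∀ x y : P.Obj, P.comp (zero_add 0) (snd x y) (inl x y) = 0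
  fst_inr : ∀ x y : P.Obj, P.comp (zero_add 0) (fst x y) (inr x y) = 0
  inl_fst_add_inr_snd : ∀ x y : P.Obj, P.comp (zero_add 0) (inl x y) (fst x y) +
    P.comp (zero_add 0) (inr x y) (snd x y) = P.one (sum x y)
  d_inl : ∀ x y : P.Obj, P.d (zero_add 1) (inl x y) = 0
  d_inr : ∀ x y : P.Obj, P.d (zero_add 1) (inr x y) = 0
  d_fst : ∀ x y : P.Obj, P.d (zero_add 1) (fst x y) = 0
  d_snd : ∀ x y : P.Obj, P.d (zero_add 1) (snd x y) = 0

namespace DGSum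

variable {k : Type u} [CommRing k] {P : DGCat.{u, v, w} k} [DGSum P]

theorem tot_ξ_ξinv (n : ℤ) (x : P.Obj) :
    P.tot (ξinv n x) ≫ P.tot (ξ n x) = 𝟙 _ := by
  rw [← P.tot_comp (add_neg_cancel n), DGSum.ξ_ξinv, P.tot_one]

theorem tot_ξ_ξinv_assoc (n : ℤ) (x : P.Obj) {Z : P.Tot} (h : ⟨x⟩ ⟶ Z) :
    P.tot (ξinv n x) ≫ P.tot (ξ n x) ≫ h = h := by
  rw [← Category.assoc, tot_ξ_ξinv, Category.id_comp]

theorem tot_ξinv_ξ (n : ℤ) (x : P.Obj) :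
    P.tot (ξ n x) ≫ P.tot (ξinv n x) = 𝟙 _ := by
  rw [← P.tot_comp (neg_add_cancel n), DGSum.ξinv_ξ, P.tot_one]

theorem tot_ξinv_ξ_assoc (n : ℤ) (x : P.Obj) {Z : P.Tot} (h : ⟨susp n x⟩ ⟶ Z) :
    P.tot (ξ n x) ≫ P.tot (ξinv n x) ≫ h = h := by
  rw [← Category.assoc, tot_ξinv_ξ, Category.id_comp]

theorem tot_fst_inl (x y : P.Obj) :
    P.tot (inl x y) ≫ P.tot (fst x y) = 𝟙 _ := by
  rw [← P.tot_comp (zero_add 0), DGSum.fst_inl, P.tot_one]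

theorem tot_fst_inl_assoc (x y : P.Obj) {Z : P.Tot} (h : ⟨x⟩ ⟶ Z) :
    P.tot (inl x y) ≫ P.tot (fst x y) ≫ h = h := by
  rw [← Category.assoc, tot_fst_inl, Category.id_comp]

theorem tot_snd_inr (x y : P.Obj) :
    P.tot (inr x y) ≫ P.tot (snd x y) = 𝟙 _ := by
  rw [← P.tot_comp (zero_add 0), DGSum.snd_inr, P.tot_one]

theorem tot_snd_inr_assoc (x y : P.Obj) {Z : P.Tot} (h : ⟨y⟩ ⟶ Z) :
    P.tot (inr x y) ≫ P.tot (snd x y) ≫ h = h := by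
  rw [← Category.assoc, tot_snd_inr, Category.id_comp]

theorem tot_snd_inl (x y : P.Obj) :
    P.tot (inl x y) ≫ P.tot (snd x y) = 0 := by
  rw [← P.tot_comp (zero_add 0), DGSum.snd_inl, map_zero]

theorem tot_snd_inl_assoc (x y : P.Obj) {Z : P.Tot} (h : ⟨y⟩ ⟶ Z) :
    P.tot (inl x y) ≫ P.tot (snd x y) ≫ h = 0 := by
  rw [← Category.assoc, tot_snd_inl, Limits.zero_comp]

theorem tot_fst_inr (x y : P.Obj) :
    P.tot (inr x y) ≫ P.tot (fst x y) = 0 := by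
  rw [← P.tot_comp (zero_add 0), DGSum.fst_inr, map_zero]

theorem tot_fst_inr_assoc (x y : P.Obj) {Z : P.Tot} (h : ⟨x⟩ ⟶ Z) :
    P.tot (inr x y) ≫ P.tot (fst x y) ≫ h = 0 := by
  rw [← Category.assoc, tot_fst_inr, Limits.zero_comp]

theorem tot_total (x y : P.Obj) : P.tot (fst x y) ≫ P.tot (inl x y) +
    P.tot (snd x y) ≫ P.tot (inr x y) = 𝟙 _ := by
  rw [← P.tot_comp (zero_add 0), ← P.tot_comp (zero_add 0), ← map_add, inl_fst_add_inr_snd,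
    P.tot_one]

theorem dtot_ξ (n : ℤ) (x : P.Obj) : P.dtot (ξ n x) = 0 := P.dtot_eq_zero rfl (d_ξ n x)

theorem dtot_ξinv (n : ℤ) (x : P.Obj) : P.dtot (ξinv n x) = 0 := P.dtot_eq_zero rfl (d_ξinv n x)

theorem dtot_inl (x y : P.Obj) : P.dtot (inl x y) = 0 := P.dtot_eq_zero _ (d_inl x y)

theorem dtot_inr (x y : P.Obj) : P.dtot (inr x y) = 0 := P.dtot_eq_zero _ (d_inr x y)

theorem dtot_fst (x y : P.Obj) : P.dtot (fst x y) = 0 := P.dtot_eq_zero _ (d_fst x y)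

theorem dtot_snd (x y : P.Obj) : P.dtot (snd x y) = 0 := P.dtot_eq_zero _ (d_snd x y)

end DGSum

namespace DGCat

variable {k : Type u} [CommRing k]

/-- An object of a dg category with a Maurer-Cartan endomorphism `q`: `q` has degree one and
`d q + q ∘ q = 0`. -/
structure MCObj (P : DGCat.{u, v, w} k) where
  /-- the underlying object -/
  obj : P.Obj
  /-- the Maurer-Cartan endomorphism -/
  q : P.Hom obj obj 1
  maurerCartan : P.d (q := 2) rfl q + P.comp (r := 2) rfl q q = 0

/-- The twisted differential `f ↦ d f + q ∘ f - (-1)^|f| f ∘ q`. -/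
def mcD (P : DGCat.{u, v, w} k) {X Y : MCObj P} {p p' : ℤ} (h : p + 1 = p') :
    P.Hom X.obj Y.obj p →ₗ[k] P.Hom X.obj Y.obj p' :=
  P.d h + P.comp ((add_comm 1 p).trans h) Y.q - dgSign k p • (P.comp h).flip X.q

theorem MCObj.dtot_q {P : DGCat.{u, v, w} k} (X : MCObj P) :
    P.dtot X.q = -(P.tot X.q ≫ P.tot X.q) := by
  have h := congrArg P.tot X.maurerCartan
  rw [map_add, P.tot_d, P.tot_comp, map_zero] at h
  exact eq_neg_of_add_eq_zero_left h

theorem tot_mcD (P : DGCat.{u, v, w} k) {X Y : MCObj P} {p p' : ℤ} (h : p + 1 = p')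
    (f : P.Hom X.obj Y.obj p) : P.tot (P.mcD h f) =
      P.dtot f + P.tot f ≫ P.tot Y.q - dgSign k p • (P.tot X.q ≫ P.tot f) := by
  simp [mcD, P.tot_d, P.tot_comp]

theorem dtot_mcD (P : DGCat.{u, v, w} k) {X Y : MCObj P} {p p' : ℤ} (h : p + 1 = p')
    (f : P.Hom X.obj Y.obj p) : P.dtot (P.mcD h f) =
      -(P.tot f ≫ P.tot Y.q ≫ P.tot Y.q) - P.dtot f ≫ P.tot Y.q -
        dgSign k p • (P.tot X.q ≫ P.dtot f) + P.tot X.q ≫ P.tot X.q ≫ P.tot f := by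
  simp [mcD, P.dtot_d, P.dtot_comp, MCObj.dtot_q, dgSign_one, smul_smul, dgSign_mul_self]
  abel

/-- The dg category of Maurer-Cartan objects. -/
def mc (P : DGCat.{u, v, w} k) : DGCat.{u, max v w, w} k where
  Obj := MCObj P
  Hom X Y p := P.Hom X.obj Y.obj p
  d h := P.mcD h
  comp h := P.comp h
  one X := P.one X.obj
  d_d h h' f := by
    apply P.tot_inj
    rw [P.tot_mcD, P.dtot_mcD, P.tot_mcD, ← h, dgSign_add, dgSign_one]
    simp [smul_sub, smul_smul, dgSign_mul_self]
    abel
  assoc := P.assoc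
  one_comp := P.one_comp
  comp_one := P.comp_one
  leibniz h hp hq hr g f := by
    apply P.tot_inj
    simp only [P.tot_mcD, P.tot_comp, P.dtot_comp, map_add, map_smul]
    rw [← h, dgSign_add]
    simp [smul_sub, smul_smul, mul_comm]
    abel

theorem mcD_closed (P : DGCat.{u, v, w} k) {X Y : MCObj P} (f : P.Hom X.obj Y.obj 0)
    (hf : P.mcD (X := X) (Y := Y) (zero_add 1) f = 0) :
    P.dtot f + P.tot f ≫ P.tot Y.q - P.tot X.q ≫ P.tot f = 0 := by
  have h := (P.tot_mcD (zero_add 1) f).symm.trans ((congrArg P.tot hf).trans (map_zero _))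
  rwa [dgSign_zero, one_smul] at h

section exact

variable (P : DGCat.{u, v, w} k) [DGSum P]

open DGSum

/-- The Maurer-Cartan endomorphism of a suspension. -/
def mcSuspQ (n : ℤ) (X : MCObj P) : P.Hom (susp n X.obj) (susp n X.obj) 1 :=
  dgSign k n • P.comp (q := -n) (p := 1 + n) (by omega) (ξinv n X.obj)
    (P.comp rfl X.q (ξ n X.obj))

theorem tot_mcSuspQ (n : ℤ) (X : MCObj P) : P.tot (P.mcSuspQ n X) =
    dgSign k n • (P.tot (ξ n X.obj) ≫ P.tot X.q ≫ P.tot (ξinv n X.obj)) := by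
  simp [mcSuspQ, P.tot_comp]

theorem dtot_mcSuspQ (n : ℤ) (X : MCObj P) :
    P.dtot (P.mcSuspQ n X) = -(P.tot (P.mcSuspQ n X) ≫ P.tot (P.mcSuspQ n X)) := by
  simp [mcSuspQ, P.tot_comp, P.dtot_comp, dtot_ξ, dtot_ξinv, MCObj.dtot_q, smul_smul,
    dgSign_neg, dgSign_mul_self, tot_ξ_ξinv_assoc]

/-- The suspension of a Maurer-Cartan object. -/
def mcSusp (n : ℤ) (X : MCObj P) : MCObj P where
  obj := susp n X.obj
  q := P.mcSuspQ n X
  maurerCartan := by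
    apply P.tot_inj
    rw [map_add, P.tot_d, P.tot_comp, dtot_mcSuspQ, map_zero, neg_add_cancel]

/-- The Maurer-Cartan endomorphism of a cone. -/
def mcConeQ {X Y : MCObj P} (f : P.Hom X.obj Y.obj 0) :
    P.Hom (sum Y.obj (susp 1 X.obj)) (sum Y.obj (susp 1 X.obj)) 1 :=
  P.comp (zero_add 1) (inl _ _) (P.comp (add_zero 1) Y.q (fst _ _)) +
    P.comp (zero_add 1) (inr _ _) (P.comp (add_zero 1) (P.mcSuspQ 1 X) (snd _ _)) +
    P.comp (zero_add 1) (inl _ _) (P.comp (zero_add 1) f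
      (P.comp (add_zero 1) (ξ 1 X.obj) (snd _ _)))

theorem tot_mcConeQ {X Y : MCObj P} (f : P.Hom X.obj Y.obj 0) :
    P.tot (P.mcConeQ f) = P.tot (fst _ _) ≫ P.tot Y.q ≫ P.tot (inl _ _) +
      P.tot (snd _ _) ≫ P.tot (P.mcSuspQ 1 X) ≫ P.tot (inr _ _) +
      P.tot (snd _ _) ≫ P.tot (ξ 1 X.obj) ≫ P.tot f ≫ P.tot (inl _ _) := by
  simp [mcConeQ, P.tot_comp]

/-- The cone of a closed morphism of degree zero between Maurer-Cartan objects. -/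
def mcCone {X Y : MCObj P} (f : P.Hom X.obj Y.obj 0)
    (hf : P.dtot f + P.tot f ≫ P.tot Y.q - P.tot X.q ≫ P.tot f = 0) : MCObj P where
  obj := sum Y.obj (susp 1 X.obj)
  q := P.mcConeQ f
  maurerCartan := by
    have hf' : P.dtot f = P.tot X.q ≫ P.tot f - P.tot f ≫ P.tot Y.q := by
      rw [← sub_eq_zero, ← hf]
      abel
    apply P.tot_inj
    rw [map_add, P.tot_d, P.tot_comp, tot_mcConeQ, mcConeQ]
    simp [P.tot_comp, P.dtot_comp, MCObj.dtot_q, dtot_inl, dtot_inr, dtot_fst,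
      dtot_snd, dtot_ξ, hf', dtot_mcSuspQ, tot_mcSuspQ, dgSign_zero, dgSign_one,
      tot_ξ_ξinv_assoc, tot_fst_inl_assoc, tot_fst_inr_assoc, tot_snd_inl_assoc,
      tot_snd_inr_assoc]
    abel

theorem mcD_ξ (n : ℤ) (X : MCObj P) :
    P.mcD (X := P.mcSusp n X) (Y := X) rfl (ξ n X.obj) = 0 := by
  apply P.tot_inj
  refine (P.tot_mcD (X := P.mcSusp n X) (Y := X) rfl (ξ n X.obj)).trans ?_
  change P.dtot (ξ n X.obj) + P.tot (ξ n X.obj) ≫ P.tot X.q -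
    dgSign k n • (P.tot (P.mcSuspQ n X) ≫ P.tot (ξ n X.obj)) = P.tot 0
  rw [dtot_ξ, tot_mcSuspQ]
  simp [smul_smul, dgSign_mul_self, tot_ξ_ξinv]

section

variable {X Y : MCObj P} (f : P.Hom X.obj Y.obj 0)
    (hf : P.dtot f + P.tot f ≫ P.tot Y.q - P.tot X.q ≫ P.tot f = 0)

theorem mcD_inl : P.mcD (X := Y) (Y := P.mcCone f hf) (zero_add 1)
    (inl Y.obj (susp 1 X.obj)) = 0 := by
  apply P.tot_inj
  refine (P.tot_mcD (X := Y) (Y := P.mcCone f hf) _ _).trans ?_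
  change P.dtot (inl Y.obj (susp 1 X.obj)) + P.tot (inl Y.obj (susp 1 X.obj)) ≫
    P.tot (P.mcConeQ f) - dgSign k 0 • (P.tot Y.q ≫ P.tot (inl Y.obj (susp 1 X.obj))) = P.tot 0
  rw [dtot_inl, tot_mcConeQ]
  simp [dgSign_zero, tot_fst_inl_assoc, tot_snd_inl_assoc]

theorem mcD_snd : P.mcD (X := P.mcCone f hf) (Y := P.mcSusp 1 X) (zero_add 1)
    (snd Y.obj (susp 1 X.obj)) = 0 := by
  apply P.tot_inj
  refine (P.tot_mcD (X := P.mcCone f hf) (Y := P.mcSusp 1 X) _ _).trans ?_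
  change P.dtot (snd Y.obj (susp 1 X.obj)) + P.tot (snd Y.obj (susp 1 X.obj)) ≫
    P.tot (P.mcSuspQ 1 X) - dgSign k 0 • (P.tot (P.mcConeQ f) ≫
      P.tot (snd Y.obj (susp 1 X.obj))) = P.tot 0
  rw [dtot_snd, tot_mcConeQ]
  simp [dgSign_zero, tot_snd_inl, tot_snd_inr]

theorem mcD_inr : P.mcD (X := P.mcSusp 1 X) (Y := P.mcCone f hf) (zero_add 1)
    (inr Y.obj (susp 1 X.obj)) = P.comp (zero_add 1) (inl Y.obj (susp 1 X.obj))
      (P.comp (zero_add 1) f (ξ 1 X.obj)) := by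
  apply P.tot_inj
  refine (P.tot_mcD (X := P.mcSusp 1 X) (Y := P.mcCone f hf) _ _).trans ?_
  change P.dtot (inr Y.obj (susp 1 X.obj)) + P.tot (inr Y.obj (susp 1 X.obj)) ≫
    P.tot (P.mcConeQ f) - dgSign k 0 • (P.tot (P.mcSuspQ 1 X) ≫
      P.tot (inr Y.obj (susp 1 X.obj))) =
    P.tot (P.comp (zero_add 1) (inl Y.obj (susp 1 X.obj)) (P.comp (zero_add 1) f (ξ 1 X.obj)))
  rw [dtot_inr, tot_mcConeQ]
  simp [dgSign_zero, P.tot_comp, tot_fst_inr_assoc, tot_snd_inr_assoc]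

end

instance : DGExact P.mc where
  zero := ⟨zero, 0, by simp⟩
  one_zero := one_zero (P := P)
  susp := P.mcSusp
  ξ n X := ξ n X.obj
  ξinv n X := ξinv n X.obj
  d_ξ n X := P.mcD_ξ n X
  ξ_ξinv n X := ξ_ξinv n X.obj
  ξinv_ξ n X := ξinv_ξ n X.obj
  cone f hf := P.mcCone f (P.mcD_closed f hf)
  j {X Y} f hf := inl Y.obj (susp 1 X.obj)
  t {X Y} f hf := fst Y.obj (susp 1 X.obj)
  p {X Y} f hf := snd Y.obj (susp 1 X.obj)
  s {X Y} f hf := inr Y.obj (susp 1 X.obj)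
  t_j f hf := fst_inl _ _
  p_s f hf := snd_inr _ _
  p_j f hf := snd_inl _ _
  t_s f hf := fst_inr _ _
  j_t_add_s_p f hf := inl_fst_add_inr_snd _ _
  d_j f hf := P.mcD_inl f (P.mcD_closed f hf)
  d_p f hf := P.mcD_snd f (P.mcD_closed f hf)
  d_s f hf := P.mcD_inr f (P.mcD_closed f hf)

end exact

end DGCat

/-! ### One-sided twisted complexes -/

namespace DGCat

variable {k : Type u} [CommRing k]

section sums

variable {A : DGCat.{u, v, w} k}

theorem AddHom.comp_eq_zero {X Y Z : AddObj A} {p q r : ℤ} (h : q + p = r) (g : AddHom A Y Z q)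
    (f : AddHom A X Y p) (i : X.ι) (l : Z.ι) (H : ∀ j, f i j = 0 ∨ g j l = 0) :
    AddHom.comp h g f i l = 0 := by
  rw [AddHom.comp_apply]
  refine Finset.sum_eq_zero fun j _ => ?_
  obtain h | h := H j
  · rw [h, map_zero]
  · rw [h, map_zero, LinearMap.zero_apply]

/-- The empty formal sum. -/
def AddObj.empty (A : DGCat.{u, v, w} k) : AddObj A := ⟨Empty, Empty.elim, Empty.elim⟩

/-- The shift of a formal sum. -/
def AddObj.shift (n : ℤ) (X : AddObj A) : AddObj A := ⟨X.ι, X.obj, fun i => X.deg i + n⟩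

/-- The direct sum of two formal sums. -/
def AddObj.sum (X Y : AddObj A) : AddObj A :=
  ⟨X.ι ⊕ Y.ι, Sum.elim X.obj Y.obj, Sum.elim X.deg Y.deg⟩

namespace AddHom

theorem one_self (X : AddObj A) (i : X.ι) : one X i i = A.eqHom rfl (by omega) :=
  mat_pos _ _ rfl

theorem one_of_ne (X : AddObj A) {i j : X.ι} (h : ¬ i = j) : one X i j = 0 := mat_neg _ _ h

/-- The tautological morphism of degree `n` from the `n`-th shift. -/
def ξ (n : ℤ) (X : AddObj A) : AddHom A (X.shift n) X n :=
  mat (Y := X) (fun i j => i = j) (by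
    rintro i _ rfl
    exact ⟨rfl, by simp [AddObj.shift, add_comm]⟩)

/-- The inverse of `ξ`. -/
def ξinv (n : ℤ) (X : AddObj A) : AddHom A X (X.shift n) (-n) :=
  mat (X := X) (fun i j => i = j) (by
    rintro i _ rfl
    exact ⟨rfl, by simp [AddObj.shift]⟩)

/-- The first inclusion. -/
def inl (X Y : AddObj A) : AddHom A X (X.sum Y) 0 :=
  mat (fun i s => s = Sum.inl i) (by
    rintro i _ rfl
    exact ⟨rfl, by simp [AddObj.sum]⟩)

/-- The second inclusion. -/
def inr (X Y : AddObj A) : AddHom A Y (X.sum Y) 0 :=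
  mat (fun i s => s = Sum.inr i) (by
    rintro i _ rfl
    exact ⟨rfl, by simp [AddObj.sum]⟩)

/-- The first projection. -/
def fst (X Y : AddObj A) : AddHom A (X.sum Y) X 0 :=
  mat (fun s i => s = Sum.inl i) (by
    rintro _ i rfl
    exact ⟨rfl, by simp [AddObj.sum]⟩)

/-- The second projection. -/
def snd (X Y : AddObj A) : AddHom A (X.sum Y) Y 0 :=
  mat (fun s i => s = Sum.inr i) (by
    rintro _ i rfl
    exact ⟨rfl, by simp [AddObj.sum]⟩)

theorem mat_eq_zero {X Y : AddObj A} {p : ℤ} (r : X.ι → Y.ι → Prop)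
    (h : ∀ i j, r i j → X.obj i = Y.obj j ∧ 0 = p + Y.deg j - X.deg i) (hr : ∀ i j, ¬ r i j) :
    mat r h = 0 := by
  funext i j
  exact mat_neg r h (hr i j)

theorem ξ_ξinv (n : ℤ) (X : AddObj A) : comp (add_neg_cancel n) (ξ n X) (ξinv n X) = one X := by
  refine mat_comp_mat (X := X) (Y := X.shift n) (Z := X) (fun i j => i = j) (fun i j => i = j)
    (fun i j => i = j) _ _ _ _ ?_ ?_ ?_
  · rintro i _ rfl
    exact ⟨i, rfl, rfl⟩
  · rintro i _ _ rfl rfl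
    rfl
  · rintro i _ _ _ rfl rfl rfl _
    rfl

theorem ξinv_ξ (n : ℤ) (X : AddObj A) :
    comp (neg_add_cancel n) (ξinv n X) (ξ n X) = one (X.shift n) := by
  refine mat_comp_mat (X := X.shift n) (Y := X) (Z := X.shift n) (fun i j => i = j)
    (fun i j => i = j) (fun i j => i = j) _ _ _ _ ?_ ?_ ?_
  · rintro i _ rfl
    exact ⟨i, rfl, rfl⟩
  · rintro i _ _ rfl rfl
    rfl
  · rintro i _ _ _ rfl rfl rfl _
    rfl

theorem fst_inl (X Y : AddObj A) : comp (zero_add 0) (fst X Y) (inl X Y) = one X := by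
  refine mat_comp_mat (X := X) (Y := X.sum Y) (Z := X) (fun i s => s = Sum.inl i)
    (fun s i => s = Sum.inl i) (fun i j => i = j) _ _ _ _ ?_ ?_ ?_
  · rintro i _ rfl
    exact ⟨Sum.inl i, rfl, rfl⟩
  · rintro i _ l rfl h
    exact Sum.inl.inj h
  · rintro i _ _ l rfl _ rfl _
    rfl

theorem snd_inr (X Y : AddObj A) : comp (zero_add 0) (snd X Y) (inr X Y) = one Y := by
  refine mat_comp_mat (X := Y) (Y := X.sum Y) (Z := Y) (fun i s => s = Sum.inr i)
    (fun s i => s = Sum.inr i) (fun i j => i = j) _ _ _ _ ?_ ?_ ?_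
  · rintro i _ rfl
    exact ⟨Sum.inr i, rfl, rfl⟩
  · rintro i _ l rfl h
    exact Sum.inr.inj h
  · rintro i _ _ l rfl _ rfl _
    rfl

theorem snd_inl (X Y : AddObj A) : comp (zero_add 0) (snd X Y) (inl X Y) = 0 := by
  refine (mat_comp_mat (X := X) (Y := X.sum Y) (Z := Y) (fun i s => s = Sum.inl i)
    (fun s i => s = Sum.inr i) (fun _ _ => False) _ _ (fun _ _ h => h.elim) _
      (fun _ _ h => h.elim) ?_ ?_).trans (mat_eq_zero _ _ fun _ _ h => h)
  · rintro i _ l rfl h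
    cases h
  · rintro i _ _ l rfl _ rfl _
    rfl

theorem fst_inr (X Y : AddObj A) : comp (zero_add 0) (fst X Y) (inr X Y) = 0 := by
  refine (mat_comp_mat (X := Y) (Y := X.sum Y) (Z := X) (fun i s => s = Sum.inr i)
    (fun s i => s = Sum.inl i) (fun _ _ => False) _ _ (fun _ _ h => h.elim) _
      (fun _ _ h => h.elim) ?_ ?_).trans (mat_eq_zero _ _ fun _ _ h => h)
  · rintro i _ l rfl h
    cases h
  · rintro i _ _ l rfl _ rfl _
    rfl

theorem total (X Y : AddObj A) : comp (zero_add 0) (inl X Y) (fst X Y) +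
    comp (zero_add 0) (inr X Y) (snd X Y) = one (X.sum Y) := by
  have h : ∀ i j : (X.sum Y).ι, i = j → (X.sum Y).obj i = (X.sum Y).obj j ∧
      0 = 0 + (X.sum Y).deg j - (X.sum Y).deg i := by
    rintro i _ rfl
    exact ⟨rfl, by omega⟩
  have h1 : comp (zero_add 0) (inl X Y) (fst X Y) =
      mat (fun i j : (X.sum Y).ι => i = j ∧ ∃ a, i = Sum.inl a) (fun i j e => h i j e.1) := by
    refine mat_comp_mat (X := X.sum Y) (Y := X) (Z := X.sum Y) (fun s i => s = Sum.inl i)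
      (fun i s => s = Sum.inl i) _ _ _ _ _ ?_ ?_ ?_
    · rintro i _ ⟨rfl, a, rfl⟩
      exact ⟨a, rfl, rfl⟩
    · rintro i a l rfl rfl
      exact ⟨rfl, a, rfl⟩
    · rintro i a a' l rfl rfl ha ha'
      exact Sum.inl.inj ha'.symm
  have h2 : comp (zero_add 0) (inr X Y) (snd X Y) =
      mat (fun i j : (X.sum Y).ι => i = j ∧ ∃ a, i = Sum.inr a) (fun i j e => h i j e.1) := by
    refine mat_comp_mat (X := X.sum Y) (Y := Y) (Z := X.sum Y) (fun s i => s = Sum.inr i)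
      (fun i s => s = Sum.inr i) _ _ _ _ _ ?_ ?_ ?_
    · rintro i _ ⟨rfl, a, rfl⟩
      exact ⟨a, rfl, rfl⟩
    · rintro i a l rfl rfl
      exact ⟨rfl, a, rfl⟩
    · rintro i a a' l rfl rfl ha ha'
      exact Sum.inr.inj ha'.symm
  rw [h1, h2]
  refine mat_add_mat _ _ _ _ _ _ (fun i j => ⟨fun e => ?_, fun e => e.elim And.left And.left⟩) ?_
  · obtain a | a := i
    · exact Or.inl ⟨e, a, rfl⟩
    · exact Or.inr ⟨e, a, rfl⟩
  · rintro i j ⟨_, a, rfl⟩ ⟨_, b, hb⟩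
    exact Sum.inl_ne_inr hb

end AddHom

instance : DGSum A.add where
  zero := AddObj.empty A
  one_zero := by
    funext i
    exact i.elim
  susp := AddObj.shift
  ξ := AddHom.ξ
  ξinv := AddHom.ξinv
  d_ξ n X := AddHom.d_mat _ _ rfl
  d_ξinv n X := AddHom.d_mat _ _ rfl
  ξ_ξinv := AddHom.ξ_ξinv
  ξinv_ξ := AddHom.ξinv_ξ
  sum := AddObj.sum
  inl := AddHom.inl
  inr := AddHom.inr
  fst := AddHom.fst
  snd := AddHom.snd
  fst_inl := AddHom.fst_inl
  snd_inr := AddHom.snd_inr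
  snd_inl := AddHom.snd_inl
  fst_inr := AddHom.fst_inr
  inl_fst_add_inr_snd := AddHom.total
  d_inl X Y := AddHom.d_mat _ _ (zero_add 1)
  d_inr X Y := AddHom.d_mat _ _ (zero_add 1)
  d_fst X Y := AddHom.d_mat _ _ (zero_add 1)
  d_snd X Y := AddHom.d_mat _ _ (zero_add 1)

end sums

/-- A full dg subcategory which contains the zero object and is stable under suspensions and
cones is exact. -/
abbrev exactFull (P : DGCat.{u, v, w} k) [DGExact P] (S : Set P.Obj) (h0 : DGExact.zero ∈ S)
    (hs : ∀ n x, x ∈ S → DGExact.susp n x ∈ S)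
    (hc : ∀ (x y : P.Obj) (f : P.Hom x y 0) (hf : P.d (zero_add 1) f = 0), x ∈ S → y ∈ S →
      DGExact.cone f hf ∈ S) : DGExact (P.full S) where
  zero := ⟨DGExact.zero, h0⟩
  one_zero := DGExact.one_zero (P := P)
  susp n x := ⟨DGExact.susp n x.1, hs n x.1 x.2⟩
  ξ n x := DGExact.ξ n x.1
  ξinv n x := DGExact.ξinv n x.1
  d_ξ n x := DGExact.d_ξ n x.1
  ξ_ξinv n x := DGExact.ξ_ξinv n x.1
  ξinv_ξ n x := DGExact.ξinv_ξ n x.1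
  cone {x y} f hf := ⟨DGExact.cone (P := P) (x := x.1) (y := y.1) f hf, hc _ _ _ _ x.2 y.2⟩
  j {x y} f hf := DGExact.j (P := P) (x := x.1) (y := y.1) f hf
  t {x y} f hf := DGExact.t (P := P) (x := x.1) (y := y.1) f hf
  p {x y} f hf := DGExact.p (P := P) (x := x.1) (y := y.1) f hf
  s {x y} f hf := DGExact.s (P := P) (x := x.1) (y := y.1) f hf
  t_j {x y} f hf := DGExact.t_j (P := P) (x := x.1) (y := y.1) f hf
  p_s {x y} f hf := DGExact.p_s (P := P) (x := x.1) (y := y.1) f hf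
  p_j {x y} f hf := DGExact.p_j (P := P) (x := x.1) (y := y.1) f hf
  t_s {x y} f hf := DGExact.t_s (P := P) (x := x.1) (y := y.1) f hf
  j_t_add_s_p {x y} f hf := DGExact.j_t_add_s_p (P := P) (x := x.1) (y := y.1) f hf
  d_j {x y} f hf := DGExact.d_j (P := P) (x := x.1) (y := y.1) f hf
  d_p {x y} f hf := DGExact.d_p (P := P) (x := x.1) (y := y.1) f hf
  d_s {x y} f hf := DGExact.d_s (P := P) (x := x.1) (y := y.1) f hf

/-- A twisted complex is one-sided if its indices can be ordered in such a way that the matrix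
`q` is strictly triangular. -/
def IsOneSided {A : DGCat.{u, v, w} k} (X : MCObj A.add) : Prop :=
  ∃ rk : AddObj.ι X.obj → ℕ, ∀ i j, rk i ≤ rk j → X.q i j = 0

theorem isOneSided_susp {A : DGCat.{u, v, w} k} (n : ℤ) (X : MCObj A.add) (hX : IsOneSided X) :
    IsOneSided (A.add.mcSusp n X) := by
  obtain ⟨rk, hrk⟩ := hX
  refine ⟨rk, fun i j hij => ?_⟩
  refine (congrArg (dgSign k n • ·) (AddHom.comp_eq_zero (by omega) _ _ i j fun b => ?_)).trans
    (smul_zero _)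
  have z1 : ∀ a b : AddObj.ι X.obj, ¬ a = b → AddHom.ξ n X.obj a b = 0 := fun a b h =>
    AddHom.mat_neg _ _ h
  have z2 : ∀ a b : AddObj.ι X.obj, ¬ a = b → AddHom.ξinv n X.obj a b = 0 := fun a b h =>
    AddHom.mat_neg _ _ h
  by_cases hb : b = j
  · subst hb
    refine Or.inl (AddHom.comp_eq_zero rfl _ _ i b fun a => ?_)
    by_cases ha : i = a
    · subst ha
      exact Or.inr (hrk _ _ hij)
    · exact Or.inl (z1 i a ha)
  · exact Or.inr (z2 b j hb)

theorem add_eq_zero_of {M : Type w} [AddCommGroup M] {a b : M} (ha : a = 0) (hb : b = 0) :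
    a + b = 0 := by
  rw [ha, hb, add_zero]

theorem isOneSided_cone {A : DGCat.{u, v, w} k} {X Y : MCObj A.add}
    (f : A.add.Hom X.obj Y.obj 0) (hf : A.add.dtot f + A.add.tot f ≫ A.add.tot Y.q -
      A.add.tot X.q ≫ A.add.tot f = 0) (hX : IsOneSided X) (hY : IsOneSided Y) :
    IsOneSided (A.add.mcCone f hf) := by
  obtain ⟨rX, hrX⟩ := isOneSided_susp 1 X hX
  obtain ⟨rY, hrY⟩ := hY
  let _ : Fintype (AddObj.ι Y.obj) := AddObj.fintype Y.obj
  refine ⟨Sum.elim rY (fun i => rX i + 1 + Finset.univ.sup rY), ?_⟩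
  have z1 : ∀ (a : AddObj.ι Y.obj) (i : AddObj.ι X.obj),
      AddHom.snd Y.obj (AddObj.shift 1 X.obj) (Sum.inl a) i = 0 := fun a i =>
    AddHom.mat_neg _ _ (fun h => by cases h)
  have z2 : ∀ (a : AddObj.ι Y.obj) (i : AddObj.ι X.obj),
      AddHom.fst Y.obj (AddObj.shift 1 X.obj) (Sum.inr i) a = 0 := fun a i =>
    AddHom.mat_neg _ _ (fun h => by cases h)
  have z3 : ∀ (a : AddObj.ι Y.obj) (i : AddObj.ι X.obj),
      AddHom.inl Y.obj (AddObj.shift 1 X.obj) a (Sum.inr i) = 0 := fun a i =>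
    AddHom.mat_neg _ _ (fun h => by cases h)
  have hq : ∀ s s', (A.add.mcCone f hf).q s s' =
      AddHom.comp (zero_add 1) (AddHom.inl Y.obj (AddObj.shift 1 X.obj))
        (AddHom.comp (add_zero 1) Y.q (AddHom.fst Y.obj (AddObj.shift 1 X.obj))) s s' +
      AddHom.comp (zero_add 1) (AddHom.inr Y.obj (AddObj.shift 1 X.obj))
        (AddHom.comp (add_zero 1) (A.add.mcSuspQ 1 X)
          (AddHom.snd Y.obj (AddObj.shift 1 X.obj))) s s' +
      AddHom.comp (zero_add 1) (AddHom.inl Y.obj (AddObj.shift 1 X.obj))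
        (AddHom.comp (zero_add 1) f (AddHom.comp (add_zero 1) (AddHom.ξ 1 X.obj)
          (AddHom.snd Y.obj (AddObj.shift 1 X.obj)))) s s' := fun _ _ => rfl
  rintro (a | a) (b | b) h
  · refine (hq _ _).trans (add_eq_zero_of (add_eq_zero_of
      (AddHom.comp_eq_zero (zero_add 1) _ _ _ _ ?_) (AddHom.comp_eq_zero (zero_add 1) _ _ _ _ ?_))
      (AddHom.comp_eq_zero (zero_add 1) _ _ _ _ ?_))
    · intro c
      by_cases hc : (Sum.inl b : AddObj.ι Y.obj ⊕ AddObj.ι X.obj) = Sum.inl c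
      · refine Or.inl (AddHom.comp_eq_zero (add_zero 1) _ _ _ _ fun e => ?_)
        by_cases he : (Sum.inl a : AddObj.ι Y.obj ⊕ AddObj.ι X.obj) = Sum.inl e
        · obtain rfl := Sum.inl.inj hc
          obtain rfl := Sum.inl.inj he
          exact Or.inr (hrY _ _ h)
        · exact Or.inl (AddHom.mat_neg _ _ he)
      · exact Or.inr (AddHom.mat_neg _ _ hc)
    · exact fun _ => Or.inl (AddHom.comp_eq_zero (add_zero 1) _ _ _ _ fun _ => Or.inl (z1 _ _))
    · exact fun _ => Or.inl (AddHom.comp_eq_zero (zero_add 1) _ _ _ _ fun _ => Or.inl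
        (AddHom.comp_eq_zero (add_zero 1) _ _ _ _ fun _ => Or.inl (z1 _ _)))
  · refine (hq _ _).trans (add_eq_zero_of (add_eq_zero_of
      (AddHom.comp_eq_zero (zero_add 1) _ _ _ _ ?_) (AddHom.comp_eq_zero (zero_add 1) _ _ _ _ ?_))
      (AddHom.comp_eq_zero (zero_add 1) _ _ _ _ ?_))
    · exact fun _ => Or.inr (z3 _ _)
    · exact fun _ => Or.inl (AddHom.comp_eq_zero (add_zero 1) _ _ _ _ fun _ => Or.inl (z1 _ _))
    · exact fun _ => Or.inr (z3 _ _)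
  · have h1 : rX a + 1 + Finset.univ.sup rY ≤ rY b := h
    have h2 : rY b ≤ Finset.univ.sup rY := Finset.le_sup (Finset.mem_univ b)
    omega
  · have h' : rX a ≤ rX b := by
      have h1 : rX a + 1 + Finset.univ.sup rY ≤ rX b + 1 + Finset.univ.sup rY := h
      omega
    refine (hq _ _).trans (add_eq_zero_of (add_eq_zero_of
      (AddHom.comp_eq_zero (zero_add 1) _ _ _ _ ?_) (AddHom.comp_eq_zero (zero_add 1) _ _ _ _ ?_))
      (AddHom.comp_eq_zero (zero_add 1) _ _ _ _ ?_))
    · exact fun _ => Or.inr (z3 _ _)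
    · intro c
      by_cases hc : (Sum.inr b : AddObj.ι Y.obj ⊕ AddObj.ι X.obj) = Sum.inr c
      · refine Or.inl (AddHom.comp_eq_zero (add_zero 1) _ _ _ _ fun e => ?_)
        by_cases he : (Sum.inr a : AddObj.ι Y.obj ⊕ AddObj.ι X.obj) = Sum.inr e
        · obtain rfl := Sum.inr.inj hc
          obtain rfl := Sum.inr.inj he
          exact Or.inr (hrX _ _ h')
        · exact Or.inl (AddHom.mat_neg _ _ he)
      · exact Or.inr (AddHom.mat_neg _ _ hc)
    · exact fun _ => Or.inr (z3 _ _)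

/-- The pretriangulated hull of a dg category: the dg category of one-sided twisted complexes. -/
def pretr (A : DGCat.{u, v, w} k) : DGCat.{u, max 1 v w, w} k :=
  A.add.mc.full { X | IsOneSided X }

instance (A : DGCat.{u, v, w} k) : DGExact A.pretr :=
  A.add.mc.exactFull { X | IsOneSided X }
    ⟨fun _ => 0, fun _ _ _ => rfl⟩
    (fun n X hX => isOneSided_susp n X hX)
    (fun _ _ f hf hX hY => isOneSided_cone f (A.add.mcD_closed f hf) hX hY)

end DGCat

namespace DGFunctor

variable {k : Type u} [CommRing k] {A : DGCat.{u, v, w} k} {B : DGCat.{u, v', w'} k}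

theorem map_eqHom (F : DGFunctor A B) {x y : A.Obj} (e : x = y) {p : ℤ} (hp : 0 = p) :
    F.map (A.eqHom e hp) = B.eqHom (congrArg F.obj e) hp := by
  subst e hp
  exact F.map_one _

/-- The image of a formal sum of shifts. -/
def mapAddObj (F : DGFunctor A B) (X : DGCat.AddObj A) : DGCat.AddObj B :=
  ⟨X.ι, fun i => F.obj (X.obj i), X.deg⟩

/-- The image of a matrix. -/
def mapAddHom (F : DGFunctor A B) {X Y : DGCat.AddObj A} {p : ℤ} :
    DGCat.AddHom A X Y p →ₗ[k] DGCat.AddHom B (F.mapAddObj X) (F.mapAddObj Y) p where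
  toFun f i j := F.map (f i j)
  map_add' f g := by
    funext i j
    exact map_add _ _ _
  map_smul' c f := by
    funext i j
    exact map_smul _ _ _

theorem mapAddHom_one (F : DGFunctor A B) (X : DGCat.AddObj A) :
    F.mapAddHom (DGCat.AddHom.one X) = DGCat.AddHom.one (F.mapAddObj X) := by
  have h : ∀ i j : X.ι, F.map (DGCat.AddHom.one X i j) = DGCat.AddHom.one (F.mapAddObj X) i j := by
    intro i j
    by_cases h : i = j
    · subst h
      exact (congrArg F.map (DGCat.AddHom.one_self X i)).trans ((F.map_eqHom _ _).trans
        (DGCat.AddHom.one_self (F.mapAddObj X) i).symm)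
    · exact (congrArg F.map (DGCat.AddHom.one_of_ne X h)).trans ((map_zero _).trans
        (DGCat.AddHom.one_of_ne (F.mapAddObj X) h).symm)
  funext i j
  exact h i j

/-- The extension of a dg functor to formal sums of shifts. -/
def add (F : DGFunctor A B) : DGFunctor A.add B.add where
  obj := F.mapAddObj
  map := F.mapAddHom
  map_d h f := by
    funext i j
    exact (map_smul F.map _ _).trans (congrArg _ (F.map_d _ _))
  map_comp h g f := by
    funext i j
    refine (map_sum F.map _ _).trans ?_
    exact Finset.sum_congr rfl fun _ _ => F.map_comp _ _ _
  map_one := F.mapAddHom_one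

/-- The image of a Maurer-Cartan object. -/
def mapMC (F : DGFunctor A B) (X : DGCat.MCObj A) : DGCat.MCObj B :=
  ⟨F.obj X.obj, F.map X.q, by
    rw [← F.map_d, ← F.map_comp, ← map_add, X.maurerCartan, map_zero]⟩

theorem map_mcD (F : DGFunctor A B) {X Y : DGCat.MCObj A} {p q : ℤ} (h : p + 1 = q)
    (f : A.Hom X.obj Y.obj p) :
    F.map (A.mcD h f) = B.mcD (X := F.mapMC X) (Y := F.mapMC Y) h (F.map f) := by
  simp only [DGCat.mcD, LinearMap.sub_apply, LinearMap.add_apply,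
    LinearMap.smul_apply, LinearMap.flip_apply, map_sub, map_add, map_smul, F.map_d,
    F.map_comp]
  rfl

/-- The extension of a dg functor to Maurer-Cartan objects. -/
def mc (F : DGFunctor A B) : DGFunctor A.mc B.mc where
  obj := F.mapMC
  map := F.map
  map_d h f := F.map_mcD h f
  map_comp := F.map_comp
  map_one X := F.map_one X.obj

theorem isOneSided_map (F : DGFunctor A B) (X : DGCat.MCObj A.add) (hX : DGCat.IsOneSided X) :
    DGCat.IsOneSided (F.add.mapMC X) := by
  obtain ⟨rk, h⟩ := hX
  exact ⟨rk, fun i j hij => (congrArg F.map (h i j hij)).trans (map_zero _)⟩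

/-- The extension of a dg functor to pretriangulated hulls. -/
def pretr (F : DGFunctor A B) : DGFunctor A.pretr B.pretr where
  obj X := ⟨F.add.mapMC X.1, F.isOneSided_map X.1 X.2⟩
  map := F.mapAddHom
  map_d h f := F.add.mc.map_d h f
  map_comp h g f := F.add.mc.map_comp h g f
  map_one X := F.add.mc.map_one X.1

end DGFunctor

/-! ### The triangulated hull, Verdier quotients and the canonical functor -/

namespace DGCat

variable {k : Type u} [CommRing k] (A : DGCat.{u, v, w} k) (B : Set A.Obj)

/-- The triangulated hull of a dg category. -/
abbrev tr : Type (max 1 v w) := H0 A.pretr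

/-- The inclusion of a full dg subcategory. -/
def inclusion : DGFunctor (A.full B) A where
  obj := Subtype.val
  map := LinearMap.id
  map_d _ _ := rfl
  map_comp _ _ _ := rfl
  map_one _ := rfl

/-- The triangulated functor from the triangulated hull of a full dg subcategory to the
triangulated hull of the dg category. -/
abbrev inclusionTr : (A.full B).tr ⥤ A.tr := (A.inclusion B).pretr.H0map

/-- The triangulated functor from the triangulated hull of a dg category to the triangulated hull
of its dg quotient. -/
abbrev quotTr : A.tr ⥤ (A.quot B).tr := (A.quotFunctor B).pretr.H0map

instance : (A.inclusionTr B).Full :=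
  DGFunctor.H0map_full _ fun _ _ _ => ⟨fun _ _ h => h, fun f => ⟨f, rfl⟩⟩

/-- The triangulated hull of a full dg subcategory, as a strictly full subcategory of the
triangulated hull of the dg category. -/
def subTr : ObjectProperty A.tr := (A.inclusionTr B).essImage

instance : (A.subTr B).IsTriangulated :=
  inferInstanceAs (A.inclusionTr B).essImage.IsTriangulated

/-- The Verdier quotient: the localization at the morphisms whose cone belongs to the
subcategory. -/
abbrev VerdierQuotient : Type (max 1 v w) := (A.subTr B).trW.Localization

variable (h : (A.subTr B).trW.IsInvertedBy (A.quotTr B))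

/-- The functor from the Verdier quotient to the triangulated hull of the dg quotient which is
induced by `A.quotTr B`. -/
def comparison : A.VerdierQuotient B ⥤ (A.quot B).tr :=
  Localization.lift (A.quotTr B) h (A.subTr B).trW.Q

instance : Localization.Lifting (A.subTr B).trW.Q (A.subTr B).trW (A.quotTr B)
    (A.comparison B h) :=
  inferInstanceAs (Localization.Lifting (A.subTr B).trW.Q (A.subTr B).trW (A.quotTr B)
    (Localization.lift (A.quotTr B) h (A.subTr B).trW.Q))

/-- The commutation of the comparison functor with the shift, induced by that of `A.quotTr B`. -/
instance : (A.comparison B h).CommShift ℤ :=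
  Functor.commShiftOfLocalization (A.subTr B).trW.Q (A.subTr B).trW ℤ (A.quotTr B)
    (A.comparison B h)

end DGCat

end

/-!
The functor `Φ` is shown to be full and faithful by a calculus of fractions in the dg quotient, and
to be essentially surjective because the objects of the dg category generate both sides.

*Words.* The differential of a new endomorphism `ε` is an identity, but no relation is imposed on
composites with `ε`. Hence a morphism of the dg quotient is a unique combination of words
`f₀ ε f₁ ε ⋯ ε fₙ`, and the words with `n` new letters form an iterated tensor product, a right dg
module which is obtained from the one with `n - 1` new letters by `RMod.next`. This is used for
twisted complexes: there, the letters `ε` belong to the one-term complexes `U` with `U` in `B`, and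
`Pretr.evalAll_surjective` and `Pretr.evalAll_injective` say that the words describe the modules of
morphisms completely. Injectivity holds because the dg quotient, defined by generators and
relations, acts on the words. The differential removes letters, and modulo words with fewer letters
it is the differential of the iterated tensor product (`Words.δ_eval_sub_mem_low`). The signs become
manageable when the grading is forgotten: `THom` is the sum of the modules of morphisms of all
degrees, with the involution `τ f = (-1)^|f| f` and the differential `δ f = (-1)^|f| d f`.

*Torsion.* Let `f : X → U` be a cycle of degree `p`, with `U` in `B^tr`. The fibre `s : X' → X` of
the corresponding morphism `X → Σ^p U` has its cone in `B^tr`, and the composite of `s` and `f` is a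
boundary (`DGExact.isKilling_trWHom`). If `Hom(X, U)` is homotopically flat, then the same holds for
each cycle of `C ⊗ Hom(X, U)`, for any differential module `C` (`IsKilling.exists_of_hflat`).
Indeed, by adding elements freely whose boundaries are the cycles, over and over again, `C` is
embedded in an acyclic differential module, in which the cycle becomes a boundary by flatness, and
it does so after finitely many steps. Each step adds a free module with zero differential, so that
going back one step only requires to kill finitely many cycles of `Hom(X, U)`.

*Fractions.* Consider a morphism of the dg quotient between twisted complexes over `A` whose
differential comes from `A`. Its part with the largest number of letters is a cycle in a sum of
modules `C ⊗ Hom(X, U)`, where `C` consists of shorter words. It becomes a boundary after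
precomposition with a morphism whose cone is in `B^tr`, and then the number of letters can be
lowered. By induction, the morphism becomes homologous to one of `A` (`Words.exists_roof`).
For closed morphisms, this shows that each morphism of `(A/B)^tr` is a fraction
(`Pretr.exists_fraction`). For a morphism with differential `f`, it shows that `f` is annihilated by
a denominator (`Pretr.exists_comp_eq_zero`). So `Φ` is full and faithful.

*Generation.* A one-sided twisted complex is an iterated extension of shifts of objects
(`Pretr.induction`). This extends the flatness from the objects to all twisted complexes
(`HFlat.pretr`), shows that the functor to `(A/B)^tr` vanishes on `B^tr`, as it vanishes on `B`
(`DGCat.quotTr_isInvertedBy`), and that `Φ`, whose essential image is a triangulated subcategory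
which contains the objects of `A/B`, is essentially surjective.
-/

noncomputable section

/-! ### Inhomogeneous morphisms -/

namespace DGCat

variable {k : Type u} [CommRing k] (A : DGCat.{u, v, w} k)

/-- The module of inhomogeneous morphisms: the direct sum of the `A.Hom x y p` over all `p`. -/
abbrev THom (x y : A.Obj) : Type w := (⟨x⟩ : Tot A) ⟶ ⟨y⟩

variable {A}

namespace THom

variable {x y z t : A.Obj}

/-- The linear map out of the inhomogeneous morphisms given by a family of linear maps. -/
def lift {M : Type*} [AddCommGroup M] [Module k M] (φ : ∀ p, A.Hom x y p →ₗ[k] M) :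
    A.THom x y →ₗ[k] M :=
  DirectSum.toModule k ℤ M φ

theorem lift_tot {M : Type*} [AddCommGroup M] [Module k M] (φ : ∀ p, A.Hom x y p →ₗ[k] M) {p : ℤ}
    (f : A.Hom x y p) : lift φ (A.tot f) = φ p f :=
  DirectSum.toModule_lof k p f

theorem ind {motive : A.THom x y → Prop} (zero : motive 0)
    (tot : ∀ p (f : A.Hom x y p), motive (A.tot f))
    (add : ∀ f g, motive f → motive g → motive (f + g)) (f : A.THom x y) : motive f :=
  DirectSum.induction_on f zero (fun p f => tot p f) add

variable (k) in
/-- The component of degree `p`. -/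
def comp (p : ℤ) : A.THom x y →ₗ[k] A.Hom x y p :=
  DirectSum.component k ℤ (fun p => A.Hom x y p) p

theorem comp_tot {p : ℤ} (f : A.Hom x y p) : comp k p (A.tot f) = f :=
  DirectSum.component.lof_self k p f

theorem comp_tot_of_ne {p q : ℤ} (h : p ≠ q) (f : A.Hom x y p) : comp k q (A.tot f) = 0 := by
  refine (DirectSum.component.of k (M := fun p => A.Hom x y p) q p f).trans ?_
  exact dif_neg h

/-- The sign involution `f ↦ (-1)^|f| f`. -/
def τ : A.THom x y →ₗ[k] A.THom x y := lift fun p => dgSign k p • A.tot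

/-- The signed differential `f ↦ (-1)^|f| d f`. -/
def δ : A.THom x y →ₗ[k] A.THom x y := lift fun p => dgSign k p • A.dtot

theorem τ_tot {p : ℤ} (f : A.Hom x y p) : τ (A.tot f) = dgSign k p • A.tot f := lift_tot _ f

theorem δ_tot {p : ℤ} (f : A.Hom x y p) : δ (A.tot f) = dgSign k p • A.dtot f := lift_tot _ f

theorem τ_dtot {p : ℤ} (f : A.Hom x y p) : τ (A.dtot f) = -(dgSign k p • A.dtot f) := by
  rw [← A.tot_d rfl, τ_tot, dgSign_add, dgSign_one, mul_neg_one, neg_smul]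

theorem δ_dtot {p : ℤ} (f : A.Hom x y p) : δ (A.dtot f) = 0 := by
  rw [← A.tot_d rfl, δ_tot, A.dtot_d, smul_zero]

@[simp]
theorem τ_τ (f : A.THom x y) : τ (τ f) = f := by
  induction f using ind with
  | zero => simp only [map_zero]
  | tot p f => rw [τ_tot, map_smul, τ_tot, smul_smul, dgSign_mul_self, one_smul]
  | add f g hf hg => rw [map_add, map_add, hf, hg]

@[simp]
theorem δ_δ (f : A.THom x y) : δ (δ f) = 0 := by
  induction f using ind with
  | zero => simp only [map_zero]
  | tot p f => rw [δ_tot, map_smul, δ_dtot, smul_zero]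
  | add f g hf hg => rw [map_add, map_add, hf, hg, add_zero]

theorem δ_τ (f : A.THom x y) : δ (τ f) = -τ (δ f) := by
  induction f using ind with
  | zero => simp only [map_zero, neg_zero]
  | tot p f => rw [τ_tot, δ_tot, map_smul, map_smul, τ_dtot, δ_tot, smul_neg, neg_neg]
  | add f g hf hg => rw [map_add, map_add, map_add, map_add, hf, hg, neg_add]

theorem τ_comp (f : A.THom x y) (g : A.THom y z) : τ (f ≫ g) = τ f ≫ τ g := by
  induction f using ind with
  | zero => simp only [map_zero, Limits.zero_comp]
  | add f f' hf hf' => simp only [map_add, Preadditive.add_comp, hf, hf']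
  | tot p f =>
    induction g using ind with
    | zero => simp only [map_zero, Limits.comp_zero]
    | add g g' hg hg' => simp only [map_add, Preadditive.comp_add, hg, hg']
    | tot q g =>
      rw [← A.tot_comp rfl, τ_tot, τ_tot, τ_tot, A.tot_comp, dgSign_add, Linear.smul_comp,
        Linear.comp_smul, smul_smul, mul_comm]

/-- The Leibniz rule for `δ`. The signs only involve the morphism which is applied first. -/
theorem δ_comp (f : A.THom x y) (g : A.THom y z) : δ (f ≫ g) = τ f ≫ δ g + δ f ≫ g := by
  induction f using ind with
  | zero => simp only [map_zero, Limits.zero_comp, add_zero]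
  | add f f' hf hf' =>
    simp only [map_add, Preadditive.add_comp, hf, hf']
    abel
  | tot p f =>
    induction g using ind with
    | zero => simp only [map_zero, Limits.comp_zero, add_zero]
    | add g g' hg hg' =>
      simp only [map_add, Preadditive.comp_add, hg, hg']
      abel
    | tot q g =>
      rw [← A.tot_comp rfl, δ_tot, δ_tot, δ_tot, τ_tot, A.dtot_comp]
      simp only [dgSign_add, Linear.smul_comp, Linear.comp_smul, smul_add, smul_smul, mul_comm]
      congr 2
      rw [mul_comm (dgSign k p), ← mul_assoc, dgSign_mul_self, one_mul]

theorem comp_δ {p q : ℤ} (h : p + 1 = q) (f : A.THom x y) :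
    comp k q (δ f) = dgSign k p • A.d h (comp k p f) := by
  induction f using ind with
  | zero => simp only [map_zero, smul_zero]
  | add f g hf hg => rw [map_add, map_add, hf, hg, map_add, map_add, smul_add]
  | tot r f =>
    rw [δ_tot, map_smul, ← A.tot_d rfl]
    by_cases hr : r = p
    · subst hr h
      rw [comp_tot, comp_tot]
    · rw [comp_tot_of_ne hr, comp_tot_of_ne (fun e => hr (by omega)), map_zero, smul_zero,
        smul_zero]

theorem comp_tot_comp {p q r : ℤ} (h : q + p = r) (f : A.Hom x y p) (g : A.THom y z) :
    comp k r (A.tot f ≫ g) = A.comp h (comp k q g) f := by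
  induction g using ind with
  | zero => simp only [map_zero, Limits.comp_zero, LinearMap.zero_apply]
  | add f g hf hg => rw [Preadditive.comp_add, map_add, hf, hg, map_add, map_add,
      LinearMap.add_apply]
  | tot s g =>
    rw [← A.tot_comp rfl]
    by_cases hs : s = q
    · subst hs h
      rw [comp_tot, comp_tot]
    · rw [comp_tot_of_ne hs, comp_tot_of_ne (fun e => hs (by omega)), map_zero,
        LinearMap.zero_apply]

/-- Precomposition, as a linear map. -/
abbrev pre (f : A.THom x y) (z : A.Obj) : A.THom y z →ₗ[k] A.THom x z :=
  Linear.leftComp k _ f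

end THom

end DGCat

namespace DGFunctor

open DGCat

variable {k : Type u} [CommRing k] {A : DGCat.{u, v, w} k} {B : DGCat.{u, v', w'} k}
  (F : DGFunctor A B)

/-- The extension of a dg functor to inhomogeneous morphisms. -/
def tmap {x y : A.Obj} : A.THom x y →ₗ[k] B.THom (F.obj x) (F.obj y) :=
  THom.lift fun _ => B.tot ∘ₗ F.map

theorem tmap_tot {x y : A.Obj} {p : ℤ} (f : A.Hom x y p) : F.tmap (A.tot f) = B.tot (F.map f) :=
  THom.lift_tot _ f

theorem tmap_id (x : A.Obj) : F.tmap (𝟙 (⟨x⟩ : Tot A)) = 𝟙 _ := by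
  rw [← A.tot_one, tmap_tot, F.map_one, B.tot_one]

theorem tmap_comp {x y z : A.Obj} (f : A.THom x y) (g : A.THom y z) :
    F.tmap (f ≫ g) = F.tmap f ≫ F.tmap g := by
  induction f using THom.ind with
  | zero => simp only [map_zero, Limits.zero_comp]
  | add f f' hf hf' => simp only [map_add, Preadditive.add_comp, hf, hf']
  | tot p f =>
    induction g using THom.ind with
    | zero => simp only [map_zero, Limits.comp_zero]
    | add g g' hg hg' => simp only [map_add, Preadditive.comp_add, hg, hg']
    | tot q g => rw [← A.tot_comp rfl, tmap_tot, tmap_tot, tmap_tot, F.map_comp, B.tot_comp]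

theorem tmap_τ {x y : A.Obj} (f : A.THom x y) : F.tmap (THom.τ f) = THom.τ (F.tmap f) := by
  induction f using THom.ind with
  | zero => simp only [map_zero]
  | add f f' hf hf' => simp only [map_add, hf, hf']
  | tot p f => rw [THom.τ_tot, map_smul, tmap_tot, THom.τ_tot]

theorem tmap_δ {x y : A.Obj} (f : A.THom x y) : F.tmap (THom.δ f) = THom.δ (F.tmap f) := by
  induction f using THom.ind with
  | zero => simp only [map_zero]
  | add f f' hf hf' => simp only [map_add, hf, hf']
  | tot p f => rw [THom.δ_tot, map_smul, ← A.tot_d rfl, tmap_tot, tmap_tot, THom.δ_tot, F.map_d,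
      B.tot_d]

theorem comp_tmap {x y : A.Obj} (p : ℤ) (f : A.THom x y) :
    THom.comp k p (F.tmap f) = F.map (THom.comp k p f) := by
  induction f using THom.ind with
  | zero => simp only [map_zero]
  | add f f' hf hf' => simp only [map_add, hf, hf']
  | tot q f =>
    rw [tmap_tot]
    by_cases h : q = p
    · subst h
      rw [THom.comp_tot, THom.comp_tot]
    · rw [THom.comp_tot_of_ne h, THom.comp_tot_of_ne h, map_zero]

end DGFunctor

/-! ### Right dg modules, without grading -/

namespace DGCat

open TensorProduct DirectSum

variable {k : Type u} [CommRing k]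

/-- A right dg module over a dg category, without its grading. Over a dg category, the differential
of a graded module is here replaced by `r ↦ (-1)^|r| d r`, so that the signs in the
Leibniz rule only involve the scalar. -/
structure RMod (P : DGCat.{u, v, u} k) where
  /-- the value at an object -/
  carrier : P.Obj → Type u
  [addCommGroup : ∀ x, AddCommGroup (carrier x)]
  [module : ∀ x, Module k (carrier x)]
  /-- the action of a morphism -/
  act : ∀ {x y : P.Obj}, P.THom x y →ₗ[k] carrier y →ₗ[k] carrier x
  /-- the differential -/
  d : ∀ {x : P.Obj}, carrier x →ₗ[k] carrier x
  act_id : ∀ {x : P.Obj} (r : carrier x), act (𝟙 (⟨x⟩ : Tot P)) r = r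
  act_comp : ∀ {x y z : P.Obj} (f : P.THom x y) (g : P.THom y z) (r : carrier z),
    act (f ≫ g) r = act f (act g r)
  d_act : ∀ {x y : P.Obj} (f : P.THom x y) (r : carrier y),
    d (act f r) = act (THom.τ f) (d r) + act (THom.δ f) r
  d_d : ∀ {x : P.Obj} (r : carrier x), d (d r) = 0

attribute [instance] RMod.addCommGroup RMod.module

/-- The right dg module represented by an object. -/
abbrev rep (P : DGCat.{u, v, u} k) (y : P.Obj) : RMod P where
  carrier x := P.THom x y
  act {x x'} := Linear.comp (S := k) (⟨x⟩ : Tot P) ⟨x'⟩ ⟨y⟩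
  d := THom.δ
  act_id r := Category.id_comp r
  act_comp f g r := Category.assoc f g r
  d_act f r := THom.δ_comp f r
  d_d r := THom.δ_δ r

namespace RMod

variable {P : DGCat.{u, v, u} k} (R : RMod P) {I : Type u} [DecidableEq I] (o : I → P.Obj)

/-- The value of `R.next o` at `x`: a sum `∑ r ⊗ f` stands for the sum of the composites of
`f : x → o i`, the new endomorphism of `o i`, and `r`. -/
def Next (x : P.Obj) : Type u := ⨁ i, R.carrier (o i) ⊗[k] P.THom x (o i)

instance (x : P.Obj) : AddCommGroup (R.Next o x) :=
  inferInstanceAs (AddCommGroup (⨁ i, R.carrier (o i) ⊗[k] P.THom x (o i)))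

instance (x : P.Obj) : Module k (R.Next o x) :=
  inferInstanceAs (Module k (⨁ i, R.carrier (o i) ⊗[k] P.THom x (o i)))

/-- The inclusion of a summand. -/
def nextIn (i : I) (x : P.Obj) : R.carrier (o i) ⊗[k] P.THom x (o i) →ₗ[k] R.Next o x :=
  DirectSum.lof k I (fun i => R.carrier (o i) ⊗[k] P.THom x (o i)) i

/-- The tensor `r ⊗ f` in the summand with index `i`. -/
def nextMk (i : I) (x : P.Obj) : R.carrier (o i) →ₗ[k] P.THom x (o i) →ₗ[k] R.Next o x :=
  (TensorProduct.mk k _ _).compr₂ (R.nextIn o i x)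

/-- Morphisms out of `R.Next o x`, from bilinear maps. -/
def nextLift {M : Type*} [AddCommGroup M] [Module k M] {x : P.Obj}
    (φ : ∀ i, R.carrier (o i) →ₗ[k] P.THom x (o i) →ₗ[k] M) : R.Next o x →ₗ[k] M :=
  DirectSum.toModule k I M fun i => TensorProduct.lift (φ i)

theorem nextLift_mk {M : Type*} [AddCommGroup M] [Module k M] {x : P.Obj}
    (φ : ∀ i, R.carrier (o i) →ₗ[k] P.THom x (o i) →ₗ[k] M) (i : I) (r : R.carrier (o i))
    (f : P.THom x (o i)) : R.nextLift o φ (R.nextMk o i x r f) = φ i r f :=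
  (DirectSum.toModule_lof k (φ := fun i => TensorProduct.lift (φ i)) i (r ⊗ₜ f)).trans
    (TensorProduct.lift.tmul r f)

theorem next_hom_ext {M : Type*} [AddCommGroup M] [Module k M] {x : P.Obj}
    {φ ψ : R.Next o x →ₗ[k] M}
    (h : ∀ i r f, φ (R.nextMk o i x r f) = ψ (R.nextMk o i x r f)) : φ = ψ :=
  DirectSum.linearMap_ext k fun i => TensorProduct.ext' fun r f => h i r f

/-- The action of morphisms on `R.Next o`. -/
def nextAct {x y : P.Obj} : P.THom x y →ₗ[k] R.Next o y →ₗ[k] R.Next o x :=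
  LinearMap.mk₂ k
    (fun f => R.nextLift o fun i => (R.nextMk o i x).compl₂ (THom.pre f (o i)))
    (fun f f' w => by
      rw [← LinearMap.add_apply]
      congr 1
      refine R.next_hom_ext o fun i r g => ?_
      simp [nextLift_mk])
    (fun c f w => by
      rw [← LinearMap.smul_apply]
      congr 1
      refine R.next_hom_ext o fun i r g => ?_
      simp [nextLift_mk])
    (fun f w w' => map_add _ w w')
    (fun c f w => map_smul _ c w)

theorem nextAct_mk {x y : P.Obj} (f : P.THom x y) (i : I) (r : R.carrier (o i))
    (g : P.THom y (o i)) : R.nextAct o f (R.nextMk o i y r g) = R.nextMk o i x r (f ≫ g) :=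
  R.nextLift_mk o _ i r g

/-- The part of the differential of `R.Next o` which preserves the summands. -/
def nextD {x : P.Obj} : R.Next o x →ₗ[k] R.Next o x :=
  R.nextLift o fun i => (R.nextMk o i x).compl₂ THom.δ - (R.nextMk o i x).compl₁₂ R.d THom.τ

theorem nextD_mk {x : P.Obj} (i : I) (r : R.carrier (o i)) (f : P.THom x (o i)) :
    R.nextD o (R.nextMk o i x r f) =
      R.nextMk o i x r (THom.δ f) - R.nextMk o i x (R.d r) (THom.τ f) :=
  R.nextLift_mk o _ i r f

theorem nextD_comp_nextD {x : P.Obj} : R.nextD o ∘ₗ R.nextD o (x := x) = 0 :=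
  R.next_hom_ext o fun i r e => by
    rw [LinearMap.comp_apply, nextD_mk, map_sub, nextD_mk, nextD_mk, THom.δ_δ, R.d_d, THom.δ_τ]
    simp

/-- The right dg module of formal composites of a morphism of `P` with values `o i`, a new
endomorphism of `o i`, and an element of `R`. -/
abbrev next : RMod P where
  carrier := R.Next o
  act := R.nextAct o
  d := R.nextD o
  act_id {x} w := by
    have h : R.nextAct o (𝟙 (⟨x⟩ : Tot P)) = LinearMap.id :=
      R.next_hom_ext o fun i r f => by rw [nextAct_mk, Category.id_comp, LinearMap.id_apply]
    rw [h, LinearMap.id_apply]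
  act_comp f g w := by
    have h : R.nextAct o (f ≫ g) = R.nextAct o f ∘ₗ R.nextAct o g :=
      R.next_hom_ext o fun i r e => by
        rw [LinearMap.comp_apply, nextAct_mk, nextAct_mk, nextAct_mk, Category.assoc]
    rw [h, LinearMap.comp_apply]
  d_act f w := by
    have h : R.nextD o ∘ₗ R.nextAct o f =
        R.nextAct o (THom.τ f) ∘ₗ R.nextD o + R.nextAct o (THom.δ f) :=
      R.next_hom_ext o fun i r e => by
        simp only [LinearMap.comp_apply, LinearMap.add_apply, nextAct_mk, nextD_mk, map_sub,
          THom.δ_comp, THom.τ_comp, map_add]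
        abel
    exact LinearMap.congr_fun h w
  d_d w := LinearMap.congr_fun (R.nextD_comp_nextD o) w

/-- The right dg module of formal composites with `n` new morphisms. -/
def iter (n : ℕ) : RMod P := Nat.rec R (fun _ S => S.next o) n

end RMod

end DGCat

namespace DGCat

open TensorProduct DirectSum

variable {k : Type u} [CommRing k] {P : DGCat.{u, v, u} k}

/-! ### Inhomogeneous morphisms of a dg quotient -/

section

variable {A : DGCat.{u, v, u} k} {B : Set A.Obj}

variable (B) in
/-- The inhomogeneous morphisms between objects of `A` in the dg quotient. -/
abbrev QTHom (x y : A.Obj) : Type (max u v) :=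
  (A.quot B).THom ((A.quotFunctor B).obj x) ((A.quotFunctor B).obj y)

/-- The morphism of the dg quotient given by a formal expression. -/
def qmk {x y : A.Obj} {p : ℤ} (e : QExpr A B x y p) : QTHom B x y :=
  (A.quot B).tot (x := (A.quotFunctor B).obj x) (y := (A.quotFunctor B).obj y) (QHom.mk e)

theorem qmk_of {x y : A.Obj} {p : ℤ} (f : A.Hom x y p) :
    qmk (.of f) = (A.quotFunctor B).tmap (A.tot f) :=
  ((A.quotFunctor B).tmap_tot f).symm

theorem qmk_zero {x y : A.Obj} {p : ℤ} : qmk (B := B) (.zero : QExpr A B x y p) = 0 :=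
  map_zero ((A.quot B).tot (x := (A.quotFunctor B).obj x) (y := (A.quotFunctor B).obj y) (p := p))

theorem qmk_add {x y : A.Obj} {p : ℤ} (e e' : QExpr A B x y p) :
    qmk (.add e e') = qmk e + qmk e' :=
  map_add ((A.quot B).tot (x := (A.quotFunctor B).obj x) (y := (A.quotFunctor B).obj y) (p := p))
    (QHom.mk e) (QHom.mk e')

theorem qmk_smul {x y : A.Obj} {p : ℤ} (c : k) (e : QExpr A B x y p) :
    qmk (.smul c e) = c • qmk e :=
  map_smul ((A.quot B).tot (x := (A.quotFunctor B).obj x) (y := (A.quotFunctor B).obj y) (p := p))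
    c (QHom.mk e)

theorem qmk_comp {x y z : A.Obj} {p q r : ℤ} (h : q + p = r) (g : QExpr A B y z q)
    (f : QExpr A B x y p) : qmk (.comp h g f) = qmk f ≫ qmk g :=
  (A.quot B).tot_comp (x := (A.quotFunctor B).obj x) (y := (A.quotFunctor B).obj y)
    (z := (A.quotFunctor B).obj z) h (QHom.mk g) (QHom.mk f)

theorem qmk_ind {x y : A.Obj} {motive : QTHom B x y → Prop} (zero : motive 0)
    (mk : ∀ p (e : QExpr A B x y p), motive (qmk e))
    (add : ∀ f g, motive f → motive g → motive (f + g)) (f : QTHom B x y) : motive f :=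
  THom.ind zero (fun p f => QHom.ind (motive := fun f => motive ((A.quot B).tot
    (x := (A.quotFunctor B).obj x) (y := (A.quotFunctor B).obj y) f)) (mk p) f) add f

/-- The new endomorphism of an object of `B`. -/
def qeps (U : B) : QTHom B U.1 U.1 := qmk (.eps U.1 U.2)

theorem τ_qeps (U : B) : THom.τ (qeps U) = -qeps U := by
  refine (THom.τ_tot _).trans ?_
  rw [dgSign_neg, dgSign_one, neg_one_smul]
  rfl

theorem δ_qeps (U : B) :
    THom.δ (qeps U) = -𝟙 (⟨(A.quotFunctor B).obj U.1⟩ : Tot (A.quot B)) := by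
  refine (THom.δ_tot _).trans ?_
  rw [dgSign_neg, dgSign_one, neg_one_smul]
  exact congrArg Neg.neg ((A.quot B).tot_d (neg_add_cancel 1) _).symm

end

/-! ### Words -/

namespace Words

variable {I : Type u} [DecidableEq I] (o : I → P.Obj) (Y : P.Obj)

/-- The words with `n` new letters, ending at `Y`. -/
abbrev mod (n : ℕ) : RMod P := (rep P Y).iter o n

/-- The linear combinations of words of any length. -/
def All (x : P.Obj) : Type u := ⨁ n, (mod o Y n).carrier x

instance (x : P.Obj) : AddCommGroup (All o Y x) :=
  inferInstanceAs (AddCommGroup (⨁ n, (mod o Y n).carrier x))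

instance (x : P.Obj) : Module k (All o Y x) :=
  inferInstanceAs (Module k (⨁ n, (mod o Y n).carrier x))

variable {Y}

/-- The word of length `n + 1` which consists of a morphism, the new letter with index `i`, and a
word of length `n`. -/
def cons (n : ℕ) (i : I) (x : P.Obj) :
    (mod o Y n).carrier (o i) →ₗ[k] P.THom x (o i) →ₗ[k] (mod o Y (n + 1)).carrier x :=
  (mod o Y n).nextMk o i x

theorem act_cons (n : ℕ) {x y : P.Obj} (f : P.THom x y) (i : I) (r : (mod o Y n).carrier (o i))
    (g : P.THom y (o i)) : (mod o Y (n + 1)).act f (cons o n i y r g) = cons o n i x r (f ≫ g) :=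
  RMod.nextAct_mk _ o f i r g

theorem d_cons (n : ℕ) (i : I) {x : P.Obj} (r : (mod o Y n).carrier (o i))
    (f : P.THom x (o i)) : (mod o Y (n + 1)).d (cons o n i x r f) =
      cons o n i x r (THom.δ f) - cons o n i x ((mod o Y n).d r) (THom.τ f) :=
  RMod.nextD_mk _ o i r f

theorem cons_hom_ext (n : ℕ) {x : P.Obj} {M : Type*} [AddCommGroup M] [Module k M]
    {φ ψ : (mod o Y (n + 1)).carrier x →ₗ[k] M}
    (h : ∀ i r f, φ (cons o n i x r f) = ψ (cons o n i x r f)) : φ = ψ :=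
  RMod.next_hom_ext _ o h

/-- The inclusion of the words of length `n`. -/
def incl (n : ℕ) (x : P.Obj) : (mod o Y n).carrier x →ₗ[k] All o Y x :=
  DirectSum.lof k ℕ (fun n => (mod o Y n).carrier x) n

/-- The projection to the words of length `n`. -/
def proj (n : ℕ) (x : P.Obj) : All o Y x →ₗ[k] (mod o Y n).carrier x :=
  DirectSum.component k ℕ (fun n => (mod o Y n).carrier x) n

theorem proj_incl (n : ℕ) (x : P.Obj) (r : (mod o Y n).carrier x) :
    proj o n x (incl o n x r) = r :=
  DirectSum.component.lof_self k (M := fun n => (mod o Y n).carrier x) n r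

theorem proj_incl_of_ne {m n : ℕ} (h : m ≠ n) (x : P.Obj) (r : (mod o Y m).carrier x) :
    proj o n x (incl o m x r) = 0 :=
  (DirectSum.component.of k (M := fun n => (mod o Y n).carrier x) n m r).trans (dif_neg h)

/-- Linear maps out of the words. -/
def lift {x : P.Obj} {M : Type*} [AddCommGroup M] [Module k M]
    (φ : ∀ n, (mod o Y n).carrier x →ₗ[k] M) : All o Y x →ₗ[k] M := DirectSum.toModule k ℕ M φ

theorem lift_incl {x : P.Obj} {M : Type*} [AddCommGroup M] [Module k M]
    (φ : ∀ n, (mod o Y n).carrier x →ₗ[k] M) (n : ℕ) (r : (mod o Y n).carrier x) :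
    lift o φ (incl o n x r) = φ n r :=
  DirectSum.toModule_lof k (M := fun n => (mod o Y n).carrier x) (φ := φ) n r

theorem hom_ext {x : P.Obj} {M : Type*} [AddCommGroup M] [Module k M] {φ ψ : All o Y x →ₗ[k] M}
    (h : ∀ n r, φ (incl o n x r) = ψ (incl o n x r)) : φ = ψ :=
  DirectSum.linearMap_ext k fun n => LinearMap.ext fun r => h n r

theorem ind {x : P.Obj} {motive : All o Y x → Prop} (zero : motive 0)
    (incl : ∀ n r, motive (incl o n x r)) (add : ∀ f g, motive f → motive g → motive (f + g))
    (f : All o Y x) : motive f :=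
  DirectSum.induction_on f zero (fun n r => incl n r) add

/-- The right action of the morphisms of `P` on words. -/
def actOf {x y : P.Obj} : P.THom x y →ₗ[k] All o Y y →ₗ[k] All o Y x :=
  LinearMap.mk₂ k (fun f => lift o fun n => incl o n x ∘ₗ (mod o Y n).act f)
    (fun f f' w => by
      rw [← LinearMap.add_apply]
      congr 1
      refine hom_ext o fun n r => ?_
      simp [lift_incl])
    (fun c f w => by
      rw [← LinearMap.smul_apply]
      congr 1
      refine hom_ext o fun n r => ?_
      simp [lift_incl])
    (fun f w w' => map_add _ w w')
    (fun c f w => map_smul _ c w)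

theorem actOf_incl {x y : P.Obj} (f : P.THom x y) (n : ℕ) (r : (mod o Y n).carrier y) :
    actOf o f (incl o n y r) = incl o n x ((mod o Y n).act f r) := lift_incl o _ n r

theorem actOf_id {x : P.Obj} (w : All o Y x) : actOf o (𝟙 (⟨x⟩ : Tot P)) w = w := by
  have h : actOf o (Y := Y) (𝟙 (⟨x⟩ : Tot P)) = LinearMap.id :=
    hom_ext o fun n r => by rw [actOf_incl, RMod.act_id, LinearMap.id_apply]
  rw [h, LinearMap.id_apply]

theorem actOf_comp {x y z : P.Obj} (f : P.THom x y) (g : P.THom y z) (w : All o Y z) :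
    actOf o (f ≫ g) w = actOf o f (actOf o g w) := by
  have h : actOf o (Y := Y) (f ≫ g) = actOf o f ∘ₗ actOf o g :=
    hom_ext o fun n r => by
      rw [LinearMap.comp_apply, actOf_incl, actOf_incl, actOf_incl, RMod.act_comp]
  rw [h, LinearMap.comp_apply]

section Action

variable {A : DGCat.{u, u, u} k} {B : Set A.Obj} [DecidableEq B] (ι : DGFunctor A P)

/-- The right action of a new letter on words. -/
def actEps (U : B) :
    All (fun U : B => ι.obj U) Y (ι.obj U) →ₗ[k] All (fun U : B => ι.obj U) Y (ι.obj U) :=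
  lift _ fun n => incl _ (n + 1) (ι.obj U) ∘ₗ
    (cons (fun U : B => ι.obj U) n U (ι.obj U)).flip (𝟙 (⟨ι.obj U⟩ : Tot P))

theorem actEps_incl (U : B) (n : ℕ) (r : (mod (fun U : B => ι.obj U) Y n).carrier (ι.obj U)) :
    actEps ι U (incl _ n (ι.obj U) r) =
      incl _ (n + 1) (ι.obj U)
        (cons (fun U : B => ι.obj U) n U (ι.obj U) r (𝟙 (⟨ι.obj U⟩ : Tot P))) :=
  lift_incl _ _ n r

/-- The right action of formal expressions on words. -/
def actExpr : ∀ {x y : A.Obj} {p : ℤ}, QExpr A B x y p →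
    (All (fun U : B => ι.obj U) Y (ι.obj y) →ₗ[k] All (fun U : B => ι.obj U) Y (ι.obj x))
  | _, _, _, .of f => actOf _ (ι.tmap (A.tot f))
  | _, _, _, .eps U hU => actEps ι ⟨U, hU⟩
  | _, _, _, .zero => 0
  | _, _, _, .add f g => actExpr f + actExpr g
  | _, _, _, .smul c f => c • actExpr f
  | _, _, _, .comp _ g f => actExpr f ∘ₗ actExpr g

theorem actExpr_eq {x y : A.Obj} {p : ℤ} {e e' : QExpr A B x y p} (H : QRel A B e e') :
    actExpr ι (Y := Y) e = actExpr ι e' := by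
  induction H with
  | add_left f f' g _ ih => simp only [actExpr, ih]
  | add_right f g g' _ ih => simp only [actExpr, ih]
  | smul_right c f f' _ ih => simp only [actExpr, ih]
  | comp_left hr g g' f hg ih => simp only [actExpr, ih]
  | comp_right hr g f f' hf ih => simp only [actExpr, ih]
  | add_comm f g => exact add_comm _ _
  | add_assoc f g e => exact add_assoc _ _ _
  | zero_add f => exact zero_add _
  | one_smul f => exact one_smul k _
  | zero_smul f => exact zero_smul k _
  | mul_smul c c' f => exact mul_smul c c' _
  | add_smul c c' f => exact add_smul c c' _
  | smul_add c f g => exact smul_add c _ _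
  | add_comp hr g g' f => exact LinearMap.comp_add _ _ _
  | comp_add hr g f f' => exact LinearMap.add_comp _ _ _
  | smul_comp hr c g f => exact LinearMap.comp_smul _ _ _
  | comp_smul hr c g f => exact LinearMap.smul_comp _ _ _
  | assoc h₁ h₂ h₃ h₄ e g f => rfl
  | one_comp f =>
    refine LinearMap.ext fun w => congrArg (actExpr ι f) ?_
    rw [actExpr, A.tot_one, ι.tmap_id, actOf_id]
  | comp_one f =>
    refine LinearMap.ext fun w => ?_
    rw [actExpr, actExpr, A.tot_one, ι.tmap_id, LinearMap.comp_apply, actOf_id]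
  | of_add f g => simp only [actExpr, map_add]
  | of_smul c f => simp only [actExpr, map_smul]
  | of_comp hr g f =>
    refine LinearMap.ext fun w => ?_
    simp only [actExpr, A.tot_comp, ι.tmap_comp, LinearMap.comp_apply, actOf_comp]

/-- The right action of the homogeneous morphisms of the dg quotient on words. -/
def actHom {x y : A.Obj} {p : ℤ} : QHom A B x y p →ₗ[k]
    All (fun U : B => ι.obj U) Y (ι.obj y) →ₗ[k] All (fun U : B => ι.obj U) Y (ι.obj x) where
  toFun := Quot.lift (actExpr ι) fun _ _ H => actExpr_eq ι H
  map_add' f g := by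
    induction f using QHom.ind
    induction g using QHom.ind
    rfl
  map_smul' c f := by
    induction f using QHom.ind
    rfl

/-- The right action of the morphisms of the dg quotient on words. -/
def act {x y : A.Obj} : QTHom B x y →ₗ[k]
    All (fun U : B => ι.obj U) Y (ι.obj y) →ₗ[k] All (fun U : B => ι.obj U) Y (ι.obj x) :=
  THom.lift fun _ => actHom ι

theorem act_mk {x y : A.Obj} {p : ℤ} (e : QExpr A B x y p) :
    act ι (Y := Y) (qmk e) = actExpr ι e :=
  THom.lift_tot (A := A.quot B) (x := (A.quotFunctor B).obj x) (y := (A.quotFunctor B).obj y)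
    (fun _ => actHom ι) (QHom.mk e)

theorem act_comp {x y z : A.Obj} (f : QTHom B x y) (g : QTHom B y z)
    (w : All (fun U : B => ι.obj U) Y (ι.obj z)) : act ι (f ≫ g) w = act ι f (act ι g w) := by
  induction f using qmk_ind with
  | zero => simp only [map_zero, Limits.zero_comp, LinearMap.zero_apply]
  | add f f' hf hf' => simp only [map_add, Preadditive.add_comp, LinearMap.add_apply, hf, hf']
  | mk p f =>
    induction g using qmk_ind with
    | zero => simp only [map_zero, Limits.comp_zero, LinearMap.zero_apply]
    | add g g' hg hg' => simp only [map_add, Preadditive.comp_add, LinearMap.add_apply, hg, hg']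
    | mk q g => rw [← qmk_comp rfl, act_mk, act_mk, act_mk, actExpr, LinearMap.comp_apply]

theorem act_of {x y : A.Obj} (f : A.THom x y) :
    act ι (Y := Y) ((A.quotFunctor B).tmap f) = actOf _ (ι.tmap f) := by
  induction f using THom.ind with
  | zero => simp only [map_zero]
  | add f f' hf hf' => simp only [map_add, hf, hf']
  | tot p f => rw [← qmk_of, act_mk, actExpr]

theorem act_qeps (U : B) : act ι (Y := Y) (qeps U) = actEps ι U := act_mk ι (.eps U.1 U.2)

end Action

section Eval

variable {Q : DGCat.{u, v', w'} k} (F : DGFunctor P Q)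
  (ε : ∀ i, Q.THom (F.obj (o i)) (F.obj (o i)))

/-- The value of a word with `n` new letters: the composite of its letters. -/
def eval : ∀ (n : ℕ) {x : P.Obj}, (mod o Y n).carrier x →ₗ[k] Q.THom (F.obj x) (F.obj Y)
  | 0, _ => F.tmap
  | n + 1, _ => (mod o Y n).nextLift o fun i =>
      LinearMap.mk₂ k (fun r f => F.tmap f ≫ ε i ≫ eval n r)
        (fun r r' f => by simp) (fun c r f => by simp) (fun r f f' => by simp)
        (fun c r f => by simp)

theorem eval_succ (n : ℕ) {x : P.Obj} (i : I) (r : (mod o Y n).carrier (o i))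
    (f : P.THom x (o i)) : eval o F ε (n + 1) (cons o n i x r f) =
      F.tmap f ≫ ε i ≫ eval o F ε n r := RMod.nextLift_mk _ o _ i r f

/-- The value of a linear combination of words. -/
def evalAll {x : P.Obj} : All o Y x →ₗ[k] Q.THom (F.obj x) (F.obj Y) :=
  lift o fun n => eval o F ε n

theorem evalAll_incl (n : ℕ) {x : P.Obj} (r : (mod o Y n).carrier x) :
    evalAll o F ε (incl o n x r) = eval o F ε n r := lift_incl o _ n r

theorem eval_act (n : ℕ) {x y : P.Obj} (f : P.THom x y) (r : (mod o Y n).carrier y) :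
    eval o F ε n ((mod o Y n).act f r) = F.tmap f ≫ eval o F ε n r := by
  cases n with
  | zero => exact F.tmap_comp f r
  | succ n =>
    have h : eval o F ε (n + 1) ∘ₗ (mod o Y (n + 1)).act f =
        THom.pre (F.tmap f) (F.obj Y) ∘ₗ eval o F ε (n + 1) :=
      cons_hom_ext o n fun i r g => by
        rw [LinearMap.comp_apply, LinearMap.comp_apply, act_cons, eval_succ, eval_succ,
          F.tmap_comp, Category.assoc]
        rfl
    exact LinearMap.congr_fun h r

theorem evalAll_actOf {x y : P.Obj} (f : P.THom x y) (w : All o Y y) :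
    evalAll o F ε (actOf o f w) = F.tmap f ≫ evalAll o F ε w := by
  induction w using ind with
  | zero => simp only [map_zero, Limits.comp_zero]
  | add f g hf hg => simp only [map_add, Preadditive.comp_add, hf, hg]
  | incl n r => rw [actOf_incl, evalAll_incl, evalAll_incl, eval_act]

end Eval

section EvalAct

variable {A : DGCat.{u, u, u} k} {B : Set A.Obj} [DecidableEq B] (ι : DGFunctor A P)
  {Q : DGCat.{u, v', w'} k} (F : DGFunctor P Q)
  (ε : ∀ U : B, Q.THom (F.obj (ι.obj U)) (F.obj (ι.obj U)))

theorem evalAll_actEps (U : B) (w : All (fun U : B => ι.obj U) Y (ι.obj U)) :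
    evalAll _ F ε (actEps ι U w) = ε U ≫ evalAll _ F ε w := by
  induction w using ind with
  | zero => simp only [map_zero, Limits.comp_zero]
  | add f g hf hg => simp only [map_add, Preadditive.comp_add, hf, hg]
  | incl n r =>
    rw [actEps_incl, evalAll_incl, evalAll_incl]
    exact (eval_succ _ F ε n U r _).trans (by rw [F.tmap_id, Category.id_comp])

/-- The value of words is compatible with the actions of the dg quotient, for a dg functor
to `Q` from the dg quotient which is given by its effect `γ` on inhomogeneous morphisms. -/
theorem evalAll_act
    (γ : ∀ {x y : A.Obj}, QTHom B x y →ₗ[k] Q.THom (F.obj (ι.obj x)) (F.obj (ι.obj y)))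
    (γ_comp : ∀ {x y z : A.Obj} (f : QTHom B x y) (g : QTHom B y z), γ (f ≫ g) = γ f ≫ γ g)
    (γ_of : ∀ {x y : A.Obj} (f : A.THom x y),
      γ ((A.quotFunctor B).tmap f) = F.tmap (ι.tmap f))
    (γ_eps : ∀ U : B, γ (qeps U) = ε U)
    {x y : A.Obj} (f : QTHom B x y) (w : All (fun U : B => ι.obj U) Y (ι.obj y)) :
    evalAll _ F ε (act ι f w) = γ f ≫ evalAll _ F ε w := by
  induction f using qmk_ind with
  | zero => simp only [map_zero, Limits.zero_comp, LinearMap.zero_apply]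
  | add f f' hf hf' => simp only [map_add, Preadditive.add_comp, LinearMap.add_apply, hf, hf']
  | mk p f =>
    rw [act_mk]
    induction f with
    | of f => rw [qmk_of, γ_of, actExpr, evalAll_actOf]
    | eps U hU => exact (evalAll_actEps ι F ε ⟨U, hU⟩ w).trans (by rw [← γ_eps]; rfl)
    | zero =>
      rw [qmk_zero, actExpr, map_zero, Limits.zero_comp, LinearMap.zero_apply, map_zero]
    | add f g hf hg =>
      rw [qmk_add, actExpr, LinearMap.add_apply, map_add, map_add, Preadditive.add_comp, hf, hg]
    | smul c f hf =>
      rw [qmk_smul, actExpr, LinearMap.smul_apply, map_smul, map_smul, Linear.smul_comp, hf]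
    | comp h g f hg hf =>
      rw [qmk_comp, actExpr, LinearMap.comp_apply, γ_comp, hf, hg, Category.assoc]

end EvalAct

/-- The word without new letters given by the identity of `Y`. -/
def unit : All o Y Y := incl o 0 Y (𝟙 (⟨Y⟩ : Tot P))

theorem actOf_unit {x : P.Obj} (f : P.THom x Y) : actOf o f (unit o) = incl o 0 x f :=
  (actOf_incl o f 0 _).trans (congrArg (incl o 0 x) (Category.comp_id f))

theorem evalAll_unit {Q : DGCat.{u, v', w'} k} (F : DGFunctor P Q)
    (ε : ∀ i, Q.THom (F.obj (o i)) (F.obj (o i))) :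
    evalAll o F ε (unit o (Y := Y)) = 𝟙 (⟨F.obj Y⟩ : Tot Q) :=
  (evalAll_incl o F ε 0 _).trans (F.tmap_id Y)

end Words

end DGCat

/-! ### Ungraded differential modules and homotopical flatness -/

namespace DGCat

open TensorProduct

/-- A module with a differential, without a grading. -/
structure DMod (k : Type u) [CommRing k] where
  /-- the module -/
  carrier : Type u
  [addCommGroup : AddCommGroup carrier]
  [module : Module k carrier]
  /-- the differential -/
  d : carrier →ₗ[k] carrier
  d_d : ∀ c, d (d c) = 0

attribute [instance] DMod.addCommGroup DMod.module

variable {k : Type u} [CommRing k] {P : DGCat.{u, v, u} k}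

namespace DMod

variable (C : DMod k)

/-- A differential module is acyclic if every cycle is a boundary. -/
def Acyclic : Prop := ∀ c, C.d c = 0 → ∃ b, C.d b = c

/-- The differential of the tensor product of a differential module and the morphisms from `X` to
`U`. -/
def D (X U : P.Obj) : C.carrier ⊗[k] P.THom X U →ₗ[k] C.carrier ⊗[k] P.THom X U :=
  TensorProduct.map C.d THom.τ + TensorProduct.map LinearMap.id THom.δ

theorem D_tmul {X U : P.Obj} (c : C.carrier) (f : P.THom X U) :
    C.D X U (c ⊗ₜ f) = C.d c ⊗ₜ THom.τ f + c ⊗ₜ THom.δ f := rfl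

/-- Precomposition with a morphism on the tensor product. -/
def pre {X' X : P.Obj} (s : P.THom X' X) (U : P.Obj) :
    C.carrier ⊗[k] P.THom X U →ₗ[k] C.carrier ⊗[k] P.THom X' U :=
  LinearMap.lTensor C.carrier (THom.pre s U)

theorem pre_tmul {X' X U : P.Obj} (s : P.THom X' X) (c : C.carrier) (f : P.THom X U) :
    C.pre s U (c ⊗ₜ f) = c ⊗ₜ (s ≫ f) := rfl

theorem pre_comp {X'' X' X U : P.Obj} (t : P.THom X'' X') (s : P.THom X' X)
    (z : C.carrier ⊗[k] P.THom X U) : C.pre (t ≫ s) U z = C.pre t U (C.pre s U z) := by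
  induction z using TensorProduct.induction_on with
  | zero => simp only [map_zero]
  | tmul c f => rw [pre_tmul, pre_tmul, pre_tmul, Category.assoc]
  | add z z' h h' => simp only [map_add, h, h']

theorem pre_id {X U : P.Obj} (z : C.carrier ⊗[k] P.THom X U) :
    C.pre (𝟙 (⟨X⟩ : Tot P)) U z = z := by
  induction z using TensorProduct.induction_on with
  | zero => simp only [map_zero]
  | tmul c f => rw [pre_tmul, Category.id_comp]
  | add z z' h h' => simp only [map_add, h, h']

theorem D_pre {X' X U : P.Obj} {s : P.THom X' X} (hτ : THom.τ s = s) (hδ : THom.δ s = 0)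
    (z : C.carrier ⊗[k] P.THom X U) : C.D X' U (C.pre s U z) = C.pre s U (C.D X U z) := by
  induction z using TensorProduct.induction_on with
  | zero => simp only [map_zero]
  | tmul c f =>
    rw [pre_tmul, D_tmul, D_tmul, map_add, pre_tmul, pre_tmul, THom.τ_comp, THom.δ_comp, hτ, hδ,
      Limits.zero_comp, add_zero]
  | add z z' h h' => simp only [map_add, h, h']

/-- The differential module obtained by freely adding, for each cycle, an element of which it is
the boundary. -/
abbrev plus : DMod k where
  carrier := C.carrier × (LinearMap.ker C.d →₀ k)
  d := LinearMap.inl k _ _ ∘ₗ (C.d.coprod (Finsupp.linearCombination k Subtype.val))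
  d_d := by
    rintro ⟨c, φ⟩
    have h : C.d ∘ₗ Finsupp.linearCombination k (Subtype.val : LinearMap.ker C.d → C.carrier) = 0 :=
      Finsupp.lhom_ext fun ζ a => by
        rw [LinearMap.comp_apply, Finsupp.linearCombination_single, map_smul, ζ.2, smul_zero]
        rfl
    have h' := LinearMap.congr_fun h φ
    simp only [LinearMap.comp_apply, LinearMap.zero_apply] at h'
    simp only [LinearMap.comp_apply, LinearMap.inl_apply, LinearMap.coprod_apply, map_zero,
      map_add, C.d_d, h', add_zero]

/-- The inclusion of a differential module in `C.plus`. -/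
def toPlus : C.carrier →ₗ[k] C.plus.carrier := LinearMap.inl k _ _

/-- The projection to the old elements, which does not commute with the differentials. -/
def plusFst : C.plus.carrier →ₗ[k] C.carrier := LinearMap.fst k _ _

/-- The coefficients of the new elements. -/
def plusSnd : C.plus.carrier →ₗ[k] (LinearMap.ker C.d →₀ k) := LinearMap.snd k _ _

theorem plus_d (c : C.plus.carrier) : C.plus.d c =
    C.toPlus (C.d (C.plusFst c) + Finsupp.linearCombination k Subtype.val (C.plusSnd c)) := rfl

theorem plus_d_toPlus (c : C.carrier) : C.plus.d (C.toPlus c) = C.toPlus (C.d c) := by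
  rw [plus_d]
  change C.toPlus (C.d c + Finsupp.linearCombination k Subtype.val 0) = _
  rw [map_zero, add_zero]

theorem exists_plus_d (c : C.carrier) (hc : C.d c = 0) : ∃ b, C.plus.d b = C.toPlus c := by
  refine ⟨(0, Finsupp.single ⟨c, hc⟩ 1), ?_⟩
  refine (C.plus_d _).trans ?_
  change C.toPlus (C.d 0 + Finsupp.linearCombination k Subtype.val (Finsupp.single _ 1)) = _
  rw [map_zero, zero_add, Finsupp.linearCombination_single, one_smul]

theorem plusFst_toPlus (c : C.carrier) : C.plusFst (C.toPlus c) = c := rfl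

theorem plusSnd_toPlus (c : C.carrier) : C.plusSnd (C.toPlus c) = 0 := rfl

open Classical in
/-- The coefficients of the new elements, in a tensor product. -/
def plusCoeff (X U : P.Obj) :
    C.plus.carrier ⊗[k] P.THom X U →ₗ[k] (LinearMap.ker C.d →₀ P.THom X U) :=
  (TensorProduct.finsuppScalarLeft k (P.THom X U) (LinearMap.ker C.d)).toLinearMap ∘ₗ
    C.plusSnd.rTensor (P.THom X U)

theorem plusCoeff_tmul {X U : P.Obj} (c : C.plus.carrier) (f : P.THom X U) (ζ : LinearMap.ker C.d) :
    C.plusCoeff X U (c ⊗ₜ f) ζ = C.plusSnd c ζ • f := by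
  classical
  exact TensorProduct.finsuppScalarLeft_apply_tmul_apply _ _ _

/-- The sum of the tensors of the cycles with their coefficients. -/
def cycleSum (X U : P.Obj) : (LinearMap.ker C.d →₀ P.THom X U) →ₗ[k] C.carrier ⊗[k] P.THom X U :=
  Finsupp.lsum k fun ζ => TensorProduct.mk k C.carrier (P.THom X U) ζ.1 ∘ₗ THom.τ

theorem cycleSum_smul {X U : P.Obj} (φ : LinearMap.ker C.d →₀ k) (f : P.THom X U) :
    C.cycleSum X U (φ.mapRange (· • f) (zero_smul _ _)) =
      Finsupp.linearCombination k Subtype.val φ ⊗ₜ THom.τ f := by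
  induction φ using Finsupp.induction_linear with
  | zero => simp
  | add φ ψ h h' =>
    rw [map_add, TensorProduct.add_tmul, ← h, ← h', ← map_add]
    congr 1
    ext ζ
    simp [add_smul]
  | single ζ a => simp [cycleSum, TensorProduct.smul_tmul]

theorem plusFst_D {X U : P.Obj} (v : C.plus.carrier ⊗[k] P.THom X U) :
    C.plusFst.rTensor (P.THom X U) (C.plus.D X U v) =
      C.D X U (C.plusFst.rTensor (P.THom X U) v) + C.cycleSum X U (C.plusCoeff X U v) := by
  induction v using TensorProduct.induction_on with
  | zero => simp only [map_zero, add_zero]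
  | add v v' h h' =>
    simp only [map_add, h, h']
    abel
  | tmul c f =>
    have h : C.plusCoeff X U (c ⊗ₜ f) = (C.plusSnd c).mapRange (· • f) (zero_smul _ _) :=
      Finsupp.ext fun ζ => (C.plusCoeff_tmul c f ζ).trans rfl
    rw [h, cycleSum_smul, D_tmul, map_add, LinearMap.rTensor_tmul, LinearMap.rTensor_tmul,
      LinearMap.rTensor_tmul, plus_d, plusFst_toPlus, D_tmul, TensorProduct.add_tmul]
    abel

theorem plusCoeff_D {X U : P.Obj} (v : C.plus.carrier ⊗[k] P.THom X U) (ζ : LinearMap.ker C.d) :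
    C.plusCoeff X U (C.plus.D X U v) ζ = THom.δ (C.plusCoeff X U v ζ) := by
  induction v using TensorProduct.induction_on with
  | zero => simp only [map_zero, Finsupp.zero_apply]
  | add v v' h h' => simp only [map_add, Finsupp.add_apply, h, h']
  | tmul c f =>
    rw [D_tmul, map_add, Finsupp.add_apply, plusCoeff_tmul, plusCoeff_tmul, plusCoeff_tmul,
      plus_d, plusSnd_toPlus, Finsupp.zero_apply, zero_smul, zero_add, map_smul]

theorem plusCoeff_toPlus {X U : P.Obj} (z : C.carrier ⊗[k] P.THom X U) :
    C.plusCoeff X U (C.toPlus.rTensor (P.THom X U) z) = 0 := by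
  induction z using TensorProduct.induction_on with
  | zero => simp only [map_zero]
  | add z z' h h' => simp only [map_add, h, h', add_zero]
  | tmul c f =>
    refine Finsupp.ext fun ζ => ?_
    rw [LinearMap.rTensor_tmul, plusCoeff_tmul, plusSnd_toPlus, Finsupp.zero_apply, zero_smul]
    rfl

theorem plusFst_toPlus_rTensor {X U : P.Obj} (z : C.carrier ⊗[k] P.THom X U) :
    C.plusFst.rTensor (P.THom X U) (C.toPlus.rTensor (P.THom X U) z) = z := by
  rw [← LinearMap.rTensor_comp_apply]
  exact LinearMap.rTensor_id_apply _ _ z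

/-- The iterates of `plus`. -/
def stage : ℕ → DMod k
  | 0 => C
  | n + 1 => (stage n).plus

/-- The inclusion of an iterate of `plus` in the next one. -/
def stageStep (n : ℕ) : (C.stage n).carrier →ₗ[k] (C.stage (n + 1)).carrier := (C.stage n).toPlus

theorem stageStep_d (n : ℕ) (c : (C.stage n).carrier) :
    (C.stage (n + 1)).d (C.stageStep n c) = C.stageStep n ((C.stage n).d c) :=
  plus_d_toPlus _ c

theorem exists_stage_d (n : ℕ) (c : (C.stage n).carrier) (hc : (C.stage n).d c = 0) :
    ∃ b, (C.stage (n + 1)).d b = C.stageStep n c :=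
  exists_plus_d _ c hc

/-- The inclusions between the iterates of `plus`. -/
def stageMap (m n : ℕ) (h : m ≤ n) : (C.stage m).carrier →ₗ[k] (C.stage n).carrier :=
  Nat.leRecOn (C := fun n => (C.stage m).carrier →ₗ[k] (C.stage n).carrier) h
    (fun {n} f => C.stageStep n ∘ₗ f) LinearMap.id

theorem stageMap_self (n : ℕ) (h : n ≤ n) : C.stageMap n n h = LinearMap.id :=
  Nat.leRecOn_self _

theorem stageMap_succ {m n : ℕ} (h : m ≤ n) (h' : m ≤ n + 1) :
    C.stageMap m (n + 1) h' = C.stageStep n ∘ₗ C.stageMap m n h :=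
  Nat.leRecOn_succ h _

instance : DirectedSystem (fun n => (C.stage n).carrier) fun m n h => C.stageMap m n h where
  map_self n x := by rw [stageMap_self, LinearMap.id_apply]
  map_map l m n hlm hmn x := by
    induction hmn with
    | refl => rw [stageMap_self, LinearMap.id_apply]
    | @step n hmn ih =>
      rw [C.stageMap_succ hmn, LinearMap.comp_apply, ih, C.stageMap_succ (hlm.trans hmn),
        LinearMap.comp_apply]

theorem stageMap_d (m n : ℕ) (h : m ≤ n) (c : (C.stage m).carrier) :
    (C.stage n).d (C.stageMap m n h c) = C.stageMap m n h ((C.stage m).d c) := by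
  induction h with
  | refl => simp only [stageMap_self, LinearMap.id_apply]
  | @step n h ih =>
    rw [C.stageMap_succ h, LinearMap.comp_apply, LinearMap.comp_apply, ← ih]
    exact C.stageStep_d _ _

/-- The colimit of the iterates of `plus`. -/
abbrev colim : DMod k where
  carrier := Module.DirectLimit (fun n => (C.stage n).carrier) C.stageMap
  d := Module.DirectLimit.map (fun n => (C.stage n).d) fun m n h =>
    LinearMap.ext fun c => C.stageMap_d m n h c
  d_d c := by
    obtain ⟨n, c, rfl⟩ := Module.DirectLimit.exists_of c
    rw [Module.DirectLimit.map_apply_of, Module.DirectLimit.map_apply_of, d_d, map_zero]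

/-- The map from the iterates of `plus` to their colimit. -/
def toColim (n : ℕ) : (C.stage n).carrier →ₗ[k] C.colim.carrier :=
  Module.DirectLimit.of k ℕ (fun n => (C.stage n).carrier) C.stageMap n

theorem colim_d_toColim (n : ℕ) (c : (C.stage n).carrier) :
    C.colim.d (C.toColim n c) = C.toColim n ((C.stage n).d c) :=
  Module.DirectLimit.map_apply_of (fun n => (C.stage n).d) (fun m n h =>
    LinearMap.ext fun c => C.stageMap_d m n h c) c

theorem acyclic_colim : C.colim.Acyclic := by
  intro c hc
  obtain ⟨n, c, rfl⟩ := Module.DirectLimit.exists_of c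
  have hc' : C.toColim n ((C.stage n).d c) = 0 := (C.colim_d_toColim n c).symm.trans hc
  obtain ⟨m, hm, h⟩ := Module.DirectLimit.of.zero_exact hc'
  rw [← stageMap_d] at h
  obtain ⟨b, hb⟩ := C.exists_stage_d m _ h
  refine ⟨C.toColim (m + 1) b, ?_⟩
  rw [colim_d_toColim, hb]
  refine (congrArg (C.toColim (m + 1))
    (LinearMap.congr_fun (C.stageMap_succ hm (hm.trans m.le_succ)) c).symm).trans ?_
  exact Module.DirectLimit.of_f

theorem toColim_D (n : ℕ) {X U : P.Obj} (z : (C.stage n).carrier ⊗[k] P.THom X U) :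
    C.colim.D X U ((C.toColim n).rTensor _ z) = (C.toColim n).rTensor _ ((C.stage n).D X U z) := by
  induction z using TensorProduct.induction_on with
  | zero => simp only [map_zero]
  | tmul c f =>
    rw [D_tmul, map_add, LinearMap.rTensor_tmul, LinearMap.rTensor_tmul, LinearMap.rTensor_tmul,
      ← colim_d_toColim]
    exact D_tmul _ _ _
  | add z z' h h' => simp only [map_add, h, h']

theorem stageMap_D (m n : ℕ) (hmn : m ≤ n) {X U : P.Obj}
    (z : (C.stage m).carrier ⊗[k] P.THom X U) : (C.stage n).D X U ((C.stageMap m n hmn).rTensor _ z)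
      = (C.stageMap m n hmn).rTensor _ ((C.stage m).D X U z) := by
  induction z using TensorProduct.induction_on with
  | zero => simp only [map_zero]
  | tmul c f => simp only [D_tmul, map_add, LinearMap.rTensor_tmul, stageMap_d]
  | add z z' h h' => simp only [map_add, h, h']

theorem stageMap_pre (m n : ℕ) (hmn : m ≤ n) {X' X U : P.Obj} (s : P.THom X' X)
    (z : (C.stage m).carrier ⊗[k] P.THom X U) :
    (C.stage n).pre s U ((C.stageMap m n hmn).rTensor _ z) =
      (C.stageMap m n hmn).rTensor _ ((C.stage m).pre s U z) := by
  induction z using TensorProduct.induction_on with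
  | zero => simp only [map_zero]
  | tmul c f => rfl
  | add z z' h h' => simp only [map_add, h, h']

/-- If an element of `C ⊗ P(X, U)` becomes a boundary in the colimit, then it does so at a finite
stage. -/
theorem exists_stage {X U : P.Obj} (z : (C.stage 0).carrier ⊗[k] P.THom X U)
    (v : C.colim.carrier ⊗[k] P.THom X U)
    (hv : C.colim.D X U v = (C.toColim 0).rTensor _ z) :
    ∃ (n : ℕ) (v : (C.stage n).carrier ⊗[k] P.THom X U),
      (C.stage n).D X U v = (C.stageMap 0 n n.zero_le).rTensor _ z := by
  let e := TensorProduct.directLimitLeft C.stageMap (P.THom X U)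
  have he : ∀ n (w : (C.stage n).carrier ⊗[k] P.THom X U), e ((C.toColim n).rTensor _ w) =
      Module.DirectLimit.of k ℕ _ _ n w := fun n w =>
    TensorProduct.directLimitLeft_rTensor_of C.stageMap _ w
  obtain ⟨n, w, hw⟩ := Module.DirectLimit.exists_of (e v)
  have hv' : v = (C.toColim n).rTensor _ w := e.injective (by rw [he, hw])
  rw [hv', toColim_D] at hv
  have h0 : (C.toColim 0).rTensor (P.THom X U) z =
      (C.toColim n).rTensor _ ((C.stageMap 0 n n.zero_le).rTensor _ z) := by
    rw [← LinearMap.rTensor_comp_apply]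
    congr 2
    exact LinearMap.ext fun c => Module.DirectLimit.of_f.symm
  rw [h0, ← sub_eq_zero, ← map_sub] at hv
  have h1 := (he n _).symm.trans ((congrArg e hv).trans (map_zero e))
  obtain ⟨m, hm, h⟩ := Module.DirectLimit.of.zero_exact h1
  refine ⟨m, (C.stageMap n m hm).rTensor _ w, ?_⟩
  rw [map_sub, sub_eq_zero] at h
  rw [stageMap_D, h, ← LinearMap.rTensor_comp_apply]
  congr 2
  exact LinearMap.ext fun c => DirectedSystem.map_map' C.stageMap _ _ c

end DMod

/-- The complex of morphisms from `X` to `U` is homotopically flat, in the ungraded sense. -/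
def HFlat (P : DGCat.{u, v, u} k) (X U : P.Obj) : Prop :=
  ∀ C : DMod k, C.Acyclic → ∀ z, C.D X U z = 0 → ∃ v, C.D X U v = z

/-! ### Torsion -/

/-- A class of closed morphisms of degree zero such that each closed morphism to an object `o i`
becomes a boundary after composition with a morphism of this class. -/
structure IsKilling {I : Type u} (o : I → P.Obj) (S : ∀ ⦃X' X : P.Obj⦄, P.THom X' X → Prop) :
    Prop where
  id_mem : ∀ X, S (𝟙 (⟨X⟩ : Tot P))
  comp_mem : ∀ {X'' X' X : P.Obj} (t : P.THom X'' X') (s : P.THom X' X), S t → S s → S (t ≫ s)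
  τ_eq : ∀ {X' X : P.Obj} (s : P.THom X' X), S s → THom.τ s = s
  δ_eq : ∀ {X' X : P.Obj} (s : P.THom X' X), S s → THom.δ s = 0
  kill : ∀ {X : P.Obj} (i : I) (f : P.THom X (o i)), THom.δ f = 0 →
    ∃ (X' : P.Obj) (s : P.THom X' X), S s ∧ ∃ h, THom.δ h = s ≫ f

namespace IsKilling

variable {I : Type u} {o : I → P.Obj} {S : ∀ ⦃X' X : P.Obj⦄, P.THom X' X → Prop}
  (hS : IsKilling o S)
include hS

theorem δ_comp {X' X Y : P.Obj} {s : P.THom X' X} (hs : S s) (f : P.THom X Y) :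
    THom.δ (s ≫ f) = s ≫ THom.δ f := by
  rw [THom.δ_comp, hS.τ_eq s hs, hS.δ_eq s hs, Limits.zero_comp, add_zero]

theorem τ_comp {X' X Y : P.Obj} {s : P.THom X' X} (hs : S s) (f : P.THom X Y) :
    THom.τ (s ≫ f) = s ≫ THom.τ f := by
  rw [THom.τ_comp, hS.τ_eq s hs]

theorem kill_finset {J : Type*} (T : Finset J) {X : P.Obj} (i : I) (f : J → P.THom X (o i))
    (hf : ∀ j, THom.δ (f j) = 0) :
    ∃ (X' : P.Obj) (s : P.THom X' X), S s ∧ ∀ j ∈ T, ∃ h, THom.δ h = s ≫ f j := by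
  classical
  induction T using Finset.induction_on with
  | empty => exact ⟨X, 𝟙 _, hS.id_mem X, fun j hj => absurd hj (Finset.notMem_empty j)⟩
  | insert j T hj ih =>
    obtain ⟨X', s, hs, h⟩ := ih
    obtain ⟨X'', t, ht, h', hh'⟩ := hS.kill i (s ≫ f j) (by
      rw [hS.δ_comp hs, hf, Limits.comp_zero])
    refine ⟨X'', t ≫ s, hS.comp_mem t s ht hs, fun l hl => ?_⟩
    rcases Finset.mem_insert.mp hl with rfl | hl
    · exact ⟨h', by rw [hh', Category.assoc]⟩
    · obtain ⟨e, he⟩ := h l hl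
      exact ⟨t ≫ e, by rw [hS.δ_comp ht, he, Category.assoc]⟩

/-- The quotient of `C.plus` by `C` is free with zero differential, hence the coefficients of the
new elements in `v` are finitely many cycles of `P(X, o i)`. Once these are killed, `v` can be
corrected to an element which only involves `C`. -/
theorem exists_of_plus (C : DMod k) {X : P.Obj} (i : I) (z : C.carrier ⊗[k] P.THom X (o i))
    (v : C.plus.carrier ⊗[k] P.THom X (o i))
    (hv : C.plus.D X (o i) v = C.toPlus.rTensor _ z) :
    ∃ (X' : P.Obj) (s : P.THom X' X), S s ∧ ∃ v, C.D X' (o i) v = C.pre s (o i) z := by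
  have h1 := C.plusFst_D v
  rw [hv, C.plusFst_toPlus_rTensor] at h1
  have h2 : ∀ ζ, THom.δ (C.plusCoeff X (o i) v ζ) = 0 := fun ζ => by
    rw [← C.plusCoeff_D, hv, C.plusCoeff_toPlus, Finsupp.zero_apply]
  obtain ⟨X', s, hs, h⟩ := hS.kill_finset (C.plusCoeff X (o i) v).support i _ h2
  refine ⟨X', s, hs, ?_⟩
  suffices h3 : ∃ w, C.D X' (o i) w = C.pre s (o i) (C.cycleSum X (o i) (C.plusCoeff X (o i) v)) by
    obtain ⟨w, hw⟩ := h3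
    refine ⟨C.pre s (o i) (C.plusFst.rTensor _ v) + w, ?_⟩
    rw [map_add, C.D_pre (hS.τ_eq s hs) (hS.δ_eq s hs), hw, h1, map_add]
  have h4 : C.cycleSum X (o i) (C.plusCoeff X (o i) v) = ∑ ζ ∈ (C.plusCoeff X (o i) v).support,
      ζ.1 ⊗ₜ THom.τ (C.plusCoeff X (o i) v ζ) := rfl
  choose! e he using h
  refine ⟨∑ ζ ∈ (C.plusCoeff X (o i) v).support, -(ζ.1 ⊗ₜ THom.τ (e ζ)), ?_⟩
  rw [h4, map_sum, map_sum]
  refine Finset.sum_congr rfl fun ζ hζ => ?_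
  rw [map_neg, C.D_tmul, ζ.2, TensorProduct.zero_tmul, zero_add, THom.δ_τ, TensorProduct.tmul_neg,
    neg_neg, he ζ hζ, C.pre_tmul, hS.τ_comp hs]

theorem exists_of_stage (C : DMod k) {X : P.Obj} (i : I)
    (z : (C.stage 0).carrier ⊗[k] P.THom X (o i)) (n : ℕ)
    (v : (C.stage n).carrier ⊗[k] P.THom X (o i))
    (hv : (C.stage n).D X (o i) v = (C.stageMap 0 n n.zero_le).rTensor _ z) :
    ∃ (X' : P.Obj) (s : P.THom X' X), S s ∧
      ∃ v, (C.stage 0).D X' (o i) v = (C.stage 0).pre s (o i) z := by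
  induction n generalizing X with
  | zero =>
    rw [C.stageMap_self, LinearMap.rTensor_id_apply] at hv
    exact ⟨X, 𝟙 _, hS.id_mem X, v, hv.trans ((C.stage 0).pre_id z).symm⟩
  | succ n ih =>
    rw [C.stageMap_succ n.zero_le, LinearMap.rTensor_comp_apply] at hv
    obtain ⟨X', s, hs, v', hv'⟩ := hS.exists_of_plus (C.stage n) i
      ((C.stageMap 0 n n.zero_le).rTensor _ z) v hv
    rw [C.stageMap_pre] at hv'
    obtain ⟨X'', t, ht, w, hw⟩ := ih ((C.stage 0).pre s (o i) z) v' hv'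
    exact ⟨X'', t ≫ s, hS.comp_mem t s ht hs, w, hw.trans ((C.stage 0).pre_comp t s z).symm⟩

/-- If `P(X, o i)` is homotopically flat, then each cycle of `C ⊗ P(X, o i)` becomes a boundary
after precomposition with a morphism of `S`, for an arbitrary differential module `C`. -/
theorem exists_of_hflat (C : DMod k) {X : P.Obj} (i : I) (hX : HFlat P X (o i))
    (z : C.carrier ⊗[k] P.THom X (o i)) (hz : C.D X (o i) z = 0) :
    ∃ (X' : P.Obj) (s : P.THom X' X), S s ∧ ∃ v, C.D X' (o i) v = C.pre s (o i) z := by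
  have h : C.colim.D X (o i) ((C.toColim 0).rTensor _ z) = 0 :=
    (C.toColim_D 0 z).trans ((congrArg _ hz).trans (map_zero _))
  obtain ⟨v, hv⟩ := hX C.colim C.acyclic_colim _ h
  obtain ⟨n, w, hw⟩ := C.exists_stage z v hv
  exact hS.exists_of_stage C i z n w hw

end IsKilling

namespace RMod

variable (R : RMod P) {I : Type u} [DecidableEq I] (o : I → P.Obj)

/-- The value of a right module as a differential module, with the opposite of its differential. -/
abbrev toDMod (x : P.Obj) : DMod k where
  carrier := R.carrier x
  d := -R.d
  d_d c := by simp [R.d_d]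

/-- The projection to a summand. -/
def nextProj (i : I) (x : P.Obj) : R.Next o x →ₗ[k] R.carrier (o i) ⊗[k] P.THom x (o i) :=
  DirectSum.component k I (fun i => R.carrier (o i) ⊗[k] P.THom x (o i)) i

theorem nextProj_nextIn (i : I) (x : P.Obj) (z : R.carrier (o i) ⊗[k] P.THom x (o i)) :
    R.nextProj o i x (R.nextIn o i x z) = z :=
  DirectSum.component.lof_self k (M := fun i => R.carrier (o i) ⊗[k] P.THom x (o i)) i z

theorem nextProj_nextIn_of_ne {i j : I} (h : i ≠ j) (x : P.Obj)
    (z : R.carrier (o i) ⊗[k] P.THom x (o i)) : R.nextProj o j x (R.nextIn o i x z) = 0 :=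
  (DirectSum.component.of k (M := fun i => R.carrier (o i) ⊗[k] P.THom x (o i)) j i z).trans
    (dif_neg h)

theorem nextD_nextIn (i : I) (x : P.Obj) (z : R.carrier (o i) ⊗[k] P.THom x (o i)) :
    R.nextD o (R.nextIn o i x z) = R.nextIn o i x ((R.toDMod (o i)).D x (o i) z) := by
  induction z using TensorProduct.induction_on with
  | zero => simp only [map_zero]
  | add z z' h h' => simp only [map_add, h, h']
  | tmul r f =>
    refine (R.nextD_mk o i r f).trans ?_
    refine (?_ : _ = R.nextIn o i x ((-R.d r) ⊗ₜ THom.τ f + r ⊗ₜ THom.δ f))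
    rw [TensorProduct.neg_tmul, map_add, map_neg, neg_add_eq_sub]
    rfl

theorem nextAct_nextIn {x y : P.Obj} (s : P.THom x y) (i : I)
    (z : R.carrier (o i) ⊗[k] P.THom y (o i)) :
    R.nextAct o s (R.nextIn o i y z) = R.nextIn o i x ((R.toDMod (o i)).pre s (o i) z) := by
  induction z using TensorProduct.induction_on with
  | zero => simp only [map_zero]
  | add z z' h h' => simp only [map_add, h, h']
  | tmul r f => exact R.nextAct_mk o s i r f

theorem next_ind {x : P.Obj} {motive : R.Next o x → Prop} (zero : motive 0)
    (nextIn : ∀ i z, motive (R.nextIn o i x z))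
    (add : ∀ f g, motive f → motive g → motive (f + g)) (f : R.Next o x) : motive f :=
  DirectSum.induction_on f zero (fun i z => nextIn i z) add

theorem nextProj_nextD (i : I) (x : P.Obj) (w : R.Next o x) :
    R.nextProj o i x (R.nextD o w) = (R.toDMod (o i)).D x (o i) (R.nextProj o i x w) := by
  induction w using R.next_ind o with
  | zero => simp only [map_zero]
  | add w w' h h' => simp only [map_add, h, h']
  | nextIn j z =>
    rw [nextD_nextIn]
    by_cases h : j = i
    · subst h
      rw [nextProj_nextIn, nextProj_nextIn]
    · rw [nextProj_nextIn_of_ne _ _ h, nextProj_nextIn_of_ne _ _ h, map_zero]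

theorem exists_finset (x : P.Obj) (w : R.Next o x) :
    ∃ T : Finset I, w = ∑ i ∈ T, R.nextIn o i x (R.nextProj o i x w) := by
  classical
  exact ⟨DFinsupp.support w, (DirectSum.sum_support_of w).symm⟩

variable {o} {S : ∀ ⦃X' X : P.Obj⦄, P.THom X' X → Prop}

/-- Under the flatness assumption, the cohomology of `R.next o` is torsion: each cycle is mapped to
a boundary by the action of a morphism of the class `S`. -/
theorem exists_act_eq_nextD (hS : IsKilling o S) (hflat : ∀ X i, HFlat P X (o i)) {X : P.Obj}
    (w : R.Next o X) (hw : R.nextD o w = 0) :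
    ∃ (X' : P.Obj) (s : P.THom X' X), S s ∧ ∃ v, R.nextD o v = R.nextAct o s w := by
  have h : ∀ T : Finset I, ∃ (X' : P.Obj) (s : P.THom X' X), S s ∧
      ∃ v, R.nextD o v = R.nextAct o s (∑ i ∈ T, R.nextIn o i X (R.nextProj o i X w)) := by
    intro T
    induction T using Finset.induction_on with
    | empty => exact ⟨X, 𝟙 _, hS.id_mem X, 0, by simp only [map_zero, Finset.sum_empty]⟩
    | insert j T hj ih =>
      obtain ⟨X', s, hs, v, hv⟩ := ih
      have h1 : (R.toDMod (o j)).D X (o j) (R.nextProj o j X w) = 0 := by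
        rw [← nextProj_nextD, hw, map_zero]
      have h2 : (R.toDMod (o j)).D X' (o j)
          ((R.toDMod (o j)).pre s (o j) (R.nextProj o j X w)) = 0 := by
        rw [DMod.D_pre _ (hS.τ_eq s hs) (hS.δ_eq s hs), h1, map_zero]
      obtain ⟨X'', t, ht, v', hv'⟩ := hS.exists_of_hflat _ j (hflat X' j) _ h2
      refine ⟨X'', t ≫ s, hS.comp_mem t s ht hs,
        R.nextIn o j X'' v' + R.nextAct o t v, ?_⟩
      have h3 : R.nextD o (R.nextAct o t v) = R.nextAct o t (R.nextD o v) := by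
        refine ((R.next o).d_act t v).trans ?_
        rw [hS.τ_eq t ht, hS.δ_eq t ht, map_zero, LinearMap.zero_apply, add_zero]
      have h4 : ∀ w, R.nextAct o (t ≫ s) w = R.nextAct o t (R.nextAct o s w) :=
        (R.next o).act_comp t s
      rw [Finset.sum_insert hj, map_add, map_add, h3, hv, nextD_nextIn, hv', h4, h4, nextAct_nextIn,
        nextAct_nextIn]
  obtain ⟨T, hT⟩ := R.exists_finset o X w
  rw [hT]
  exact h T

end RMod

end DGCat

/-! ### The filtration by the number of new letters -/

namespace DGCat

namespace Words

variable {k : Type u} [CommRing k] {P : DGCat.{u, v, u} k} {I : Type u} [DecidableEq I]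
  (o : I → P.Obj) {Q : DGCat.{u, v', w'} k} (F : DGFunctor P Q)
  (ε : ∀ i, Q.THom (F.obj (o i)) (F.obj (o i))) {X Y : P.Obj}

/-- The values of the combinations of words with less than `n` new letters. -/
def low (X Y : P.Obj) : ℕ → Submodule k (Q.THom (F.obj X) (F.obj Y))
  | 0 => ⊥
  | n + 1 => low X Y n ⊔ LinearMap.range (eval o F ε n)

theorem low_le_succ (n : ℕ) : low o F ε X Y n ≤ low o F ε X Y (n + 1) := le_sup_left

theorem eval_mem_low (n : ℕ) (w : (mod o Y n).carrier X) :
    eval o F ε n w ∈ low o F ε X Y (n + 1) :=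
  Submodule.mem_sup_right ⟨w, rfl⟩

theorem low_mono {m n : ℕ} (h : m ≤ n) : low o F ε X Y m ≤ low o F ε X Y n :=
  monotone_nat_of_le_succ (fun n => low_le_succ o F ε n) h

theorem mem_low_succ {n : ℕ} {H : Q.THom (F.obj X) (F.obj Y)}
    (h : H ∈ low o F ε X Y (n + 1)) :
    ∃ H₀ ∈ low o F ε X Y n, ∃ w, H = H₀ + eval o F ε n w := by
  obtain ⟨H₀, h₀, _, ⟨w, rfl⟩, rfl⟩ := Submodule.mem_sup.mp h
  exact ⟨H₀, h₀, w, rfl⟩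

theorem tmap_comp_mem_low {X' : P.Obj} (f : P.THom X' X) {n : ℕ} {H : Q.THom (F.obj X) (F.obj Y)}
    (h : H ∈ low o F ε X Y n) : F.tmap f ≫ H ∈ low o F ε X' Y n := by
  induction n generalizing H with
  | zero =>
    rw [(Submodule.mem_bot k).mp h, Limits.comp_zero]
    exact zero_mem _
  | succ n ih =>
    obtain ⟨H₀, h₀, w, rfl⟩ := mem_low_succ o F ε h
    rw [Preadditive.comp_add, ← eval_act]
    exact add_mem (low_le_succ o F ε n (ih h₀)) (eval_mem_low o F ε n _)

theorem tmap_comp_eps_comp_mem_low {i : I} (f : P.THom X (o i)) {n : ℕ}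
    {H : Q.THom (F.obj (o i)) (F.obj Y)} (h : H ∈ low o F ε (o i) Y n) :
    F.tmap f ≫ ε i ≫ H ∈ low o F ε X Y (n + 1) := by
  induction n generalizing H with
  | zero =>
    rw [(Submodule.mem_bot k).mp h, Limits.comp_zero, Limits.comp_zero]
    exact zero_mem _
  | succ n ih =>
    obtain ⟨H₀, h₀, w, rfl⟩ := mem_low_succ o F ε h
    rw [Preadditive.comp_add, Preadditive.comp_add, ← eval_succ]
    exact add_mem (low_le_succ o F ε _ (ih h₀)) (eval_mem_low o F ε (n + 1) _)

/-- The evaluation of words is compatible with the differentials, up to words with fewer new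
letters. -/
theorem δ_eval_sub_mem_low (hτ : ∀ i, THom.τ (ε i) = -ε i)
    (hδ : ∀ i, THom.δ (ε i) = -𝟙 (⟨F.obj (o i)⟩ : Tot Q)) (n : ℕ) (w : (mod o Y n).carrier X) :
    THom.δ (eval o F ε n w) - eval o F ε n ((mod o Y n).d w) ∈ low o F ε X Y n := by
  induction n generalizing X with
  | zero =>
    have h : THom.δ (eval o F ε 0 w) = eval o F ε 0 ((mod o Y 0).d w) := (F.tmap_δ w).symm
    rw [h, sub_self]
    exact zero_mem _
  | succ n ih =>
    have h : (low o F ε X Y (n + 1)).mkQ ∘ₗ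
        (THom.δ ∘ₗ eval o F ε (n + 1) - eval o F ε (n + 1) ∘ₗ (mod o Y (n + 1)).d) = 0 := by
      refine cons_hom_ext o n fun i r f => ?_
      rw [LinearMap.comp_apply, LinearMap.sub_apply, LinearMap.comp_apply, LinearMap.comp_apply,
        d_cons, map_sub (eval o F ε (n + 1)), eval_succ, eval_succ, eval_succ, LinearMap.zero_apply,
        Submodule.mkQ_apply, Submodule.Quotient.mk_eq_zero, THom.δ_comp, THom.δ_comp, hτ, hδ,
        ← F.tmap_τ, ← F.tmap_δ]
      have h1 := tmap_comp_eps_comp_mem_low o F ε (THom.τ f) (ih r)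
      have h2 := tmap_comp_mem_low o F ε (THom.τ f) (eval_mem_low o F ε n r)
      convert neg_mem (add_mem h1 h2) using 1
      simp only [Preadditive.comp_add, Preadditive.neg_comp, Preadditive.comp_neg,
        Preadditive.comp_sub, Category.id_comp]
      abel
    have h' := LinearMap.congr_fun h w
    rwa [LinearMap.comp_apply, LinearMap.zero_apply, Submodule.mkQ_apply,
      Submodule.Quotient.mk_eq_zero] at h'

theorem δ_mem_low (hτ : ∀ i, THom.τ (ε i) = -ε i)
    (hδ : ∀ i, THom.δ (ε i) = -𝟙 (⟨F.obj (o i)⟩ : Tot Q)) {n : ℕ}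
    {H : Q.THom (F.obj X) (F.obj Y)} (h : H ∈ low o F ε X Y n) :
    THom.δ H ∈ low o F ε X Y n := by
  induction n generalizing H with
  | zero =>
    rw [(Submodule.mem_bot k).mp h, map_zero]
    exact zero_mem _
  | succ n ih =>
    obtain ⟨H₀, h₀, w, rfl⟩ := mem_low_succ o F ε h
    rw [map_add, ← sub_add_cancel (THom.δ (eval o F ε n w)) (eval o F ε n ((mod o Y n).d w))]
    exact add_mem (low_le_succ o F ε n (ih h₀)) (add_mem
      (low_le_succ o F ε n (δ_eval_sub_mem_low o F ε hτ hδ n w)) (eval_mem_low o F ε n _))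

theorem exists_of_mem_low {n : ℕ} {H : Q.THom (F.obj X) (F.obj Y)} (h : H ∈ low o F ε X Y n) :
    ∃ a : All o Y X, evalAll o F ε a = H ∧ ∀ m, n ≤ m → proj o m X a = 0 := by
  induction n generalizing H with
  | zero => exact ⟨0, by rw [map_zero, (Submodule.mem_bot k).mp h], fun m _ => map_zero _⟩
  | succ n ih =>
    obtain ⟨H₀, h₀, w, rfl⟩ := mem_low_succ o F ε h
    obtain ⟨a, rfl, ha⟩ := ih h₀
    refine ⟨a + incl o n X w, by rw [map_add, evalAll_incl], fun m hm => ?_⟩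
    rw [map_add, ha m (Nat.le_of_succ_le hm), proj_incl_of_ne o (Nat.ne_of_lt hm), add_zero]

variable {F ε}

/-- A word with `n` new letters is not a combination of words with fewer new letters. -/
theorem eq_zero_of_eval_mem_low (hinj : Function.Injective (evalAll o F ε (x := X) (Y := Y)))
    {n : ℕ} {w : (mod o Y n).carrier X} (h : eval o F ε n w ∈ low o F ε X Y n) : w = 0 := by
  obtain ⟨a, ha, ha'⟩ := exists_of_mem_low o F ε h
  have h1 : a = incl o n X w := hinj (ha.trans (evalAll_incl o F ε n w).symm)
  rw [← proj_incl o n X w, ← h1, ha' n le_rfl]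

theorem exists_mem_low (hsurj : Function.Surjective (evalAll o F ε (x := X) (Y := Y)))
    (H : Q.THom (F.obj X) (F.obj Y)) : ∃ n, H ∈ low o F ε X Y n := by
  obtain ⟨a, rfl⟩ := hsurj H
  induction a using ind with
  | zero => exact ⟨0, by rw [map_zero]; exact zero_mem _⟩
  | incl n r => exact ⟨n + 1, by rw [evalAll_incl]; exact eval_mem_low o F ε n r⟩
  | add f g hf hg =>
    obtain ⟨m, hm⟩ := hf
    obtain ⟨n, hn⟩ := hg
    refine ⟨max m n, ?_⟩
    rw [map_add]
    exact add_mem (low_mono o F ε (le_max_left m n) hm) (low_mono o F ε (le_max_right m n) hn)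

theorem tmap_injective (hinj : Function.Injective (evalAll o F ε (x := X) (Y := Y))) :
    Function.Injective (F.tmap (x := X) (y := Y)) := by
  intro f g h
  have h1 : incl o 0 X (Y := Y) f = incl o 0 X g :=
    hinj ((evalAll_incl o F ε 0 f).trans (h.trans (evalAll_incl o F ε 0 g).symm))
  rw [← proj_incl o 0 X f, h1]
  exact proj_incl o 0 X g

variable {o}

/-- A morphism of the dg quotient whose differential comes from `P` becomes homologous to a
morphism which comes from `P` after precomposition with a morphism of the class `S`. The
part of the morphism with the largest number of new letters is a cycle of words, hence torsion,
and this allows to remove it. -/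
theorem exists_roof {S : ∀ ⦃X' X : P.Obj⦄, P.THom X' X → Prop} (hS : IsKilling o S)
    (hflat : ∀ X i, HFlat P X (o i)) (hτ : ∀ i, THom.τ (ε i) = -ε i)
    (hδ : ∀ i, THom.δ (ε i) = -𝟙 (⟨F.obj (o i)⟩ : Tot Q))
    (hinj : ∀ X Y, Function.Injective (evalAll o F ε (x := X) (Y := Y)))
    (hsurj : ∀ X Y, Function.Surjective (evalAll o F ε (x := X) (Y := Y)))
    (H : Q.THom (F.obj X) (F.obj Y)) (f : P.THom X Y) (hf : THom.δ H = F.tmap f) :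
    ∃ (X' : P.Obj) (s : P.THom X' X), S s ∧ ∃ e H', F.tmap s ≫ H = F.tmap e + THom.δ H' := by
  obtain ⟨n, hn⟩ := exists_mem_low o (hsurj X Y) H
  induction n generalizing X with
  | zero =>
    refine ⟨X, 𝟙 _, hS.id_mem X, 0, 0, ?_⟩
    rw [(Submodule.mem_bot k).mp hn, Limits.comp_zero, map_zero, map_zero, add_zero]
  | succ n ih =>
    obtain ⟨H₀, h₀, w, rfl⟩ := mem_low_succ o F ε hn
    cases n with
    | zero =>
      refine ⟨X, 𝟙 _, hS.id_mem X, w, 0, ?_⟩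
      rw [(Submodule.mem_bot k).mp h₀, zero_add, F.tmap_id, Category.id_comp, map_zero, add_zero]
      rfl
    | succ n =>
      have hw : (mod o Y (n + 1)).d w = 0 := by
        refine eq_zero_of_eval_mem_low o (hinj X Y) ?_
        have h1 := δ_eval_sub_mem_low o F ε hτ hδ (n + 1) w
        have h2 : F.tmap f ∈ low o F ε X Y (n + 1) :=
          low_mono o F ε (Nat.le_add_left 1 n) (eval_mem_low o F ε 0 f)
        have h3 := sub_mem (sub_mem h2 (δ_mem_low o F ε hτ hδ h₀)) h1
        rwa [← hf, map_add, add_sub_cancel_left, sub_sub_cancel] at h3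
      obtain ⟨X', s, hs, v, hv⟩ := (mod o Y n).exists_act_eq_nextD hS hflat w hw
      have hs' : THom.τ (F.tmap s) = F.tmap s := by rw [← F.tmap_τ, hS.τ_eq s hs]
      have hs'' : THom.δ (F.tmap s) = 0 := by rw [← F.tmap_δ, hS.δ_eq s hs, map_zero]
      have h4 : F.tmap s ≫ (H₀ + eval o F ε (n + 1) w) - THom.δ (eval o F ε (n + 1) v) ∈
          low o F ε X' Y (n + 1) := by
        have h5 := sub_mem (tmap_comp_mem_low o F ε s h₀)
          (δ_eval_sub_mem_low o F ε hτ hδ (n + 1) v)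
        have h6 : eval o F ε (n + 1) ((mod o Y (n + 1)).d v) =
            F.tmap s ≫ eval o F ε (n + 1) w :=
          (congrArg (eval o F ε (n + 1)) hv).trans (eval_act o F ε (n + 1) s w)
        rw [h6] at h5
        convert h5 using 1
        rw [Preadditive.comp_add]
        abel
      obtain ⟨X'', t, ht, e, H', h7⟩ := ih _ (s ≫ f) (by
        rw [map_sub, THom.δ_δ, sub_zero, THom.δ_comp, hs', hs'', Limits.zero_comp, add_zero, hf,
          F.tmap_comp]) h4
      have ht' : THom.τ (F.tmap t) = F.tmap t := by rw [← F.tmap_τ, hS.τ_eq t ht]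
      have ht'' : THom.δ (F.tmap t) = 0 := by rw [← F.tmap_δ, hS.δ_eq t ht, map_zero]
      refine ⟨X'', t ≫ s, hS.comp_mem t s ht hs, e, H' + F.tmap t ≫ eval o F ε (n + 1) v, ?_⟩
      rw [map_add, THom.δ_comp, ht', ht'', Limits.zero_comp, add_zero, ← add_assoc, ← h7,
        F.tmap_comp, Preadditive.comp_sub, sub_add_cancel, Category.assoc]

end Words

end DGCat

/-! ### Matrix entries of morphisms of twisted complexes -/

namespace DGCat

variable {k : Type u} [CommRing k]

namespace AddHom

variable {C : DGCat.{u, v, w} k} {X Y : AddObj C}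

/-- An entry of a matrix. -/
def entry (i : X.ι) (j : Y.ι) {p : ℤ} :
    AddHom C X Y p →ₗ[k] C.Hom (X.obj i) (Y.obj j) (p + Y.deg j - X.deg i) where
  toFun f := f i j
  map_add' _ _ := rfl
  map_smul' _ _ := rfl

open Classical in
/-- The matrix with a single entry. -/
def single (i : X.ι) (j : Y.ι) {p : ℤ} :
    C.Hom (X.obj i) (Y.obj j) (p + Y.deg j - X.deg i) →ₗ[k] AddHom C X Y p :=
  LinearMap.single k (φ := fun i => ∀ j, C.Hom (X.obj i) (Y.obj j) (p + Y.deg j - X.deg i)) i ∘ₗ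
    LinearMap.single k (fun j => C.Hom (X.obj i) (Y.obj j) (p + Y.deg j - X.deg i)) j

theorem single_self (i : X.ι) (j : Y.ι) {p : ℤ}
    (f : C.Hom (X.obj i) (Y.obj j) (p + Y.deg j - X.deg i)) : single i j f i j = f := by
  simp [single]

theorem single_of_ne {i i' : X.ι} {j j' : Y.ι} (h : ¬ (i = i' ∧ j = j')) {p : ℤ}
    (f : C.Hom (X.obj i) (Y.obj j) (p + Y.deg j - X.deg i)) : single i j f i' j' = 0 := by
  classical
  simp only [single, LinearMap.comp_apply, LinearMap.single_apply]
  by_cases hi : i' = i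
  · subst hi
    rw [Pi.single_eq_same, Pi.single_eq_of_ne (fun e => h ⟨rfl, e.symm⟩)]
  · rw [Pi.single_eq_of_ne hi, Pi.zero_apply]

end AddHom

namespace Pretr

section Entries

variable {C : DGCat.{u, v, w} k}

/-- The formal sum underlying a one-sided twisted complex. -/
def under (X : C.pretr.Obj) : AddObj C := MCObj.obj X.1

/-- The twist of a one-sided twisted complex. -/
def twist (X : C.pretr.Obj) : AddHom C (under X) (under X) 1 := MCObj.q X.1

/-- A matrix, as a morphism of twisted complexes. -/
def ofMat {X Y : C.pretr.Obj} {p : ℤ} :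
    AddHom C (under X) (under Y) p →ₗ[k] C.pretr.Hom X Y p := LinearMap.id

theorem ofMat_comp {X Y Z : C.pretr.Obj} {p q r : ℤ} (h : q + p = r)
    (g : AddHom C (under Y) (under Z) q) (f : AddHom C (under X) (under Y) p) :
    C.pretr.comp h (ofMat g) (ofMat f) = ofMat (AddHom.comp h g f) := rfl

theorem ofMat_d {X Y : C.pretr.Obj} (hX : twist X = 0) (hY : twist Y = 0) {p q : ℤ} (h : p + 1 = q)
    (f : AddHom C (under X) (under Y) p) : C.pretr.d h (ofMat f) = ofMat (AddHom.d h f) := by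
  have h1 : C.pretr.d h (ofMat f) = ofMat (AddHom.d h f + AddHom.comp ((add_comm 1 p).trans h)
      (twist Y) f - dgSign k p • AddHom.comp h f (twist X)) := rfl
  rw [h1, hX, hY, map_zero, map_zero, LinearMap.zero_apply, add_zero, smul_zero, sub_zero]

/-- The matrix entries of an inhomogeneous morphism. -/
def coef (X Y : C.pretr.Obj) (i : (under X).ι) (j : (under Y).ι) :
    C.pretr.THom X Y →ₗ[k] C.THom ((under X).obj i) ((under Y).obj j) :=
  THom.lift fun _ => C.tot ∘ₗ AddHom.entry (X := under X) (Y := under Y) i j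

theorem coef_tot {X Y : C.pretr.Obj} (i : (under X).ι) (j : (under Y).ι) {p : ℤ}
    (f : AddHom C (under X) (under Y) p) : coef X Y i j (C.pretr.tot (ofMat f)) = C.tot (f i j) :=
  THom.lift_tot (A := C.pretr) (fun _ => C.tot ∘ₗ AddHom.entry (X := under X) (Y := under Y) i j)
    (ofMat f)

theorem tot_ind {X Y : C.pretr.Obj} {motive : C.pretr.THom X Y → Prop} (zero : motive 0)
    (tot : ∀ p (f : AddHom C (under X) (under Y) p), motive (C.pretr.tot (ofMat f)))
    (add : ∀ f g, motive f → motive g → motive (f + g)) (f : C.pretr.THom X Y) : motive f :=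
  THom.ind zero tot add f

theorem coef_comp {X Y Z : C.pretr.Obj} (f : C.pretr.THom X Y) (g : C.pretr.THom Y Z)
    (i : (under X).ι) (l : (under Z).ι) :
    coef X Z i l (f ≫ g) = ∑ j, coef X Y i j f ≫ coef Y Z j l g := by
  induction f using tot_ind with
  | zero => simp only [map_zero, Limits.zero_comp, Finset.sum_const_zero]
  | add f f' hf hf' => simp only [map_add, Preadditive.add_comp, hf, hf', Finset.sum_add_distrib]
  | tot p f =>
    induction g using tot_ind with
    | zero => simp only [map_zero, Limits.comp_zero, Finset.sum_const_zero]
    | add g g' hg hg' => simp only [map_add, Preadditive.comp_add, hg, hg', Finset.sum_add_distrib]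
    | tot q g =>
      rw [← C.pretr.tot_comp rfl, ofMat_comp, coef_tot, AddHom.comp_apply, map_sum]
      refine Finset.sum_congr rfl fun j _ => ?_
      rw [coef_tot, coef_tot, C.tot_comp]

theorem comp_coef {X Y : C.pretr.Obj} (f : C.pretr.THom X Y) (i : (under X).ι) (j : (under Y).ι)
    (p : ℤ) : THom.comp k (p + (under Y).deg j - (under X).deg i) (coef X Y i j f) =
      (show AddHom C (under X) (under Y) p from THom.comp k p f) i j := by
  induction f using tot_ind with
  | zero => simp only [map_zero]; rfl
  | add f g hf hg => simp only [map_add, hf, hg]; rfl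
  | tot q f =>
    rw [coef_tot]
    by_cases h : q = p
    · subst h
      rw [THom.comp_tot, THom.comp_tot]
      rfl
    · rw [THom.comp_tot_of_ne h, THom.comp_tot_of_ne (by omega)]
      rfl

theorem coef_ext {X Y : C.pretr.Obj} {f g : C.pretr.THom X Y}
    (h : ∀ i j, coef X Y i j f = coef X Y i j g) : f = g := by
  refine DFinsupp.ext fun p => ?_
  have hp : THom.comp k p f = THom.comp k p g := by
    have h1 : ∀ i j, (show AddHom C (under X) (under Y) p from THom.comp k p f) i j =
        (show AddHom C (under X) (under Y) p from THom.comp k p g) i j := fun i j => by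
      rw [← comp_coef, ← comp_coef, h]
    exact funext fun i => funext fun j => h1 i j
  exact hp

/-- The morphism whose matrix has a single entry. -/
def entry (X Y : C.pretr.Obj) (i : (under X).ι) (j : (under Y).ι) :
    C.THom ((under X).obj i) ((under Y).obj j) →ₗ[k] C.pretr.THom X Y :=
  THom.lift fun p => C.pretr.tot (p := p - (under Y).deg j + (under X).deg i) ∘ₗ ofMat ∘ₗ
    AddHom.single i j ∘ₗ C.castDeg (by omega)

theorem coef_entry {X Y : C.pretr.Obj} (i : (under X).ι) (j : (under Y).ι) {p : ℤ}
    (f : C.Hom ((under X).obj i) ((under Y).obj j) p) (i' : (under X).ι) (j' : (under Y).ι) :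
    coef X Y i' j' (entry X Y i j (C.tot f)) =
      C.tot (AddHom.single (X := under X) (Y := under Y)
        (p := p - (under Y).deg j + (under X).deg i) i j (C.castDeg (by omega) f) i' j') := by
  rw [entry, THom.lift_tot]
  exact coef_tot i' j' _

theorem coef_entry_self {X Y : C.pretr.Obj} (i : (under X).ι) (j : (under Y).ι)
    (f : C.THom ((under X).obj i) ((under Y).obj j)) : coef X Y i j (entry X Y i j f) = f := by
  induction f using THom.ind with
  | zero => simp only [map_zero]
  | add f g hf hg => simp only [map_add, hf, hg]
  | tot p f => rw [coef_entry, AddHom.single_self, C.tot_castDeg]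

theorem coef_entry_of_ne {X Y : C.pretr.Obj} {i i' : (under X).ι} {j j' : (under Y).ι}
    (h : ¬ (i = i' ∧ j = j')) (f : C.THom ((under X).obj i) ((under Y).obj j)) :
    coef X Y i' j' (entry X Y i j f) = 0 := by
  induction f using THom.ind with
  | zero => simp only [map_zero]
  | add f g hf hg => simp only [map_add, hf, hg, add_zero]
  | tot p f => rw [coef_entry, AddHom.single_of_ne h, map_zero]

theorem entry_comp {X Y Z : C.pretr.Obj} (i : (under X).ι) (j : (under Y).ι) (l : (under Z).ι)
    (f : C.THom ((under X).obj i) ((under Y).obj j))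
    (g : C.THom ((under Y).obj j) ((under Z).obj l)) :
    entry X Z i l (f ≫ g) = entry X Y i j f ≫ entry Y Z j l g := by
  refine coef_ext fun a b => ?_
  rw [coef_comp, Finset.sum_eq_single j]
  · by_cases h : i = a ∧ l = b
    · obtain ⟨rfl, rfl⟩ := h
      rw [coef_entry_self, coef_entry_self, coef_entry_self]
    · rw [coef_entry_of_ne h]
      by_cases ha : i = a
      · rw [coef_entry_of_ne (i' := j) (j' := b) (fun e => h ⟨ha, e.2⟩), Limits.comp_zero]
      · rw [coef_entry_of_ne (i' := a) (j' := j) (fun e => ha e.1), Limits.zero_comp]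
  · intro c _ hc
    rw [coef_entry_of_ne (i' := a) (j' := c) (fun e => hc e.2.symm), Limits.zero_comp]
  · exact fun h => absurd (Finset.mem_univ _) h

theorem entry_comp_of_ne {X Y Z : C.pretr.Obj} (i : (under X).ι) {j j' : (under Y).ι}
    (l : (under Z).ι) (hj : j ≠ j') (f : C.THom ((under X).obj i) ((under Y).obj j))
    (g : C.THom ((under Y).obj j') ((under Z).obj l)) :
    entry X Y i j f ≫ entry Y Z j' l g = 0 := by
  refine coef_ext fun a b => ?_
  rw [coef_comp, map_zero]
  refine Finset.sum_eq_zero fun c _ => ?_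
  by_cases hc : j = c
  · rw [coef_entry_of_ne (i' := c) (j' := b) (fun e => hj (hc.trans e.1.symm)), Limits.comp_zero]
  · rw [coef_entry_of_ne (i' := a) (j' := c) (fun e => hc e.2), Limits.zero_comp]

theorem sum_entry {X Y : C.pretr.Obj} (f : C.pretr.THom X Y) :
    ∑ i, ∑ j, entry X Y i j (coef X Y i j f) = f := by
  refine coef_ext fun a b => ?_
  rw [map_sum, Finset.sum_eq_single a, map_sum, Finset.sum_eq_single b, coef_entry_self]
  · exact fun j _ hj => coef_entry_of_ne (fun e => hj e.2) _
  · exact fun h => absurd (Finset.mem_univ _) h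
  · intro i _ hi
    rw [map_sum]
    exact Finset.sum_eq_zero fun j _ => coef_entry_of_ne (fun e => hi e.1) _
  · exact fun h => absurd (Finset.mem_univ _) h

theorem coef_τ {X Y : C.pretr.Obj} (i : (under X).ι) (j : (under Y).ι)
    (hi : (under X).deg i = 0) (hj : (under Y).deg j = 0) (f : C.pretr.THom X Y) :
    coef X Y i j (THom.τ f) = THom.τ (coef X Y i j f) := by
  induction f using tot_ind with
  | zero => simp only [map_zero]
  | add f g hf hg => simp only [map_add, hf, hg]
  | tot p f =>
    have hp : p + (under Y).deg j - (under X).deg i = p := by omega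
    rw [coef_tot, THom.τ_tot, THom.τ_tot, map_smul, coef_tot, congrArg (dgSign k) hp]

theorem coef_δ {X Y : C.pretr.Obj} (hX : twist X = 0) (hY : twist Y = 0) (i : (under X).ι)
    (j : (under Y).ι) (hi : (under X).deg i = 0) (hj : (under Y).deg j = 0)
    (f : C.pretr.THom X Y) : coef X Y i j (THom.δ f) = THom.δ (coef X Y i j f) := by
  induction f using tot_ind with
  | zero => simp only [map_zero]
  | add f g hf hg => simp only [map_add, hf, hg]
  | tot p f =>
    have hp : p + (under Y).deg j - (under X).deg i = p := by omega
    rw [coef_tot, THom.δ_tot, THom.δ_tot, map_smul, ← C.pretr.tot_d rfl, ofMat_d hX hY, coef_tot,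
      AddHom.d_apply, map_smul, C.tot_d, congrArg (dgSign k) hp, congrArg (dgSign k) hj,
      dgSign_zero, one_smul]

end Entries

/-! ### The inclusion of a dg category in its pretriangulated hull -/

section Incl

variable (C : DGCat.{u, v, w} k)

/-- An object, as a formal sum with one term. -/
def singleAdd (x : C.Obj) : AddObj C := ⟨Unit, fun _ => x, fun _ => 0⟩

/-- A morphism, as a matrix with one entry. -/
def singleMat {x y : C.Obj} {p : ℤ} :
    C.Hom x y p →ₗ[k] AddHom C (singleAdd C x) (singleAdd C y) p :=
  LinearMap.pi fun _ => LinearMap.pi fun _ => C.castDeg ((add_zero p).symm.trans (sub_zero _).symm)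

theorem tot_singleMat {x y : C.Obj} {p : ℤ} (f : C.Hom x y p) (i j : Unit) :
    C.tot (x := x) (y := y) (singleMat C f i j) = C.tot f :=
  C.tot_castDeg ((add_zero p).symm.trans (sub_zero _).symm) f

theorem singleMat_d {x y : C.Obj} {p q : ℤ} (h : p + 1 = q) (f : C.Hom x y p) :
    AddHom.d h (singleMat C f) = singleMat C (C.d h f) := by
  funext i j
  refine C.tot_inj (x := x) (y := y) ?_
  change C.tot (dgSign k 0 • C.d _ (C.castDeg _ f)) = C.tot (C.castDeg _ (C.d h f))
  rw [dgSign_zero, one_smul, C.tot_d, C.dtot_castDeg, C.tot_castDeg, C.tot_d]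

theorem singleMat_comp {x y z : C.Obj} {p q r : ℤ} (h : q + p = r) (g : C.Hom y z q)
    (f : C.Hom x y p) :
    AddHom.comp h (singleMat C g) (singleMat C f) = singleMat C (C.comp h g f) := by
  funext i j
  refine C.tot_inj (x := x) (y := z) ?_
  change C.tot (∑ j : Unit, C.comp _ (C.castDeg _ g) (C.castDeg _ f)) =
    C.tot (C.castDeg _ (C.comp h g f))
  rw [Finset.univ_unique, Finset.sum_singleton, C.tot_castDeg, C.tot_comp, C.tot_comp,
    C.tot_castDeg]
  exact congrArg (C.tot f ≫ ·) (tot_singleMat C g () ())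

theorem singleMat_one (x : C.Obj) : singleMat C (C.one x) = AddHom.one (singleAdd C x) := by
  funext i j
  refine C.tot_inj (x := x) (y := x) ?_
  have h : C.tot (x := x) (y := x) (AddHom.one (singleAdd C x) i j) = C.tot (C.one x) :=
    (congrArg (C.tot (x := x) (y := x)) (AddHom.one_self (singleAdd C x) i)).trans
      (C.tot_castDeg _ _)
  exact (tot_singleMat C (C.one x) i j).trans h.symm

/-- An object, as a twisted complex. -/
def single (x : C.Obj) : C.pretr.Obj :=
  ⟨⟨(show C.add.Obj from singleAdd C x), 0, by rw [map_zero, map_zero, add_zero]⟩,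
    fun _ => 0, fun _ _ _ => rfl⟩

/-- The dg functor from a dg category to its pretriangulated hull. -/
def singleFunctor : DGFunctor C C.pretr where
  obj := single C
  map {x y _} := ofMat (X := single C x) (Y := single C y) ∘ₗ singleMat C
  map_d {x y _ _} h f := ((ofMat_d (X := single C x) (Y := single C y) rfl rfl h
    (singleMat C f)).trans (congrArg (ofMat (X := single C x) (Y := single C y))
      (singleMat_d C h f))).symm
  map_comp {x _ z _ _ _} h g f :=
    (congrArg (ofMat (X := single C x) (Y := single C z)) (singleMat_comp C h g f)).symm
  map_one x := congrArg (ofMat (X := single C x) (Y := single C x)) (singleMat_one C x)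

variable {C}

/-- The entry of a morphism between twisted complexes with one term. -/
def coefSingle (x y : C.Obj) :
    C.pretr.THom ((singleFunctor C).obj x) ((singleFunctor C).obj y) →ₗ[k] C.THom x y :=
  coef (single C x) (single C y) () ()

theorem coefSingle_tmap {x y : C.Obj} (f : C.THom x y) :
    coefSingle x y ((singleFunctor C).tmap f) = f := by
  induction f using THom.ind with
  | zero => rw [map_zero, map_zero]
  | add f g hf hg => rw [map_add, map_add, hf, hg]
  | tot p f =>
    rw [DGFunctor.tmap_tot]
    exact (coef_tot (X := single C x) (Y := single C y) () () (singleMat C f)).trans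
      (tot_singleMat C f () ())

theorem singleFunctor_tmap {x y : C.Obj} (f : C.THom x y) :
    (singleFunctor C).tmap f = entry (single C x) (single C y) () () f :=
  coef_ext fun _ _ => (coefSingle_tmap f).trans
    (coef_entry_self (X := single C x) (Y := single C y) () () f).symm

/-- The projection of a twisted complex to one of its terms. -/
def toTerm (X : C.pretr.Obj) (i : (under X).ι) :
    C.pretr.THom X ((singleFunctor C).obj ((under X).obj i)) :=
  entry X (single C ((under X).obj i)) i () (𝟙 (⟨(under X).obj i⟩ : Tot C))

/-- The inclusion of one of its terms in a twisted complex. -/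
def ofTerm (X : C.pretr.Obj) (i : (under X).ι) :
    C.pretr.THom ((singleFunctor C).obj ((under X).obj i)) X :=
  entry (single C ((under X).obj i)) X () i (𝟙 (⟨(under X).obj i⟩ : Tot C))

theorem ofTerm_toTerm_self (X : C.pretr.Obj) (i : (under X).ι) : ofTerm X i ≫ toTerm X i = 𝟙 _ := by
  refine (entry_comp (X := single C ((under X).obj i)) (Z := single C ((under X).obj i)) () i ()
    (𝟙 (⟨(under X).obj i⟩ : Tot C)) (𝟙 (⟨(under X).obj i⟩ : Tot C))).symm.trans ?_
  refine (congrArg (entry (single C ((under X).obj i)) (single C ((under X).obj i)) () ())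
    (Category.comp_id (𝟙 (⟨(under X).obj i⟩ : Tot C)))).trans ?_
  exact (singleFunctor_tmap (𝟙 (⟨(under X).obj i⟩ : Tot C))).symm.trans
    ((singleFunctor C).tmap_id _)

theorem ofTerm_toTerm_of_ne (X : C.pretr.Obj) {i j : (under X).ι} (h : i ≠ j) :
    ofTerm X i ≫ toTerm X j = 0 :=
  entry_comp_of_ne (X := single C ((under X).obj i)) (Z := single C ((under X).obj j)) () () h
    (𝟙 (⟨(under X).obj i⟩ : Tot C)) (𝟙 (⟨(under X).obj j⟩ : Tot C))

theorem toTerm_tmap_ofTerm {X Y : C.pretr.Obj} (i : (under X).ι) (j : (under Y).ι)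
    (f : C.THom ((under X).obj i) ((under Y).obj j)) :
    toTerm X i ≫ (singleFunctor C).tmap f ≫ ofTerm Y j = entry X Y i j f := by
  rw [singleFunctor_tmap]
  have h1 : entry (single C ((under X).obj i)) Y () j f = entry (single C ((under X).obj i))
      (single C ((under Y).obj j)) () () f ≫ ofTerm Y j :=
    (congrArg (entry (single C ((under X).obj i)) Y () j) (Category.comp_id f)).symm.trans
      (entry_comp (X := single C ((under X).obj i)) (Y := single C ((under Y).obj j))
        (Z := Y) () () j f (𝟙 (⟨(under Y).obj j⟩ : Tot C)))
  have h2 : entry X Y i j f = toTerm X i ≫ entry (single C ((under X).obj i)) Y () j f :=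
    (congrArg (entry X Y i j) (Category.id_comp f)).symm.trans
      (entry_comp (X := X) (Y := single C ((under X).obj i)) (Z := Y) i () j
        (𝟙 (⟨(under X).obj i⟩ : Tot C)) f)
  rw [h2]
  exact congrArg (toTerm X i ≫ ·) h1.symm

theorem toTerm_single (x : C.Obj) : toTerm (single C x) () = 𝟙 _ :=
  (singleFunctor_tmap (𝟙 (⟨x⟩ : Tot C))).symm.trans ((singleFunctor C).tmap_id x)

theorem ofTerm_single (x : C.Obj) : ofTerm (single C x) () = 𝟙 _ :=
  (singleFunctor_tmap (𝟙 (⟨x⟩ : Tot C))).symm.trans ((singleFunctor C).tmap_id x)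

end Incl

section Functor

variable {A : DGCat.{u, v, w} k} {C : DGCat.{u, v', w'} k} (F : DGFunctor A C)

theorem coef_tmap {X Y : A.pretr.Obj} (f : A.pretr.THom X Y) (i : (under X).ι) (j : (under Y).ι) :
    coef (F.pretr.obj X) (F.pretr.obj Y) i j (F.pretr.tmap f) = F.tmap (coef X Y i j f) := by
  induction f using tot_ind with
  | zero => simp only [map_zero]; rfl
  | add f g hf hg => simp only [map_add, hf, hg]; rfl
  | tot p f =>
    rw [coef_tot, DGFunctor.tmap_tot, DGFunctor.tmap_tot]
    exact coef_tot (X := F.pretr.obj X) (Y := F.pretr.obj Y) i j _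

theorem tmap_entry {X Y : A.pretr.Obj} (i : (under X).ι) (j : (under Y).ι)
    (f : A.THom ((under X).obj i) ((under Y).obj j)) :
    F.pretr.tmap (entry X Y i j f) = entry (F.pretr.obj X) (F.pretr.obj Y) i j (F.tmap f) := by
  refine coef_ext fun a b => (coef_tmap F _ a b).trans ?_
  by_cases h : i = a ∧ j = b
  · obtain ⟨rfl, rfl⟩ := h
    rw [coef_entry_self]
    exact (coef_entry_self (X := F.pretr.obj X) (Y := F.pretr.obj Y) i j _).symm
  · rw [coef_entry_of_ne h, map_zero]
    exact (coef_entry_of_ne (X := F.pretr.obj X) (Y := F.pretr.obj Y) h _).symm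

end Functor

end Pretr

end DGCat

/-! ### Words for the twisted complexes over a dg quotient -/

namespace DGCat

namespace Pretr

open Words

variable {k : Type u} [CommRing k] {A : DGCat.{u, u, u} k} {B : Set A.Obj}

variable (B) in
/-- The morphisms of twisted complexes with one term which are given by morphisms of the dg
quotient. -/
def quotEntry (x y : A.Obj) : QTHom B x y →ₗ[k]
    (A.quot B).pretr.THom ((A.quotFunctor B).pretr.obj ((singleFunctor A).obj x))
      ((A.quotFunctor B).pretr.obj ((singleFunctor A).obj y)) :=
  entry ((A.quotFunctor B).pretr.obj (single A x)) ((A.quotFunctor B).pretr.obj (single A y)) () ()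

theorem quotEntry_comp {x y z : A.Obj} (f : QTHom B x y) (g : QTHom B y z) :
    quotEntry B x z (f ≫ g) = quotEntry B x y f ≫ quotEntry B y z g :=
  entry_comp (X := (A.quotFunctor B).pretr.obj (single A x))
    (Y := (A.quotFunctor B).pretr.obj (single A y))
    (Z := (A.quotFunctor B).pretr.obj (single A z)) () () () f g

theorem quotEntry_tmap {x y : A.Obj} (f : A.THom x y) :
    quotEntry B x y ((A.quotFunctor B).tmap f) =
      (A.quotFunctor B).pretr.tmap ((singleFunctor A).tmap f) := by
  rw [singleFunctor_tmap]
  exact (tmap_entry (A.quotFunctor B) (X := single A x) (Y := single A y) () () f).symm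

theorem twist_quot_single (x : A.Obj) :
    twist ((A.quotFunctor B).pretr.obj (single A x)) = 0 :=
  map_zero ((A.quotFunctor B).mapAddHom (X := singleAdd A x) (Y := singleAdd A x) (p := 1))

/-- The matrix entry of a morphism between twisted complexes with one term. -/
def quotCoefSingle (x y : A.Obj) :
    (A.quot B).pretr.THom ((A.quotFunctor B).pretr.obj ((singleFunctor A).obj x))
      ((A.quotFunctor B).pretr.obj ((singleFunctor A).obj y)) →ₗ[k] QTHom B x y :=
  coef ((A.quotFunctor B).pretr.obj (single A x)) ((A.quotFunctor B).pretr.obj (single A y)) () ()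

theorem quotCoefSingle_quotEntry {x y : A.Obj} (f : QTHom B x y) :
    quotCoefSingle x y (quotEntry B x y f) = f :=
  coef_entry_self (X := (A.quotFunctor B).pretr.obj (single A x))
    (Y := (A.quotFunctor B).pretr.obj (single A y)) () () f

theorem quotCoefSingle_injective (x y : A.Obj) :
    Function.Injective (quotCoefSingle (B := B) x y) :=
  fun _ _ h => coef_ext (X := (A.quotFunctor B).pretr.obj (single A x))
    (Y := (A.quotFunctor B).pretr.obj (single A y)) fun _ _ => h

theorem τ_quotEntry {x y : A.Obj} (f : QTHom B x y) :
    THom.τ (quotEntry B x y f) = quotEntry B x y (THom.τ f) := by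
  apply quotCoefSingle_injective
  rw [quotCoefSingle_quotEntry]
  refine (coef_τ (X := (A.quotFunctor B).pretr.obj (single A x))
    (Y := (A.quotFunctor B).pretr.obj (single A y)) () () rfl rfl _).trans ?_
  exact congrArg THom.τ (quotCoefSingle_quotEntry f)

theorem δ_quotEntry {x y : A.Obj} (f : QTHom B x y) :
    THom.δ (quotEntry B x y f) = quotEntry B x y (THom.δ f) := by
  apply quotCoefSingle_injective
  rw [quotCoefSingle_quotEntry]
  refine (coef_δ (X := (A.quotFunctor B).pretr.obj (single A x))
    (Y := (A.quotFunctor B).pretr.obj (single A y)) (twist_quot_single x) (twist_quot_single y)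
    () () rfl rfl _).trans ?_
  exact congrArg THom.δ (quotCoefSingle_quotEntry f)

/-- The contraction of an object of `B`, as a twisted complex over the dg quotient. -/
def quotEps (U : B) : (A.quot B).pretr.THom
    ((A.quotFunctor B).pretr.obj ((singleFunctor A).obj U))
    ((A.quotFunctor B).pretr.obj ((singleFunctor A).obj U)) :=
  quotEntry B U U (qeps U)

theorem τ_quotEps (U : B) : THom.τ (quotEps U) = -quotEps U := by
  rw [quotEps, τ_quotEntry, τ_qeps, map_neg]

theorem δ_quotEps (U : B) : THom.δ (quotEps U) = -𝟙 (⟨(A.quotFunctor B).pretr.obj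
    ((singleFunctor A).obj U)⟩ : Tot (A.quot B).pretr) := by
  rw [quotEps, δ_quotEntry, δ_qeps, map_neg, ← (A.quotFunctor B).tmap_id, quotEntry_tmap,
    DGFunctor.tmap_id, DGFunctor.tmap_id]

variable (B) in
/-- The matrix entries of a morphism of twisted complexes over the dg quotient. -/
def quotCoef (X Y : A.pretr.Obj) (i : (under X).ι) (j : (under Y).ι) :
    (A.quot B).pretr.THom ((A.quotFunctor B).pretr.obj X) ((A.quotFunctor B).pretr.obj Y) →ₗ[k]
      QTHom B ((under X).obj i) ((under Y).obj j) :=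
  coef ((A.quotFunctor B).pretr.obj X) ((A.quotFunctor B).pretr.obj Y) i j

theorem quotCoef_tmap {X Y : A.pretr.Obj} (f : A.pretr.THom X Y) (i : (under X).ι)
    (j : (under Y).ι) : quotCoef B X Y i j ((A.quotFunctor B).pretr.tmap f) =
      (A.quotFunctor B).tmap (coef X Y i j f) :=
  coef_tmap (A.quotFunctor B) f i j

theorem quotCoef_comp {X Y Z : A.pretr.Obj}
    (f : (A.quot B).pretr.THom ((A.quotFunctor B).pretr.obj X) ((A.quotFunctor B).pretr.obj Y))
    (g : (A.quot B).pretr.THom ((A.quotFunctor B).pretr.obj Y) ((A.quotFunctor B).pretr.obj Z))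
    (i : (under X).ι) (l : (under Z).ι) :
    quotCoef B X Z i l (f ≫ g) = ∑ j, quotCoef B X Y i j f ≫ quotCoef B Y Z j l g :=
  coef_comp (X := (A.quotFunctor B).pretr.obj X) (Y := (A.quotFunctor B).pretr.obj Y)
    (Z := (A.quotFunctor B).pretr.obj Z) f g i l

theorem quotEntry_eq_entry {X Y : A.pretr.Obj} (i : (under X).ι) (j : (under Y).ι)
    (f : QTHom B ((under X).obj i) ((under Y).obj j)) :
    (A.quotFunctor B).pretr.tmap (toTerm X i) ≫ quotEntry B _ _ f ≫
      (A.quotFunctor B).pretr.tmap (ofTerm Y j) =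
    entry ((A.quotFunctor B).pretr.obj X) ((A.quotFunctor B).pretr.obj Y) i j f := by
  let FX := (A.quotFunctor B).pretr.obj X
  let FY := (A.quotFunctor B).pretr.obj Y
  let Fx := (A.quotFunctor B).pretr.obj (single A ((under X).obj i))
  let Fy := (A.quotFunctor B).pretr.obj (single A ((under Y).obj j))
  have h1 : (A.quotFunctor B).pretr.tmap (toTerm X i) = entry FX Fx i ()
      (𝟙 (⟨(A.quotFunctor B).obj ((under X).obj i)⟩ : Tot (A.quot B))) :=
    (tmap_entry (A.quotFunctor B) (X := X) (Y := single A ((under X).obj i)) i ()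
      (𝟙 (⟨(under X).obj i⟩ : Tot A))).trans
        (congrArg (entry FX Fx i ()) ((A.quotFunctor B).tmap_id ((under X).obj i)))
  have h2 : (A.quotFunctor B).pretr.tmap (ofTerm Y j) = entry Fy FY () j
      (𝟙 (⟨(A.quotFunctor B).obj ((under Y).obj j)⟩ : Tot (A.quot B))) :=
    (tmap_entry (A.quotFunctor B) (X := single A ((under Y).obj j)) (Y := Y) () j
      (𝟙 (⟨(under Y).obj j⟩ : Tot A))).trans
        (congrArg (entry Fy FY () j) ((A.quotFunctor B).tmap_id ((under Y).obj j)))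
  have h3 : entry Fx FY () j f = quotEntry B _ _ f ≫ (A.quotFunctor B).pretr.tmap (ofTerm Y j) := by
    rw [h2]
    exact (congrArg (entry Fx FY () j) (Category.comp_id f)).symm.trans
      (entry_comp (X := Fx) (Y := Fy) (Z := FY) () () j f
        (𝟙 (⟨(A.quotFunctor B).obj ((under Y).obj j)⟩ : Tot (A.quot B))))
  have h4 : entry FX FY i j f =
      (A.quotFunctor B).pretr.tmap (toTerm X i) ≫ entry Fx FY () j f := by
    rw [h1]
    exact (congrArg (entry FX FY i j) (Category.id_comp f)).symm.trans
      (entry_comp (X := FX) (Y := Fx) (Z := FY) i () j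
        (𝟙 (⟨(A.quotFunctor B).obj ((under X).obj i)⟩ : Tot (A.quot B))) f)
  rw [h4, h3]

theorem sum_quotEntry {X Y : A.pretr.Obj} (f : (A.quot B).pretr.THom
    ((A.quotFunctor B).pretr.obj X) ((A.quotFunctor B).pretr.obj Y)) :
    ∑ i, ∑ j, (A.quotFunctor B).pretr.tmap (toTerm X i) ≫ quotEntry B _ _ (quotCoef B X Y i j f) ≫
      (A.quotFunctor B).pretr.tmap (ofTerm Y j) = f := by
  refine Eq.trans ?_ (sum_entry (X := (A.quotFunctor B).pretr.obj X)
    (Y := (A.quotFunctor B).pretr.obj Y) f)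
  refine Finset.sum_congr rfl fun i _ => Finset.sum_congr rfl fun j _ => ?_
  exact quotEntry_eq_entry i j _

variable [DecidableEq B]

variable (B) in
/-- The words for the twisted complexes over the dg quotient. -/
abbrev WordsOf (Y X : A.pretr.Obj) : Type u := All (fun U : B => (singleFunctor A).obj U) Y X

/-- The right action of the morphisms of twisted complexes over the dg quotient on words. -/
def matAct {X Z : A.pretr.Obj} (Y : A.pretr.Obj) : (A.quot B).pretr.THom
    ((A.quotFunctor B).pretr.obj X) ((A.quotFunctor B).pretr.obj Z) →ₗ[k]
      WordsOf B Y Z →ₗ[k] WordsOf B Y X :=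
  LinearMap.mk₂ k (fun f w => ∑ i, ∑ j, actOf _ (toTerm X i) (act (singleFunctor A)
    (quotCoef B X Z i j f) (actOf _ (ofTerm Z j) w)))
    (fun f f' w => by simp only [map_add, LinearMap.add_apply, Finset.sum_add_distrib])
    (fun c f w => by simp only [map_smul, LinearMap.smul_apply, Finset.smul_sum])
    (fun f w w' => by simp only [map_add, Finset.sum_add_distrib])
    (fun c f w => by simp only [map_smul, Finset.smul_sum])

theorem matAct_apply {X Y Z : A.pretr.Obj} (f : (A.quot B).pretr.THom
    ((A.quotFunctor B).pretr.obj X) ((A.quotFunctor B).pretr.obj Z)) (w : WordsOf B Y Z) :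
    matAct Y f w = ∑ i, ∑ j, actOf _ (toTerm X i) (act (singleFunctor A) (quotCoef B X Z i j f)
      (actOf _ (ofTerm Z j) w)) := rfl

theorem matAct_tmap {X Y Z : A.pretr.Obj} (f : A.pretr.THom X Z) (w : WordsOf B Y Z) :
    matAct Y ((A.quotFunctor B).pretr.tmap f) w = actOf _ f w := by
  rw [matAct_apply]
  conv_rhs => rw [← sum_entry f]
  simp only [map_sum, LinearMap.sum_apply]
  refine Finset.sum_congr rfl fun i _ => Finset.sum_congr rfl fun j _ => ?_
  rw [quotCoef_tmap, act_of, ← actOf_comp, ← actOf_comp, ← toTerm_tmap_ofTerm, Category.assoc]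

theorem matAct_comp {W X Y Z : A.pretr.Obj}
    (f : (A.quot B).pretr.THom ((A.quotFunctor B).pretr.obj W) ((A.quotFunctor B).pretr.obj X))
    (g : (A.quot B).pretr.THom ((A.quotFunctor B).pretr.obj X) ((A.quotFunctor B).pretr.obj Z))
    (w : WordsOf B Y Z) : matAct Y (f ≫ g) w = matAct Y f (matAct Y g w) := by
  have h : ∀ j, actOf _ (ofTerm X j) (matAct Y g w) =
      ∑ l, act (singleFunctor A) (quotCoef B X Z j l g) (actOf _ (ofTerm Z l) w) := by
    intro j
    rw [matAct_apply]
    simp only [map_sum]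
    rw [Finset.sum_eq_single j]
    · refine Finset.sum_congr rfl fun l _ => ?_
      rw [← actOf_comp, ofTerm_toTerm_self, actOf_id]
    · intro i _ hi
      refine Finset.sum_eq_zero fun l _ => ?_
      rw [← actOf_comp, ofTerm_toTerm_of_ne X hi.symm, map_zero, LinearMap.zero_apply]
    · exact fun hj => absurd (Finset.mem_univ _) hj
  rw [matAct_apply, matAct_apply]
  refine Finset.sum_congr rfl fun i _ => ?_
  simp only [h, quotCoef_comp, map_sum, LinearMap.sum_apply, act_comp]
  exact Finset.sum_comm

theorem matAct_quotEps {Y : A.pretr.Obj} (U : B)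
    (w : WordsOf B Y ((singleFunctor A).obj U)) :
    matAct Y (quotEps U) w = actEps (singleFunctor A) U w := by
  rw [matAct_apply]
  refine (Finset.sum_singleton _ ()).trans ((Finset.sum_singleton _ ()).trans ?_)
  have h1 : ofTerm ((singleFunctor A).obj U) () = 𝟙 _ := ofTerm_single (U : A.Obj)
  have h2 : toTerm ((singleFunctor A).obj U) () = 𝟙 _ := toTerm_single (U : A.Obj)
  have h3 : quotCoef B ((singleFunctor A).obj U) ((singleFunctor A).obj U) () () (quotEps U) =
    qeps U := quotCoefSingle_quotEntry (qeps U)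
  rw [h1, h2, h3]
  refine (actOf_id _ _).trans ?_
  refine (LinearMap.congr_fun (act_qeps (singleFunctor A) U) _).trans ?_
  exact congrArg _ (actOf_id _ w)

theorem evalAll_matAct {X Y Z : A.pretr.Obj} (f : (A.quot B).pretr.THom
    ((A.quotFunctor B).pretr.obj X) ((A.quotFunctor B).pretr.obj Z)) (w : WordsOf B Y Z) :
    evalAll _ (A.quotFunctor B).pretr quotEps (matAct Y f w) =
      f ≫ evalAll _ (A.quotFunctor B).pretr quotEps w := by
  rw [matAct_apply]
  conv_rhs => rw [← sum_quotEntry f]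
  simp only [map_sum, Preadditive.sum_comp]
  refine Finset.sum_congr rfl fun i _ => Finset.sum_congr rfl fun j _ => ?_
  rw [evalAll_actOf, evalAll_act (singleFunctor A) (A.quotFunctor B).pretr quotEps
    (fun {x y} => quotEntry B x y) quotEntry_comp quotEntry_tmap fun U => rfl, evalAll_actOf]
  simp only [Category.assoc]

/-- Every morphism of twisted complexes over the dg quotient is the value of a combination of
words. -/
theorem evalAll_surjective (X Y : A.pretr.Obj) : Function.Surjective
    (evalAll (fun U : B => (singleFunctor A).obj U) (A.quotFunctor B).pretr quotEps
      (x := X) (Y := Y)) := fun f => by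
  refine ⟨matAct Y f (unit _), ?_⟩
  rw [evalAll_matAct, evalAll_unit, Category.comp_id]

/-- The value of a word, acting on the unit word, gives back the word. -/
theorem matAct_eval_unit (n : ℕ) {X Y : A.pretr.Obj}
    (r : (mod (fun U : B => (singleFunctor A).obj U) Y n).carrier X) :
    matAct Y (Words.eval _ (A.quotFunctor B).pretr quotEps n r) (unit _) = incl _ n X r := by
  induction n generalizing X with
  | zero => exact (matAct_tmap r _).trans (actOf_unit _ r)
  | succ n ih =>
    have h : (matAct Y).flip (unit _) ∘ₗ Words.eval (fun U : B => (singleFunctor A).obj U)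
        (A.quotFunctor B).pretr quotEps (n + 1) = incl _ (n + 1) X :=
      cons_hom_ext _ n fun i r f => by
        rw [LinearMap.comp_apply, LinearMap.flip_apply, eval_succ, matAct_comp, matAct_comp, ih,
          matAct_quotEps, actEps_incl, matAct_tmap, actOf_incl, act_cons]
        exact congrArg (fun g => incl _ (n + 1) X (cons _ n i X r g)) (Category.comp_id f)
    exact LinearMap.congr_fun h r

/-- The combinations of words are determined by their values. -/
theorem evalAll_injective (X Y : A.pretr.Obj) : Function.Injective
    (evalAll (fun U : B => (singleFunctor A).obj U) (A.quotFunctor B).pretr quotEps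
      (x := X) (Y := Y)) := by
  have h : (matAct Y).flip (unit _) ∘ₗ evalAll (fun U : B => (singleFunctor A).obj U)
      (A.quotFunctor B).pretr quotEps (x := X) (Y := Y) = LinearMap.id :=
    hom_ext _ fun n r => by
      rw [LinearMap.comp_apply, evalAll_incl, LinearMap.flip_apply, matAct_eval_unit,
        LinearMap.id_apply]
  exact Function.LeftInverse.injective (g := fun f => matAct Y f (unit _)) (LinearMap.congr_fun h)

end Pretr

end DGCat

/-! ### Homotopically flat complexes of morphisms -/

namespace TensorComplex

open TensorProduct

variable {k : Type u} [CommRing k] (K L : CochainComplex (ModuleCat.{u} k) ℤ)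

/-- The inclusion of a summand of the tensor product of two cochain complexes of modules. -/
def inc {p q n : ℤ} (h : p + q = n) :
    K.X p ⊗[k] L.X q →ₗ[k] ((MonoidalCategory.tensorObj K L).X n : ModuleCat k) :=
  (HomologicalComplex.ιTensorObj K L p q n h).hom

/-- The linear map out of the tensor product of two cochain complexes of modules given by a family
of linear maps. -/
def desc {n : ℤ} {M : Type u} [AddCommGroup M] [Module k M]
    (φ : ∀ p q, p + q = n → (K.X p ⊗[k] L.X q →ₗ[k] M)) :
    ((MonoidalCategory.tensorObj K L).X n : ModuleCat k) →ₗ[k] M :=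
  (HomologicalComplex.mapBifunctorDesc (K₁ := K) (K₂ := L)
    (F := MonoidalCategory.curriedTensor (ModuleCat k)) (c := ComplexShape.up ℤ)
    (A := ModuleCat.of k M) (j := n) (fun p q h => ModuleCat.ofHom (φ p q h))).hom

theorem desc_inc {n : ℤ} {M : Type u} [AddCommGroup M] [Module k M]
    (φ : ∀ p q, p + q = n → (K.X p ⊗[k] L.X q →ₗ[k] M)) {p q : ℤ} (h : p + q = n)
    (z : K.X p ⊗[k] L.X q) : desc K L φ (inc K L h z) = φ p q h z :=
  LinearMap.congr_fun (congrArg ModuleCat.Hom.hom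
    (HomologicalComplex.ι_mapBifunctorDesc (K₁ := K) (K₂ := L)
    (F := MonoidalCategory.curriedTensor (ModuleCat k)) (c := ComplexShape.up ℤ)
    (A := ModuleCat.of k M) (j := n) (fun p q h => ModuleCat.ofHom (φ p q h)) p q h)) z

theorem hom_ext {n : ℤ} {M : Type u} [AddCommGroup M] [Module k M]
    {φ ψ : ((MonoidalCategory.tensorObj K L).X n : ModuleCat k) →ₗ[k] M}
    (H : ∀ p q (h : p + q = n) (a : K.X p) (b : L.X q),
      φ (inc K L h (a ⊗ₜ b)) = ψ (inc K L h (a ⊗ₜ b))) : φ = ψ := by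
  have : (ModuleCat.ofHom φ : (MonoidalCategory.tensorObj K L).X n ⟶ ModuleCat.of k M) =
      ModuleCat.ofHom ψ := by
    refine HomologicalComplex.mapBifunctor.hom_ext (K₁ := K) (K₂ := L)
      (F := MonoidalCategory.curriedTensor (ModuleCat k)) (c := ComplexShape.up ℤ)
      fun p q h => ModuleCat.hom_ext (TensorProduct.ext' fun a b => H p q h a b)
  exact congrArg ModuleCat.Hom.hom this

theorem d_inc {p q n : ℤ} (h : p + q = n) (a : K.X p) (b : L.X q) :
    ((MonoidalCategory.tensorObj K L).d n (n + 1)).hom (inc K L h (a ⊗ₜ b)) =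
      inc K L (by omega) ((K.d p (p + 1)).hom a ⊗ₜ[k] b) +
        dgSign k p • inc K L (by omega) (a ⊗ₜ[k] (L.d q (q + 1)).hom b) := by
  have e : HomologicalComplex.ιTensorObj K L p q n h ≫
      (HomologicalComplex.tensorObj K L).d n (n + 1) =
        HomologicalComplex.mapBifunctor.d₁ K L (MonoidalCategory.curriedTensor (ModuleCat k))
          (ComplexShape.up ℤ) p q (n + 1) +
        HomologicalComplex.mapBifunctor.d₂ K L (MonoidalCategory.curriedTensor (ModuleCat k))
          (ComplexShape.up ℤ) p q (n + 1) := by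
    rw [HomologicalComplex.mapBifunctor.d_eq, Preadditive.comp_add,
      HomologicalComplex.mapBifunctor.ι_D₁, HomologicalComplex.mapBifunctor.ι_D₂]
  rw [HomologicalComplex.mapBifunctor.d₁_eq (i₁' := p + 1) _ _ _ _ rfl _ _
        (show p + 1 + q = n + 1 by omega),
      HomologicalComplex.mapBifunctor.d₂_eq (i₂' := q + 1) _ _ _ _ _ rfl _
        (show p + (q + 1) = n + 1 by omega)] at e
  refine (LinearMap.congr_fun (congrArg ModuleCat.Hom.hom e) (a ⊗ₜ b)).trans ?_
  have e1 : ComplexShape.ε₁ (ComplexShape.up ℤ) (ComplexShape.up ℤ) (ComplexShape.up ℤ) (p, q)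
      = 1 := rfl
  have e2 : ComplexShape.ε₂ (ComplexShape.up ℤ) (ComplexShape.up ℤ) (ComplexShape.up ℤ) (p, q)
      = p.negOnePow := rfl
  rw [e1, e2, one_smul]
  refine congrArg₂ (fun a b : ((MonoidalCategory.tensorObj K L).X (n + 1) : ModuleCat k) => a + b)
    rfl ?_
  refine Eq.trans ?_ (Int.cast_smul_eq_zsmul k _ _).symm
  rfl

end TensorComplex

namespace DGCat

open TensorProduct

variable {k : Type u} [CommRing k]

theorem acyclic_iff (K : CochainComplex (ModuleCat.{u} k) ℤ) :
    K.Acyclic ↔ ∀ p (x : K.X (p + 1)), (K.d (p + 1) (p + 1 + 1)).hom x = 0 →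
      ∃ y : K.X p, (K.d p (p + 1)).hom y = x := by
  have key : ∀ p, K.ExactAt (p + 1) ↔ ∀ x : K.X (p + 1), (K.d (p + 1) (p + 1 + 1)).hom x = 0 →
      ∃ y : K.X p, (K.d p (p + 1)).hom y = x := fun p => by
    rw [K.exactAt_iff' p (p + 1) (p + 1 + 1) (by simp) (by simp)]
    exact ShortComplex.moduleCat_exact_iff _
  refine ⟨fun h p => (key p).1 (h _), fun h p => ?_⟩
  obtain ⟨q, rfl⟩ : ∃ q, p = q + 1 := ⟨p - 1, by omega⟩
  exact (key q).2 (h q)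

namespace DMod

variable (C : DMod k)

/-- The unrolling of a differential module: the cochain complex which is `C` in each degree, with
the differential `(-1)^p d` in degree `p`. -/
def unroll : CochainComplex (ModuleCat.{u} k) ℤ :=
  CochainComplex.of (fun _ => ModuleCat.of k C.carrier)
    (fun p => ModuleCat.ofHom (dgSign k p • C.d))
    (fun p => by
      ext c
      change dgSign k (p + 1) • C.d (dgSign k p • C.d c) = 0
      rw [map_smul, C.d_d, smul_zero, smul_zero])

/-- The differential of the unrolling, as an endomorphism of the given module. -/
def unrollD (p : ℤ) : C.carrier →ₗ[k] C.carrier := (C.unroll.d p (p + 1)).hom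

theorem unrollD_eq (p : ℤ) : C.unrollD p = dgSign k p • C.d :=
  congrArg ModuleCat.Hom.hom (CochainComplex.of_d (fun _ : ℤ => ModuleCat.of k C.carrier)
    (fun p => ModuleCat.ofHom (dgSign k p • C.d)) p)

theorem unroll_acyclic (hC : C.Acyclic) : C.unroll.Acyclic := by
  rw [acyclic_iff]
  intro p
  change ∀ c : C.carrier, C.unrollD (p + 1) c = 0 → ∃ b : C.carrier, C.unrollD p b = c
  intro c hc
  obtain ⟨b, hb⟩ := hC c (by
    rw [unrollD_eq, LinearMap.smul_apply] at hc
    have h := congrArg (fun c => dgSign k (p + 1) • c) hc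
    simpa only [smul_smul, dgSign_mul_self, one_smul, smul_zero] using h)
  refine ⟨dgSign k p • b, ?_⟩
  rw [unrollD_eq, LinearMap.smul_apply, map_smul, hb, smul_smul, dgSign_mul_self, one_smul]

end DMod

variable {A : DGCat.{u, v, u} k}

variable (A) in
/-- The differential of the complex of morphisms. -/
def homComplexD (x y : A.Obj) (p : ℤ) : A.Hom x y p →ₗ[k] A.Hom x y (p + 1) :=
  ((A.homComplex x y).d p (p + 1)).hom

theorem homComplexD_eq (x y : A.Obj) (p : ℤ) : A.homComplexD x y p = A.d rfl :=
  congrArg ModuleCat.Hom.hom (CochainComplex.of_d (fun p => ModuleCat.of k (A.Hom x y p))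
    (fun _ => ModuleCat.ofHom (A.d rfl)) p)

namespace DMod

variable (C : DMod k) (x y : A.Obj)

/-- The tensor product of the unrolling with the complex of morphisms. -/
abbrev unrollTensor : CochainComplex (ModuleCat.{u} k) ℤ :=
  MonoidalCategory.tensorObj C.unroll (A.homComplex x y)

/-- The inclusion of a summand. -/
def unrollInc {p q n : ℤ} (h : p + q = n) :
    C.carrier ⊗[k] A.Hom x y q →ₗ[k] ((C.unrollTensor x y).X n : ModuleCat k) :=
  TensorComplex.inc C.unroll (A.homComplex x y) h

theorem d_unrollInc {p q n : ℤ} (h : p + q = n) (c : C.carrier) (f : A.Hom x y q) :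
    ((C.unrollTensor x y).d n (n + 1)).hom (C.unrollInc x y h (c ⊗ₜ f)) =
      dgSign k p • (C.unrollInc x y (p := p + 1) (by omega) (C.d c ⊗ₜ f) +
        C.unrollInc x y (p := p) (by omega) (c ⊗ₜ A.d rfl f)) := by
  have e := TensorComplex.d_inc C.unroll (A.homComplex x y) h c f
  have e1 : ((C.unroll.d p (p + 1)).hom c : C.carrier) = dgSign k p • C.d c :=
    LinearMap.congr_fun (C.unrollD_eq p) c
  have e2 : (((A.homComplex x y).d q (q + 1)).hom f : A.Hom x y (q + 1)) = A.d rfl f :=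
    LinearMap.congr_fun (A.homComplexD_eq x y q) f
  refine e.trans ?_
  rw [smul_add]
  refine congrArg₂ (fun a b : ((C.unrollTensor x y).X (n + 1) : ModuleCat k) => a + b) ?_ ?_
  · refine Eq.trans (congrArg (fun c : C.carrier =>
      C.unrollInc x y (p := p + 1) (show p + 1 + q = n + 1 by omega) (c ⊗ₜ[k] f)) e1) ?_
    rw [← TensorProduct.smul_tmul', map_smul]
  · exact congrArg (fun f : A.Hom x y (q + 1) => dgSign k p •
      C.unrollInc x y (p := p) (show p + (q + 1) = n + 1 by omega) (c ⊗ₜ[k] f)) e2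

/-- The comparison of the ungraded with the graded tensor product. -/
def toUnroll (n : ℤ) : C.carrier ⊗[k] A.THom x y →ₗ[k] ((C.unrollTensor x y).X n : ModuleCat k) :=
  TensorProduct.lift (THom.lift fun q => (TensorProduct.mk k C.carrier (A.Hom x y q)).flip.compr₂
    (C.unrollInc x y (p := n - q) (by omega))).flip

theorem toUnroll_tmul_tot {p q n : ℤ} (h : p + q = n) (c : C.carrier) (f : A.Hom x y q) :
    C.toUnroll x y n (c ⊗ₜ A.tot f) = C.unrollInc x y h (c ⊗ₜ f) := by
  obtain rfl : p = n - q := by omega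
  rw [toUnroll, TensorProduct.lift.tmul, LinearMap.flip_apply, THom.lift_tot]
  rfl

/-- The comparison of the graded with the ungraded tensor product. -/
def ofUnroll (n : ℤ) : ((C.unrollTensor x y).X n : ModuleCat k) →ₗ[k] C.carrier ⊗[k] A.THom x y :=
  TensorComplex.desc C.unroll (A.homComplex x y) fun _ q _ =>
    (LinearMap.lTensor C.carrier (A.tot (p := q)) :
      C.carrier ⊗[k] A.Hom x y q →ₗ[k] C.carrier ⊗[k] A.THom x y)

theorem ofUnroll_inc {p q n : ℤ} (h : p + q = n) (c : C.carrier) (f : A.Hom x y q) :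
    C.ofUnroll x y n (C.unrollInc x y h (c ⊗ₜ f)) = c ⊗ₜ A.tot f :=
  TensorComplex.desc_inc C.unroll (A.homComplex x y) _ h (c ⊗ₜ f)

variable {x y}

theorem tensor_ind {motive : C.carrier ⊗[k] A.THom x y → Prop} (zero : motive 0)
    (tmul : ∀ (c : C.carrier) (p : ℤ) (f : A.Hom x y p), motive (c ⊗ₜ A.tot f))
    (add : ∀ z z', motive z → motive z' → motive (z + z')) (z : C.carrier ⊗[k] A.THom x y) :
    motive z := by
  induction z using TensorProduct.induction_on with
  | zero => exact zero
  | add z z' h h' => exact add z z' h h'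
  | tmul c f =>
    induction f using THom.ind with
    | zero => rw [TensorProduct.tmul_zero]; exact zero
    | tot p f => exact tmul c p f
    | add f g h h' => rw [TensorProduct.tmul_add]; exact add _ _ h h'

theorem ofUnroll_toUnroll (n : ℤ) (z : C.carrier ⊗[k] A.THom x y) :
    C.ofUnroll x y n (C.toUnroll x y n z) = z := by
  induction z using C.tensor_ind with
  | zero => simp only [map_zero]
  | add z z' h h' => rw [map_add, map_add, h, h']
  | tmul c p f => rw [C.toUnroll_tmul_tot x y (sub_add_cancel n p), ofUnroll_inc]

theorem D_tmul_tot {p : ℤ} (c : C.carrier) (f : A.Hom x y p) :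
    C.D x y (c ⊗ₜ A.tot f) = dgSign k p • (C.d c ⊗ₜ A.tot f + c ⊗ₜ A.dtot f) := by
  rw [D_tmul, THom.τ_tot, THom.δ_tot, TensorProduct.tmul_smul, TensorProduct.tmul_smul, smul_add]

/-- Up to a global sign in each degree, `C.toUnroll` is a morphism of complexes. -/
theorem d_toUnroll (n : ℤ) (z : C.carrier ⊗[k] A.THom x y) :
    ((C.unrollTensor x y).d n (n + 1)).hom (C.toUnroll x y n z) =
      dgSign k n • C.toUnroll x y (n + 1) (C.D x y z) := by
  induction z using C.tensor_ind with
  | zero => simp only [map_zero, smul_zero]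
  | add z z' h h' => simp only [map_add, smul_add, h, h']
  | tmul c p f =>
    rw [C.toUnroll_tmul_tot x y (sub_add_cancel n p), d_unrollInc, D_tmul_tot, ← A.tot_d rfl,
      map_smul, map_add, C.toUnroll_tmul_tot x y (p := n - p + 1) (by omega),
      C.toUnroll_tmul_tot x y (p := n - p) (by omega), smul_smul, ← dgSign_add]
    congr 1
    rw [← sub_add_cancel n p, add_assoc, dgSign_add, dgSign_add k p, dgSign_mul_self,
      sub_add_cancel, mul_one]

theorem D_ofUnroll (n : ℤ) (z : ((C.unrollTensor x y).X n : ModuleCat k)) :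
    C.D x y (C.ofUnroll x y n z) =
      dgSign k n • C.ofUnroll x y (n + 1) (((C.unrollTensor x y).d n (n + 1)).hom z) := by
  have : C.D x y ∘ₗ C.ofUnroll x y n =
      dgSign k n • C.ofUnroll x y (n + 1) ∘ₗ ((C.unrollTensor x y).d n (n + 1)).hom := by
    refine TensorComplex.hom_ext C.unroll (A.homComplex x y) fun p q h => ?_
    change ∀ (c : C.carrier) (f : A.Hom x y q), C.D x y (C.ofUnroll x y n
      (C.unrollInc x y h (c ⊗ₜ f))) = dgSign k n • C.ofUnroll x y (n + 1)
        (((C.unrollTensor x y).d n (n + 1)).hom (C.unrollInc x y h (c ⊗ₜ f)))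
    intro c f
    rw [ofUnroll_inc, d_unrollInc, D_tmul_tot, map_smul, map_add, ofUnroll_inc, ofUnroll_inc,
      smul_smul, A.tot_d, ← dgSign_add]
    congr 1
    rw [← h, add_right_comm, dgSign_add, dgSign_add, dgSign_mul_self, one_mul]
  exact LinearMap.congr_fun this z

end DMod

/-- A cycle of `C ⊗ A(x, y)` for an acyclic differential module `C` is placed in a single degree of
the tensor product of the unrolled acyclic complex with the complex of morphisms. -/
theorem hflat_of_isHomotopicallyFlat {x y : A.Obj}
    (h : IsHomotopicallyFlat (A.homComplex x y)) : HFlat A x y := by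
  intro C hC z hz
  have h1 := (acyclic_iff _).1 (h C.unroll (C.unroll_acyclic hC)) (-1) (C.toUnroll x y (-1 + 1) z)
    ((C.d_toUnroll _ z).trans (by rw [hz, map_zero, smul_zero]))
  obtain ⟨w, hw⟩ := h1
  refine ⟨-C.ofUnroll x y (-1) w, ?_⟩
  rw [map_neg, C.D_ofUnroll]
  refine (congrArg (fun a => -(dgSign k (-1) • C.ofUnroll x y (-1 + 1) a)) hw).trans ?_
  rw [C.ofUnroll_toUnroll, dgSign_neg, dgSign_one, neg_smul, one_smul, neg_neg]

end DGCat

/-! ### Twisted complexes are iterated extensions -/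

namespace DGCat

variable {k : Type u} [CommRing k]

namespace AddHom

variable {A : DGCat.{u, v, w} k}

open Classical in
/-- The terms of a formal sum whose index satisfies a predicate. -/
abbrev restrict (X : AddObj A) (T : X.ι → Prop) : AddObj A :=
  ⟨{i // T i}, fun i => X.obj i.1, fun i => X.deg i.1⟩

/-- The inclusion of some of the terms. -/
def restrictInc (X : AddObj A) (T : X.ι → Prop) : AddHom A (restrict X T) X 0 :=
  mat (fun i j => i.1 = j) (by
    rintro i _ rfl
    exact ⟨rfl, by simp⟩)

/-- The projection to some of the terms. -/
def restrictPr (X : AddObj A) (T : X.ι → Prop) : AddHom A X (restrict X T) 0 :=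
  mat (fun i j => i = j.1) (by
    rintro _ i rfl
    exact ⟨rfl, by simp⟩)

theorem restrictPr_restrictInc_self (X : AddObj A) (T : X.ι → Prop) :
    comp (zero_add 0) (restrictPr X T) (restrictInc X T) = one (restrict X T) := by
  refine mat_comp_mat _ _ _ _ _ _ _ ?_ ?_ ?_
  · rintro i _ rfl
    exact ⟨i.1, rfl, rfl⟩
  · intro i j l h h'
    exact Subtype.ext (h.trans h')
  · intro i j j' l h _ h' _
    exact h'.symm.trans h

theorem restrictPr_restrictInc_of_disjoint (X : AddObj A) (T T' : X.ι → Prop)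
    (hT : ∀ i, T i → ¬ T' i) :
    comp (zero_add 0) (restrictPr X T') (restrictInc X T) = 0 := by
  refine (mat_comp_mat _ _ (fun _ _ => False) _ _ (fun _ _ h => h.elim) _ ?_ ?_ ?_).trans
    (mat_eq_zero _ _ fun _ _ h => h)
  · exact fun _ _ h => h.elim
  · intro i j l h h'
    exact hT i.1 i.2 (by rw [h.trans h']; exact l.2)
  · intro i j j' l h _ h' _
    exact h'.symm.trans h

theorem restrictInc_restrictPr (X : AddObj A) (T : X.ι → Prop) :
    comp (zero_add 0) (restrictInc X T) (restrictPr X T) = mat (fun i j => i = j ∧ T i) (by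
      rintro i _ ⟨rfl, _⟩
      exact ⟨rfl, by simp⟩) := by
  refine mat_comp_mat _ _ _ _ _ _ _ ?_ ?_ ?_
  · rintro i _ ⟨rfl, h⟩
    exact ⟨⟨i, h⟩, rfl, rfl⟩
  · rintro i j l h h'
    exact ⟨h.trans h', by rw [h]; exact j.2⟩
  · intro i j j' l h _ h' _
    exact Subtype.ext (h'.symm.trans h)

theorem restrict_total (X : AddObj A) (T T' : X.ι → Prop) (hT : ∀ i, T i → ¬ T' i)
    (hT' : ∀ i, T i ∨ T' i) :
    comp (zero_add 0) (restrictInc X T) (restrictPr X T) +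
      comp (zero_add 0) (restrictInc X T') (restrictPr X T') = one X := by
  rw [restrictInc_restrictPr, restrictInc_restrictPr]
  refine mat_add_mat _ _ _ _ _ _ (fun i j => ?_) fun i j h h' => hT i h.2 h'.2
  constructor
  · rintro rfl
    exact (hT' i).imp (fun h => ⟨rfl, h⟩) (fun h => ⟨rfl, h⟩)
  · rintro (h | h) <;> exact h.1

end AddHom

/-- A splitting of an object `X` into `X'` and `X''` by morphisms of degree zero, such that the
inclusion of `X'` and the projection to `X''` are closed. -/
structure SplitExt (P : DGCat.{u, v, w} k) (X' X X'' : P.Obj) where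
  /-- the inclusion -/
  j : P.Hom X' X 0
  /-- the retraction of the inclusion -/
  t : P.Hom X X' 0
  /-- the projection -/
  p : P.Hom X X'' 0
  /-- the section of the projection -/
  s : P.Hom X'' X 0
  dtot_j : P.dtot j = 0
  dtot_p : P.dtot p = 0
  j_t : P.tot j ≫ P.tot t = 𝟙 _
  s_p : P.tot s ≫ P.tot p = 𝟙 _
  j_p : P.tot j ≫ P.tot p = 0
  total : P.tot t ≫ P.tot j + P.tot p ≫ P.tot s = 𝟙 _

namespace SplitExt

theorem s_t {P : DGCat.{u, v, w} k} {X' X X'' : P.Obj} (E : SplitExt P X' X X'') :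
    P.tot E.s ≫ P.tot E.t = 0 := by
  have h : P.tot E.s ≫ (P.tot E.t ≫ P.tot E.j + P.tot E.p ≫ P.tot E.s) ≫ P.tot E.t =
      P.tot E.s ≫ P.tot E.t := by rw [E.total, Category.id_comp]
  rw [Preadditive.add_comp, Preadditive.comp_add, Category.assoc, Category.assoc, E.j_t,
    Category.comp_id, ← Category.assoc (P.tot E.s) (P.tot E.p), E.s_p, Category.id_comp] at h
  exact add_eq_right.1 h

variable {P : DGCat.{u, v, w} k} {X : MCObj P} {Y' Y'' : P.Obj} (E : SplitExt P Y' X.obj Y'')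
  (ht : P.dtot E.t = 0) (hq : P.tot X.q ≫ P.tot E.p = 0)

/-- The twist induced on a summand. -/
def subTwist : P.Hom Y' Y' 1 := P.comp (zero_add 1) E.t (P.comp (add_zero 1) X.q E.j)

theorem tot_subTwist : P.tot E.subTwist = P.tot E.j ≫ P.tot X.q ≫ P.tot E.t := by
  rw [subTwist, P.tot_comp, P.tot_comp, Category.assoc]

include hq in
theorem tot_q : P.tot X.q ≫ P.tot E.t ≫ P.tot E.j = P.tot X.q := by
  have h : P.tot X.q ≫ (P.tot E.t ≫ P.tot E.j + P.tot E.p ≫ P.tot E.s) = P.tot X.q := by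
    rw [E.total, Category.comp_id]
  rwa [Preadditive.comp_add, ← Category.assoc _ (P.tot E.p), hq, Limits.zero_comp, add_zero] at h

/-- The subobject of a twisted object given by a splitting compatible with the twist. -/
abbrev sub : MCObj P where
  obj := Y'
  q := E.subTwist
  maurerCartan := by
    apply P.tot_inj
    rw [map_add, P.tot_d, P.tot_comp, tot_subTwist, map_zero, subTwist, P.dtot_comp, P.dtot_comp,
      E.dtot_j, ht, MCObj.dtot_q, Limits.comp_zero, dgSign_zero, one_smul, Limits.zero_comp,
      smul_zero, add_zero, zero_add, Preadditive.comp_neg, Preadditive.neg_comp]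
    have h := E.tot_q hq
    simp only [Category.assoc]
    rw [← Category.assoc (P.tot E.t) (P.tot E.j), ← Category.assoc (P.tot X.q) (_ ≫ _), h,
      neg_add_cancel]

/-- The quotient of a twisted object given by a splitting compatible with the twist. -/
abbrev quo (_ : SplitExt P Y' X.obj Y'') : MCObj P where
  obj := Y''
  q := 0
  maurerCartan := by rw [map_zero, map_zero, add_zero]

/-- A splitting compatible with the twist, as a splitting of twisted objects. -/
def toMC : SplitExt P.mc (E.sub ht hq) X E.quo where
  j := E.j
  t := E.t
  p := E.p
  s := E.s
  dtot_j := P.mc.dtot_eq_zero (zero_add 1) (P.tot_inj (by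
    refine (P.tot_mcD (X := E.sub ht hq) (Y := X) (zero_add 1) E.j).trans ?_
    rw [E.dtot_j, tot_subTwist, Category.assoc, Category.assoc, E.tot_q hq, dgSign_zero, one_smul,
      zero_add, sub_self]
    exact (map_zero P.tot).symm))
  dtot_p := P.mc.dtot_eq_zero (zero_add 1) (P.tot_inj (by
    refine (P.tot_mcD (X := X) (Y := E.quo) (zero_add 1) E.p).trans ?_
    rw [E.dtot_p, hq, map_zero, Limits.comp_zero, smul_zero, sub_zero, add_zero]
    exact (map_zero P.tot).symm))
  j_t := E.j_t
  s_p := E.s_p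
  j_p := E.j_p
  total := E.total

end SplitExt

namespace AddHom

variable {A : DGCat.{u, v, w} k}

/-- A matrix, as a morphism of the underlying ungraded category. -/
def toTot {X Y : AddObj A} {p : ℤ} :
    AddHom A X Y p →ₗ[k] ((⟨(X : A.add.Obj)⟩ : Tot A.add) ⟶ ⟨(Y : A.add.Obj)⟩) := A.add.tot

theorem toTot_comp {X Y Z : AddObj A} {p q r : ℤ} (h : q + p = r) (g : AddHom A Y Z q)
    (f : AddHom A X Y p) : toTot (comp h g f) = toTot f ≫ toTot g := A.add.tot_comp h g f

theorem toTot_one (X : AddObj A) : toTot (one X) = 𝟙 _ := rfl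

/-- The splitting of a formal sum given by a partition of its index set. -/
def restrictSplit (X : AddObj A) (T T' : X.ι → Prop) (hT : ∀ i, T i → ¬ T' i)
    (hT' : ∀ i, T i ∨ T' i) : SplitExt A.add (restrict X T) X (restrict X T') where
  j := restrictInc X T
  t := restrictPr X T
  p := restrictPr X T'
  s := restrictInc X T'
  dtot_j := A.add.dtot_eq_zero (zero_add 1) (d_mat _ _ (zero_add 1))
  dtot_p := A.add.dtot_eq_zero (zero_add 1) (d_mat _ _ (zero_add 1))
  j_t := by
    change toTot (restrictInc X T) ≫ toTot (restrictPr X T) = _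
    rw [← toTot_comp (zero_add 0), restrictPr_restrictInc_self, toTot_one]
  s_p := by
    change toTot (restrictInc X T') ≫ toTot (restrictPr X T') = _
    rw [← toTot_comp (zero_add 0), restrictPr_restrictInc_self, toTot_one]
  j_p := by
    change toTot (restrictInc X T) ≫ toTot (restrictPr X T') = _
    rw [← toTot_comp (zero_add 0), restrictPr_restrictInc_of_disjoint X T T' hT, map_zero]
  total := by
    change toTot (restrictPr X T) ≫ toTot (restrictInc X T) +
      toTot (restrictPr X T') ≫ toTot (restrictInc X T') = _
    rw [← toTot_comp (zero_add 0), ← toTot_comp (zero_add 0), ← map_add,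
      restrict_total X T T' hT hT', toTot_one]

theorem dtot_restrictSplit_t (X : AddObj A) (T T' : X.ι → Prop) (hT : ∀ i, T i → ¬ T' i)
    (hT' : ∀ i, T i ∨ T' i) : A.add.dtot (restrictSplit X T T' hT hT').t = 0 := by
  have h : d (zero_add 1) (restrictPr X T) = 0 := d_mat _ _ _
  exact A.add.dtot_eq_zero (zero_add 1) h

end AddHom

namespace Pretr

variable {C : DGCat.{u, v, w} k}

theorem comp_restrictPr (X : AddObj C) (q : AddHom C X X 1) (T : X.ι → Prop)
    (h : ∀ i j, T j → q i j = 0) :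
    AddHom.comp (zero_add 1) (AddHom.restrictPr X T) q = 0 := by
  funext i j
  refine AddHom.comp_eq_zero _ _ _ i j fun l => ?_
  by_cases hl : l = j.1
  · exact Or.inl (by rw [hl]; exact h i j.1 j.2)
  · exact Or.inr (AddHom.mat_neg _ _ hl)

theorem isOneSided_sub {X : MCObj C.add} (hX : IsOneSided X)
    {T T' : AddObj.ι X.obj → Prop} (hT : ∀ i, T i → ¬ T' i) (hT' : ∀ i, T i ∨ T' i)
    (ht : C.add.dtot (AddHom.restrictSplit X.obj T T' hT hT').t = 0)
    (hq : C.add.tot X.q ≫ C.add.tot (AddHom.restrictSplit X.obj T T' hT hT').p = 0) :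
    IsOneSided ((AddHom.restrictSplit X.obj T T' hT hT').sub ht hq) := by
  obtain ⟨rk, hrk⟩ := hX
  refine ⟨fun i => rk i.1, fun i j hij => ?_⟩
  refine AddHom.comp_eq_zero (zero_add 1) (AddHom.restrictPr X.obj T)
    (AddHom.comp (add_zero 1) X.q (AddHom.restrictInc X.obj T)) i j fun l => ?_
  by_cases hl : l = j.1
  · subst hl
    refine Or.inl (AddHom.comp_eq_zero (add_zero 1) X.q (AddHom.restrictInc X.obj T) i _
      fun m => ?_)
    by_cases hm : i.1 = m
    · subst hm
      exact Or.inr (hrk _ _ hij)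
    · exact Or.inl (AddHom.mat_neg _ _ hm)
  · exact Or.inr (AddHom.mat_neg _ _ hl)

/-- An invertible closed morphism of some degree. -/
structure ShiftIso (P : DGCat.{u, v, w} k) (X Y : P.Obj) where
  /-- the degree -/
  deg : ℤ
  /-- the morphism -/
  hom : P.Hom X Y deg
  /-- the inverse -/
  inv : P.Hom Y X (-deg)
  dtot_hom : P.dtot hom = 0
  dtot_inv : P.dtot inv = 0
  hom_inv : P.tot hom ≫ P.tot inv = 𝟙 _
  inv_hom : P.tot inv ≫ P.tot hom = 𝟙 _

theorem oneTerm_comp {X Y : AddObj C} {p q : ℤ}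
    (h : ∀ i j, True → X.obj i = Y.obj j ∧ 0 = p + Y.deg j - X.deg i)
    (h' : ∀ i j, True → Y.obj i = X.obj j ∧ 0 = q + X.deg j - Y.deg i) (hs : q + p = 0)
    (hX : ∀ i i' : X.ι, i = i') (j : Y.ι) (hY : ∀ j' : Y.ι, j' = j) :
    AddHom.comp hs (AddHom.mat (fun _ _ => True) h') (AddHom.mat (fun _ _ => True) h) =
      AddHom.one X :=
  AddHom.mat_comp_mat _ _ _ _ _ _ _ (fun _ _ _ => ⟨j, trivial, trivial⟩)
    (fun _ _ _ _ _ => hX _ _) (fun _ j j' _ _ _ _ _ => (hY j').trans (hY j).symm)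

theorem oneTerm_relation (X : C.pretr.Obj) (i : (under X).ι) (hi : ∀ j, j = i) (j : (under X).ι)
    (l : (singleAdd C ((under X).obj i)).ι) (_ : True) :
    (under X).obj j = (singleAdd C ((under X).obj i)).obj l ∧
      0 = (under X).deg i + (singleAdd C ((under X).obj i)).deg l - (under X).deg j := by
  obtain rfl := hi j
  exact ⟨rfl, by simp [singleAdd]⟩

theorem oneTerm_relation' (X : C.pretr.Obj) (i : (under X).ι) (hi : ∀ j, j = i)
    (l : (singleAdd C ((under X).obj i)).ι) (j : (under X).ι) (_ : True) :
    (singleAdd C ((under X).obj i)).obj l = (under X).obj j ∧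
      0 = -(under X).deg i + (under X).deg j - (singleAdd C ((under X).obj i)).deg l := by
  obtain rfl := hi j
  exact ⟨rfl, by simp [singleAdd]⟩

/-- A twisted complex with one term is a shift of that term. -/
def shiftIsoSingle (X : C.pretr.Obj) (hX : twist X = 0) (i : (under X).ι)
    (hi : ∀ j, j = i) : ShiftIso C.pretr X (single C ((under X).obj i)) where
  deg := (under X).deg i
  hom := ofMat (Y := single C ((under X).obj i))
    (AddHom.mat (fun _ _ => True) (oneTerm_relation X i hi))
  inv := ofMat (X := single C ((under X).obj i))
    (AddHom.mat (fun _ _ => True) (oneTerm_relation' X i hi))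
  dtot_hom := C.pretr.dtot_eq_zero rfl
    ((ofMat_d (Y := single C ((under X).obj i)) hX rfl rfl _).trans (AddHom.d_mat _ _ rfl))
  dtot_inv := C.pretr.dtot_eq_zero rfl
    ((ofMat_d (X := single C ((under X).obj i)) rfl hX rfl _).trans (AddHom.d_mat _ _ rfl))
  hom_inv := (C.pretr.tot_comp (neg_add_cancel _) _ _).symm.trans
    (congrArg C.pretr.tot (oneTerm_comp (oneTerm_relation X i hi) (oneTerm_relation' X i hi)
      (neg_add_cancel _) (fun j l => (hi j).trans (hi l).symm) () fun _ => rfl))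
  inv_hom := (C.pretr.tot_comp (add_neg_cancel _) _ _).symm.trans
    (congrArg C.pretr.tot (oneTerm_comp (oneTerm_relation' X i hi) (oneTerm_relation X i hi)
      (add_neg_cancel _) (fun _ _ => rfl) i hi))

/-- A property of twisted complexes holds for all of them if it holds for the objects of the
dg category and is stable under shifts and extensions: the term with an index of maximal rank is a
quotient of the twisted complex. -/
theorem induction {S : C.pretr.Obj → Prop} (zero : ∀ X, 𝟙 (⟨X⟩ : Tot C.pretr) = 0 → S X)
    (single : ∀ x, S (single C x)) (shift : ∀ {X Y}, ShiftIso C.pretr X Y → S Y → S X)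
    (ext : ∀ {X' X X''}, SplitExt C.pretr X' X X'' → S X' → S X'' → S X) (X : C.pretr.Obj) :
    S X := by
  classical
  obtain ⟨n, hn⟩ : ∃ n, Fintype.card (under X).ι = n := ⟨_, rfl⟩
  induction n generalizing X with
  | zero =>
    have := Fintype.card_eq_zero_iff.1 hn
    exact zero X (coef_ext fun i => isEmptyElim i)
  | succ n ih =>
    have hne : Nonempty (under X).ι := Fintype.card_pos_iff.1 (by omega)
    obtain ⟨rk, hrk⟩ := X.2
    obtain ⟨i₀, hi₀⟩ := Finite.exists_max (α := (under X).ι) rk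
    have hT : ∀ i, i ≠ i₀ → ¬ i = i₀ := fun _ h => h
    have hT' : ∀ i, i ≠ i₀ ∨ i = i₀ := fun i => (em (i = i₀)).symm
    have hq : C.add.tot (MCObj.q X.1) ≫
        C.add.tot (AddHom.restrictSplit (under X) (· ≠ i₀) (· = i₀) hT hT').p = 0 := by
      change AddHom.toTot (twist X) ≫ AddHom.toTot (AddHom.restrictPr (under X) (· = i₀)) = 0
      rw [← AddHom.toTot_comp (zero_add 1), comp_restrictPr, map_zero]
      rintro i j rfl
      exact hrk i j (hi₀ i)
    let E := (AddHom.restrictSplit (under X) (· ≠ i₀) (· = i₀) hT hT').toMC (X := X.1)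
      (AddHom.dtot_restrictSplit_t _ _ _ _ _) hq
    let X' : C.pretr.Obj := ⟨_, isOneSided_sub X.2 hT hT'
      (AddHom.dtot_restrictSplit_t _ _ _ _ _) hq⟩
    let X'' : C.pretr.Obj := ⟨(AddHom.restrictSplit (under X) (· ≠ i₀) (· = i₀) hT hT').quo
      (X := X.1), fun _ => 0, fun _ _ _ => rfl⟩
    have E' : SplitExt C.pretr X' X X'' :=
      ⟨E.j, E.t, E.p, E.s, E.dtot_j, E.dtot_p, E.j_t, E.s_p, E.j_p, E.total⟩
    refine ext E' (ih X' ?_) (shift (shiftIsoSingle X'' rfl ⟨i₀, rfl⟩ fun j => Subtype.ext j.2)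
      (single _))
    refine (Fintype.card_congr (α := (under X').ι) (β := {i // i ≠ i₀}) (Equiv.refl _)).trans ?_
    rw [Fintype.card_subtype_compl, Fintype.card_subtype_eq, hn, Nat.add_sub_cancel]

end Pretr

end DGCat

/-! ### Homotopical flatness for twisted complexes -/

namespace DGCat

open TensorProduct

variable {k : Type u} [CommRing k]

theorem THom.τ_of_deg_zero {P : DGCat.{u, v, w} k} {X Y : P.Obj} (f : P.Hom X Y 0) :
    THom.τ (P.tot f) = P.tot f := by rw [THom.τ_tot, dgSign_zero, one_smul]

theorem THom.δ_tot_eq_zero {P : DGCat.{u, v, w} k} {X Y : P.Obj} {p : ℤ} {f : P.Hom X Y p}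
    (hf : P.dtot f = 0) : THom.δ (P.tot f) = 0 := by rw [THom.δ_tot, hf, smul_zero]

namespace DMod

variable {P : DGCat.{u, v, u} k} (C : DMod k)

theorem pre_add {X' X U : P.Obj} (s s' : P.THom X' X) (z : C.carrier ⊗[k] P.THom X U) :
    C.pre (s + s') U z = C.pre s U z + C.pre s' U z := by
  induction z using TensorProduct.induction_on with
  | zero => simp only [map_zero, add_zero]
  | tmul c f => rw [pre_tmul, pre_tmul, pre_tmul, Preadditive.add_comp, TensorProduct.tmul_add]
  | add z z' h h' =>
    simp only [map_add, h, h']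
    abel

theorem pre_zero {X' X U : P.Obj} (z : C.carrier ⊗[k] P.THom X U) :
    C.pre (0 : P.THom X' X) U z = 0 := by
  induction z using TensorProduct.induction_on with
  | zero => simp only [map_zero]
  | tmul c f => rw [pre_tmul, Limits.zero_comp, TensorProduct.tmul_zero]
  | add z z' h h' => simp only [map_add, h, h', add_zero]

theorem D_pre_tot {X' X U : P.Obj} {p : ℤ} (s : P.Hom X' X p) (hs : P.dtot s = 0)
    (z : C.carrier ⊗[k] P.THom X U) :
    C.D X' U (C.pre (P.tot s) U z) = dgSign k p • C.pre (P.tot s) U (C.D X U z) := by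
  induction z using TensorProduct.induction_on with
  | zero => simp only [map_zero, smul_zero]
  | tmul c f =>
    rw [pre_tmul, D_tmul, D_tmul, map_add, pre_tmul, pre_tmul, THom.τ_comp, THom.δ_comp,
      THom.δ_tot_eq_zero hs, THom.τ_tot, Limits.zero_comp, add_zero, Linear.smul_comp,
      Linear.smul_comp, TensorProduct.tmul_smul, TensorProduct.tmul_smul, smul_add]
  | add z z' h h' => simp only [map_add, smul_add, h, h']

theorem D_D {X U : P.Obj} (z : C.carrier ⊗[k] P.THom X U) : C.D X U (C.D X U z) = 0 := by
  induction z using TensorProduct.induction_on with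
  | zero => simp only [map_zero]
  | tmul c f =>
    rw [D_tmul, map_add, D_tmul, D_tmul, C.d_d, THom.δ_δ, THom.δ_τ, TensorProduct.zero_tmul,
      TensorProduct.tmul_zero, TensorProduct.tmul_neg, zero_add, add_zero, neg_add_cancel]
  | add z z' h h' => simp only [map_add, h, h', add_zero]

end DMod

namespace HFlat

section

variable {P : DGCat.{u, v, u} k}

theorem of_id_eq_zero {X : P.Obj} (U : P.Obj) (h : 𝟙 (⟨X⟩ : Tot P) = 0) : HFlat P X U :=
  fun C _ z _ => ⟨0, by rw [map_zero, ← C.pre_id z, h, C.pre_zero]⟩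

theorem of_shiftIso {X Y U : P.Obj} (E : Pretr.ShiftIso P X Y) (h : HFlat P Y U) :
    HFlat P X U := by
  intro C hC z hz
  obtain ⟨v, hv⟩ := h C hC (C.pre (P.tot E.inv) U z) (by
    rw [C.D_pre_tot _ E.dtot_inv, hz, map_zero, smul_zero])
  refine ⟨dgSign k E.deg • C.pre (P.tot E.hom) U v, ?_⟩
  rw [map_smul, C.D_pre_tot _ E.dtot_hom, hv, smul_smul, dgSign_mul_self, one_smul,
    ← C.pre_comp, E.hom_inv, C.pre_id]

theorem of_splitExt {X' X X'' U : P.Obj} (E : SplitExt P X' X X'') (h' : HFlat P X' U)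
    (h'' : HFlat P X'' U) : HFlat P X U := by
  intro C hC z hz
  have hj := fun z : C.carrier ⊗[k] P.THom X U =>
    C.D_pre (THom.τ_of_deg_zero E.j) (THom.δ_tot_eq_zero E.dtot_j) z
  have hp := fun z : C.carrier ⊗[k] P.THom X'' U =>
    C.D_pre (THom.τ_of_deg_zero E.p) (THom.δ_tot_eq_zero E.dtot_p) z
  obtain ⟨w, hw⟩ := h' C hC (C.pre (P.tot E.j) U z) (by rw [hj, hz, map_zero])
  -- correcting `z` by a boundary makes it vanish on the subobject
  obtain ⟨z₁, hz₁⟩ : ∃ z₁, z₁ = z - C.D X U (C.pre (P.tot E.t) U w) := ⟨_, rfl⟩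
  have h1 : C.pre (P.tot E.j) U z₁ = 0 := by
    rw [hz₁, map_sub, ← hj, ← C.pre_comp, E.j_t, C.pre_id, hw, sub_self]
  have h2 : C.pre (P.tot E.p) U (C.pre (P.tot E.s) U z₁) = z₁ := by
    rw [← C.pre_comp]
    conv_rhs => rw [← C.pre_id z₁, ← E.total, C.pre_add, C.pre_comp _ (P.tot E.j), h1, map_zero,
      zero_add]
  have h3 : C.D X U z₁ = 0 := by
    rw [hz₁, map_sub, hz, C.D_D, sub_self]
  have h4 : C.D X'' U (C.pre (P.tot E.s) U z₁) = 0 := by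
    rw [← C.pre_id (C.D X'' U (C.pre (P.tot E.s) U z₁)), ← E.s_p, C.pre_comp, ← hp, h2, h3,
      map_zero]
  obtain ⟨v, hv⟩ := h'' C hC _ h4
  refine ⟨C.pre (P.tot E.t) U w + C.pre (P.tot E.p) U v, ?_⟩
  rw [map_add, hp, hv, h2, hz₁, add_sub_cancel]

end

/-- Homotopical flatness only depends on the complex of morphisms. -/
theorem of_bijective {P : DGCat.{u, v, u} k} {Q : DGCat.{u, v', u} k} {X U : P.Obj} {Y V : Q.Obj}
    (φ : P.THom X U →ₗ[k] Q.THom Y V) (ψ : Q.THom Y V →ₗ[k] P.THom X U)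
    (hτ : ∀ f, φ (THom.τ f) = THom.τ (φ f)) (hδ : ∀ f, φ (THom.δ f) = THom.δ (φ f))
    (hφψ : ∀ f, φ (ψ f) = f) (hψφ : ∀ f, ψ (φ f) = f) (h : HFlat P X U) : HFlat Q Y V := by
  intro C hC z hz
  have hD : ∀ z, C.D Y V (LinearMap.lTensor C.carrier φ z) =
      LinearMap.lTensor C.carrier φ (C.D X U z) := by
    intro z
    induction z using TensorProduct.induction_on with
    | zero => simp only [map_zero]
    | tmul c f =>
      rw [LinearMap.lTensor_tmul, DMod.D_tmul, DMod.D_tmul, map_add, LinearMap.lTensor_tmul,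
        LinearMap.lTensor_tmul, hτ, hδ]
    | add z z' h h' => simp only [map_add, h, h']
  have e1 : φ ∘ₗ ψ = LinearMap.id := LinearMap.ext hφψ
  have e2 : ψ ∘ₗ φ = LinearMap.id := LinearMap.ext hψφ
  have h1 : ∀ z, LinearMap.lTensor C.carrier φ (LinearMap.lTensor C.carrier ψ z) = z := fun z => by
    rw [← LinearMap.comp_apply, ← LinearMap.lTensor_comp, e1, LinearMap.lTensor_id,
      LinearMap.id_apply]
  have h2 : ∀ z, LinearMap.lTensor C.carrier ψ (LinearMap.lTensor C.carrier φ z) = z := fun z => by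
    rw [← LinearMap.comp_apply, ← LinearMap.lTensor_comp, e2, LinearMap.lTensor_id,
      LinearMap.id_apply]
  obtain ⟨v, hv⟩ := h C hC (LinearMap.lTensor C.carrier ψ z) (by
    rw [← h2 (C.D X U _), ← hD, h1, hz, map_zero])
  exact ⟨LinearMap.lTensor C.carrier φ v, by rw [hD, hv, h1]⟩

theorem single {A : DGCat.{u, u, u} k} {x U : A.Obj} (h : HFlat A x U) :
    HFlat A.pretr ((Pretr.singleFunctor A).obj x) ((Pretr.singleFunctor A).obj U) :=
  h.of_bijective (Pretr.singleFunctor A).tmap (Pretr.coefSingle x U)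
    (Pretr.singleFunctor A).tmap_τ (Pretr.singleFunctor A).tmap_δ
    (fun f => Pretr.coef_ext (X := Pretr.single A x) (Y := Pretr.single A U)
      fun _ _ => Pretr.coefSingle_tmap (Pretr.coefSingle x U f))
    Pretr.coefSingle_tmap

/-- If the complexes of morphisms to `U` are homotopically flat, then this also holds for twisted
complexes, since these are iterated extensions of shifts. -/
theorem pretr {A : DGCat.{u, u, u} k} {U : A.Obj} (h : ∀ x, HFlat A x U) (X : A.pretr.Obj) :
    HFlat A.pretr X ((Pretr.singleFunctor A).obj U) :=
  Pretr.induction (fun _ hX => of_id_eq_zero _ hX) (fun x => (h x).single)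
    (fun E h => h.of_shiftIso E) (fun E h' h'' => of_splitExt E h' h'') X

end HFlat

end DGCat

/-! ### Generation of the triangulated hull -/

namespace DGCat

variable {k : Type u} [CommRing k]

section

variable {P : DGCat.{u, v, w} k}

theorem dtot_inv_eq_zero {X Y : P.Obj} {p q : ℤ} {f : P.Hom X Y p} {g : P.Hom Y X q}
    (hf : P.dtot f = 0) (hpq : q + p = 0) (h : P.tot f ≫ P.tot g = 𝟙 _)
    (h' : P.tot g ≫ P.tot f = 𝟙 _) : P.dtot g = 0 := by
  have e : P.comp hpq g f = P.one X := P.tot_inj ((P.tot_comp hpq g f).trans h)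
  have h1 := P.dtot_comp hpq g f
  rw [e, P.dtot_one, hf, Limits.zero_comp, smul_zero, add_zero] at h1
  rw [← Category.id_comp (P.dtot g), ← h', Category.assoc, ← h1, Limits.comp_zero]

/-- An isomorphism of the homotopy category from an invertible closed morphism of degree zero. -/
theorem nonempty_iso {X Y : P.Obj} (f : P.Hom X Y 0) (g : P.Hom Y X 0) (hf : P.dtot f = 0)
    (h : P.tot f ≫ P.tot g = 𝟙 _) (h' : P.tot g ≫ P.tot f = 𝟙 _) :
    Nonempty ((⟨X⟩ : H0 P) ≅ ⟨Y⟩) :=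
  have hg := dtot_inv_eq_zero hf (add_zero 0) h h'
  ⟨P.isoMk0 f g (P.d_eq_zero_of _ hf) (P.d_eq_zero_of _ hg) (P.mk0_comp_one _ _ _ _ h)
    (P.mk0_comp_one _ _ _ _ h')⟩

theorem isZero_of_id_eq_zero {X : P.Obj} (h : 𝟙 (⟨X⟩ : Tot P) = 0) :
    Limits.IsZero (⟨X⟩ : H0 P) := by
  rw [Limits.IsZero.iff_id_eq_zero]
  rw [← P.mk0_one, ← P.mk0_zero]
  exact P.mk0_congr _ _ (h.trans (map_zero _).symm)

end

namespace SplitExt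

variable {P : DGCat.{u, v, w} k} {X' X X'' : P.Obj} (E : SplitExt P X' X X'')

theorem dtot_s_p : P.dtot E.s ≫ P.tot E.p = 0 := by
  have e : P.comp (zero_add 0) E.p E.s = P.one X'' :=
    P.tot_inj ((P.tot_comp _ _ _).trans E.s_p)
  have h := P.dtot_comp (zero_add 0) E.p E.s
  rwa [e, P.dtot_one, E.dtot_p, Limits.comp_zero, zero_add, dgSign_zero, one_smul, eq_comm] at h

theorem j_dtot_t : P.tot E.j ≫ P.dtot E.t = 0 := by
  have e : P.comp (zero_add 0) E.t E.j = P.one X' :=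
    P.tot_inj ((P.tot_comp _ _ _).trans E.j_t)
  have h := P.dtot_comp (zero_add 0) E.t E.j
  rwa [e, P.dtot_one, E.dtot_j, Limits.zero_comp, smul_zero, add_zero, eq_comm] at h

theorem dtot_s : P.dtot E.s ≫ P.tot E.t ≫ P.tot E.j = P.dtot E.s := by
  have h : P.dtot E.s ≫ (P.tot E.t ≫ P.tot E.j + P.tot E.p ≫ P.tot E.s) = P.dtot E.s := by
    rw [E.total, Category.comp_id]
  rwa [Preadditive.comp_add, ← Category.assoc _ (P.tot E.p), E.dtot_s_p, Limits.zero_comp,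
    add_zero] at h

end SplitExt

end DGCat

namespace DGExact

open DGCat

variable {k : Type u} [CommRing k] {P : DGCat.{u, v, w} k} [DGExact P]

theorem nonempty_iso_susp {X Y : P.Obj} (E : Pretr.ShiftIso P X Y) :
    Nonempty ((⟨X⟩ : H0 P) ≅ ⟨susp E.deg Y⟩) := by
  refine nonempty_iso (P.comp (neg_add_cancel _) (ξinv E.deg Y) E.hom)
    (P.comp (neg_add_cancel _) E.inv (ξ E.deg Y)) ?_ ?_ ?_
  · rw [P.dtot_comp, E.dtot_hom, dtot_ξinv, Limits.comp_zero, Limits.zero_comp, smul_zero, add_zero]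
  · rw [P.tot_comp, P.tot_comp, Category.assoc, tot_ξ_ξinv_assoc, E.hom_inv]
  · rw [P.tot_comp, P.tot_comp, Category.assoc, ← Category.assoc (P.tot E.inv), E.inv_hom,
      Category.id_comp, tot_ξinv_ξ]

section

variable {X' X X'' : P.Obj} (E : SplitExt P X' X X'')

/-- The connecting morphism of a splitting. -/
def connecting : P.Hom (susp (-1) X'') X' 0 :=
  P.comp (q := 1) (p := -1) (add_neg_cancel 1) (P.comp (zero_add 1) E.t (P.d (zero_add 1) E.s))
    (ξ (-1) X'')

theorem tot_connecting :
    P.tot (connecting E) = P.tot (ξ (-1) X'') ≫ P.dtot E.s ≫ P.tot E.t := by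
  rw [connecting, P.tot_comp, P.tot_comp, P.tot_d]

theorem dtot_connecting : P.dtot (connecting E) = 0 := by
  rw [connecting, P.dtot_comp, dtot_ξ, P.dtot_comp, P.dtot_d, P.tot_d, ← E.dtot_s,
    Category.assoc, Category.assoc, E.j_dtot_t, Limits.comp_zero, Limits.comp_zero,
    Limits.zero_comp, Limits.zero_comp, smul_zero, smul_zero, add_zero, add_zero,
    Limits.comp_zero]

theorem d_connecting : P.d (zero_add 1) (connecting E) = 0 :=
  P.d_eq_zero_of _ (dtot_connecting E)

/-- The comparison of the cone of the connecting morphism with the extension. -/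
def ofConeConnecting : P.Hom (cone (connecting E) (d_connecting E)) X 0 :=
  P.comp (zero_add 0) E.j (t _ (d_connecting E)) +
    P.comp (zero_add 0) E.s (P.comp (q := -1) (p := 1) (neg_add_cancel 1) (ξ (-1) X'')
      (P.comp (add_zero 1) (ξ 1 (susp (-1) X'')) (p _ (d_connecting E))))

theorem tot_ofConeConnecting : P.tot (ofConeConnecting E) =
    P.tot (t _ (d_connecting E)) ≫ P.tot E.j +
      P.tot (p _ (d_connecting E)) ≫ P.tot (ξ 1 (susp (-1) X'')) ≫ P.tot (ξ (-1) X'') ≫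
        P.tot E.s := by
  rw [ofConeConnecting, map_add, P.tot_comp, P.tot_comp, P.tot_comp, P.tot_comp, Category.assoc,
    Category.assoc]

/-- The inverse of `ofConeConnecting`. -/
def toConeConnecting : P.Hom X (cone (connecting E) (d_connecting E)) 0 :=
  P.comp (zero_add 0) (j _ (d_connecting E)) E.t +
    P.comp (zero_add 0) (s _ (d_connecting E)) (P.comp (q := -1) (p := 1) (neg_add_cancel 1)
      (ξinv 1 (susp (-1) X'')) (P.comp (add_zero 1) (ξinv (-1) X'') E.p))

theorem tot_toConeConnecting : P.tot (toConeConnecting E) =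
    P.tot E.t ≫ P.tot (j _ (d_connecting E)) +
      P.tot E.p ≫ P.tot (ξinv (-1) X'') ≫ P.tot (ξinv 1 (susp (-1) X'')) ≫
        P.tot (s _ (d_connecting E)) := by
  rw [toConeConnecting, map_add, P.tot_comp, P.tot_comp, P.tot_comp, P.tot_comp, Category.assoc,
    Category.assoc]

theorem dtot_ofConeConnecting : P.dtot (ofConeConnecting E) = 0 := by
  rw [ofConeConnecting, map_add, P.dtot_comp, P.dtot_comp, P.dtot_comp, P.dtot_comp, dtot_p,
    dtot_ξ, dtot_ξ, dtot_t, E.dtot_j, P.tot_comp, P.tot_comp, tot_connecting]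
  simp only [Limits.comp_zero, Limits.zero_comp, smul_zero, add_zero, zero_add, dgSign_zero,
    one_smul, Preadditive.neg_comp, Category.assoc, E.dtot_s, neg_add_cancel]

theorem nonempty_iso_cone_connecting :
    Nonempty ((⟨cone (connecting E) (d_connecting E)⟩ : H0 P) ≅ ⟨X⟩) := by
  refine nonempty_iso (ofConeConnecting E) (toConeConnecting E) (dtot_ofConeConnecting E) ?_ ?_
  · rw [tot_ofConeConnecting, tot_toConeConnecting, Preadditive.add_comp, Preadditive.comp_add,
      Preadditive.comp_add]
    have h1 : P.tot E.j ≫ P.tot E.t ≫ P.tot (j _ (d_connecting E)) =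
        P.tot (j _ (d_connecting E)) := by rw [← Category.assoc, E.j_t, Category.id_comp]
    have h2 : ∀ {Z : P.Tot} (h : ⟨X''⟩ ⟶ Z), P.tot E.j ≫ P.tot E.p ≫ h = 0 := fun h => by
      rw [← Category.assoc, E.j_p, Limits.zero_comp]
    have h3 : ∀ {Z : P.Tot} (h : ⟨X''⟩ ⟶ Z), P.tot E.s ≫ P.tot E.p ≫ h = h := fun h => by
      rw [← Category.assoc, E.s_p, Category.id_comp]
    have h4 : ∀ {Z : P.Tot} (h : ⟨X'⟩ ⟶ Z), P.tot E.s ≫ P.tot E.t ≫ h = 0 := fun h => by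
      rw [← Category.assoc, E.s_t, Limits.zero_comp]
    simp only [Category.assoc, h1, h2, h3, h4, Limits.comp_zero, add_zero, zero_add]
    rw [← Category.assoc (P.tot (ξ (-1) X'')), tot_ξinv_ξ, Category.id_comp,
      tot_ξinv_ξ_assoc]
    exact tot_total _ _
  · rw [tot_ofConeConnecting, tot_toConeConnecting, Preadditive.add_comp, Preadditive.comp_add,
      Preadditive.comp_add]
    simp only [Category.assoc, tot_t_j_assoc, tot_p_s_assoc, tot_t_s_assoc, tot_p_j_assoc,
      Limits.comp_zero, add_zero, zero_add, tot_ξ_ξinv_assoc]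
    exact E.total

end

/-- A triangulated subcategory of the homotopy category is closed under split extensions. -/
theorem prop_of_splitExt (Q : ObjectProperty (H0 P)) [Q.IsTriangulated]
    [Q.IsClosedUnderIsomorphisms] {X' X X'' : P.Obj} (E : SplitExt P X' X X'') (h' : Q ⟨X'⟩)
    (h'' : Q ⟨X''⟩) : Q ⟨X⟩ := by
  obtain ⟨e⟩ := nonempty_iso_cone_connecting E
  refine Q.prop_of_iso e (Q.ext_of_isTriangulatedClosed₃ _
    (std_mem (connecting E) (d_connecting E)) ?_ h')
  exact Q.le_shift (-1 : ℤ) _ h''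

theorem prop_of_shiftIso (Q : ObjectProperty (H0 P)) [Q.IsTriangulated]
    [Q.IsClosedUnderIsomorphisms] {X Y : P.Obj} (E : Pretr.ShiftIso P X Y) (h : Q ⟨Y⟩) :
    Q ⟨X⟩ := by
  obtain ⟨e⟩ := nonempty_iso_susp E
  exact Q.prop_of_iso e.symm (Q.le_shift E.deg _ h)

end DGExact

namespace DGCat

variable {k : Type u} [CommRing k]

/-- The triangulated hull is generated by the objects of the dg category. -/
theorem Pretr.prop_of_single {C : DGCat.{u, v, w} k} (Q : ObjectProperty C.tr) [Q.IsTriangulated]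
    [Q.IsClosedUnderIsomorphisms] (h : ∀ x, Q ⟨Pretr.single C x⟩) (X : C.tr) : Q X :=
  Pretr.induction (S := fun X => Q ⟨X⟩)
    (fun _ hX => Q.prop_of_isZero (isZero_of_id_eq_zero hX)) h
    (fun E hY => DGExact.prop_of_shiftIso Q E hY)
    (fun E h' h'' => DGExact.prop_of_splitExt Q E h' h'') X.as

end DGCat

/-! ### Roofs in the triangulated hull -/

namespace DGExact

open DGCat Pretriangulated

section

variable {k : Type u} [CommRing k] {P : DGCat.{u, v, w} k} [DGExact P]

/-- A closed morphism to an object of a triangulated subcategory becomes a boundary after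
composition with a morphism whose cone belongs to the subcategory: the fibre of the corresponding
morphism of degree zero to a suspension. -/
theorem exists_trW_comp (Q : ObjectProperty (H0 P)) [Q.IsTriangulated] {X Y : P.Obj}
    (hY : Q ⟨Y⟩) {p : ℤ} (f : P.Hom X Y p) (hf : P.dtot f = 0) :
    ∃ (X' : P.Obj) (s : P.Hom X' X 0) (hs : P.d (zero_add 1) s = 0), Q.trW (P.mk0 s hs) ∧
      ∃ h : P.THom X' Y, THom.δ h = P.tot s ≫ P.tot f := by
  -- the morphism of degree zero to the suspension which corresponds to `f`
  have hg : P.d (zero_add 1) (P.comp (neg_add_cancel p) (ξinv p Y) f) = 0 :=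
    P.d_eq_zero_of _ (by
      rw [P.dtot_comp, hf, dtot_ξinv, Limits.comp_zero, Limits.zero_comp, smul_zero, add_zero])
  obtain ⟨X', s, c, hT⟩ := distinguished_cocone_triangle₁
    (P.mk0 (P.comp (neg_add_cancel p) (ξinv p Y) f) hg)
  obtain ⟨s, hs, rfl⟩ := P.mk0_surj s
  refine ⟨X'.as, s, hs, ObjectProperty.trW.mk Q hT (Q.le_shift p _ hY), ?_⟩
  have hz : P.mk0 s hs ≫ P.mk0 (P.comp (neg_add_cancel p) (ξinv p Y) f) hg = 0 :=
    comp_distTriang_mor_zero₁₂ _ hT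
  rw [mk0_comp, ← P.mk0_zero, mk0_eq_iff] at hz
  obtain ⟨h, hh⟩ := hz
  -- the signs come from the passage from `d` to `δ` and from moving `d` past `ξ`
  refine ⟨(dgSign k (p + -1) * dgSign k p) • P.tot (P.comp rfl (ξ p Y) h), ?_⟩
  have h1 : P.dtot h = P.tot s ≫ P.tot f ≫ P.tot (ξinv p Y) := by
    rw [← P.tot_d (neg_add_cancel 1), hh, sub_zero, P.tot_comp, P.tot_comp]
  rw [map_smul, THom.δ_tot, P.dtot_comp, dtot_ξ, Limits.comp_zero, zero_add, h1, Category.assoc,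
    Category.assoc, tot_ξ_ξinv, Category.comp_id, smul_smul, smul_smul]
  have h2 : dgSign k (p + -1) * dgSign k p * dgSign k (p + -1) * dgSign k p = 1 := by
    rw [mul_right_comm (dgSign k (p + -1)), dgSign_mul_self, one_mul, dgSign_mul_self]
  rw [h2, one_smul]

/-- The closed morphisms of degree zero whose cone belongs to a given subcategory. -/
def trWHom (Q : ObjectProperty (H0 P)) ⦃X' X : P.Obj⦄ (s : P.THom X' X) : Prop :=
  ∃ (s₀ : P.Hom X' X 0) (hs : P.d (zero_add 1) s₀ = 0), P.tot s₀ = s ∧ Q.trW (P.mk0 s₀ hs)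

end

variable {k : Type u} [CommRing k] {P : DGCat.{u, v, u} k} [DGExact P]

/-- Inhomogeneous cycles with values in the subcategory are killed by morphisms whose cone belongs
to the subcategory. -/
theorem isKilling_trWHom (Q : ObjectProperty (H0 P)) [Q.IsTriangulated] {I : Type u}
    (o : I → P.Obj) (ho : ∀ i, Q ⟨o i⟩) : IsKilling o (trWHom Q) where
  id_mem X := ⟨P.one X, P.d_one X _, rfl, Q.trW.id_mem _⟩
  comp_mem := by
    rintro X'' X' X _ _ ⟨t, ht, rfl, ht'⟩ ⟨s, hs, rfl, hs'⟩
    exact ⟨_, P.d_comp_closed _ _ _ _ _ _ hs ht, P.tot_comp (zero_add 0) s t,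
      Q.trW.comp_mem _ _ ht' hs'⟩
  τ_eq := by
    rintro X' X _ ⟨s, hs, rfl, -⟩
    exact THom.τ_of_deg_zero s
  δ_eq := by
    rintro X' X _ ⟨s, hs, rfl, -⟩
    exact THom.δ_tot_eq_zero (P.dtot_eq_zero _ hs)
  kill := by
    intro X i f hf
    have hd : ∀ p, P.dtot (THom.comp k p f) = 0 := fun p => by
      have h := THom.comp_δ (p := p) rfl f
      rw [hf, map_zero] at h
      have h' := congrArg (fun x => dgSign k p • x) h.symm
      simp only [smul_smul, dgSign_mul_self, one_smul, smul_zero] at h'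
      exact P.dtot_eq_zero rfl h'
    -- the finitely many homogeneous components are killed one after the other
    have key : ∀ T : Finset ℤ, ∃ (X' : P.Obj) (s : P.THom X' X), trWHom Q s ∧
        ∀ p ∈ T, ∃ h, THom.δ h = s ≫ P.tot (THom.comp k p f) := by
      intro T
      induction T using Finset.induction_on with
      | empty => exact ⟨X, _, ⟨P.one X, P.d_one X _, rfl, Q.trW.id_mem _⟩, by simp⟩
      | insert q T hq ih =>
        obtain ⟨X', _, ⟨s, hs, rfl, hs'⟩, hT⟩ := ih
        obtain ⟨X'', t, ht, ht', h₀, hh₀⟩ := exists_trW_comp Q (ho i)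
          (P.comp (add_zero q) (THom.comp k q f) s) (by
            rw [P.dtot_comp, hd, P.dtot_eq_zero _ hs, Limits.comp_zero, Limits.zero_comp,
              smul_zero, add_zero])
        refine ⟨X'', P.tot t ≫ P.tot s, ⟨_, P.d_comp_closed _ _ _ _ _ _ hs ht,
          P.tot_comp (zero_add 0) s t, Q.trW.comp_mem _ _ ht' hs'⟩, fun p hp => ?_⟩
        obtain rfl | hp := Finset.mem_insert.1 hp
        · exact ⟨h₀, by rw [hh₀, P.tot_comp, Category.assoc]⟩
        · obtain ⟨h, hh⟩ := hT p hp
          refine ⟨P.tot t ≫ h, ?_⟩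
          rw [THom.δ_comp, THom.τ_of_deg_zero, THom.δ_tot_eq_zero (P.dtot_eq_zero _ ht),
            Limits.zero_comp, add_zero, hh, Category.assoc]
    obtain ⟨T, hT⟩ : ∃ T : Finset ℤ, f = ∑ p ∈ T, P.tot (THom.comp k p f) := by
      classical
      exact ⟨DFinsupp.support f, (DirectSum.sum_support_of f).symm⟩
    obtain ⟨X', s, hs, h⟩ := key T
    choose! h hh using h
    refine ⟨X', s, hs, ∑ p ∈ T, h p, ?_⟩
    rw [map_sum, Finset.sum_congr rfl hh, ← Preadditive.comp_sum, ← hT]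

end DGExact

/-! ### Fractions over the dg quotient -/

namespace DGCat

open Pretriangulated

variable {k : Type u} [CommRing k]

namespace Pretr

section

variable {A : DGCat.{u, v, w} k} (B : Set A.Obj)

theorem subTr_single (U : B) : A.subTr B ⟨single A U⟩ :=
  ⟨⟨single (A.full B) U⟩, ⟨Iso.refl _⟩⟩

end

variable {A : DGCat.{u, u, u} k} {B : Set A.Obj}

section Roofs

variable (hflat : ∀ x U : A.Obj, U ∈ B → IsHomotopicallyFlat (A.homComplex x U))
include hflat

theorem exists_quot_roof {X Y : A.pretr.Obj}
    (H : (A.quot B).pretr.THom ((A.quotFunctor B).pretr.obj X) ((A.quotFunctor B).pretr.obj Y))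
    (f : A.pretr.THom X Y) (hf : THom.δ H = (A.quotFunctor B).pretr.tmap f) :
    ∃ (X' : A.pretr.Obj) (s : A.pretr.Hom X' X 0) (hs : A.pretr.d (zero_add 1) s = 0),
      (A.subTr B).trW (A.pretr.mk0 s hs) ∧ ∃ (e : A.pretr.THom X' Y) (H' : _),
        (A.quotFunctor B).pretr.tmap (A.pretr.tot s) ≫ H =
          (A.quotFunctor B).pretr.tmap e + THom.δ H' := by
  classical
  obtain ⟨X', _, ⟨s, hs, rfl, hs'⟩, h⟩ := Words.exists_roof
    (o := fun U : B => (singleFunctor A).obj U) (F := (A.quotFunctor B).pretr) (ε := quotEps)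
    (DGExact.isKilling_trWHom (A.subTr B) _ fun U => subTr_single B U)
    (fun X U => HFlat.pretr (fun x => hflat_of_isHomotopicallyFlat (hflat x U U.2)) X)
    τ_quotEps δ_quotEps evalAll_injective evalAll_surjective H f hf
  exact ⟨X', s, hs, hs', h⟩

omit hflat in
theorem quot_map_injective (X Y : A.pretr.Obj) (p : ℤ) :
    Function.Injective ((A.quotFunctor B).pretr.map (x := X) (y := Y) (p := p)) := by
  classical
  intro f g h
  refine A.pretr.tot_inj (Words.tmap_injective (fun U : B => (singleFunctor A).obj U)
    (F := (A.quotFunctor B).pretr) (ε := quotEps) (evalAll_injective X Y) ?_)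
  rw [DGFunctor.tmap_tot, DGFunctor.tmap_tot, h]

/-- Each closed morphism of degree zero of the dg quotient is homologous to a fraction of closed
morphisms, whose denominator has its cone in the subcategory generated by `B`. -/
theorem exists_dg_fraction {X Y : A.pretr.Obj} (g : (A.quot B).pretr.Hom
      ((A.quotFunctor B).pretr.obj X) ((A.quotFunctor B).pretr.obj Y) 0)
    (hg : (A.quot B).pretr.d (zero_add 1) g = 0) :
    ∃ (X' : A.pretr.Obj) (s : A.pretr.Hom X' X 0) (hs : A.pretr.d (zero_add 1) s = 0),
      (A.subTr B).trW (A.pretr.mk0 s hs) ∧ ∃ (e : A.pretr.Hom X' Y 0)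
        (_ : A.pretr.d (zero_add 1) e = 0) (h : _), (A.quot B).pretr.d (neg_add_cancel 1) h =
          (A.quot B).pretr.comp (zero_add 0) g ((A.quotFunctor B).pretr.map s) -
            (A.quotFunctor B).pretr.map e := by
  obtain ⟨X', s, hs, hs', e, H', h⟩ := exists_quot_roof hflat ((A.quot B).pretr.tot g) 0 (by
    rw [map_zero]
    exact THom.δ_tot_eq_zero ((A.quot B).pretr.dtot_eq_zero _ hg))
  have h0 := congrArg (THom.comp k 0) h
  rw [DGFunctor.tmap_tot, THom.comp_tot_comp (zero_add 0), THom.comp_tot, map_add,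
    DGFunctor.comp_tmap, THom.comp_δ (neg_add_cancel 1)] at h0
  refine ⟨X', s, hs, hs', THom.comp k 0 e, ?_, dgSign k (-1) • THom.comp k (-1) H', ?_⟩
  · refine quot_map_injective (B := B) _ _ _ ?_
    have h1 := congrArg ((A.quot B).pretr.d (zero_add 1)) h0
    rw [map_add, map_smul, (A.quot B).pretr.d_d, smul_zero, add_zero,
      (A.quot B).pretr.d_comp_closed _ (zero_add 1) (zero_add 1) _ _ _ hg
        (DGFunctor.d_map_eq_zero _ _ _ hs)] at h1
    rw [DGFunctor.map_d, map_zero]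
    exact h1.symm
  · rw [map_smul]
    exact (sub_eq_of_eq_add' h0).symm

/-- Each morphism of the triangulated hull of the dg quotient is a fraction. -/
theorem exists_fraction {X Y : A.tr} (g : (A.quotTr B).obj X ⟶ (A.quotTr B).obj Y) :
    ∃ (X' : A.tr) (s : X' ⟶ X) (e : X' ⟶ Y), (A.subTr B).trW s ∧
      (A.quotTr B).map s ≫ g = (A.quotTr B).map e := by
  obtain ⟨g, hg, rfl⟩ := (A.quot B).pretr.mk0_surj g
  obtain ⟨X', s, hs, hs', e, he, h⟩ := exists_dg_fraction hflat (X := X.as) (Y := Y.as) g hg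
  exact ⟨⟨X'⟩, A.pretr.mk0 s hs, A.pretr.mk0 e he, hs', ((A.quot B).pretr.mk0_eq_iff _ _
    ((A.quot B).pretr.d_comp_closed _ (zero_add 1) (zero_add 1) _ _ _ hg
      (DGFunctor.d_map_eq_zero _ _ _ hs)) (DGFunctor.d_map_eq_zero _ _ _ he)).2 h⟩

theorem exists_dg_comp {X Y : A.pretr.Obj} (f : A.pretr.Hom X Y 0)
    (h : (A.quot B).pretr.Hom ((A.quotFunctor B).pretr.obj X) ((A.quotFunctor B).pretr.obj Y) (-1))
    (hh : (A.quot B).pretr.d (neg_add_cancel 1) h = (A.quotFunctor B).pretr.map f) :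
    ∃ (X' : A.pretr.Obj) (s : A.pretr.Hom X' X 0) (hs : A.pretr.d (zero_add 1) s = 0),
      (A.subTr B).trW (A.pretr.mk0 s hs) ∧ ∃ h' : A.pretr.Hom X' Y (-1),
        A.pretr.d (neg_add_cancel 1) h' = A.pretr.comp (zero_add 0) f s := by
  have hδ : THom.δ ((A.quot B).pretr.tot h) =
      (A.quotFunctor B).pretr.tmap (A.pretr.tot (-f)) := by
    rw [THom.δ_tot, ← (A.quot B).pretr.tot_d (neg_add_cancel 1), hh, DGFunctor.tmap_tot, map_neg,
      map_neg, dgSign_neg, dgSign_one, neg_smul, one_smul]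
  obtain ⟨X', s, hs, hs', e, H', h'⟩ := exists_quot_roof hflat _ _ hδ
  refine ⟨X', s, hs, hs', THom.comp k (-1) e, ?_⟩
  have h1 : A.pretr.tot s ≫ A.pretr.tot (-f) = THom.δ e := by
    classical
    refine Words.tmap_injective (fun U : B => (singleFunctor A).obj U)
      (F := (A.quotFunctor B).pretr) (ε := quotEps) (evalAll_injective _ _) ?_
    have h2 := congrArg THom.δ h'
    rw [map_add, THom.δ_δ, add_zero, THom.δ_comp, ← DGFunctor.tmap_τ, ← DGFunctor.tmap_δ,
      THom.δ_tot_eq_zero (A.pretr.dtot_eq_zero _ hs), map_zero, Limits.zero_comp, add_zero,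
      THom.τ_of_deg_zero, hδ] at h2
    rw [DGFunctor.tmap_comp, h2, DGFunctor.tmap_δ]
  have h3 := congrArg (THom.comp k 0) h1
  rw [THom.comp_tot_comp (zero_add 0), THom.comp_tot, THom.comp_δ (neg_add_cancel 1), dgSign_neg,
    dgSign_one, neg_smul, one_smul, map_neg, LinearMap.neg_apply, neg_inj] at h3
  exact h3.symm

/-- A morphism of the triangulated hull which becomes zero over the dg quotient vanishes after
composition with a morphism whose cone comes from `B`. -/
theorem exists_comp_eq_zero {X Y : A.tr} (f : X ⟶ Y) (hf : (A.quotTr B).map f = 0) :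
    ∃ (X' : A.tr) (s : X' ⟶ X), (A.subTr B).trW s ∧ s ≫ f = 0 := by
  obtain ⟨f, hf', rfl⟩ := A.pretr.mk0_surj f
  obtain ⟨h, hh⟩ := ((A.quot B).pretr.mk0_eq_iff ((A.quotFunctor B).pretr.map f) 0
    (DGFunctor.d_map_eq_zero _ _ _ hf') (map_zero _)).1 hf
  obtain ⟨X', s, hs, hs', h', hh'⟩ := exists_dg_comp hflat f h (hh.trans (sub_zero _))
  exact ⟨⟨X'⟩, A.pretr.mk0 s hs, hs', (A.pretr.mk0_eq_iff _ 0
    (A.pretr.d_comp_closed _ (zero_add 1) (zero_add 1) _ _ _ hf' hs) (map_zero _)).2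
    ⟨h', hh'.trans (sub_zero _).symm⟩⟩

end Roofs

/-- The objects of `B` become contractible in the dg quotient. -/
theorem isZero_quotTr_single (U : B) : Limits.IsZero ((A.quotTr B).obj ⟨single A U⟩) := by
  have h := congrArg (THom.comp k 0) (δ_quotEps (A := A) U)
  rw [THom.comp_δ (neg_add_cancel 1), dgSign_neg, dgSign_one, neg_smul, one_smul, map_neg,
    neg_inj, ← tot_one, THom.comp_tot] at h
  rw [Limits.IsZero.iff_id_eq_zero, ← mk0_one, ← mk0_zero, mk0_eq_iff]
  exact ⟨_, h.trans (sub_zero _).symm⟩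

end Pretr

end DGCat

/-! ### Functors which are induced on localizations -/

namespace CategoryTheory

open Pretriangulated
open scoped ZeroObject

/-- The functor induced on a localization is full if each morphism between images is a right
fraction. -/
theorem Localization.full_of_lifting {C D E : Type*} [Category* C] [Category* D] [Category* E]
    (L : C ⥤ D) (W : MorphismProperty C) [L.IsLocalization W] (F : C ⥤ E) (Φ : D ⥤ E)
    [Localization.Lifting L W F Φ]
    (h : ∀ ⦃X Y : C⦄ (g : F.obj X ⟶ F.obj Y), ∃ (X' : C) (s : X' ⟶ X) (e : X' ⟶ Y),
      W s ∧ F.map s ≫ g = F.map e) : Φ.Full := by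
  have := Localization.essSurj L W
  let i : L ⋙ Φ ≅ F := Localization.Lifting.iso L W F Φ
  refine Functor.full_of_comp_essSurj Φ L fun X Y g => ?_
  obtain ⟨X', s, e, hs, hg⟩ := h (i.inv.app X ≫ g ≫ i.hom.app Y)
  have := Localization.inverts L W s hs
  refine ⟨inv (L.map s) ≫ L.map e, ?_⟩
  rw [Functor.map_comp, Functor.map_inv, IsIso.inv_comp_eq, ← cancel_mono (i.hom.app Y)]
  have h1 := i.hom.naturality e
  have h2 := i.hom.naturality s
  simp only [Functor.comp_map] at h1 h2
  rw [h1, ← hg, Category.assoc, ← reassoc_of% h2]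
  simp

/-- The functor induced on a localization is faithful if it is additive and each morphism with
vanishing image is annihilated by a morphism which is inverted. -/
theorem Localization.faithful_of_lifting {C D E : Type*} [Category* C] [Category* D] [Category* E]
    [Preadditive C] [Preadditive D] [Preadditive E]
    (L : C ⥤ D) (W : MorphismProperty C) [L.IsLocalization W] [W.HasRightCalculusOfFractions]
    [L.Additive] (F : C ⥤ E) (Φ : D ⥤ E) [Φ.Additive] [Localization.Lifting L W F Φ]
    (h : ∀ ⦃X Y : C⦄ (f : X ⟶ Y), F.map f = 0 → ∃ (X' : C) (s : X' ⟶ X), W s ∧ s ≫ f = 0) :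
    Φ.Faithful := by
  have := Localization.essSurj L W
  let i : L ⋙ Φ ≅ F := Localization.Lifting.iso L W F Φ
  refine Functor.faithful_of_comp_essSurj Φ L fun X Y f g hfg => ?_
  obtain ⟨φ, hφ⟩ := Localization.exists_rightFraction L W (f - g)
  have := Localization.inverts L W φ.s φ.hs
  have e : L.map φ.f = L.map φ.s ≫ (f - g) := by rw [hφ]; simp
  have h0 : Φ.map (L.map φ.f) = 0 := by
    rw [e, Functor.map_comp, Functor.map_sub, hfg, sub_self, Limits.comp_zero]
  obtain ⟨X', s, hs, hs'⟩ := h φ.f (by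
    have h1 := i.hom.naturality φ.f
    simp only [Functor.comp_map] at h1
    rw [h0, Limits.zero_comp] at h1
    rw [← cancel_epi (i.hom.app _), ← h1, Limits.comp_zero])
  have := Localization.inverts L W s hs
  have h2 : L.map φ.f = 0 := by
    rw [← cancel_epi (L.map s), ← Functor.map_comp, hs', Functor.map_zero, Limits.comp_zero]
  rw [h2, eq_comm, ← Limits.comp_zero (f := L.map φ.s), cancel_epi] at e
  exact sub_eq_zero.1 e

variable {C D : Type*} [Category* C] [Category* D] [Limits.HasZeroObject C] [HasShift C ℤ]
  [Preadditive C] [∀ n : ℤ, (shiftFunctor C n).Additive] [Pretriangulated C]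
  [Limits.HasZeroObject D] [HasShift D ℤ] [Preadditive D]
  [∀ n : ℤ, (shiftFunctor D n).Additive] [Pretriangulated D]

/-- The objects which a triangulated functor maps to zero. -/
def Functor.zeroObjects (F : C ⥤ D) : ObjectProperty C := fun X => Limits.IsZero (F.obj X)

instance (F : C ⥤ D) : F.zeroObjects.IsClosedUnderIsomorphisms where
  of_iso e hX := hX.of_iso (F.mapIso e.symm)

instance (F : C ⥤ D) [F.CommShift ℤ] [F.IsTriangulated] : F.zeroObjects.IsTriangulated where
  exists_zero := ⟨0, Limits.isZero_zero C, F.map_isZero (Limits.isZero_zero C)⟩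
  isStableUnderShiftBy n :=
    { le_shift := fun X hX => ((shiftFunctor D n).map_isZero hX).of_iso
        ((F.commShiftIso n).app X) }
  toIsTriangulatedClosed₂ := .mk' fun T hT h₁ h₃ =>
    Triangle.isZero₂_of_isZero₁₃ _ (F.map_distinguished T hT) h₁ h₃

theorem Functor.isInvertedBy_trW (F : C ⥤ D) [F.CommShift ℤ] [F.IsTriangulated]
    (P : ObjectProperty C) (hP : P ≤ F.zeroObjects) : P.trW.IsInvertedBy F := by
  rintro X Y f hf
  obtain ⟨Z, g, h, hT, hZ⟩ := (P.trW_iff f).1 hf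
  exact (Triangle.isZero₃_iff_isIso₁ _ (F.map_distinguished _ hT)).1 (hP _ hZ)

end CategoryTheory

/-! ### The comparison functor is a triangle equivalence -/

namespace DGCat

variable {k : Type u} [CommRing k]

theorem MCObj.mk_congr {P : DGCat.{u, v, w} k} {X : P.Obj} {q q' : P.Hom X X 1}
    (h : P.d (q := 2) rfl q + P.comp (r := 2) rfl q q = 0)
    (h' : P.d (q := 2) rfl q' + P.comp (r := 2) rfl q' q' = 0) (e : q = q') :
    (⟨X, q, h⟩ : MCObj P) = ⟨X, q', h'⟩ := by
  subst e
  rfl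

theorem Pretr.obj_single {A : DGCat.{u, v, w} k} {C : DGCat.{u, v', w'} k} (F : DGFunctor A C)
    (x : A.Obj) : F.pretr.obj (single A x) = single C (F.obj x) :=
  Subtype.ext (MCObj.mk_congr (P := C.add) (X := singleAdd C (F.obj x)) _ _
    (map_zero (F.mapAddHom (X := singleAdd A x) (Y := singleAdd A x) (p := 1))))

variable {A : DGCat.{u, u, u} k} {B : Set A.Obj}

/-- The functor to the triangulated hull of the dg quotient vanishes on the objects of `B`, hence on
the twisted complexes over `B`. -/
theorem quotTr_isInvertedBy : (A.subTr B).trW.IsInvertedBy (A.quotTr B) := by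
  refine Functor.isInvertedBy_trW _ _ ?_
  rintro X ⟨Y, ⟨e⟩⟩
  refine (A.quotTr B).zeroObjects.prop_of_iso e ?_
  exact Pretr.prop_of_single (A.inclusionTr B ⋙ A.quotTr B).zeroObjects
    (fun U => Pretr.isZero_quotTr_single U) Y

theorem comparison_isTriangulated (h : (A.subTr B).trW.IsInvertedBy (A.quotTr B)) :
    (A.comparison B h).IsTriangulated := by
  have := Localization.essSurj_mapArrow (A.subTr B).trW.Q (A.subTr B).trW
  have : NatTrans.CommShift (Localization.Lifting.iso (A.subTr B).trW.Q (A.subTr B).trW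
    (A.quotTr B) (A.comparison B h)).hom ℤ := inferInstance
  exact Functor.isTriangulated_of_precomp_iso (Localization.Lifting.iso (A.subTr B).trW.Q
    (A.subTr B).trW (A.quotTr B) (A.comparison B h))

end DGCat

end

/-- Let `A` be a small dg category over a commutative ring `k` and let `B` be a full dg subcategory
such that all complexes `A(x, U)`, with `x` in `A` and `U` in `B`, are homotopically flat. Then the
functor `A.tr ⥤ (A.quot B).tr` between triangulated hulls factors through the Verdier quotient of
`A.tr` by the triangulated hull of `B`, and the induced functor is a triangle equivalence. -/
theorem theorem6p1 {k : Type u} [CommRing k] (A : DGCat.{u, u, u} k) (B : Set A.Obj)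
    (hflat : ∀ x U : A.Obj, U ∈ B → IsHomotopicallyFlat (A.homComplex x U)) :
    ∃ h : (A.subTr B).trW.IsInvertedBy (A.quotTr B),
      (A.comparison B h).IsEquivalence ∧ (A.comparison B h).IsTriangulated := by
  refine ⟨DGCat.quotTr_isInvertedBy, ?_, DGCat.comparison_isTriangulated _⟩
  have := DGCat.comparison_isTriangulated (A := A) (B := B) DGCat.quotTr_isInvertedBy
  have : (A.comparison B DGCat.quotTr_isInvertedBy).Full :=
    Localization.full_of_lifting (A.subTr B).trW.Q (A.subTr B).trW (A.quotTr B) _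
      fun _ _ g => DGCat.Pretr.exists_fraction hflat g
  have : (A.comparison B DGCat.quotTr_isInvertedBy).Faithful :=
    Localization.faithful_of_lifting (A.subTr B).trW.Q (A.subTr B).trW (A.quotTr B) _
      fun _ _ f hf => DGCat.Pretr.exists_comp_eq_zero hflat f hf
  have : (A.comparison B DGCat.quotTr_isInvertedBy).EssSurj :=
    ⟨fun X => DGCat.Pretr.prop_of_single
      (A.comparison B DGCat.quotTr_isInvertedBy).essImage (fun x =>
        ⟨(A.subTr B).trW.Q.obj ⟨DGCat.Pretr.single A x⟩,
          ⟨(Localization.Lifting.iso (A.subTr B).trW.Q (A.subTr B).trW (A.quotTr B)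
            (A.comparison B DGCat.quotTr_isInvertedBy)).app ⟨DGCat.Pretr.single A x⟩ ≪≫
              eqToIso (congrArg DGCat.H0.mk (DGCat.Pretr.obj_single (A.quotFunctor B) x))⟩⟩) X⟩
  exact { }
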